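/- **Lemma (Small cluster decomposition).** Let $G=(V,E,w)$ be a finite undirected weighted graph with at least two vertices and non-negative edge weights. For disjoint $X,Y\subseteq V$ let $w(X,Y)$ be the total weight of the edges between $X$ and $Y$; put $\partial U=w(U,V\setminus U)$, and $\partial_{G[A]}U=w(U,A\setminus U)$ for $U\subseteq A\subseteq V$. Let $\lambda=\min_{\emptyset\ne U\subsetneq V}\partial U$ be the minimum cut of $G$. A set $U\subseteq A$ is *$\beta$-boundary-sparse in $A$* if $w(U,A\setminus U)<\beta\min\{w(U,V\setminus A),\,w(A\setminus U,V\setminus A)\}$, and non-$\beta$-boundary-sparse in $A$ otherwise. For $s,\delta\ge 0$, a set $C\subseteq V$ is *$s$-strong for $\delta$* if every cut $\emptyset\ne S\subsetneq V$ with $\partial S\le 1.1\,\delta$ satisfies $\min\{\mathrm{vol}(S\cap C),\mathrm{vol}(C\setminus S)\}\le s$, where $\mathrm{vol}(X)$ is the sum of the weighted degrees in $G$ of the vertices of $X$. A *cluster* (with respect to $s,\delta$) is a set that is $s$-strong for $\delta$ and is the vertex set of a connected component of $G\setminus E'$ for some $E'\subseteq E$. There are a deterministic algorithm and absolute constants $K,c$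 such that the following holds for every such $G$, every non-empty $A\subseteq V$ (in particular, every cluster $A$), every $0<\epsilon\le 0.01$ and every real number $\tilde\lambda\le 1.01\lambda$. Given $\epsilon$, $\tilde\lambda$, the weighted graph $G[A]$ and the weights $w(v,V\setminus A)$ of all $v\in A$, the algorithm computes a partition of $A$ into non-empty sets $A_1,\dots,A_k$ such that: 0. for all $s,\delta\ge0$ for which $A$ is $s$-strong for $\delta$, every $A_i$ is a cluster with respect to $s,\delta$; 1. for every $S\subseteq A$ with $\partial_{G[A]}S\le 1.01\,\tilde\lambda$ there is a partition $\mathcal P$ of the set $\{A_1,\dots,A_k\}$ such that for every part $P\in\mathcal P$, writing $A_P=\bigcup_{A'\in P}A'$, the set $S\cap A_P$ is non-$(1-\epsilon)$-boundary-sparse in $A_P$; 2. $\sum_i\partial A_i\le K\epsilon^{-3}(1+\log|A|)^{c}\,\partial A$. The running time is at most $K|A|^9(1+\log|A|)^{c}$. Here running time is measured on a random access machine in which arithmetic operations and comparisons of real numbers (weights) have unit cost, while operations on integers, including addresses, are charged the bit lengths of the numbers involved. -/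

import Mathlib

/-! ## Weighted graphs, cuts, clusters -/

/-- A finite undirected weighted graph without loops: `w u v` is the weight of the edge `uv`,
and `w u v = 0` means that there is no such edge. -/
structure WeightedGraph (V : Type*) where
  w : V → V → ℝ
  symm : ∀ u v, w u v = w v u
  nonneg : ∀ u v, 0 ≤ w u v
  loopless : ∀ v, w v v = 0

namespace WeightedGraph

variable {V : Type*} (G : WeightedGraph V)

/-- The underlying simple graph. -/
def graph : SimpleGraph V where
  Adj u v := 0 < G.w u v
  symm := ⟨fun u v h => by rw [G.symm v u]; exact h⟩
  loopless := ⟨fun v h => by rw [G.loopless v] at h; exact lt_irrefl _ h⟩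

/-- `w(A, B)`: the total weight of the edges between the disjoint sets `A` and `B`. -/
def cut (A B : Finset V) : ℝ := ∑ u ∈ A, ∑ v ∈ B, G.w u v

variable [DecidableEq V]

/-- `∂_{G[A]} U = w(U, A \ U)`: the boundary of `U ⊆ A` in the induced graph `G[A]`. -/
def inducedBoundary (A U : Finset V) : ℝ := G.cut U (A \ U)

variable [Fintype V]

/-- `∂U = w(U, V \ U)`. -/
def boundary (U : Finset V) : ℝ := G.cut U Uᶜ

/-- The value of a minimum cut of `G` (for a graph with at least two vertices). -/
noncomputable def minCut : ℝ :=
  sInf {x : ℝ | ∃ S : Finset V, S.Nonempty ∧ S ≠ Finset.univ ∧ x = G.boundary S}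

/-- `U` is `β`-boundary-sparse in `A`. -/
def BoundarySparse (β : ℝ) (A U : Finset V) : Prop :=
  G.cut U (A \ U) < β * min (G.cut U Aᶜ) (G.cut (A \ U) Aᶜ)

/-- The weight `w(v, V \ C)` of the self-loop at `v ∈ C` in `G{C}`, the graph which consists of
the induced graph `G[C]` and these self-loops. -/
def loopWeight (C : Finset V) (v : V) : ℝ := ∑ u ∈ Cᶜ, G.w v u

/-- The weighted volume of `X ⊆ C` in `G{C}`; a self-loop counts once in the degree. -/
def volIn (C X : Finset V) : ℝ := ∑ v ∈ X, (∑ u ∈ C, G.w v u + G.loopWeight C v)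

/-- `C` is a connected component of the graph that is left after deleting some set of edges. -/
def IsComponent (C : Finset V) : Prop :=
  ∃ (E' : Set (Sym2 V)) (c : (G.graph.deleteEdges E').ConnectedComponent), c.supp = (C : Set V)

/-- The defining condition of `s`-strength for `δ`. -/
def IsStrong (δ s : ℝ) (C : Finset V) : Prop :=
  ∀ S : Finset V, S.Nonempty → S ≠ Finset.univ → G.boundary S ≤ 1.1 * δ →
    min (G.volIn C (S ∩ C)) (G.volIn C (C \ S)) ≤ s

/-- A cluster: an `s`-strong component. -/
def IsCluster (δ s : ℝ) (C : Finset V) : Prop := G.IsComponent C ∧ G.IsStrong δ s C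

end WeightedGraph

/-! ## Machine model

A random access machine with one memory of natural numbers and one memory of real numbers, both
addressed by natural numbers, programmed in a structured language. Arithmetic `+, -, *, /` and
comparison of reals have unit cost (there is no rounding); operations on natural numbers,
including the computation of addresses, are charged the bit lengths of all numbers involved. -/

namespace RealRAM

/-- A state of the machine. -/
structure State where
  nat : ℕ → ℕ
  real : ℕ → ℝ

/-- Expressions with values in `ℕ`; `load a` is the content of the cell `a`. -/
inductive NExp where
  | lit (n : ℕ)
  | load (a : NExp)
  | add (a b : NExp)
  | sub (a b : NExp)
  | mul (a b : NExp)
  | div (a b : NExp)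

/-- Truncated subtraction and division with remainder on `ℕ` (division by zero gives zero). -/
def NExp.eval (σ : State) : NExp → ℕ
  | lit n => n
  | load a => σ.nat (a.eval σ)
  | add a b => a.eval σ + b.eval σ
  | sub a b => a.eval σ - b.eval σ
  | mul a b => a.eval σ * b.eval σ
  | div a b => a.eval σ / b.eval σ

/-- Each node of an expression costs one plus the bit length of its value. -/
def NExp.cost (σ : State) : NExp → ℕ
  | lit n => 1 + n.size
  | load a => 1 + (σ.nat (a.eval σ)).size + a.cost σ
  | add a b => 1 + (a.eval σ + b.eval σ).size + a.cost σ + b.cost σ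
  | sub a b => 1 + (a.eval σ - b.eval σ).size + a.cost σ + b.cost σ
  | mul a b => 1 + (a.eval σ * b.eval σ).size + a.cost σ + b.cost σ
  | div a b => 1 + (a.eval σ / b.eval σ).size + a.cost σ + b.cost σ

/-- Expressions with values in `ℝ`; the constants of a program are rational. -/
inductive RExp where
  | lit (q : ℚ)
  | load (a : NExp)
  | ofNat (a : NExp)
  | add (x y : RExp)
  | sub (x y : RExp)
  | mul (x y : RExp)
  | div (x y : RExp)

noncomputable def RExp.eval (σ : State) : RExp → ℝ
  | lit q => (q : ℝ)
  | load a => σ.real (a.eval σ)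
  | ofNat a => (a.eval σ : ℝ)
  | add x y => x.eval σ + y.eval σ
  | sub x y => x.eval σ - y.eval σ
  | mul x y => x.eval σ * y.eval σ
  | div x y => x.eval σ / y.eval σ

def RExp.cost (σ : State) : RExp → ℕ
  | lit _ => 1
  | load a => 1 + a.cost σ
  | ofNat a => 1 + a.cost σ
  | add x y => 1 + x.cost σ + y.cost σ
  | sub x y => 1 + x.cost σ + y.cost σ
  | mul x y => 1 + x.cost σ + y.cost σ
  | div x y => 1 + x.cost σ + y.cost σ

/-- Tests. -/
inductive Test where
  | natLe (a b : NExp)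
  | natEq (a b : NExp)
  | realLe (x y : RExp)
  | not (p : Test)
  | and (p q : Test)

def Test.holds (σ : State) : Test → Prop
  | natLe a b => a.eval σ ≤ b.eval σ
  | natEq a b => a.eval σ = b.eval σ
  | realLe x y => x.eval σ ≤ y.eval σ
  | not p => ¬ p.holds σ
  | and p q => p.holds σ ∧ q.holds σ

def Test.cost (σ : State) : Test → ℕ
  | natLe a b => 1 + a.cost σ + b.cost σ
  | natEq a b => 1 + a.cost σ + b.cost σ
  | realLe x y => 1 + x.cost σ + y.cost σ
  | not p => 1 + p.cost σ
  | and p q => 1 + p.cost σ + q.cost σ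

/-- Programs; `setNat a b` writes the value of `b` into the cell whose address is the value
of `a`. -/
inductive Program where
  | skip
  | setNat (a b : NExp)
  | setReal (a : NExp) (x : RExp)
  | seq (P Q : Program)
  | ite (p : Test) (P Q : Program)
  | while (p : Test) (P : Program)

/-- `Runs P σ τ t`: the program `P`, started in the state `σ`, halts in the state `τ` and
its total cost is `t`. -/
inductive Runs : Program → State → State → ℕ → Prop
  | skip (σ : State) : Runs .skip σ σ 1
  | setNat (a b : NExp) (σ : State) :
      Runs (.setNat a b) σ ⟨Function.update σ.nat (a.eval σ) (b.eval σ), σ.real⟩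
        (1 + a.cost σ + b.cost σ)
  | setReal (a : NExp) (x : RExp) (σ : State) :
      Runs (.setReal a x) σ ⟨σ.nat, Function.update σ.real (a.eval σ) (x.eval σ)⟩
        (1 + a.cost σ + x.cost σ)
  | seq {P Q : Program} {σ τ υ : State} {t t' : ℕ} :
      Runs P σ τ t → Runs Q τ υ t' → Runs (.seq P Q) σ υ (1 + t + t')
  | iteTrue {p : Test} {P Q : Program} {σ τ : State} {t : ℕ} :
      p.holds σ → Runs P σ τ t → Runs (.ite p P Q) σ τ (1 + p.cost σ + t)
  | iteFalse {p : Test} {P Q : Program} {σ τ : State} {t : ℕ} :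
      ¬ p.holds σ → Runs Q σ τ t → Runs (.ite p P Q) σ τ (1 + p.cost σ + t)
  | whileTrue {p : Test} {P : Program} {σ τ υ : State} {t t' : ℕ} :
      p.holds σ → Runs P σ τ t → Runs (.while p P) τ υ t' →
        Runs (.while p P) σ υ (1 + p.cost σ + t + t')
  | whileFalse {p : Test} {P : Program} {σ : State} :
      ¬ p.holds σ → Runs (.while p P) σ σ (1 + p.cost σ)

/-- The machine is deterministic. -/
theorem Runs.deterministic {P : Program} {σ τ : State} {t : ℕ} (h : Runs P σ τ t) :
    ∀ {τ' : State} {t' : ℕ}, Runs P σ τ' t' → τ = τ' ∧ t = t' := by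
  induction h with
  | skip σ => intro _ _ h'; cases h'; exact ⟨rfl, rfl⟩
  | setNat a b σ => intro _ _ h'; cases h'; exact ⟨rfl, rfl⟩
  | setReal a x σ => intro _ _ h'; cases h'; exact ⟨rfl, rfl⟩
  | seq _ _ ih₁ ih₂ =>
    intro _ _ h'
    cases h' with
    | seq h₁ h₂ =>
      obtain ⟨rfl, rfl⟩ := ih₁ h₁
      obtain ⟨rfl, rfl⟩ := ih₂ h₂
      exact ⟨rfl, rfl⟩
  | iteTrue hp _ ih =>
    intro _ _ h'
    cases h' with
    | iteTrue _ h₁ => obtain ⟨rfl, rfl⟩ := ih h₁; exact ⟨rfl, rfl⟩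
    | iteFalse hn _ => exact absurd hp hn
  | iteFalse hn _ ih =>
    intro _ _ h'
    cases h' with
    | iteTrue hp _ => exact absurd hp hn
    | iteFalse _ h₁ => obtain ⟨rfl, rfl⟩ := ih h₁; exact ⟨rfl, rfl⟩
  | whileTrue hp _ _ ih₁ ih₂ =>
    intro _ _ h'
    cases h' with
    | whileTrue _ h₁ h₂ =>
      obtain ⟨rfl, rfl⟩ := ih₁ h₁
      obtain ⟨rfl, rfl⟩ := ih₂ h₂
      exact ⟨rfl, rfl⟩
    | whileFalse hn => exact absurd hp hn
  | whileFalse hn =>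
    intro _ _ h'
    cases h' with
    | whileTrue hp _ _ => exact absurd hp hn
    | whileFalse _ => exact ⟨rfl, rfl⟩

end RealRAM

/-! ## Input and output of the decomposition algorithm -/

/-- `σ` is the initial state for the graph `G{A}` and the parameters `ε` and `lam`, where the
vertices of `A` are numbered by `e`. With `k = |A|`, natural cell `0` holds `k`; real cells `0`
and `1` hold `ε` and `lam`; real cell `2 + i` holds the weight of the self-loop at vertex `i`;
real cell `2 + k + i * k + j` holds the weight of the edge `ij`; all other cells hold zero. -/
structure IsInput {V : Type*} [Fintype V] [DecidableEq V] (G : WeightedGraph V) (A : Finset V)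
    (e : Fin A.card ≃ A) (ε lam : ℝ) (σ : RealRAM.State) : Prop where
  card : σ.nat 0 = A.card
  nat_zero : ∀ n, 0 < n → σ.nat n = 0
  eps : σ.real 0 = ε
  est : σ.real 1 = lam
  loop : ∀ i : Fin A.card, σ.real (2 + i) = G.loopWeight A (e i)
  edge : ∀ i j : Fin A.card, σ.real (2 + A.card + i * A.card + j) = G.w (e i) (e j)
  real_zero : ∀ n, 2 + A.card + A.card * A.card ≤ n → σ.real n = 0

/-- The state `τ` represents the partition `𝒜` of `A`: natural cell `1 + i` holds a label of the
part that contains vertex `i`. -/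
def IsOutput {V : Type*} [DecidableEq V] {A : Finset V} (e : Fin A.card ≃ A)
    (𝒜 : Finpartition A) (τ : RealRAM.State) : Prop :=
  ∀ i j : Fin A.card,
    τ.nat (1 + i) = τ.nat (1 + j) ↔ 𝒜.part (e i : V) = 𝒜.part (e j : V)

/-! Put l = λ̃/1.01 (`Env.unit`), so that l ≤ λ, and for a piece C ⊆ A let b(X) be the weight of the
edges from X ⊆ C to V \ C (`outerWeight`). A nonempty U ⊆ C with U ≠ V has ∂U ≥ l, that is, its cut
inside G[C] plus b(U) is at least l.

For λ̃ > 0 the algorithm keeps a partition of A into pieces and a list of stored cuts for each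
piece; the atoms are the classes generated by the pieces and the stored cuts. For an unfinished
piece C it looks for the cheapest cut of G[C] that is (i) lighter than 0.49 l, or (ii) if b(C) > 4l,
of weight at most 1.01 λ̃ and (1-ε)-sparse, or (iii) if b(C) ≤ 4l, of weight at most 1.03 l, not a
union of atoms, and at b-distance more than εl/2 from the empty set and from all stored cuts. A cut
of kind (i) or (ii) splits C, any other one is stored, and if there is none, C is finished. The
output consists of the connected components of the atoms. For λ̃ ≤ 0 it consists of the components
of G[A], which suffices because small cuts then have weight zero. Connectedness makes the parts
components, and strength passes to subsets.

Uncrossing. Let C be finished and S a small cut. If b(C) > 4l, the whole piece is a valid group,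
since no sparse cut is left. If b(C) ≤ 4l, the unions of atoms form a net: because the cheapest cut
was stored each time, every cut Q of weight at most 1.03 l has a union of atoms N with ∂N ≤ ∂Q and
b(N Δ Q) ≤ εl/2 (`PieceInvariant.store`). Let T minimise ∂T + b(T Δ S) among the unions of atoms.
Were S sparse in T or in C \ T, moving the vertices on the wrong side would contradict either
minimality or the minimum cut (`not_sparse_of_move`, `exists_nonsparse_bipartition`). So T and C \ T
are the two groups of C.

Boundary. The stored cuts of a piece are pairwise separated by εl/2 in b, while b(C) ≤ 4l. At the
scale of 0.01 l they have VC dimension at most 31, and within a ball of that radius at most 2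
(`card_le_of_shatters`, `card_le_two_of_shatters`); a greedy hitting set and the Sauer–Shelah lemma
bound their number by ε⁻² times a power of the logarithm (`card_le_of_separated_cuts`). Splits do
not increase a potential (`potential_add_le`) that dominates the boundaries of the pieces together
with their stored cuts and is at most a constant times M/ε times ∂A initially, where M is one plus
the bound on the number of stored cuts. This gives ε⁻³.

Search. If κ is a lower bound for the cuts of G[C], trees packed by multiplicative weights contain,
for each cut of weight at most 2.103 κ, one that the cut crosses at most four times
(`exists_crossing_le`). Hence it is enough to try all choices of four edges in each tree. Either κ =
0.49 l covers all cuts of interest, or G[C] has a cut of kind (i), and then its minimum cut is found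
(`search_spec`).

Machine. The algorithm is a program in a small language with bounded loops, whose meaning is a
function on stores and whose cost is a polynomial read off from the syntax; a compiler to the random
access machine is proved correct (`Encodes.exists_runs`). The exponent 9 is one for the rounds, two
for the number of trees, four for the choices of edges and two for the evaluation of a cut. Every
round creates a piece or an atom or finishes a piece, so 3|A| rounds are enough
(`Store.Inv.round_step`, `inv_final`). -/

namespace WeightedGraph

/-! ### Elementary properties of cut weights -/

section Cuts

variable {α : Type*} (G : WeightedGraph α)

theorem cut_nonneg (X Y : Finset α) : 0 ≤ G.cut X Y :=
  Finset.sum_nonneg fun _ _ => Finset.sum_nonneg fun _ _ => G.nonneg _ _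

theorem cut_comm (X Y : Finset α) : G.cut X Y = G.cut Y X := by
  unfold cut
  rw [Finset.sum_comm]
  exact Finset.sum_congr rfl fun _ _ => Finset.sum_congr rfl fun _ _ => G.symm _ _

@[simp] theorem cut_empty_left (Y : Finset α) : G.cut ∅ Y = 0 := by simp [cut]

@[simp] theorem cut_empty_right (X : Finset α) : G.cut X ∅ = 0 := by simp [cut]

theorem cut_mono {X X' Y Y' : Finset α} (h : X ⊆ X') (h' : Y ⊆ Y') :
    G.cut X Y ≤ G.cut X' Y' := by
  unfold cut
  calc _ ≤ ∑ u ∈ X, ∑ v ∈ Y', G.w u v :=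
        Finset.sum_le_sum fun _ _ =>
          Finset.sum_le_sum_of_subset_of_nonneg h' fun _ _ _ => G.nonneg _ _
    _ ≤ _ := Finset.sum_le_sum_of_subset_of_nonneg h
        fun _ _ _ => Finset.sum_nonneg fun _ _ => G.nonneg _ _

variable [DecidableEq α]

theorem cut_union_left {X Y : Finset α} (h : Disjoint X Y) (Z : Finset α) :
    G.cut (X ∪ Y) Z = G.cut X Z + G.cut Y Z := by
  unfold cut; rw [Finset.sum_union h]

theorem cut_union_right (X : Finset α) {Y Z : Finset α} (h : Disjoint Y Z) :
    G.cut X (Y ∪ Z) = G.cut X Y + G.cut X Z := by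
  rw [cut_comm, cut_union_left G h, cut_comm, G.cut_comm X Z]

theorem cut_split_left (X Y Z : Finset α) :
    G.cut X Z = G.cut (X ∩ Y) Z + G.cut (X \ Y) Z := by
  rw [← cut_union_left G (Finset.disjoint_sdiff_inter X Y).symm, Finset.union_comm,
    Finset.sdiff_union_inter]

theorem cut_split_right (X Y Z : Finset α) :
    G.cut X Z = G.cut X (Z ∩ Y) + G.cut X (Z \ Y) := by
  rw [cut_comm, cut_split_left G Z Y X, cut_comm, G.cut_comm X (Z \ Y)]

theorem inducedBoundary_nonneg (C S : Finset α) : 0 ≤ G.inducedBoundary C S := G.cut_nonneg _ _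

theorem inducedBoundary_sdiff {C S : Finset α} (h : S ⊆ C) :
    G.inducedBoundary C (C \ S) = G.inducedBoundary C S := by
  unfold inducedBoundary
  rw [Finset.sdiff_sdiff_eq_self h, cut_comm]

/-- The cut of `S` in `G[C]` as a sum over all ordered pairs. -/
theorem inducedBoundary_eq_sum {C S : Finset α} (h : S ⊆ C) :
    G.inducedBoundary C S = ∑ u ∈ C, ∑ v ∈ C, if u ∈ S ∧ v ∉ S then G.w u v else 0 := by
  unfold inducedBoundary cut
  rw [← Finset.sum_subset h (f := fun u => ∑ v ∈ C, if u ∈ S ∧ v ∉ S then G.w u v else 0)]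
  · refine Finset.sum_congr rfl fun u hu => ?_
    rw [Finset.sdiff_eq_filter, Finset.sum_filter]
    exact Finset.sum_congr rfl fun v _ => by simp [hu]
  · intro u _ hu
    simp [hu]

/-- Twice the cut of `S` in `G[C]`, as a symmetric sum. -/
theorem two_mul_inducedBoundary {C S : Finset α} (h : S ⊆ C) :
    2 * G.inducedBoundary C S =
      ∑ u ∈ C, ∑ v ∈ C, if (u ∈ S ↔ v ∈ S) then 0 else G.w u v := by
  have h1 := G.inducedBoundary_eq_sum h
  have h2 : G.inducedBoundary C S =
      ∑ u ∈ C, ∑ v ∈ C, if v ∈ S ∧ u ∉ S then G.w u v else 0 := by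
    rw [h1, Finset.sum_comm]
    exact Finset.sum_congr rfl fun _ _ => Finset.sum_congr rfl fun _ _ => by rw [G.symm]
  rw [two_mul]
  nth_rewrite 1 [h1]
  rw [h2, ← Finset.sum_add_distrib]
  refine Finset.sum_congr rfl fun u _ => ?_
  rw [← Finset.sum_add_distrib]
  refine Finset.sum_congr rfl fun v _ => ?_
  by_cases hu : u ∈ S <;> by_cases hv : v ∈ S <;> simp [hu, hv]

theorem inducedBoundary_mono {C D S : Finset α} (h : C ⊆ D) :
    G.inducedBoundary C (S ∩ C) ≤ G.inducedBoundary D S := by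
  refine G.cut_mono Finset.inter_subset_left fun v hv => ?_
  simp only [Finset.mem_sdiff, Finset.mem_inter, not_and] at hv ⊢
  exact ⟨h hv.1, fun hS => hv.2 hS hv.1⟩

end Cuts

/-! ### Uncrossing a small cut with a net of cuts -/

section Net

variable {α : Type*} [DecidableEq α] (G : WeightedGraph α)

/-- The condition that `S ∩ T` is not sparse in `T ⊆ C`, where `b v` is the weight of the edges
from `v ∈ C` to the outside of `C`. -/
def NonsparseIn (C : Finset α) (b : α → ℝ) (β : ℝ) (T S : Finset α) : Prop :=
  ¬ G.cut (S ∩ T) (T \ S) < β * min (∑ v ∈ S ∩ T, b v + G.cut (S ∩ T) (C \ T))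
    (∑ v ∈ T \ S, b v + G.cut (T \ S) (C \ T))

/-- The uncrossing step: if a set `D ⊆ C` has about as much weight to `E` as to the rest of the
graph, then it does not witness sparsity. -/
theorem not_sparse_of_move {C : Finset α} {b : α → ℝ} {l ε δ : ℝ} (hε : 0 < ε)
    (hδ : δ ≤ ε / 2 * l) (hb : ∀ v, 0 ≤ b v)
    (hlow : ∀ U ⊆ C, U.Nonempty → l ≤ G.inducedBoundary C U + ∑ v ∈ U, b v)
    {D E F : Finset α} (hD : D.Nonempty) (hDC : D ⊆ C) (hpart : C \ D = E ∪ F)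
    (hEF : Disjoint E F)
    (hmove : G.cut D F + ∑ v ∈ D, b v ≤ G.cut D E + δ) :
    ¬ G.cut D E < (1 - ε) * (∑ v ∈ D, b v + G.cut D F) := by
  intro h
  have h1 := hlow D hDC hD
  unfold inducedBoundary at h1
  rw [hpart, G.cut_union_right D hEF] at h1
  have hq0 : 0 ≤ ∑ v ∈ D, b v + G.cut D F :=
    add_nonneg (Finset.sum_nonneg fun v _ => hb v) (G.cut_nonneg _ _)
  set q := ∑ v ∈ D, b v + G.cut D F with hq
  have h2 : G.cut D E + q ≥ l := by linarith
  -- With q = b(D) + w(D, F), sparsity gives q ≤ w(D, E) + δ < (1-ε)q + δ, so q is at most l/2. But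
  -- w(D, E) + q ≥ l and w(D, E) < q.
  have h4 : ε * q < δ := by nlinarith
  have h6 : q ≤ l / 2 := by
    by_contra hc
    push Not at hc
    nlinarith
  have h7 : 0 ≤ ε * q := by positivity
  nlinarith

theorem sum_symmDiff_triangle {b : α → ℝ} (hb : ∀ v, 0 ≤ b v) (X Y Z : Finset α) :
    ∑ v ∈ symmDiff X Z, b v ≤ ∑ v ∈ symmDiff X Y, b v + ∑ v ∈ symmDiff Y Z, b v := by
  have h : symmDiff X Z ⊆ symmDiff X Y ∪ symmDiff Y Z := by
    intro v
    simp only [Finset.mem_symmDiff, Finset.mem_union]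
    tauto
  calc _ ≤ ∑ v ∈ symmDiff X Y ∪ symmDiff Y Z, b v :=
        Finset.sum_le_sum_of_subset_of_nonneg h fun v _ _ => hb v
    _ ≤ _ := by
        rw [← Finset.sum_union_inter]
        exact le_add_of_nonneg_right (Finset.sum_nonneg fun v _ => hb v)

/-- If every small cut is close to a cut of the family `net` which is at most as large, then
for every small cut `S` a cut `T` of the family splits `C` into two pieces in which `S` is not
sparse. -/
theorem exists_nonsparse_bipartition {C : Finset α} {b : α → ℝ} {l ε δ θ θ' : ℝ} (hε : 0 < ε)
    (hε1 : ε < 1) (hδ : δ ≤ ε / 2 * l) (hδ0 : 0 ≤ δ) (hθ : θ + δ ≤ θ')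
    (hb : ∀ v, 0 ≤ b v)
    (hlow : ∀ U ⊆ C, U.Nonempty → l ≤ G.inducedBoundary C U + ∑ v ∈ U, b v)
    (net : Set (Finset α)) (hsub : ∀ N ∈ net, N ⊆ C)
    (hnet : ∀ Q ⊆ C, G.inducedBoundary C Q ≤ θ' → ∃ N ∈ net,
      G.inducedBoundary C N ≤ G.inducedBoundary C Q ∧ ∑ v ∈ symmDiff N Q, b v ≤ δ)
    {S : Finset α} (hS : S ⊆ C) (hxS : G.inducedBoundary C S ≤ θ) :
    ∃ T ∈ net, G.NonsparseIn C b (1 - ε) T S ∧ G.NonsparseIn C b (1 - ε) (C \ T) S := by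
  classical
  -- Each vertex which T puts on another side than S is charged its mass b; a minimiser trades
  -- cheapness of the cut against agreement with S.
  set Φ : Finset α → ℝ := fun T => G.inducedBoundary C T + ∑ v ∈ symmDiff T S, b v with hΦ
  obtain ⟨N₀, hN₀, hN₀x, hN₀b⟩ := hnet S hS (by linarith)
  obtain ⟨T, hT, hTmin⟩ := (C.powerset.filter (· ∈ net)).exists_min_image Φ
    ⟨N₀, by simp [hN₀, hsub _ hN₀]⟩
  simp only [Finset.mem_filter, Finset.mem_powerset] at hT hTmin
  obtain ⟨hTC, hTnet⟩ := hT
  have hTθ : Φ T ≤ θ + δ := by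
    have := hTmin N₀ ⟨hsub _ hN₀, hN₀⟩
    simp only [hΦ] at this ⊢
    linarith
  have hsumT : ∑ v ∈ symmDiff T S, b v = ∑ v ∈ T \ S, b v + ∑ v ∈ S \ T, b v := by
    rw [← Finset.sum_union (by
      rw [Finset.disjoint_left]; intro v; simp only [Finset.mem_sdiff]; tauto)]
    rfl
  have hnn : ∀ X : Finset α, 0 ≤ ∑ v ∈ X, b v := fun X => Finset.sum_nonneg fun v _ => hb v
  -- a set `Q` whose distance to `S` is smaller than that of `T` by the mass `d`
  have key : ∀ (Q : Finset α) (d : ℝ), Q ⊆ C →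
      ∑ v ∈ symmDiff Q S, b v + d = ∑ v ∈ symmDiff T S, b v →
      G.inducedBoundary C T + d ≤ G.inducedBoundary C Q + δ := by
    intro Q d hQ hd
    rcases le_or_gt (G.inducedBoundary C Q) θ' with hx | hx
    · obtain ⟨N, hN, hNx, hNb⟩ := hnet Q hQ hx
      have h1 := hTmin N ⟨hsub _ hN, hN⟩
      have h2 := sum_symmDiff_triangle hb N Q S
      simp only [hΦ] at h1
      linarith
    -- A cut heavier than θ' need not be approximated: Φ T ≤ θ + δ ≤ θ' is already below its weight.
    · have := hnn (symmDiff Q S)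
      simp only [hΦ] at hTθ
      linarith
  refine ⟨T, hTnet, ?_, ?_⟩
  · unfold NonsparseIn
    intro h
    have hlt := h.trans_le (mul_le_mul_of_nonneg_left (min_le_right _ _) (by linarith))
    rcases Finset.eq_empty_or_nonempty (T \ S) with h0 | h0
    · rw [h0] at hlt
      simp at hlt
    · rw [cut_comm] at hlt
      refine G.not_sparse_of_move hε hδ hb hlow h0 (Finset.sdiff_subset.trans hTC)
        (E := S ∩ T) (F := C \ T) ?_ ?_ ?_ hlt
      · ext v
        have := @hTC v
        simp only [Finset.mem_sdiff, Finset.mem_union, Finset.mem_inter]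
        tauto
      · rw [Finset.disjoint_left]; intro v; simp only [Finset.mem_sdiff, Finset.mem_inter]; tauto
      -- In T the vertices of D = T \ S are on the wrong side; moving them out turns T into S ∩ T
      -- and reduces the distance to S by b(D).
      · have h1 := key (S ∩ T) (∑ v ∈ T \ S, b v) (Finset.inter_subset_right.trans hTC) (by
          have : symmDiff (S ∩ T) S = S \ T := by
            ext v; simp only [Finset.mem_symmDiff, Finset.mem_sdiff, Finset.mem_inter]; tauto
          rw [this, hsumT, add_comm])
        have e1 : G.inducedBoundary C (S ∩ T) =
            G.cut (T \ S) (S ∩ T) + G.cut (S ∩ T) (C \ T) := by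
          unfold inducedBoundary
          have : C \ (S ∩ T) = (T \ S) ∪ (C \ T) := by
            ext v
            have := @hTC v
            simp only [Finset.mem_sdiff, Finset.mem_union, Finset.mem_inter]
            tauto
          rw [this, cut_union_right, cut_comm]
          rw [Finset.disjoint_left]; intro v; simp only [Finset.mem_sdiff]; tauto
        have e2 : G.inducedBoundary C T = G.cut (S ∩ T) (C \ T) + G.cut (T \ S) (C \ T) := by
          unfold inducedBoundary
          rw [G.cut_split_left T S, Finset.inter_comm]
        linarith
  · unfold NonsparseIn
    intro h
    have hlt := h.trans_le (mul_le_mul_of_nonneg_left (min_le_left _ _) (by linarith))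
    have hSS : S ∩ (C \ T) = S \ T := by
      ext v
      have := @hS v
      simp only [Finset.mem_sdiff, Finset.mem_inter]
      tauto
    rw [hSS] at hlt
    rcases Finset.eq_empty_or_nonempty (S \ T) with h0 | h0
    · rw [h0] at hlt
      simp at hlt
    · rw [Finset.sdiff_sdiff_eq_self hTC] at hlt
      refine G.not_sparse_of_move hε hδ hb hlow h0 (Finset.sdiff_subset.trans hS)
        (E := (C \ T) \ S) (F := T) ?_ ?_ ?_ hlt
      · ext v
        have := @hTC v
        simp only [Finset.mem_sdiff, Finset.mem_union]
        tauto
      · rw [Finset.disjoint_left]; intro v; simp only [Finset.mem_sdiff]; tauto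
      -- In C \ T the vertices of D = S \ T are on the wrong side; moving them into T gives T ∪ S.
      · have h1 := key (T ∪ S) (∑ v ∈ S \ T, b v) (Finset.union_subset hTC hS) (by
          have : symmDiff (T ∪ S) S = T \ S := by
            ext v; simp only [Finset.mem_symmDiff, Finset.mem_sdiff, Finset.mem_union]; tauto
          rw [this, hsumT])
        have e1 : G.inducedBoundary C (T ∪ S) =
            G.cut T ((C \ T) \ S) + G.cut (S \ T) ((C \ T) \ S) := by
          unfold inducedBoundary
          rw [← G.cut_union_left Finset.disjoint_sdiff, Finset.union_sdiff_self_eq_union]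
          congr 1
          ext v; simp only [Finset.mem_sdiff, Finset.mem_union]; tauto
        have e2 : G.inducedBoundary C T = G.cut (S \ T) T + G.cut T ((C \ T) \ S) := by
          unfold inducedBoundary
          rw [G.cut_split_right T S (C \ T), Finset.inter_comm, hSS, cut_comm]
        linarith

end Net

end WeightedGraph


namespace WeightedGraph

/-! ### Packing bounds from VC dimension -/

section Packing

variable {α : Type*} [DecidableEq α]

theorem sum_choose_le_pow (N d : ℕ) : ∑ k ∈ Finset.range (d + 1), N.choose k ≤ (N + 1) ^ d := by
  rw [add_pow]
  refine Finset.sum_le_sum fun k hk => ?_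
  have hk' : k ≤ d := Nat.lt_succ_iff.mp (Finset.mem_range.mp hk)
  calc N.choose k ≤ N ^ k := Nat.choose_le_pow N k
    _ ≤ N ^ k * 1 ^ (d - k) * d.choose k := by
        rw [one_pow, mul_one]
        exact Nat.le_mul_of_pos_right _ (Nat.choose_pos hk')

/-- The Sauer–Shelah lemma for a family whose members are distinguished by their traces on `Z`. -/
theorem card_le_of_trace_injOn (F : Finset (Finset α)) (Z : Finset α) (d : ℕ)
    (hinj : ∀ Q ∈ F, ∀ Q' ∈ F, Q ∩ Z = Q' ∩ Z → Q = Q')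
    (hvc : ∀ s, F.Shatters s → s.card ≤ d) : F.card ≤ (Z.card + 1) ^ d := by
  set T := F.image (· ∩ Z) with hT
  have h1 : F.card = T.card := (Finset.card_image_of_injOn fun Q hQ Q' hQ' h =>
    hinj Q hQ Q' hQ' h).symm
  rw [h1]
  refine (Finset.card_le_card_shatterer T).trans (le_trans ?_ (sum_choose_le_pow Z.card d))
  -- A set shattered by the traces lies in Z and is shattered by F as well, hence it is a subset of
  -- Z with at most d elements.
  have h2 : T.shatterer ⊆
      (Finset.range (d + 1)).biUnion fun k => Z.powersetCard k := by
    intro s hs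
    rw [Finset.mem_shatterer] at hs
    have hsZ : s ⊆ Z := by
      obtain ⟨u, hu, hsu⟩ := hs (Finset.Subset.refl s)
      obtain ⟨Q, -, rfl⟩ := Finset.mem_image.mp hu
      exact (Finset.inter_eq_left.mp hsu).trans Finset.inter_subset_right
    simp only [Finset.mem_biUnion, Finset.mem_range, Finset.mem_powersetCard]
    refine ⟨s.card, Nat.lt_succ_of_le (hvc s fun t ht => ?_), hsZ, rfl⟩
    obtain ⟨u, hu, hsu⟩ := hs ht
    obtain ⟨Q, hQ, rfl⟩ := Finset.mem_image.mp hu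
    refine ⟨Q, hQ, ?_⟩
    rw [← hsu]
    ext v
    have := @hsZ v
    simp only [Finset.mem_inter]
    tauto
  refine (Finset.card_le_card h2).trans (Finset.card_biUnion_le.trans ?_)
  simp

/-- A greedy hitting set. -/
theorem exists_hitting_set {C : Finset α} {b : α → ℝ} (hb : ∀ v, 0 ≤ b v) {B μ : ℝ} (hμ : 0 < μ)
    (hB : ∑ v ∈ C, b v ≤ B) (D : Finset (Finset α)) (hD : ∀ X ∈ D, X ⊆ C ∧ μ ≤ ∑ v ∈ X, b v) :
    ∃ Z : Finset α, (∀ X ∈ D, (X ∩ Z).Nonempty) ∧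
      (Z.card : ℝ) ≤ B / μ * Real.log D.card + 1 := by
  rcases D.eq_empty_or_nonempty with rfl | hne
  · exact ⟨∅, by simp, by simp⟩
  have hBμ : μ ≤ B := by
    obtain ⟨X, hX⟩ := hne
    exact ((hD X hX).2.trans (Finset.sum_le_sum_of_subset_of_nonneg (hD X hX).1
      fun v _ _ => hb v)).trans hB
  have hB0 : 0 < B := hμ.trans_le hBμ
  have hr : 0 ≤ 1 - μ / B := by
    rw [sub_nonneg, div_le_one hB0]
    exact hBμ
  -- One more vertex multiplies the number of sets that are not hit by at most 1 - μ/B.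
  have step : ∀ k : ℕ, ∃ Z : Finset α, Z.card ≤ k ∧
      ((D.filter fun X => X ∩ Z = ∅).card : ℝ) ≤ D.card * (1 - μ / B) ^ k := by
    intro k
    induction k with
    | zero => exact ⟨∅, by simp, by simp⟩
    | succ k ih =>
      obtain ⟨Z, hZ, hcard⟩ := ih
      set E := D.filter fun X => X ∩ Z = ∅ with hE
      have hsum : (E.card : ℝ) * μ ≤ ∑ v ∈ C, b v * (E.filter fun X => v ∈ X).card := by
        calc (E.card : ℝ) * μ = ∑ X ∈ E, μ := by simp
          _ ≤ ∑ X ∈ E, ∑ v ∈ C, if v ∈ X then b v else 0 := by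
              refine Finset.sum_le_sum fun X hX => ?_
              have hXD := hD X (Finset.mem_of_mem_filter X hX)
              rw [Finset.sum_ite_mem, Finset.inter_eq_right.mpr hXD.1]
              exact hXD.2
          _ = _ := by
              rw [Finset.sum_comm]
              refine Finset.sum_congr rfl fun v _ => ?_
              rw [← Finset.sum_filter, Finset.sum_const, nsmul_eq_mul, mul_comm]
      -- Averaging over C with the weights b: every remaining set has mass at least μ out of at most
      -- B, so some vertex lies in a fraction μ/B of them.
      have hex : ∃ v, (E.card : ℝ) * (μ / B) ≤ ((E.filter fun X => v ∈ X).card : ℝ) := by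
        by_contra hc
        push Not at hc
        rcases E.eq_empty_or_nonempty with h0 | ⟨X, hX⟩
        · obtain ⟨X, hX⟩ := hne
          have hXne : X.Nonempty := by
            by_contra hXe
            rw [Finset.not_nonempty_iff_eq_empty] at hXe
            have := (hD X hX).2
            rw [hXe, Finset.sum_empty] at this
            linarith
          obtain ⟨v, -⟩ := hXne
          have := hc v
          simp [h0] at this
        · have hlt : ∑ v ∈ C, b v * (E.filter fun X => v ∈ X).card ≤
              ∑ v ∈ C, b v * (E.card * (μ / B)) :=
            Finset.sum_le_sum fun v _ => mul_le_mul_of_nonneg_left (hc v).le (hb v)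
          rw [← Finset.sum_mul] at hlt
          have hEpos : (0 : ℝ) < E.card := by exact_mod_cast Finset.card_pos.mpr ⟨X, hX⟩
          have hmul : (∑ v ∈ C, b v) * (E.card * (μ / B)) ≤ B * (E.card * (μ / B)) :=
            mul_le_mul_of_nonneg_right hB (by positivity)
          have he : B * (E.card * (μ / B)) = E.card * μ := by field_simp
          -- equality forces strict inequality at a vertex of positive mass
          obtain ⟨v, hvC, hvb⟩ : ∃ v ∈ C, 0 < b v := by
            by_contra hcc
            push Not at hcc
            have hXD := hD X (Finset.mem_of_mem_filter X hX)
            have : ∑ v ∈ X, b v ≤ 0 := Finset.sum_nonpos fun v hv => hcc v (hXD.1 hv)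
            linarith [hXD.2]
          have hlt' : ∑ v ∈ C, b v * (E.filter fun X => v ∈ X).card <
              ∑ v ∈ C, b v * (E.card * (μ / B)) :=
            Finset.sum_lt_sum (fun v _ => mul_le_mul_of_nonneg_left (hc v).le (hb v))
              ⟨v, hvC, mul_lt_mul_of_pos_left (hc v) hvb⟩
          rw [← Finset.sum_mul] at hlt'
          linarith
      obtain ⟨v, hv⟩ := hex
      refine ⟨insert v Z, (Finset.card_insert_le _ _).trans (by omega), ?_⟩
      have hsub : (D.filter fun X => X ∩ insert v Z = ∅) ⊆ E \ E.filter fun X => v ∈ X := by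
        intro X
        simp only [hE, Finset.mem_filter, Finset.mem_sdiff]
        rintro ⟨h1, h2⟩
        have hvX : v ∉ X := fun h => by
          have : v ∈ X ∩ insert v Z := by simp [h]
          rw [h2] at this
          simp at this
        refine ⟨⟨h1, ?_⟩, fun h => hvX h.2⟩
        rw [← Finset.subset_empty, ← h2]
        exact Finset.inter_subset_inter_left (Finset.subset_insert v Z)
      have hc1 := Finset.card_le_card hsub
      rw [Finset.card_sdiff_of_subset (Finset.filter_subset _ _)] at hc1
      have hc2 : ((E.card - (E.filter fun X => v ∈ X).card : ℕ) : ℝ) =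
          E.card - (E.filter fun X => v ∈ X).card :=
        Nat.cast_sub (Finset.card_filter_le _ _)
      calc ((D.filter fun X => X ∩ insert v Z = ∅).card : ℝ)
          ≤ ((E.card - (E.filter fun X => v ∈ X).card : ℕ) : ℝ) := by exact_mod_cast hc1
        _ ≤ E.card * (1 - μ / B) := by rw [hc2]; linarith
        _ ≤ D.card * (1 - μ / B) ^ k * (1 - μ / B) := mul_le_mul_of_nonneg_right hcard hr
        _ = _ := by ring
  have hDpos : (0 : ℝ) < D.card := by exact_mod_cast Finset.card_pos.mpr hne
  have hlog : 0 ≤ Real.log D.card := Real.log_natCast_nonneg _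
  -- The least integer beyond (B/μ) log |D|: then |D| (1 - μ/B)^k ≤ |D| exp(-kμ/B) < 1, and no set
  -- is left.
  set k := ⌊B / μ * Real.log D.card⌋₊ + 1 with hk
  obtain ⟨Z, hZ, hcard⟩ := step k
  refine ⟨Z, fun X hX => ?_, ?_⟩
  · by_contra hc
    rw [Finset.not_nonempty_iff_eq_empty] at hc
    have h1 : (1 : ℝ) ≤ ((D.filter fun X => X ∩ Z = ∅).card : ℝ) := by
      exact_mod_cast Finset.card_pos.mpr ⟨X, Finset.mem_filter.mpr ⟨hX, hc⟩⟩
    have h2 : (1 - μ / B) ^ k ≤ Real.exp (-(μ / B) * k) := by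
      rw [mul_comm, Real.exp_nat_mul]
      exact pow_le_pow_left₀ hr (by linarith [Real.add_one_le_exp (-(μ / B))]) k
    have h3 : B / μ * Real.log D.card < k := by
      rw [hk]; push_cast; exact Nat.lt_floor_add_one _
    have h4 : Real.log D.card < μ / B * k := by
      have := mul_lt_mul_of_pos_left h3 (div_pos hμ hB0)
      have e : μ / B * (B / μ * Real.log D.card) = Real.log D.card := by field_simp
      linarith
    have h5 : D.card * Real.exp (-(μ / B) * k) < 1 := by
      calc (D.card : ℝ) * Real.exp (-(μ / B) * k) = Real.exp (Real.log D.card + -(μ / B) * k) := by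
            rw [Real.exp_add, Real.exp_log hDpos]
        _ < 1 := by rw [Real.exp_lt_one_iff]; linarith
    have h6 := mul_le_mul_of_nonneg_left h2 hDpos.le
    linarith
  · calc (Z.card : ℝ) ≤ k := by exact_mod_cast hZ
      _ ≤ _ := by
        rw [hk]; push_cast
        have := Nat.floor_le (a := B / μ * Real.log D.card) (by positivity)
        linarith

/-- A separated family of bounded VC dimension is small. -/
theorem card_le_of_separated {C : Finset α} {b : α → ℝ} (hb : ∀ v, 0 ≤ b v) {B μ : ℝ}
    (hμ : 0 < μ) (hB : ∑ v ∈ C, b v ≤ B) (F : Finset (Finset α)) (hF : ∀ Q ∈ F, Q ⊆ C)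
    (hsep : ∀ Q ∈ F, ∀ Q' ∈ F, Q ≠ Q' → μ ≤ ∑ v ∈ symmDiff Q Q', b v)
    {d : ℕ} (hvc : ∀ s, F.Shatters s → s.card ≤ d) {Λ : ℝ} (hΛ : Real.log F.card ≤ Λ) :
    (F.card : ℝ) ≤ (2 * (B / μ) * Λ + 2) ^ d := by
  have hB0 : 0 ≤ B := (Finset.sum_nonneg fun v _ => hb v).trans hB
  -- A set Z that meets all symmetric differences of distinct members tells the members apart by
  -- their traces. As |D| ≤ |F|², the logarithm of |D| in the size of Z costs only a factor 2.
  set D := F.offDiag.image fun q => symmDiff q.1 q.2 with hD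
  obtain ⟨Z, hhit, hcard⟩ := exists_hitting_set hb hμ hB D (by
    intro X hX
    obtain ⟨⟨Q, Q'⟩, hq, rfl⟩ := Finset.mem_image.mp hX
    rw [Finset.mem_offDiag] at hq
    refine ⟨fun v hv => ?_, hsep Q hq.1 Q' hq.2.1 hq.2.2⟩
    rcases Finset.mem_symmDiff.mp hv with h | h
    · exact hF _ hq.1 h.1
    · exact hF _ hq.2.1 h.1)
  have hle := card_le_of_trace_injOn F Z d (fun Q hQ Q' hQ' h => by
    by_contra hne
    obtain ⟨v, hv⟩ := hhit (symmDiff Q Q')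
      (Finset.mem_image.mpr ⟨(Q, Q'), Finset.mem_offDiag.mpr ⟨hQ, hQ', hne⟩, rfl⟩)
    have := Finset.ext_iff.mp h v
    simp only [Finset.mem_inter, Finset.mem_symmDiff] at hv this
    tauto) hvc
  have hDc : Real.log D.card ≤ 2 * Λ := by
    rcases Nat.eq_zero_or_pos D.card with h0 | h0
    · rw [h0]
      simp only [Nat.cast_zero, Real.log_zero]
      have := Real.log_natCast_nonneg F.card
      linarith
    · have h1 : (D.card : ℝ) ≤ (F.card : ℝ) ^ 2 := by
        have := Finset.card_image_le (s := F.offDiag) (f := fun q => symmDiff q.1 q.2)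
        rw [Finset.offDiag_card] at this
        have h2 : D.card ≤ F.card ^ 2 := by
          rw [sq]; exact this.trans (Nat.sub_le _ _)
        exact_mod_cast h2
      calc Real.log D.card ≤ Real.log ((F.card : ℝ) ^ 2) :=
            Real.log_le_log (by exact_mod_cast h0) h1
        _ = 2 * Real.log F.card := by rw [Real.log_pow]; norm_num
        _ ≤ 2 * Λ := by linarith
  calc (F.card : ℝ) ≤ ((Z.card : ℝ) + 1) ^ d := by exact_mod_cast hle
    _ ≤ _ := by
      refine pow_le_pow_left₀ (by positivity) ?_ d
      have := mul_le_mul_of_nonneg_left hDc (div_nonneg hB0 hμ.le)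
      linarith

end Packing

end WeightedGraph


namespace WeightedGraph

/-! ### VC dimension of families of small cuts -/

section VC

variable {α : Type*} [DecidableEq α] (G : WeightedGraph α)

/-- If all cuts of `G[C]` have value at least `κ`, then the cuts of value at most `θ` with
`5 * θ < 16 * κ` do not shatter `32` points. -/
theorem card_le_of_shatters {C : Finset α} {κ θ : ℝ} (hκθ : 5 * θ < 16 * κ)
    (hκ : ∀ U ⊆ C, U.Nonempty → U ≠ C → κ ≤ G.inducedBoundary C U)
    (F : Finset (Finset α)) (hF : ∀ Q ∈ F, Q ⊆ C ∧ G.inducedBoundary C Q ≤ θ)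
    {s : Finset α} (hs : F.Shatters s) : s.card ≤ 31 := by
  by_contra hcard
  push Not at hcard
  obtain ⟨s', hs's, hs'⟩ := Finset.exists_subset_card_eq (show 32 ≤ s.card by omega)
  have hsh : F.Shatters s' := hs.mono_right hs's
  -- The 32 points are labelled by the bit strings of length 5; shattering then supplies five cuts,
  -- one for each bit.
  have hcardeq : Fintype.card (Fin 5 → Bool) = Fintype.card s' := by simp [hs']
  let f := Fintype.equivOfCardEq hcardeq
  have hsC : s' ⊆ C := by
    obtain ⟨u, hu, hsu⟩ := hsh (Finset.Subset.refl s')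
    exact (Finset.inter_eq_left.mp hsu).trans (hF u hu).1
  have hu : ∀ j : Fin 5, ∃ u ∈ F, ∀ τ, ((f τ : α) ∈ u ↔ τ j = true) := by
    intro j
    obtain ⟨u, hu, hsu⟩ := hsh (t := s'.filter fun v => ∃ τ, (f τ : α) = v ∧ τ j = true)
      (Finset.filter_subset _ _)
    refine ⟨u, hu, fun τ => ?_⟩
    have := Finset.ext_iff.mp hsu (f τ)
    simp only [Finset.mem_inter, Finset.mem_filter, (f τ).2, true_and] at this
    rw [this]
    constructor
    · rintro ⟨τ', h1, h2⟩
      have : τ' = τ := f.injective (Subtype.ext h1)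
      exact this ▸ h2
    · exact fun h => ⟨τ, rfl, h⟩
  choose u huF hu using hu
  let σ : α → Fin 5 → Bool := fun v j => decide (v ∈ u j)
  have hσf : ∀ τ, σ (f τ) = τ := fun τ => by
    funext j
    have := hu j τ
    by_cases h : τ j = true
    · simp only [σ]; rw [h]; simpa using this.mpr h
    · have h' : τ j = false := by simpa using h
      simp only [σ]; rw [h']; simpa using fun hc => h (this.mp hc)
  -- The 32 cells of the Venn diagram of the five cuts are nonempty proper subsets of C, so each of
  -- them has boundary at least κ.
  let cell : (Fin 5 → Bool) → Finset α := fun τ => C.filter fun v => σ v = τ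
  have hcell : ∀ τ, κ ≤ G.inducedBoundary C (cell τ) := by
    intro τ
    refine hκ _ (Finset.filter_subset _ _) ⟨f τ, ?_⟩ fun h => ?_
    · simp [cell, hσf, hsC (f τ).2]
    · have hmem : (f (fun j => !τ j) : α) ∈ cell τ := h ▸ hsC (f _).2
      simp only [cell, Finset.mem_filter, hσf] at hmem
      have := congrFun hmem.2 0
      revert this
      cases τ 0 <;> decide
  -- An edge between two cells lies in the boundaries of just these two cells, and at least one of
  -- the five cuts separates its ends. So the boundaries of the 32 cells add up to at most twice
  -- those of the five cuts, and 32κ ≤ 10θ contradicts 5θ < 16κ.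
  have h1 : ∑ τ, 2 * G.inducedBoundary C (cell τ) ≤
      2 * ∑ j, 2 * G.inducedBoundary C (u j) := by
    rw [Finset.sum_congr rfl fun τ (_ : τ ∈ Finset.univ) =>
        G.two_mul_inducedBoundary (S := cell τ) (Finset.filter_subset _ C),
      Finset.sum_congr rfl fun j (_ : j ∈ Finset.univ) =>
        G.two_mul_inducedBoundary (hF (u j) (huF j)).1]
    rw [Finset.sum_comm, Finset.sum_comm (s := (Finset.univ : Finset (Fin 5))), Finset.mul_sum]
    refine Finset.sum_le_sum fun a ha => ?_
    rw [Finset.sum_comm, Finset.sum_comm (s := (Finset.univ : Finset (Fin 5))), Finset.mul_sum]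
    refine Finset.sum_le_sum fun b hb => ?_
    by_cases hab : σ a = σ b
    · refine le_of_eq_of_le (Finset.sum_eq_zero fun τ _ => ?_)
        (mul_nonneg zero_le_two (Finset.sum_nonneg fun j _ => ?_))
      · rw [if_pos]
        simp [cell, ha, hb, hab]
      · split_ifs
        · exact le_rfl
        · exact G.nonneg _ _
    · have e : ∑ τ, (if (a ∈ cell τ ↔ b ∈ cell τ) then 0 else G.w a b) ≤
          ∑ τ ∈ {σ a, σ b}, G.w a b := by
        rw [← Finset.sum_subset (Finset.subset_univ {σ a, σ b})]
        · refine Finset.sum_le_sum fun τ _ => ?_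
          split_ifs
          · exact G.nonneg _ _
          · exact le_rfl
        · intro τ _ hτ
          simp only [Finset.mem_insert, Finset.mem_singleton, not_or] at hτ
          rw [if_pos]
          simp [cell, Ne.symm hτ.1, Ne.symm hτ.2]
      rw [Finset.sum_pair hab] at e
      obtain ⟨j, hj⟩ : ∃ j, σ a j ≠ σ b j := by
        by_contra hc
        push Not at hc
        exact hab (funext hc)
      have e2 : G.w a b ≤ ∑ j, if (a ∈ u j ↔ b ∈ u j) then 0 else G.w a b := by
        refine le_of_eq_of_le ?_ (Finset.single_le_sum (f := fun j =>
          if (a ∈ u j ↔ b ∈ u j) then 0 else G.w a b) (fun j _ => ?_) (Finset.mem_univ j))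
        · show _ = if _ then _ else _
          rw [if_neg]
          intro h
          exact hj (by simp [σ, h])
        · split_ifs
          · exact le_rfl
          · exact G.nonneg _ _
      linarith
  have h2 : ∑ τ : Fin 5 → Bool, 2 * κ ≤ ∑ τ, 2 * G.inducedBoundary C (cell τ) :=
    Finset.sum_le_sum fun τ _ => by linarith [hcell τ]
  have h3 : ∑ j, 2 * G.inducedBoundary C (u j) ≤ ∑ j : Fin 5, 2 * θ :=
    Finset.sum_le_sum fun j _ => by linarith [(hF (u j) (huF j)).2]
  simp at h2 h3
  linarith

/-- Three cuts that avoid a common vertex, against the three sets of vertices which lie in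
exactly two of them and the set of vertices that lie in none of them. -/
theorem sum_inducedBoundary_le {C A₁ A₂ A₃ : Finset α} (h₁ : A₁ ⊆ C) (h₂ : A₂ ⊆ C) (h₃ : A₃ ⊆ C) :
    G.inducedBoundary C ((A₁ ∩ A₂) \ A₃) + G.inducedBoundary C ((A₁ ∩ A₃) \ A₂) +
      G.inducedBoundary C ((A₂ ∩ A₃) \ A₁) + G.inducedBoundary C (C \ (A₁ ∪ A₂ ∪ A₃)) ≤
    G.inducedBoundary C A₁ + G.inducedBoundary C A₂ + G.inducedBoundary C A₃ := by
  have e : ∀ X Y Z, X ⊆ C → (X ∩ Y) \ Z ⊆ C := fun X Y Z h =>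
    Finset.sdiff_subset.trans (Finset.inter_subset_left.trans h)
  have key : 2 * G.inducedBoundary C ((A₁ ∩ A₂) \ A₃) + 2 * G.inducedBoundary C ((A₁ ∩ A₃) \ A₂) +
      2 * G.inducedBoundary C ((A₂ ∩ A₃) \ A₁) + 2 * G.inducedBoundary C (C \ (A₁ ∪ A₂ ∪ A₃)) ≤
      2 * G.inducedBoundary C A₁ + 2 * G.inducedBoundary C A₂ + 2 * G.inducedBoundary C A₃ := by
    rw [G.two_mul_inducedBoundary (e _ _ _ h₁), G.two_mul_inducedBoundary (e _ _ _ h₁),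
      G.two_mul_inducedBoundary (e _ _ _ h₂), G.two_mul_inducedBoundary Finset.sdiff_subset,
      G.two_mul_inducedBoundary h₁, G.two_mul_inducedBoundary h₂, G.two_mul_inducedBoundary h₃]
    simp only [← Finset.sum_add_distrib]
    -- The four sets on the left are the membership patterns 110, 101, 011 and 000. Two of them
    -- differ in exactly two coordinates, so an edge between them is counted twice on both sides; an
    -- edge with one end in them is separated by at least one of the three cuts.
    refine Finset.sum_le_sum fun a ha => Finset.sum_le_sum fun b hb => ?_
    have hw := G.nonneg a b
    simp only [Finset.mem_sdiff, Finset.mem_inter, Finset.mem_union, ha, hb, true_and]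
    by_cases a1 : a ∈ A₁ <;> by_cases a2 : a ∈ A₂ <;> by_cases a3 : a ∈ A₃ <;>
      by_cases b1 : b ∈ A₁ <;> by_cases b2 : b ∈ A₂ <;> by_cases b3 : b ∈ A₃ <;>
      simp only [a1, a2, a3, b1, b2, b3, and_true, and_false, not_true_eq_false,
        not_false_eq_true, or_true, or_false, or_self, and_self, iff_true, iff_false, iff_self,
        if_true, if_false] <;> linarith
  linarith

/-- A family of small cuts which avoid a common vertex and are close to one another with respect
to the boundary does not shatter three points. -/
theorem card_le_two_of_shatters {C : Finset α} {b : α → ℝ} {l : ℝ} (hl : 0 < l)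
    (hb : ∀ v, 0 ≤ b v)
    (hlow : ∀ U ⊆ C, U.Nonempty → l ≤ G.inducedBoundary C U + ∑ v ∈ U, b v)
    (hκ : ∀ U ⊆ C, U.Nonempty → U ≠ C → 0.49 * l ≤ G.inducedBoundary C U)
    {r : α} (hr : r ∈ C) (F : Finset (Finset α))
    (hF : ∀ Q ∈ F, Q ⊆ C ∧ r ∉ Q ∧ G.inducedBoundary C Q ≤ 1.03 * l)
    (hdiam : ∀ Q ∈ F, ∀ Q' ∈ F, ∑ v ∈ symmDiff Q Q', b v ≤ 0.02 * l)
    {s : Finset α} (hs : F.Shatters s) : s.card ≤ 2 := by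
  by_contra hcard
  push Not at hcard
  obtain ⟨s', hs's, hs'⟩ := Finset.exists_subset_card_eq (show 3 ≤ s.card by omega)
  have hsh : F.Shatters s' := hs.mono_right hs's
  obtain ⟨p, q, t, hpq, hpt, hqt, rfl⟩ := Finset.card_eq_three.mp hs'
  have hget : ∀ x y, x ∈ ({p, q, t} : Finset α) → y ∈ ({p, q, t} : Finset α) →
      ∃ A ∈ F, ∀ v ∈ ({p, q, t} : Finset α), v ∈ A ↔ v = x ∨ v = y := by
    intro x y hx hy
    obtain ⟨A, hA, hAs⟩ := hsh (t := {x, y}) (by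
      intro v hv
      rcases Finset.mem_insert.mp hv with rfl | hv
      · exact hx
      · rw [Finset.mem_singleton.mp hv]; exact hy)
    refine ⟨A, hA, fun v hv => ?_⟩
    have := Finset.ext_iff.mp hAs v
    simp only [Finset.mem_inter, hv, true_and] at this
    rw [this]; simp
  obtain ⟨A₁, hA₁, h₁⟩ := hget p q (by simp) (by simp)
  obtain ⟨A₂, hA₂, h₂⟩ := hget p t (by simp) (by simp)
  obtain ⟨A₃, hA₃, h₃⟩ := hget q t (by simp) (by simp)
  -- The set (X ∩ Y) \ Z lies in X Δ Z, which has little mass; hence almost all of its boundary,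
  -- which is at least l, is inside G[C].
  have hE : ∀ X ∈ F, ∀ Y ∈ F, ∀ Z ∈ F, ∀ v, v ∈ X → v ∈ Y → v ∉ Z →
      0.98 * l ≤ G.inducedBoundary C ((X ∩ Y) \ Z) := by
    intro X hX Y hY Z hZ v hvX hvY hvZ
    have hsub : (X ∩ Y) \ Z ⊆ C :=
      Finset.sdiff_subset.trans (Finset.inter_subset_left.trans (hF X hX).1)
    have h1 := hlow _ hsub ⟨v, by simp [hvX, hvY, hvZ]⟩
    have h2 : ∑ v ∈ (X ∩ Y) \ Z, b v ≤ ∑ v ∈ symmDiff X Z, b v :=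
      Finset.sum_le_sum_of_subset_of_nonneg (fun v hv => by
        simp only [Finset.mem_sdiff, Finset.mem_inter, Finset.mem_symmDiff] at hv ⊢
        tauto) fun v _ _ => hb v
    have h3 := hdiam X hX Z hZ
    linarith
  have e1 := hE A₁ hA₁ A₂ hA₂ A₃ hA₃ p ((h₁ p (by simp)).mpr (by simp))
    ((h₂ p (by simp)).mpr (by simp)) (fun h => by
      have := (h₃ p (by simp)).mp h; tauto)
  have e2 := hE A₁ hA₁ A₃ hA₃ A₂ hA₂ q ((h₁ q (by simp)).mpr (by simp))
    ((h₃ q (by simp)).mpr (by simp)) (fun h => by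
      have := (h₂ q (by simp)).mp h; rcases this with h | h
      · exact hpq h.symm
      · exact hqt h)
  have e3 := hE A₂ hA₂ A₃ hA₃ A₁ hA₁ t ((h₂ t (by simp)).mpr (by simp))
    ((h₃ t (by simp)).mpr (by simp)) (fun h => by
      have := (h₁ t (by simp)).mp h; rcases this with h | h
      · exact hpt h.symm
      · exact hqt h.symm)
  -- The common vertex r makes the pattern 000 nonempty; this is why cuts are represented by the
  -- side that avoids the root.
  have e4 : 0.49 * l ≤ G.inducedBoundary C (C \ (A₁ ∪ A₂ ∪ A₃)) := by
    refine hκ _ Finset.sdiff_subset ⟨r, ?_⟩ fun h => ?_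
    · simp [hr, (hF _ hA₁).2.1, (hF _ hA₂).2.1, (hF _ hA₃).2.1]
    · have hp : p ∈ A₁ := (h₁ p (by simp)).mpr (by simp)
      have hpC : p ∈ C := (hF _ hA₁).1 hp
      rw [← h] at hpC
      simp [hp] at hpC
  -- Contradiction: the left side is at least 3 · 0.98 l + 0.49 l = 3.43 l, the right side at most 3
  -- · 1.03 l = 3.09 l.
  have := G.sum_inducedBoundary_le (hF _ hA₁).1 (hF _ hA₂).1 (hF _ hA₃).1
  have := (hF _ hA₁).2.2
  have := (hF _ hA₂).2.2
  have := (hF _ hA₃).2.2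
  linarith

/-- A family of small cuts of `G[C]` which are pairwise far apart with respect to the boundary
is small. -/
theorem card_le_of_separated_cuts {C : Finset α} {b : α → ℝ} {l ε : ℝ} (hl : 0 < l) (hε : 0 < ε)
    (hb : ∀ v, 0 ≤ b v) (hB : ∑ v ∈ C, b v ≤ 4 * l)
    (hlow : ∀ U ⊆ C, U.Nonempty → l ≤ G.inducedBoundary C U + ∑ v ∈ U, b v)
    (hκ : ∀ U ⊆ C, U.Nonempty → U ≠ C → 0.49 * l ≤ G.inducedBoundary C U)
    {r : α} (hr : r ∈ C) (F : Finset (Finset α))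
    (hF : ∀ Q ∈ F, Q ⊆ C ∧ r ∉ Q ∧ G.inducedBoundary C Q ≤ 1.03 * l)
    (hsep : ∀ Q ∈ F, ∀ Q' ∈ F, Q ≠ Q' → ε / 2 * l ≤ ∑ v ∈ symmDiff Q Q', b v)
    {Λ : ℝ} (hΛ : 31 * Real.log (C.card + 1) ≤ Λ) :
    (F.card : ℝ) ≤ (800 * Λ + 2) ^ 31 * (16 / ε * Λ + 2) ^ 2 := by
  classical
  have hvc : ∀ F' ⊆ F, ∀ s, F'.Shatters s → s.card ≤ 31 := fun F' hF' s hs =>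
    G.card_le_of_shatters (κ := 0.49 * l) (θ := 1.03 * l) (by linarith) hκ F'
      (fun Q hQ => ⟨(hF Q (hF' hQ)).1, (hF Q (hF' hQ)).2.2⟩) hs
  -- A crude bound, good enough inside a logarithm: members are determined by their traces on C
  -- itself.
  have hlog : ∀ F' ⊆ F, Real.log F'.card ≤ Λ := by
    intro F' hF'
    rcases Nat.eq_zero_or_pos F'.card with h0 | h0
    · rw [h0]
      simp only [Nat.cast_zero, Real.log_zero]
      refine le_trans (mul_nonneg (by norm_num) (Real.log_nonneg ?_)) hΛ
      linarith [Nat.cast_nonneg (α := ℝ) C.card]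
    · have h1 := card_le_of_trace_injOn F' C 31 (fun Q hQ Q' hQ' h => by
        rwa [Finset.inter_eq_left.mpr (hF Q (hF' hQ)).1,
          Finset.inter_eq_left.mpr (hF Q' (hF' hQ')).1] at h) (hvc F' hF')
      calc Real.log F'.card ≤ Real.log ((C.card + 1 : ℝ) ^ 31) :=
            Real.log_le_log (by exact_mod_cast h0) (by exact_mod_cast h1)
        _ = 31 * Real.log (C.card + 1) := by rw [Real.log_pow]; norm_num
        _ ≤ Λ := hΛ
  -- a maximal coarsely separated subfamily
  obtain ⟨F₀, hF₀, hmax⟩ := (F.powerset.filter fun F' => ∀ Q ∈ F', ∀ Q' ∈ F', Q ≠ Q' →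
      0.01 * l ≤ ∑ v ∈ symmDiff Q Q', b v).exists_max_image Finset.card
    ⟨∅, by simp⟩
  simp only [Finset.mem_filter, Finset.mem_powerset] at hF₀ hmax
  obtain ⟨hF₀F, hF₀sep⟩ := hF₀
  have hcomm : ∀ X Y : Finset α, ∑ v ∈ symmDiff X Y, b v = ∑ v ∈ symmDiff Y X, b v :=
    fun X Y => by rw [symmDiff_comm]
  have hcover : ∀ Q ∈ F, ∃ R ∈ F₀, ∑ v ∈ symmDiff Q R, b v ≤ 0.01 * l := by
    intro Q hQ
    by_contra hc
    push Not at hc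
    have hQ₀ : Q ∉ F₀ := fun h => by
      have := hc Q h
      simp only [symmDiff_self, Finset.bot_eq_empty, Finset.sum_empty] at this
      linarith
    have := hmax (insert Q F₀) ⟨Finset.insert_subset hQ hF₀F, by
      intro X hX Y hY hXY
      rcases Finset.mem_insert.mp hX with hX | hX <;> rcases Finset.mem_insert.mp hY with hY | hY
      · exact absurd (hX.trans hY.symm) hXY
      · rw [hX]; exact (hc Y hY).le
      · rw [hY, hcomm]; exact (hc X hX).le
      · exact hF₀sep X hX Y hY hXY⟩
    rw [Finset.card_insert_of_notMem hQ₀] at this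
    omega
  -- At the constant scale 0.01 l the large exponent 31 costs only powers of the logarithm.
  have h0 : (F₀.card : ℝ) ≤ (800 * Λ + 2) ^ 31 := by
    have := card_le_of_separated hb (μ := 0.01 * l) (by positivity) hB F₀
      (fun Q hQ => (hF Q (hF₀F hQ)).1) hF₀sep (hvc F₀ hF₀F) (hlog F₀ hF₀F)
    have e : 2 * (4 * l / (0.01 * l)) = 800 := by field_simp; norm_num
    rwa [e] at this
  -- Cuts within 0.01 l of R are within 0.02 l of each other, so here the dimension is 2 and 1/ε
  -- enters only squared.
  have h1 : ∀ R ∈ F₀, ((F.filter fun Q => ∑ v ∈ symmDiff Q R, b v ≤ 0.01 * l).card : ℝ) ≤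
      (16 / ε * Λ + 2) ^ 2 := by
    intro R hR
    set F₁ := F.filter fun Q => ∑ v ∈ symmDiff Q R, b v ≤ 0.01 * l with hF₁
    have hF₁F : F₁ ⊆ F := Finset.filter_subset _ _
    have := card_le_of_separated hb (μ := ε / 2 * l) (by positivity) hB F₁
      (fun Q hQ => (hF Q (hF₁F hQ)).1)
      (fun Q hQ Q' hQ' hne => hsep Q (hF₁F hQ) Q' (hF₁F hQ') hne) (d := 2)
      (fun s hs => G.card_le_two_of_shatters hl hb hlow hκ hr F₁ (fun Q hQ => hF Q (hF₁F hQ))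
        (fun Q hQ Q' hQ' => by
          have h2 := (Finset.mem_filter.mp hQ).2
          have h3 := (Finset.mem_filter.mp hQ').2
          have h4 := sum_symmDiff_triangle hb Q R Q'
          rw [hcomm R Q'] at h4
          linarith) hs) (hlog F₁ hF₁F)
    have e : 2 * (4 * l / (ε / 2 * l)) = 16 / ε := by field_simp; norm_num
    rwa [e] at this
  have h2 : F ⊆ F₀.biUnion fun R => F.filter fun Q => ∑ v ∈ symmDiff Q R, b v ≤ 0.01 * l := by
    intro Q hQ
    obtain ⟨R, hR, hQR⟩ := hcover Q hQ
    exact Finset.mem_biUnion.mpr ⟨R, hR, Finset.mem_filter.mpr ⟨hQ, hQR⟩⟩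
  calc (F.card : ℝ) ≤
        ∑ R ∈ F₀, ((F.filter fun Q => ∑ v ∈ symmDiff Q R, b v ≤ 0.01 * l).card : ℝ) := by
        exact_mod_cast (Finset.card_le_card h2).trans Finset.card_biUnion_le
    _ ≤ ∑ R ∈ F₀, (16 / ε * Λ + 2) ^ 2 := Finset.sum_le_sum h1
    _ = F₀.card * (16 / ε * Λ + 2) ^ 2 := by rw [Finset.sum_const, nsmul_eq_mul]
    _ ≤ _ := mul_le_mul_of_nonneg_right h0 (by positivity)

end VC

end WeightedGraph


/-! ### Prim's algorithm and packing of trees by multiplicative weights -/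

/-- The tree packing needs 5 · log 1.1 > 0.2 · 2.103 with some room; four decimals are enough. -/
theorem log_eleven_tenths_ge : 0.0953 ≤ Real.log 1.1 := by
  rw [Real.le_log_iff_exp_le (by norm_num)]
  refine (Real.exp_bound' (by norm_num) (by norm_num) (n := 4) (by norm_num)).trans ?_
  norm_num [Finset.sum_range_succ, Nat.factorial]

/-- The layer cake principle for finite sums. -/
theorem sum_mul_le_sum_mul_of_layers {ι κ : Type*} (s : Finset ι) (t : Finset κ)
    {a x : ι → ℝ} {b y : κ → ℝ} (ha : ∀ i ∈ s, 0 ≤ a i) (hb : ∀ j ∈ t, 0 ≤ b j)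
    (hx : ∀ i ∈ s, 0 ≤ x i) (hy : ∀ j ∈ t, 0 ≤ y j)
    (h : ∀ θ, 0 ≤ θ → ∑ i ∈ s, (if θ ≤ x i then a i else 0) ≤
      ∑ j ∈ t, if θ ≤ y j then b j else 0) :
    ∑ i ∈ s, a i * x i ≤ ∑ j ∈ t, b j * y j := by
  set M : ℝ := ∑ i ∈ s, x i + ∑ j ∈ t, y j with hM
  have hM0 : 0 ≤ M := add_nonneg (Finset.sum_nonneg hx) (Finset.sum_nonneg hy)
  have hxM : ∀ i ∈ s, x i ≤ M := fun i hi => by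
    have := Finset.single_le_sum hx hi
    have := Finset.sum_nonneg hy
    linarith
  have hyM : ∀ j ∈ t, y j ≤ M := fun j hj => by
    have := Finset.single_le_sum hy hj
    have := Finset.sum_nonneg hx
    linarith
  have hint : ∀ c z : ℝ, 0 ≤ c →
      IntervalIntegrable (fun θ => if θ ≤ z then c else 0) MeasureTheory.volume 0 M := by
    intro c z hc
    refine Antitone.intervalIntegrable fun p q hpq => ?_
    split_ifs with h1 h2 h2
    · exact le_rfl
    · exact absurd (hpq.trans h1) h2
    · exact hc
    · exact le_rfl
  have hval : ∀ c z : ℝ, 0 ≤ z → z ≤ M → ∫ θ in (0 : ℝ)..M, (if θ ≤ z then c else 0) = c * z := by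
    intro c z hz hzM
    have := intervalIntegral.integral_indicator (μ := MeasureTheory.volume)
      (f := fun _ : ℝ => c) (a₁ := 0) (a₂ := z) (a₃ := M) ⟨hz, hzM⟩
    simp only [Set.indicator, Set.mem_ofPred_eq, intervalIntegral.integral_const, sub_zero,
      smul_eq_mul] at this
    rw [this, mul_comm]
  -- Integrating the hypothesis over the thresholds θ from 0 to M, where M is beyond all heights,
  -- turns each indicator of θ ≤ z into z.
  have key := intervalIntegral.integral_mono_on hM0
    (IntervalIntegrable.sum s fun i hi => hint (a i) (x i) (ha i hi))
    (IntervalIntegrable.sum t fun j hj => hint (b j) (y j) (hb j hj))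
    (fun θ hθ => by simpa only [Finset.sum_apply] using h θ hθ.1)
  simp only [Finset.sum_apply] at key
  rw [intervalIntegral.integral_finsetSum fun i hi => hint (a i) (x i) (ha i hi),
    intervalIntegral.integral_finsetSum fun j hj => hint (b j) (y j) (hb j hj),
    Finset.sum_congr rfl fun i hi => hval (a i) (x i) (hx i hi) (hxM i hi),
    Finset.sum_congr rfl fun j hj => hval (b j) (y j) (hy j hj) (hyM j hj)] at key
  exact key

namespace WeightedGraph

section Prim

variable {α : Type*} [DecidableEq α] (G : WeightedGraph α)

/-- The vertices which are reached by the first `i` steps of Prim's algorithm. -/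
def reached (r : α) (vt : ℕ → α) (i : ℕ) : Finset α := insert r ((Finset.range i).image vt)

/-- The `m` steps `vt i`, `pa i` (new vertex and its parent) are the beginning of a run of Prim's
algorithm in `G[C]` for the edge lengths `ℓ`. -/
structure IsPrimRun (C : Finset α) (ℓ : α → α → ℝ) (r : α) (vt pa : ℕ → α) (m : ℕ) : Prop where
  root : r ∈ C
  mem : ∀ i < m, vt i ∈ C
  fresh : ∀ i < m, vt i ∉ reached r vt i
  parent : ∀ i < m, pa i ∈ reached r vt i
  pos : ∀ i < m, 0 < G.w (pa i) (vt i)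
  min : ∀ i < m, ∀ u ∈ reached r vt i, ∀ v ∈ C, v ∉ reached r vt i → 0 < G.w u v →
    ℓ (pa i) (vt i) ≤ ℓ u v

/-- A complete run of Prim's algorithm. -/
structure IsPrimTree (C : Finset α) (ℓ : α → α → ℝ) (r : α) (vt pa : ℕ → α) (m : ℕ) : Prop
    extends G.IsPrimRun C ℓ r vt pa m where
  maximal : ∀ u ∈ reached r vt m, ∀ v ∈ C, v ∉ reached r vt m → G.w u v = 0

theorem reached_mono (r : α) (vt : ℕ → α) {i j : ℕ} (h : i ≤ j) :
    reached r vt i ⊆ reached r vt j :=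
  Finset.insert_subset_insert _ (Finset.image_subset_image (by simpa using h))

theorem mem_reached_of_lt (r : α) (vt : ℕ → α) {i j : ℕ} (h : i < j) :
    vt i ∈ reached r vt j :=
  Finset.mem_insert_of_mem (Finset.mem_image_of_mem _ (Finset.mem_range.mpr h))

namespace IsPrimTree

variable {G} {C : Finset α} {ℓ : α → α → ℝ} {r : α} {vt pa : ℕ → α} {m : ℕ}
  (h : G.IsPrimTree C ℓ r vt pa m)

include h

theorem reached_subset : ∀ {i : ℕ}, i ≤ m → reached r vt i ⊆ C := by
  intro i hi v hv
  rcases Finset.mem_insert.mp hv with rfl | hv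
  · exact h.root
  · obtain ⟨j, hj, rfl⟩ := Finset.mem_image.mp hv
    exact h.mem j ((Finset.mem_range.mp hj).trans_le hi)

theorem parent_mem {i : ℕ} (hi : i < m) : pa i ∈ C := h.reached_subset hi.le (h.parent i hi)

theorem vt_ne {i j : ℕ} (hij : i < j) (hj : j < m) : vt i ≠ vt j := fun e =>
  h.fresh j hj (e ▸ mem_reached_of_lt r vt hij)

/-- In a graph without empty cuts the tree is spanning. -/
theorem reached_eq (hκ : ∀ U ⊆ C, U.Nonempty → U ≠ C → 0 < G.inducedBoundary C U) :
    reached r vt m = C := by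
  by_contra hne
  have := hκ _ (h.reached_subset le_rfl) ⟨r, Finset.mem_insert_self _ _⟩ hne
  refine this.ne' ?_
  unfold inducedBoundary cut
  refine Finset.sum_eq_zero fun u hu => Finset.sum_eq_zero fun v hv => ?_
  exact h.maximal u hu v (Finset.mem_sdiff.mp hv).1 (Finset.mem_sdiff.mp hv).2

/-- The number of long steps of Prim's algorithm is controlled by the weight of the long edges. -/
theorem mul_card_le {κ : ℝ} (hκ : ∀ U ⊆ C, U.Nonempty → U ≠ C → κ ≤ G.inducedBoundary C U)
    (hκ0 : 0 < κ) (hsymm : ∀ u ∈ C, ∀ v ∈ C, ℓ u v = ℓ v u) (θ : ℝ) :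
    κ * ((Finset.range m).filter fun i => θ ≤ ℓ (pa i) (vt i)).card ≤
      ∑ u ∈ C, ∑ v ∈ C, if θ ≤ ℓ u v then G.w u v else 0 := by
  set big := (Finset.range m).filter fun i => θ ≤ ℓ (pa i) (vt i) with hbig
  have hnn : ∀ u v, 0 ≤ if θ ≤ ℓ u v then G.w u v else 0 := fun u v => by
    split_ifs
    · exact G.nonneg _ _
    · exact le_rfl
  rcases big.eq_empty_or_nonempty with h0 | ⟨i₀, hi₀⟩
  · rw [h0]
    simpa using Finset.sum_nonneg fun u _ => Finset.sum_nonneg fun v _ => hnn u v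
  -- The number of long steps that are made before v is reached. Its level sets are the blocks of
  -- vertices added between consecutive long steps, with the vertices that are never reached in the
  -- last block.
  let g : α → ℕ := fun v => (big.filter fun j => v ∉ reached r vt j).card
  have hlt : ∀ u v, g u < g v → ∃ j ∈ big, u ∈ reached r vt j ∧ v ∉ reached r vt j := by
    intro u v huv
    by_contra hc
    push Not at hc
    refine absurd (Finset.card_le_card fun j hj => ?_) (not_le.mpr huv)
    obtain ⟨hj, hjv⟩ := Finset.mem_filter.mp hj
    exact Finset.mem_filter.mpr ⟨hj, fun hu => hjv (hc j hj hu)⟩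
  have hgr : g r = 0 := by
    simp [g, reached]
  have hglt : ∀ i ∈ big, ∀ j ∈ big, i < j → g (vt i) < g (vt j) := by
    intro i hi j hj hij
    have hjm := Finset.mem_range.mp (Finset.mem_filter.mp hj).1
    refine Finset.card_lt_card ⟨fun k hk => ?_, fun hsub => ?_⟩
    · obtain ⟨hk, hkv⟩ := Finset.mem_filter.mp hk
      have hki : k ≤ i := by
        by_contra hc
        exact hkv (mem_reached_of_lt r vt (not_le.mp hc))
      exact Finset.mem_filter.mpr ⟨hk, fun hc =>
        h.fresh j hjm (reached_mono r vt (hki.trans hij.le) hc)⟩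
    · have := hsub (Finset.mem_filter.mpr ⟨hj, h.fresh j hjm⟩)
      exact (Finset.mem_filter.mp this).2 (mem_reached_of_lt r vt hij)
  have hginj : Set.InjOn (fun i => g (vt i)) big := by
    intro i hi j hj hij
    rcases lt_trichotomy i j with hlt | heq | hlt
    · exact absurd hij (hglt i hi j hj hlt).ne
    · exact heq
    · exact absurd hij (hglt j hj i hi hlt).ne'
  have hpos : ∀ i ∈ big, 0 < g (vt i) := fun i hi => Finset.card_pos.mpr
    ⟨i, Finset.mem_filter.mpr ⟨hi, h.fresh i (Finset.mem_range.mp (Finset.mem_filter.mp hi).1)⟩⟩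
  -- The vertices added by long steps have distinct values of g, so there are at least as many
  -- blocks as long steps.
  have hcard : big.card ≤ (C.image g).card := by
    rw [← Finset.card_image_of_injOn hginj]
    refine Finset.card_le_card fun c hc => ?_
    obtain ⟨i, hi, rfl⟩ := Finset.mem_image.mp hc
    exact Finset.mem_image_of_mem _ (h.mem i (Finset.mem_range.mp (Finset.mem_filter.mp hi).1))
  have hblock : ∀ c ∈ C.image g, κ ≤ G.inducedBoundary C (C.filter fun v => g v = c) := by
    intro c hc
    obtain ⟨v, hv, rfl⟩ := Finset.mem_image.mp hc
    refine hκ _ (Finset.filter_subset _ _) ⟨v, by simp [hv]⟩ fun e => ?_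
    have h1 : r ∈ C.filter fun u => g u = g v := e.symm ▸ h.root
    have h2 : vt i₀ ∈ C.filter fun u => g u = g v := e.symm ▸ h.mem i₀
      (Finset.mem_range.mp (Finset.mem_filter.mp hi₀).1)
    have h3 := (Finset.mem_filter.mp h1).2
    have h4 := (Finset.mem_filter.mp h2).2
    have := hpos i₀ hi₀
    omega
  calc κ * big.card ≤ κ * (C.image g).card :=
        mul_le_mul_of_nonneg_left (by exact_mod_cast hcard) hκ0.le
    _ = ∑ c ∈ C.image g, κ := by rw [Finset.sum_const, nsmul_eq_mul, mul_comm]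
    _ ≤ ∑ c ∈ C.image g, G.inducedBoundary C (C.filter fun v => g v = c) :=
        Finset.sum_le_sum hblock
    _ = ∑ c ∈ C.image g, ∑ u ∈ C.filter (fun u => g u = c), ∑ v ∈ C,
          if g v ≠ g u then G.w u v else 0 := by
        refine Finset.sum_congr rfl fun c _ => Finset.sum_congr rfl fun u hu => ?_
        rw [← Finset.sum_filter]
        refine Finset.sum_congr ?_ fun _ _ => rfl
        ext v
        have := (Finset.mem_filter.mp hu).2
        simp only [Finset.mem_sdiff, Finset.mem_filter, this]
        tauto
    _ = ∑ u ∈ C, ∑ v ∈ C, if g v ≠ g u then G.w u v else 0 :=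
        Finset.sum_fiberwise_of_maps_to (fun u hu => Finset.mem_image_of_mem g hu) _
    _ ≤ _ := by
        refine Finset.sum_le_sum fun u hu => Finset.sum_le_sum fun v hv => ?_
        by_cases huv : g v ≠ g u
        · rw [if_pos huv]
          rcases (G.nonneg u v).eq_or_lt with h0 | h0
          · rw [← h0]; split_ifs <;> exact le_rfl
          rw [if_pos]
          -- If u and v are in different blocks, then at some long step exactly one of them had been
          -- reached, so the edge uv was available and is at least as long as the edge that was
          -- taken. Thus only long edges join different blocks.
          rcases lt_or_gt_of_ne huv with h1 | h1
          · obtain ⟨j, hj, hjv, hju⟩ := hlt v u h1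
            obtain ⟨hjm, hjl⟩ := Finset.mem_filter.mp hj
            rw [hsymm u hu v hv]
            exact hjl.trans (h.min j (Finset.mem_range.mp hjm) v hjv u hu hju (G.symm u v ▸ h0))
          · obtain ⟨j, hj, hju, hjv⟩ := hlt u v h1
            obtain ⟨hjm, hjl⟩ := Finset.mem_filter.mp hj
            exact hjl.trans (h.min j (Finset.mem_range.mp hjm) u hju v hv hjv h0)
        · rw [if_neg huv]; exact hnn u v

/-- The length of the tree is bounded by the total length of the graph. -/
theorem mul_length_le {κ : ℝ}
    (hκ : ∀ U ⊆ C, U.Nonempty → U ≠ C → κ ≤ G.inducedBoundary C U)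
    (hκ0 : 0 < κ) (hsymm : ∀ u ∈ C, ∀ v ∈ C, ℓ u v = ℓ v u) (hℓ : ∀ u ∈ C, ∀ v ∈ C, 0 ≤ ℓ u v) :
    κ * ∑ i ∈ Finset.range m, ℓ (pa i) (vt i) ≤ ∑ u ∈ C, ∑ v ∈ C, G.w u v * ℓ u v := by
  rw [Finset.mul_sum, ← Finset.sum_product' C C fun u v => G.w u v * ℓ u v]
  -- The bound for the number of long steps is integrated over the threshold.
  refine sum_mul_le_sum_mul_of_layers (a := fun _ => κ) (x := fun i => ℓ (pa i) (vt i))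
    (b := fun p : α × α => G.w p.1 p.2) (y := fun p : α × α => ℓ p.1 p.2) _ _ (fun _ _ => hκ0.le)
    (fun _ _ => G.nonneg _ _) (fun i hi => hℓ _ (h.parent_mem (Finset.mem_range.mp hi)) _
      (h.mem i (Finset.mem_range.mp hi)))
    (fun p hp => hℓ _ (Finset.mem_product.mp hp).1 _ (Finset.mem_product.mp hp).2) fun θ _ => ?_
  rw [Finset.sum_product C C]
  refine le_trans (le_of_eq ?_) (h.mul_card_le hκ hκ0 hsymm θ)
  rw [← Finset.sum_filter, Finset.sum_const, nsmul_eq_mul, mul_comm]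

end IsPrimTree

/-- The pair `uv` is an edge of the tree. -/
def TreeEdge (vt pa : ℕ → α) (m : ℕ) (u v : α) : Prop :=
  ∃ i < m, (pa i = u ∧ vt i = v) ∨ (pa i = v ∧ vt i = u)

open Classical in
/-- A packing of `q` trees by multiplicative weights: the lengths of the edges of a tree are
increased in proportion to the smallest weight `c` of an edge of the tree. -/
structure IsTreePacking (C : Finset α) (r : α) (ℓ : ℕ → α → α → ℝ) (vt pa : ℕ → ℕ → α)
    (m : ℕ → ℕ) (c : ℕ → ℝ) (q : ℕ) : Prop where
  init : ∀ u ∈ C, ∀ v ∈ C, ℓ 0 u v = (G.w u v)⁻¹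
  tree : ∀ t < q, G.IsPrimTree C (ℓ t) r (vt t) (pa t) (m t)
  step : ∀ t < q, ∀ u ∈ C, ∀ v ∈ C, ℓ (t + 1) u v =
    if TreeEdge (vt t) (pa t) (m t) u v then ℓ t u v * (1 + 0.1 * (c t / G.w u v)) else ℓ t u v
  bottleneck_le : ∀ t < q, ∀ i < m t, c t ≤ G.w (pa t i) (vt t i)
  exists_bottleneck : ∀ t < q, 0 < m t → ∃ i < m t, c t = G.w (pa t i) (vt t i)
  bottleneck_nonneg : ∀ t < q, 0 ≤ c t

omit [DecidableEq α] in
theorem TreeEdge.symm {vt pa : ℕ → α} {m : ℕ} {u v : α} (h : TreeEdge vt pa m u v) :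
    TreeEdge vt pa m v u := by
  obtain ⟨i, hi, h⟩ := h
  exact ⟨i, hi, h.symm⟩

omit [DecidableEq α] in
theorem treeEdge_comm {vt pa : ℕ → α} {m : ℕ} {u v : α} :
    TreeEdge vt pa m u v ↔ TreeEdge vt pa m v u := ⟨TreeEdge.symm, TreeEdge.symm⟩

theorem TreeEdge.pos {G : WeightedGraph α} {C : Finset α} {ℓ : α → α → ℝ} {r : α} {vt pa : ℕ → α}
    {m : ℕ} (hT : G.IsPrimTree C ℓ r vt pa m) {u v : α} (h : TreeEdge vt pa m u v) :
    0 < G.w u v := by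
  obtain ⟨i, hi, ⟨rfl, rfl⟩ | ⟨rfl, rfl⟩⟩ := h
  · exact hT.pos i hi
  · rw [G.symm]; exact hT.pos i hi

namespace IsTreePacking

variable {G} {C : Finset α} {r : α} {ℓ : ℕ → α → α → ℝ} {vt pa : ℕ → ℕ → α} {m : ℕ → ℕ}
  {c : ℕ → ℝ} {q : ℕ} (h : G.IsTreePacking C r ℓ vt pa m c q)

include h

open Classical in
theorem length_symm : ∀ t ≤ q, ∀ u ∈ C, ∀ v ∈ C, ℓ t u v = ℓ t v u := by
  intro t
  induction t with
  | zero => intro _ u hu v hv; rw [h.init u hu v hv, h.init v hv u hu, G.symm]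
  | succ t ih =>
    intro ht u hu v hv
    rw [h.step t ht u hu v hv, h.step t ht v hv u hu, ih (by omega) u hu v hv, G.symm u v]
    exact if_congr treeEdge_comm rfl rfl

theorem length_nonneg : ∀ t ≤ q, ∀ u ∈ C, ∀ v ∈ C, 0 ≤ ℓ t u v := by
  intro t
  induction t with
  | zero => intro _ u hu v hv; rw [h.init u hu v hv]; exact inv_nonneg.mpr (G.nonneg _ _)
  | succ t ih =>
    intro ht u hu v hv
    rw [h.step t ht u hu v hv]
    have h1 := ih (by omega) u hu v hv
    split_ifs
    · have := div_nonneg (h.bottleneck_nonneg t ht) (G.nonneg u v)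
      positivity
    · exact h1

/-- For a tree edge the product of weight and length grows by 0.1 c ℓ, independently of its weight,
and every edge occurs in two orders. So the total grows by at most 0.2 c times the length of the
tree, which is at most the total divided by κ. -/
theorem total_length_succ_le {κ : ℝ}
    (hκ : ∀ U ⊆ C, U.Nonempty → U ≠ C → κ ≤ G.inducedBoundary C U) (hκ0 : 0 < κ)
    {t : ℕ} (ht : t < q) :
    ∑ u ∈ C, ∑ v ∈ C, G.w u v * ℓ (t + 1) u v ≤
      (∑ u ∈ C, ∑ v ∈ C, G.w u v * ℓ t u v) * Real.exp (0.2 * (c t / κ)) := by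
  classical
  have hT := h.tree t ht
  have hsy := h.length_symm t ht.le
  have hnn := h.length_nonneg t ht.le
  have hc := h.bottleneck_nonneg t ht
  have hlen := hT.mul_length_le hκ hκ0 hsy hnn
  set D := ∑ u ∈ C, ∑ v ∈ C, G.w u v * ℓ t u v with hD
  set len := ∑ i ∈ Finset.range (m t), ℓ t (pa t i) (vt t i) with hlen'
  have h1 : ∑ u ∈ C, ∑ v ∈ C, G.w u v * ℓ (t + 1) u v = D +
      ∑ u ∈ C, ∑ v ∈ C, if TreeEdge (vt t) (pa t) (m t) u v then 0.1 * c t * ℓ t u v else 0 := by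
    rw [hD, ← Finset.sum_add_distrib]
    refine Finset.sum_congr rfl fun u hu => ?_
    rw [← Finset.sum_add_distrib]
    refine Finset.sum_congr rfl fun v hv => ?_
    rw [h.step t ht u hu v hv]
    split_ifs with he
    · have := (he.pos hT).ne'
      field_simp
    · ring
  have h2 : ∑ u ∈ C, ∑ v ∈ C, (if TreeEdge (vt t) (pa t) (m t) u v then 0.1 * c t * ℓ t u v else 0)
      ≤ ∑ u ∈ C, ∑ v ∈ C, ∑ i ∈ Finset.range (m t),
        ((if pa t i = u then if vt t i = v then 0.1 * c t * ℓ t u v else 0 else 0) +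
          (if vt t i = u then if pa t i = v then 0.1 * c t * ℓ t u v else 0 else 0)) := by
    refine Finset.sum_le_sum fun u hu => Finset.sum_le_sum fun v hv => ?_
    have hx : 0 ≤ 0.1 * c t * ℓ t u v := by
      have := hnn u hu v hv
      positivity
    have hi0 : ∀ i ∈ Finset.range (m t), 0 ≤
        (if pa t i = u then if vt t i = v then 0.1 * c t * ℓ t u v else 0 else 0) +
          (if vt t i = u then if pa t i = v then 0.1 * c t * ℓ t u v else 0 else 0) := by
      intro i _
      refine add_nonneg ?_ ?_ <;> split_ifs <;> first | exact hx | exact le_rfl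
    split_ifs with he
    · obtain ⟨i, hi, he⟩ := he
      refine le_trans ?_ (Finset.single_le_sum hi0 (Finset.mem_range.mpr hi))
      rcases he with ⟨e1, e2⟩ | ⟨e1, e2⟩
      · rw [if_pos e1, if_pos e2]
        refine le_add_of_nonneg_right ?_
        split_ifs <;> first | exact hx | exact le_rfl
      · rw [if_pos e2, if_pos e1]
        refine le_add_of_nonneg_left ?_
        split_ifs <;> first | exact hx | exact le_rfl
    · exact Finset.sum_nonneg hi0
  have h3 : ∑ u ∈ C, ∑ v ∈ C, ∑ i ∈ Finset.range (m t),
        ((if pa t i = u then if vt t i = v then 0.1 * c t * ℓ t u v else 0 else 0) +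
          (if vt t i = u then if pa t i = v then 0.1 * c t * ℓ t u v else 0 else 0)) =
      0.2 * c t * len := by
    rw [Finset.sum_congr rfl fun u _ => Finset.sum_comm, Finset.sum_comm, hlen', Finset.mul_sum]
    refine Finset.sum_congr rfl fun i hi => ?_
    have hp := hT.parent_mem (Finset.mem_range.mp hi)
    have hv := hT.mem i (Finset.mem_range.mp hi)
    have e : ∀ x y, x ∈ C → y ∈ C → ∑ u ∈ C, ∑ v ∈ C,
        (if x = u then if y = v then 0.1 * c t * ℓ t u v else 0 else 0) =
          0.1 * c t * ℓ t x y := by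
      intro x y hx hy
      rw [Finset.sum_eq_single x, Finset.sum_eq_single y]
      · simp
      · intro b _ hb; simp [hb.symm]
      · exact fun hc => absurd hy hc
      · intro b _ hb; simp [hb.symm]
      · exact fun hc => absurd hx hc
    simp only [Finset.sum_add_distrib]
    rw [e _ _ hp hv, e _ _ hv hp, hsy _ hv _ hp]
    ring
  have hD0 : 0 ≤ D := Finset.sum_nonneg fun u hu => Finset.sum_nonneg fun v hv =>
    mul_nonneg (G.nonneg _ _) (hnn u hu v hv)
  have h4 : len ≤ D / κ := by rw [le_div_iff₀ hκ0]; linarith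
  calc _ ≤ D + 0.2 * c t * len := by rw [h1]; linarith
    _ ≤ D + 0.2 * c t * (D / κ) := by
        have := mul_le_mul_of_nonneg_left h4 (show 0 ≤ 0.2 * c t by positivity)
        linarith
    _ = D * (0.2 * (c t / κ) + 1) := by ring
    _ ≤ _ := mul_le_mul_of_nonneg_left (Real.add_one_le_exp _) hD0

/-- The initial lengths are the inverse weights, so each ordered pair contributes at most 1 to the
initial total; this is where |C|² comes from. -/
theorem total_length_le {κ : ℝ}
    (hκ : ∀ U ⊆ C, U.Nonempty → U ≠ C → κ ≤ G.inducedBoundary C U) (hκ0 : 0 < κ) :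
    ∀ t ≤ q, ∑ u ∈ C, ∑ v ∈ C, G.w u v * ℓ t u v ≤
      (C.card : ℝ) ^ 2 * Real.exp (0.2 * ((∑ s ∈ Finset.range t, c s) / κ)) := by
  intro t
  induction t with
  | zero =>
    intro _
    have : ∀ u ∈ C, ∀ v ∈ C, G.w u v * ℓ 0 u v ≤ 1 := fun u hu v hv => by
      rw [h.init u hu v hv]
      exact mul_inv_le_one
    refine (Finset.sum_le_sum fun u hu => Finset.sum_le_sum fun v hv => this u hu v hv).trans ?_
    simp [sq]
  | succ t ih =>
    intro ht
    refine (h.total_length_succ_le hκ hκ0 ht).trans ?_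
    refine (mul_le_mul_of_nonneg_right (ih (by omega)) (Real.exp_nonneg _)).trans_eq ?_
    rw [mul_assoc, ← Real.exp_add, Finset.sum_range_succ]
    congr 2
    ring

open Classical in
-- Concavity, in the form 1.1^a ≤ 1 + 0.1 a for 0 ≤ a ≤ 1, applied to a = c/w. The ratio is at most
-- 1 because c is the smallest weight in the tree; this is the reason for loading a tree with its
-- bottleneck.
theorem exp_load_le : ∀ t ≤ q, ∀ u ∈ C, ∀ v ∈ C, 0 < G.w u v →
    Real.exp (Real.log 1.1 * ((∑ s ∈ Finset.range t,
      if TreeEdge (vt s) (pa s) (m s) u v then c s else 0) / G.w u v)) ≤ G.w u v * ℓ t u v := by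
  intro t
  induction t with
  | zero =>
    intro _ u hu v hv hw
    rw [h.init u hu v hv]
    simp [hw.ne']
  | succ t ih =>
    intro ht u hu v hv hw
    have h1 := ih (by omega) u hu v hv hw
    rw [Finset.sum_range_succ, add_div, mul_add, Real.exp_add, h.step t ht u hu v hv]
    split_ifs with he
    · have hc0 := h.bottleneck_nonneg t ht
      have hcw : c t ≤ G.w u v := by
        obtain ⟨i, hi, ⟨rfl, rfl⟩ | ⟨rfl, rfl⟩⟩ := he
        · exact h.bottleneck_le t ht i hi
        · rw [G.symm]; exact h.bottleneck_le t ht i hi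
      have ha0 : 0 ≤ c t / G.w u v := by positivity
      have ha1 : c t / G.w u v ≤ 1 := (div_le_one hw).mpr hcw
      have h2 : Real.exp (Real.log 1.1 * (c t / G.w u v)) ≤ 1 + 0.1 * (c t / G.w u v) := by
        rw [← Real.rpow_def_of_pos (by norm_num)]
        have := _root_.rpow_one_add_le_one_add_mul_self (s := 0.1) (by norm_num) ha0 ha1
        norm_num at this ⊢
        linarith
      rw [← mul_assoc]
      exact mul_le_mul h1 h2 (Real.exp_nonneg _) ((Real.exp_nonneg _).trans h1)
    · simpa using h1

/-- Each small cut crosses one of the trees at most four times. -/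
theorem exists_crossing_le {κ : ℝ} {L : ℕ} (hr : r ∈ C)
    (hκ : ∀ U ⊆ C, U.Nonempty → U ≠ C → κ ≤ G.inducedBoundary C U) (hκ0 : 0 < κ)
    (hL : Real.log C.card ≤ L) (hL1 : 1 ≤ L) (hq : 400 * C.card ^ 2 * L ≤ q)
    {S : Finset α} (hS : S ⊆ C) (hx : G.inducedBoundary C S ≤ 2.103 * κ) :
    ∃ t < q, ((Finset.range (m t)).filter fun i => ¬ (pa t i ∈ S ↔ vt t i ∈ S)).card ≤ 4 := by
  classical
  by_contra hcon'
  have hcon : ∀ t < q,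
      5 ≤ ((Finset.range (m t)).filter fun i => ¬ (pa t i ∈ S ↔ vt t i ∈ S)).card :=
    fun t ht => by
      by_contra hc
      exact hcon' ⟨t, ht, by omega⟩
  have : Nonempty α := ⟨r⟩
  have hCpos : 0 < C.card := Finset.card_pos.mpr ⟨r, hr⟩
  have hn1 : (1 : ℝ) ≤ C.card := by exact_mod_cast hCpos
  have hqpos : 0 < q := lt_of_lt_of_le (by positivity) hq
  set F := ∑ s ∈ Finset.range q, c s with hF
  -- The logarithm of the bound for the total length. A single edge has at most the total, so its
  -- relative load, times log 1.1, is at most Y.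
  set Y := 2 * Real.log C.card + 0.2 * (F / κ) with hY
  let load : α → α → ℝ := fun u v =>
    ∑ s ∈ Finset.range q, if TreeEdge (vt s) (pa s) (m s) u v then c s else 0
  have hln := log_eleven_tenths_ge
  have hload : ∀ u ∈ C, ∀ v ∈ C, Real.log 1.1 * load u v ≤ G.w u v * Y := by
    intro u hu v hv
    rcases (G.nonneg u v).eq_or_lt with h0 | h0
    · rw [← h0, zero_mul]
      refine le_of_eq (mul_eq_zero_of_right _ (Finset.sum_eq_zero fun s hs => if_neg fun he => ?_))
      exact (he.pos (h.tree s (Finset.mem_range.mp hs))).ne h0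
    · have h1 := h.exp_load_le q le_rfl u hu v hv h0
      have hnn : ∀ u ∈ C, ∀ v ∈ C, 0 ≤ G.w u v * ℓ q u v := fun u hu v hv =>
        mul_nonneg (G.nonneg _ _) (h.length_nonneg q le_rfl u hu v hv)
      have h2 : G.w u v * ℓ q u v ≤ ∑ u ∈ C, ∑ v ∈ C, G.w u v * ℓ q u v :=
        (Finset.single_le_sum (f := fun v => G.w u v * ℓ q u v) (hnn u hu) hv).trans
          (Finset.single_le_sum (f := fun u => ∑ v ∈ C, G.w u v * ℓ q u v)
            (fun u hu => Finset.sum_nonneg (hnn u hu)) hu)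
      have h3 := h1.trans (h2.trans (h.total_length_le hκ hκ0 q le_rfl))
      have h4 : (C.card : ℝ) ^ 2 = Real.exp (2 * Real.log C.card) := by
        rw [mul_comm, Real.exp_mul, Real.exp_log (by linarith)]
        norm_num
      rw [h4, ← Real.exp_add, Real.exp_le_exp, ← mul_div_assoc, div_le_iff₀ h0] at h3
      exact h3.trans_eq (mul_comm _ _)
  have hF0 : 0 ≤ F := Finset.sum_nonneg fun s hs => h.bottleneck_nonneg s (Finset.mem_range.mp hs)
  have hlog0 : 0 ≤ Real.log C.card := Real.log_nonneg hn1
  have hY0 : 0 ≤ Y := by positivity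
  -- the trees cross `S` often
  have hcross : 5 * F ≤ ∑ u ∈ S, ∑ v ∈ C \ S, load u v := by
    have e : ∑ u ∈ S, ∑ v ∈ C \ S, load u v = ∑ s ∈ Finset.range q, ∑ p ∈ S ×ˢ (C \ S),
        if TreeEdge (vt s) (pa s) (m s) p.1 p.2 then c s else 0 := by
      rw [← Finset.sum_product', Finset.sum_comm]
    rw [e, hF, Finset.mul_sum]
    refine Finset.sum_le_sum fun s hs => ?_
    have hs := Finset.mem_range.mp hs
    have hT := h.tree s hs
    rw [← Finset.sum_filter, Finset.sum_const, nsmul_eq_mul]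
    refine mul_le_mul_of_nonneg_right ?_ (h.bottleneck_nonneg s hs)
    have h5 := hcon s hs
    refine le_trans (by exact_mod_cast h5 : (5 : ℝ) ≤ _) (Nat.cast_le.mpr
      (Finset.card_le_card_of_injOn
        (fun i => if pa s i ∈ S then (pa s i, vt s i) else (vt s i, pa s i)) ?_ ?_))
    · intro i hi
      obtain ⟨him, hic⟩ := Finset.mem_filter.mp hi
      have him := Finset.mem_range.mp him
      have hp := hT.parent_mem him
      have hv := hT.mem i him
      by_cases hpS : pa s i ∈ S
      · have hvS : vt s i ∉ S := fun hc => hic (iff_of_true hpS hc)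
        simp only [hpS, if_true, Finset.coe_filter, Finset.mem_product, Finset.mem_sdiff]
        exact ⟨⟨hpS, hv, hvS⟩, i, him, Or.inl ⟨rfl, rfl⟩⟩
      · have hvS : vt s i ∈ S := by
          by_contra hc
          exact hic (iff_of_false hpS hc)
        simp only [hpS, if_false, Finset.coe_filter, Finset.mem_product, Finset.mem_sdiff]
        exact ⟨⟨hvS, hp, hpS⟩, i, him, Or.inr ⟨rfl, rfl⟩⟩
    -- Different steps give different edges: the vertex that is new in step j is not an end of an
    -- earlier edge.
    · have key : ∀ i j, i < j → j < m s →
          (if pa s i ∈ S then (pa s i, vt s i) else (vt s i, pa s i)) ≠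
            (if pa s j ∈ S then (pa s j, vt s j) else (vt s j, pa s j)) := by
        intro i j hij hj e
        have h1 : vt s j ∉ reached r (vt s) j := hT.fresh j hj
        have h2 : vt s i ∈ reached r (vt s) j := mem_reached_of_lt r _ hij
        have h3 : pa s i ∈ reached r (vt s) j :=
          reached_mono r _ hij.le (hT.parent i (hij.trans hj))
        split_ifs at e <;> obtain ⟨e1, e2⟩ := Prod.mk.inj e
        · exact h1 (e2 ▸ h2)
        · exact h1 (e1 ▸ h3)
        · exact h1 (e2 ▸ h3)
        · exact h1 (e1 ▸ h2)
      intro i hi j hj e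
      have hi := Finset.mem_range.mp (Finset.mem_filter.mp hi).1
      have hj := Finset.mem_range.mp (Finset.mem_filter.mp hj).1
      rcases lt_trichotomy i j with hlt | heq | hlt
      · exact absurd e (key i j hlt hj)
      · exact heq
      · exact absurd e.symm (key j i hlt hi)
  have h6 : Real.log 1.1 * (5 * F) ≤ 2.103 * κ * Y := by
    calc Real.log 1.1 * (5 * F) ≤ Real.log 1.1 * ∑ u ∈ S, ∑ v ∈ C \ S, load u v :=
          mul_le_mul_of_nonneg_left hcross (by linarith)
      _ = ∑ u ∈ S, ∑ v ∈ C \ S, Real.log 1.1 * load u v := by simp only [Finset.mul_sum]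
      _ ≤ ∑ u ∈ S, ∑ v ∈ C \ S, G.w u v * Y :=
          Finset.sum_le_sum fun u hu => Finset.sum_le_sum fun v hv =>
            hload u (hS hu) v (Finset.mem_sdiff.mp hv).1
      _ = G.inducedBoundary C S * Y := by
          simp only [← Finset.sum_mul]
          rfl
      _ ≤ _ := mul_le_mul_of_nonneg_right hx hY0
  -- every tree has a bottleneck edge
  have h7 : Real.log 1.1 * q ≤ (C.card : ℝ) ^ 2 * Y := by
    have hb : ∀ t ∈ Finset.range q, ∃ p ∈ C ×ˢ C, 0 < G.w p.1 p.2 ∧ c t = G.w p.1 p.2 ∧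
        TreeEdge (vt t) (pa t) (m t) p.1 p.2 := by
      intro t ht
      have ht := Finset.mem_range.mp ht
      have hm : 0 < m t := by
        by_contra h0
        have := hcon t ht
        rw [show m t = 0 by omega] at this
        simp at this
      obtain ⟨i, hi, he⟩ := h.exists_bottleneck t ht hm
      exact ⟨(pa t i, vt t i), Finset.mem_product.mpr ⟨(h.tree t ht).parent_mem hi,
        (h.tree t ht).mem i hi⟩, (h.tree t ht).pos i hi, he, i, hi, Or.inl ⟨rfl, rfl⟩⟩
    choose! f hfC hfpos hfc hfe using hb
    have h8 := Finset.card_eq_sum_card_fiberwise (f := f) (s := Finset.range q) (t := C ×ˢ C) hfC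
    rw [Finset.card_range] at h8
    -- Each tree whose chosen bottleneck edge is p loads p with its full weight, so the bound for
    -- the load limits the number of such trees; every tree has such an edge.
    have h9 : ∀ p ∈ C ×ˢ C,
        Real.log 1.1 * (((Finset.range q).filter fun t => f t = p).card : ℝ) ≤ Y := by
      intro p hp
      obtain ⟨hp1, hp2⟩ := Finset.mem_product.mp hp
      rcases ((Finset.range q).filter fun t => f t = p).eq_empty_or_nonempty with h0 | ⟨t₀, ht₀⟩
      · rw [h0]; simpa using hY0
      have hw : 0 < G.w p.1 p.2 := by
        obtain ⟨h1, h2⟩ := Finset.mem_filter.mp ht₀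
        exact h2 ▸ hfpos t₀ h1
      have hle : (((Finset.range q).filter fun t => f t = p).card : ℝ) * G.w p.1 p.2 ≤
          load p.1 p.2 := by
        rw [← nsmul_eq_mul, ← Finset.sum_const, Finset.sum_filter]
        refine Finset.sum_le_sum fun t ht => ?_
        by_cases hft : f t = p
        · rw [if_pos hft, if_pos (hft ▸ hfe t ht), hfc t ht, hft]
        · rw [if_neg hft]
          split_ifs
          · exact h.bottleneck_nonneg t (Finset.mem_range.mp ht)
          · exact le_rfl
      have h10 := hload _ hp1 _ hp2
      have h11 := mul_le_mul_of_nonneg_left hle (show 0 ≤ Real.log 1.1 by linarith)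
      refine le_of_mul_le_mul_right (a := G.w p.1 p.2) ?_ hw
      linarith
    calc Real.log 1.1 * q = ∑ p ∈ C ×ˢ C,
          Real.log 1.1 * (((Finset.range q).filter fun t => f t = p).card : ℝ) := by
          rw [← Finset.mul_sum]; congr 1; exact_mod_cast h8
      _ ≤ ∑ p ∈ C ×ˢ C, Y := Finset.sum_le_sum h9
      _ = _ := by rw [Finset.sum_const, Finset.card_product, nsmul_eq_mul]; push_cast; ring
  set X := F / κ with hX
  have hFX : F = X * κ := by rw [hX]; field_simp
  have hX0 : 0 ≤ X := by positivity
  -- Five crossings per tree load the cut with 5F, while its capacity allows only 2.103 κ Y / log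
  -- 1.1. The coefficient 0.4765 of X on the left exceeds 2.103 · 0.2 on the right, so X is bounded
  -- by a multiple of log |C|.
  have h12 : 0.0953 * (5 * X) ≤ 2.103 * Y := by
    have : Real.log 1.1 * (5 * X) * κ ≤ 2.103 * Y * κ := by rw [hFX] at h6; linarith
    exact le_trans (mul_le_mul_of_nonneg_right hln (mul_nonneg (by norm_num) hX0))
      (le_of_mul_le_mul_right this hκ0)
  -- Then q ≤ 18 L |C|² / 0.0953, which is less than 400 L |C|²: the number of trees was chosen to
  -- contradict this.
  have h13 : Y ≤ 18 * L := by rw [hY] at h12 ⊢; linarith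
  have h14 : 0.0953 * (q : ℝ) ≤ (C.card : ℝ) ^ 2 * (18 * L) :=
    (mul_le_mul_of_nonneg_right hln (Nat.cast_nonneg q)).trans
      (h7.trans (mul_le_mul_of_nonneg_left h13 (sq_nonneg _)))
  have h15 : 400 * (C.card : ℝ) ^ 2 * L ≤ q := by exact_mod_cast hq
  have h16 : (0 : ℝ) < (C.card : ℝ) ^ 2 * L := by
    have : (1 : ℝ) ≤ L := by exact_mod_cast hL1
    exact mul_pos (pow_pos (by linarith) 2) (by linarith)
  linarith

end IsTreePacking

end Prim

end WeightedGraph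


/-! ## A language of loop programs over arrays -/

namespace ArrayLang

/-- Variables for natural numbers and for arrays of natural numbers. -/
inductive NVar where
  | piece | atom | done | owner | stored | round | iter | root | reach | vert | par | side | best
  | found | a | b | c | d | i | u | v | x | flag | mixed | near | bu | bv | comp | fu | fv | tmp
  deriving DecidableEq

/-- Variables for real numbers and for arrays of real numbers. -/
inductive RVar where
  | w | loop | mass | len | total | cutVal | inner | outer | bestVal | bottle | acc
  deriving DecidableEq

def NVar.code : NVar → ℕ
  | piece => 0 | atom => 1 | done => 2 | owner => 3 | stored => 4 | round => 5 | iter => 6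
  | root => 7 | reach => 8 | vert => 9 | par => 10 | side => 11 | best => 12 | found => 13
  | a => 14 | b => 15 | c => 16 | d => 17 | i => 18 | u => 19 | v => 20 | x => 21 | flag => 22
  | mixed => 23 | near => 24 | bu => 25 | bv => 26 | comp => 27 | fu => 28 | fv => 29 | tmp => 30

def RVar.code : RVar → ℕ
  | w => 0 | loop => 1 | mass => 2 | len => 3 | total => 4 | cutVal => 5 | inner => 6 | outer => 7
  | bestVal => 8 | bottle => 9 | acc => 10

theorem NVar.code_lt (y : NVar) : y.code < 32 := by cases y <;> decide

theorem RVar.code_lt (y : RVar) : y.code < 32 := by cases y <;> decide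

theorem NVar.code_injective {y z : NVar} (h : y.code = z.code) : y = z := by
  cases y <;> cases z <;> first | rfl | exact absurd h (by decide)

theorem RVar.code_injective {y z : RVar} (h : y.code = z.code) : y = z := by
  cases y <;> cases z <;> first | rfl | exact absurd h (by decide)

/-- The input of a program. -/
structure Env where
  n : ℕ
  L : ℕ
  w : ℕ → ℕ → ℝ
  lp : ℕ → ℝ
  eps : ℝ
  lam : ℝ

/-- The contents of the variables; a simple variable is an array of which only one entry is
used. -/
structure Store where
  N : NVar → ℕ → ℕ → ℕ
  R : RVar → ℕ → ℕ → ℝ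

def Store.setN (s : Store) (y : NVar) (a b v : ℕ) : Store :=
  ⟨fun y' a' b' => if y' = y ∧ a' = a ∧ b' = b then v else s.N y' a' b', s.R⟩

def Store.setR (s : Store) (y : RVar) (a b : ℕ) (v : ℝ) : Store :=
  ⟨s.N, fun y' a' b' => if y' = y ∧ a' = a ∧ b' = b then v else s.R y' a' b'⟩

@[simp] theorem Store.setN_N (s : Store) (y : NVar) (a b v : ℕ) (y' : NVar) (a' b' : ℕ) :
    (s.setN y a b v).N y' a' b' = if y' = y ∧ a' = a ∧ b' = b then v else s.N y' a' b' := rfl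

@[simp] theorem Store.setN_R (s : Store) (y : NVar) (a b v : ℕ) : (s.setN y a b v).R = s.R := rfl

@[simp] theorem Store.setR_R (s : Store) (y : RVar) (a b : ℕ) (v : ℝ) (y' : RVar) (a' b' : ℕ) :
    (s.setR y a b v).R y' a' b' = if y' = y ∧ a' = a ∧ b' = b then v else s.R y' a' b' := rfl

@[simp] theorem Store.setR_N (s : Store) (y : RVar) (a b : ℕ) (v : ℝ) :
    (s.setR y a b v).N = s.N := rfl

inductive NX where
  | lit (k : ℕ)
  | size
  | get (y : NVar) (a b : NX)

inductive RX where
  | lit (q : ℚ)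
  | eps
  | lam
  | get (y : RVar) (a b : NX)
  | add (x y : RX)
  | sub (x y : RX)
  | mul (x y : RX)
  | div (x y : RX)

inductive TX where
  | le (a b : NX)
  | eq (a b : NX)
  | rle (x y : RX)
  | not (p : TX)
  | and (p q : TX)

/-- Bounds of loops. -/
inductive Bound where
  | size
  | log
  | lit (k : ℕ)
  | mul (p q : Bound)

/-- All loops have bounds that are fixed by the input, so programs terminate and have total
meanings. -/
inductive Cmd where
  | skip
  | setN (y : NVar) (a b e : NX)
  | setR (y : RVar) (a b : NX) (e : RX)
  | loadW (y : RVar) (a b : NX)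
  | loadLoop (y : RVar) (a : NX)
  | seq (P Q : Cmd)
  | ite (p : TX) (P Q : Cmd)
  | loop (y : NVar) (m : Bound) (P : Cmd)

variable (E : Env)

@[simp] def NX.eval (s : Store) : NX → ℕ
  | lit k => k
  | size => E.n
  | get y a b => s.N y (a.eval s) (b.eval s)

@[simp] noncomputable def RX.eval (s : Store) : RX → ℝ
  | lit q => q
  | eps => E.eps
  | lam => E.lam
  | get y a b => s.R y (a.eval E s) (b.eval E s)
  | add x y => x.eval s + y.eval s
  | sub x y => x.eval s - y.eval s
  | mul x y => x.eval s * y.eval s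
  | div x y => x.eval s / y.eval s

@[simp] def TX.holds (s : Store) : TX → Prop
  | le a b => a.eval E s ≤ b.eval E s
  | eq a b => a.eval E s = b.eval E s
  | rle x y => x.eval E s ≤ y.eval E s
  | not p => ¬ p.holds s
  | and p q => p.holds s ∧ q.holds s

@[simp] def Bound.val : Bound → ℕ
  | size => E.n
  | log => E.L
  | lit k => k
  | mul p q => p.val * q.val

/-- The store after `m` iterations of a loop with the counter `y` and the body `f`. -/
def iterate (f : Store → Store) (y : NVar) : ℕ → Store → Store
  | 0, s => s.setN y 0 0 0
  | m + 1, s => (f (iterate f y m s)).setN y 0 0 (m + 1)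

open Classical in
-- The meaning ignores costs; these are bounded separately by `Cmd.weight`, which depends on the
-- syntax and the input but not on the store.
noncomputable def Cmd.den : Cmd → Store → Store
  | skip, s => s
  | setN y a b e, s => s.setN y (a.eval E s) (b.eval E s) (e.eval E s)
  | setR y a b e, s => s.setR y (a.eval E s) (b.eval E s) (e.eval E s)
  | loadW y a b, s => s.setR y (a.eval E s) (b.eval E s) (E.w (a.eval E s) (b.eval E s))
  | loadLoop y a, s => s.setR y (a.eval E s) 0 (E.lp (a.eval E s))
  | seq P Q, s => Q.den (P.den s)
  | ite p P Q, s => if p.holds E s then P.den s else Q.den s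
  | loop y m P, s => iterate P.den y (m.val E) s

/-- Does the program write into the variable `z`? -/
def Cmd.writesN (z : NVar) : Cmd → Bool
  | setN y _ _ _ => y = z
  | seq P Q => P.writesN z || Q.writesN z
  | ite _ P Q => P.writesN z || Q.writesN z
  | loop y _ P => y = z || P.writesN z
  | _ => false

def Cmd.writesR (z : RVar) : Cmd → Bool
  | setR y _ _ _ => y = z
  | loadW y _ _ => y = z
  | loadLoop y _ => y = z
  | seq P Q => P.writesR z || Q.writesR z
  | ite _ P Q => P.writesR z || Q.writesR z
  | loop _ _ P => P.writesR z
  | _ => false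

variable {E}

/-- The frame rule. Its hypothesis is a Boolean computation on the syntax, so for concrete programs
it is discharged by evaluation; all reasoning about the algorithm below relies on this. -/
theorem Cmd.den_N {z : NVar} : ∀ {P : Cmd} {s : Store}, P.writesN z = false →
    (P.den E s).N z = s.N z
  | skip, _, _ => rfl
  | setN y a b e, s, h => by
    have h : y ≠ z := by simpa [writesN] using h
    funext p q
    simp [den, h.symm]
  | setR .., _, _ => rfl
  | loadW .., _, _ => rfl
  | loadLoop .., _, _ => rfl
  | seq P Q, s, h => by
    simp only [writesN, Bool.or_eq_false_iff] at h
    simp only [den]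
    rw [den_N h.2, den_N h.1]
  | ite p P Q, s, h => by
    simp only [writesN, Bool.or_eq_false_iff] at h
    simp only [den]
    split_ifs
    · exact den_N h.1
    · exact den_N h.2
  | loop y m P, s, h => by
    simp only [writesN, Bool.or_eq_false_iff, decide_eq_false_iff_not] at h
    have h1 : ∀ (s : Store) (v : ℕ), (s.setN y 0 0 v).N z = s.N z := fun s v => by
      funext p q
      simp [Ne.symm h.1]
    simp only [den]
    induction m.val E with
    | zero => exact h1 _ _
    | succ m ih => rw [iterate, h1, den_N h.2, ih]

theorem Cmd.den_R {z : RVar} : ∀ {P : Cmd} {s : Store}, P.writesR z = false →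
    (P.den E s).R z = s.R z
  | skip, _, _ => rfl
  | setN .., _, _ => rfl
  | setR y a b e, s, h => by
    have h : y ≠ z := by simpa [writesR] using h
    funext p q
    simp [den, h.symm]
  | loadW y a b, s, h => by
    have h : y ≠ z := by simpa [writesR] using h
    funext p q
    simp [den, h.symm]
  | loadLoop y a, s, h => by
    have h : y ≠ z := by simpa [writesR] using h
    funext p q
    simp [den, h.symm]
  | seq P Q, s, h => by
    simp only [writesR, Bool.or_eq_false_iff] at h
    simp only [den]
    rw [den_R h.2, den_R h.1]
  | ite p P Q, s, h => by
    simp only [writesR, Bool.or_eq_false_iff] at h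
    simp only [den]
    split_ifs
    · exact den_R h.1
    · exact den_R h.2
  | loop y m P, s, h => by
    simp only [writesR] at h
    simp only [den]
    induction m.val E with
    | zero => rfl
    | succ m ih => rw [iterate, Store.setN_R, den_R h, ih]

theorem iterate_counter (f : Store → Store) (y : NVar) (m : ℕ) (s : Store) :
    (iterate f y m s).N y 0 0 = m := by
  cases m <;> simp [iterate]

theorem iterate_N {P : Cmd} {y z : NVar} (h : P.writesN z = false) (hz : y ≠ z) (m : ℕ)
    (s : Store) : (iterate (P.den E) y m s).N z = s.N z := by
  have h1 : ∀ (s : Store) (v : ℕ), (s.setN y 0 0 v).N z = s.N z := fun s v => by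
    funext p q
    simp [Ne.symm hz]
  induction m with
  | zero => exact h1 _ _
  | succ m ih => rw [iterate, h1, Cmd.den_N h, ih]

theorem iterate_R {P : Cmd} {y : NVar} {z : RVar} (h : P.writesR z = false) (m : ℕ)
    (s : Store) : (iterate (P.den E) y m s).R z = s.R z := by
  induction m with
  | zero => rfl
  | succ m ih => rw [iterate, Store.setN_R, Cmd.den_R h, ih]

/-- Induction along a loop. -/
theorem loop_induct {y : NVar} {m : Bound} {P : Cmd} {s : Store} (I : ℕ → Store → Prop)
    (h0 : I 0 (s.setN y 0 0 0))
    (h1 : ∀ k < m.val E, ∀ s' : Store, s'.N y 0 0 = k →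
      (∀ z, (Cmd.loop y m P).writesN z = false → s'.N z = s.N z) →
      (∀ z, (Cmd.loop y m P).writesR z = false → s'.R z = s.R z) →
      I k s' → I (k + 1) ((P.den E s').setN y 0 0 (k + 1))) :
    I (m.val E) ((Cmd.loop y m P).den E s) := by
  have key : ∀ k ≤ m.val E, I k (iterate (P.den E) y k s) := by
    intro k
    induction k with
    | zero => exact fun _ => h0
    | succ k ih =>
      intro hk
      refine h1 k hk _ (iterate_counter _ _ _ _) (fun z hz => ?_) (fun z hz => ?_) (ih (by omega))
      · simp only [Cmd.writesN, Bool.or_eq_false_iff, decide_eq_false_iff_not] at hz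
        exact iterate_N hz.2 hz.1 k s
      · simp only [Cmd.writesR] at hz
        exact iterate_R hz k s
  exact key _ le_rfl

end ArrayLang


namespace ArrayLang

open RealRAM

/-! ### Compilation -/

/-- The address of a natural number. -/
def naddr (y : NVar) (a b : ℕ) : ℕ := 2 + y.code + 32 * ((a + b) * (a + b) + a)

/-- The address of a real number, in the presence of `n` vertices. -/
def raddr (n : ℕ) (y : RVar) (a b : ℕ) : ℕ :=
  2 + (n + n * n) + (y.code + 32 * ((a + b) * (a + b) + a))

/-- The value (a+b)² + a lies between (a+b)² and (a+b+1)², so it determines a + b and then a. The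
pairing stays quadratic, which keeps addresses short. -/
theorem pairing_injective {a b a' b' : ℕ} (h : (a + b) * (a + b) + a = (a' + b') * (a' + b') + a') :
    a = a' ∧ b = b' := by
  have key : ∀ {a b a' b' : ℕ}, (a + b) * (a + b) + a = (a' + b') * (a' + b') + a' →
      a + b ≤ a' + b' := by
    intro a b a' b' h
    by_contra hc
    have : a' + b' + 1 ≤ a + b := by omega
    have := Nat.mul_le_mul this this
    nlinarith
  have := le_antisymm (key h) (key h.symm)
  rw [this] at h
  omega

theorem naddr_injective {y y' : NVar} {a b a' b' : ℕ} (h : naddr y a b = naddr y' a' b') :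
    y = y' ∧ a = a' ∧ b = b' := by
  have h1 := y.code_lt
  have h2 := y'.code_lt
  unfold naddr at h
  exact ⟨NVar.code_injective (by omega), pairing_injective (by omega)⟩

theorem raddr_injective {n : ℕ} {y y' : RVar} {a b a' b' : ℕ}
    (h : raddr n y a b = raddr n y' a' b') : y = y' ∧ a = a' ∧ b = b' := by
  have h1 := y.code_lt
  have h2 := y'.code_lt
  unfold raddr at h
  exact ⟨RVar.code_injective (by omega), pairing_injective (by omega)⟩

def sizeExp : NExp := .load (.lit 0)

def naddrExp (y : NVar) (a b : NExp) : NExp :=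
  .add (.lit (2 + y.code)) (.mul (.lit 32) (.add (.mul (.add a b) (.add a b)) a))

def raddrExp (y : RVar) (a b : NExp) : NExp :=
  .add (.add (.lit 2) (.add sizeExp (.mul sizeExp sizeExp)))
    (.add (.lit y.code) (.mul (.lit 32) (.add (.mul (.add a b) (.add a b)) a)))

def NX.comp : NX → NExp
  | lit k => .lit k
  | size => sizeExp
  | get y a b => .load (naddrExp y a.comp b.comp)

def RX.comp : RX → RExp
  | lit q => .lit q
  | eps => .load (.lit 0)
  | lam => .load (.lit 1)
  | get y a b => .load (raddrExp y a.comp b.comp)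
  | add x y => .add x.comp y.comp
  | sub x y => .sub x.comp y.comp
  | mul x y => .mul x.comp y.comp
  | div x y => .div x.comp y.comp

def TX.comp : TX → Test
  | le a b => .natLe a.comp b.comp
  | eq a b => .natEq a.comp b.comp
  | rle x y => .realLe x.comp y.comp
  | not p => .not p.comp
  | and p q => .and p.comp q.comp

def Bound.comp : Bound → NExp
  | size => sizeExp
  | log => .load (.lit 1)
  | lit k => .lit k
  | mul p q => .mul p.comp q.comp

/-- The guards around accesses to the input matter: an index that is out of range would read another
cell. The value 0 used instead agrees with the meaning, since an encoded input vanishes outside of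
its range. -/
def Cmd.comp : Cmd → Program
  | skip => .skip
  | setN y a b e => .setNat (naddrExp y a.comp b.comp) e.comp
  | setR y a b e => .setReal (raddrExp y a.comp b.comp) e.comp
  | loadW y a b =>
      .ite (.and (.natLe (.add a.comp (.lit 1)) sizeExp) (.natLe (.add b.comp (.lit 1)) sizeExp))
        (.setReal (raddrExp y a.comp b.comp)
          (.load (.add (.add (.lit 2) sizeExp) (.add (.mul a.comp sizeExp) b.comp))))
        (.setReal (raddrExp y a.comp b.comp) (.lit 0))
  | loadLoop y a =>
      .ite (.natLe (.add a.comp (.lit 1)) sizeExp)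
        (.setReal (raddrExp y a.comp (.lit 0)) (.load (.add (.lit 2) a.comp)))
        (.setReal (raddrExp y a.comp (.lit 0)) (.lit 0))
  | seq P Q => .seq P.comp Q.comp
  | ite p P Q => .ite p.comp P.comp Q.comp
  | loop y m P =>
      .seq (.setNat (naddrExp y (.lit 0) (.lit 0)) (.lit 0))
        (.while (.natLe (.add (.load (naddrExp y (.lit 0) (.lit 0))) (.lit 1)) m.comp)
          (.seq P.comp (.setNat (naddrExp y (.lit 0) (.lit 0))
            (.add (.load (naddrExp y (.lit 0) (.lit 0))) (.lit 1)))))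

/-- Bounds for the number of nodes of the compiled expressions. -/
def NX.nodes : NX → ℕ
  | lit _ => 1
  | size => 2
  | get _ a b => 9 + 3 * a.nodes + 2 * b.nodes

def RX.nodes : RX → ℕ
  | lit _ => 1
  | eps => 2
  | lam => 2
  | get _ a b => 20 + 3 * a.nodes + 2 * b.nodes
  | add x y => 1 + x.nodes + y.nodes
  | sub x y => 1 + x.nodes + y.nodes
  | mul x y => 1 + x.nodes + y.nodes
  | div x y => 1 + x.nodes + y.nodes

def TX.nodes : TX → ℕ
  | le a b => 1 + a.nodes + b.nodes
  | eq a b => 1 + a.nodes + b.nodes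
  | rle x y => 1 + x.nodes + y.nodes
  | not p => 1 + p.nodes
  | and p q => 1 + p.nodes + q.nodes

def Bound.nodes : Bound → ℕ
  | size => 2
  | log => 2
  | lit _ => 1
  | mul p q => 1 + p.nodes + q.nodes

/-- A bound for the number of elementary operations of a program. -/
def Cmd.weight (E : Env) : Cmd → ℕ
  | skip => 1
  | setN _ a b e => 9 + 3 * a.nodes + 2 * b.nodes + e.nodes
  | setR _ a b e => 20 + 3 * a.nodes + 2 * b.nodes + e.nodes
  | loadW _ a b => 60 + 5 * a.nodes + 4 * b.nodes
  | loadLoop _ a => 40 + 5 * a.nodes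
  | seq P Q => 1 + P.weight E + Q.weight E
  | ite p P Q => 1 + p.nodes + P.weight E + Q.weight E
  | loop _ m P => (m.val E + 1) * (P.weight E + (60 + m.nodes))

/-- The literals and the bounds of an expression or a program do not exceed `B`. -/
def NX.Fits (B : ℕ) : NX → Prop
  | lit k => k ≤ B
  | size => True
  | get _ a b => a.Fits B ∧ b.Fits B

def RX.Fits (B : ℕ) : RX → Prop
  | get _ a b => a.Fits B ∧ b.Fits B
  | add x y => x.Fits B ∧ y.Fits B
  | sub x y => x.Fits B ∧ y.Fits B
  | mul x y => x.Fits B ∧ y.Fits B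
  | div x y => x.Fits B ∧ y.Fits B
  | _ => True

def TX.Fits (B : ℕ) : TX → Prop
  | le a b => a.Fits B ∧ b.Fits B
  | eq a b => a.Fits B ∧ b.Fits B
  | rle x y => x.Fits B ∧ y.Fits B
  | not p => p.Fits B
  | and p q => p.Fits B ∧ q.Fits B

def Bound.Fits (E : Env) (B : ℕ) : Bound → Prop
  | size => True
  | log => True
  | lit k => k ≤ B
  | mul p q => p.Fits E B ∧ q.Fits E B ∧ p.val E * q.val E ≤ B

/-- Programs whose bounds and literals do not exceed `B` and which do not change the counters of
their loops. -/
def Cmd.Fits (E : Env) (B : ℕ) : Cmd → Prop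
  | skip => True
  | setN _ a b e => a.Fits B ∧ b.Fits B ∧ e.Fits B
  | setR _ a b e => a.Fits B ∧ b.Fits B ∧ e.Fits B
  | loadW _ a b => a.Fits B ∧ b.Fits B
  | loadLoop _ a => a.Fits B
  | seq P Q => P.Fits E B ∧ Q.Fits E B
  | ite p P Q => p.Fits B ∧ P.Fits E B ∧ Q.Fits E B
  | loop y m P => m.Fits E B ∧ P.writesN y = false ∧ P.Fits E B

/-- The machine state `σ` represents the input `E` and the store `s`, whose numbers are at
most `B`. -/
structure Encodes (E : Env) (B : ℕ) (s : Store) (σ : State) : Prop where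
  size : σ.nat 0 = E.n
  log : σ.nat 1 = E.L
  nat : ∀ y a b, σ.nat (naddr y a b) = s.N y a b
  eps : σ.real 0 = E.eps
  lam : σ.real 1 = E.lam
  loop : ∀ a < E.n, σ.real (2 + a) = E.lp a
  edge : ∀ a < E.n, ∀ b < E.n, σ.real (2 + E.n + (a * E.n + b)) = E.w a b
  real : ∀ y a b, σ.real (raddr E.n y a b) = s.R y a b
  le : ∀ y a b, s.N y a b ≤ B
  one_le : 1 ≤ B
  size_le : E.n ≤ B
  log_le : E.L ≤ B
  loop_zero : ∀ a, E.n ≤ a → E.lp a = 0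
  edge_zero : ∀ a b, E.n ≤ a ∨ E.n ≤ b → E.w a b = 0

/-- The cost of an operation with numbers up to `B`. -/
def unitCost (B : ℕ) : ℕ := 1 + (512 * (B * B)).size

/-- For data up to B all intermediate values, addresses included, are below 512 B²: pairs are at
most 5 B², they are multiplied by 32, and the offsets are small. -/
theorem one_add_size_le {B v : ℕ} (h : v ≤ 512 * (B * B)) : 1 + v.size ≤ unitCost B :=
  Nat.add_le_add_left (Nat.size_le_size h) 1

theorem one_le_unitCost (B : ℕ) : 1 ≤ unitCost B := Nat.le_add_right 1 _

namespace Encodes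

variable {E : Env} {B : ℕ} {s : Store} {σ : State} (h : Encodes E B s σ)

include h

theorem sq_le : B ≤ B * B := Nat.le_mul_of_pos_left _ h.one_le

theorem sizeExp_eval : sizeExp.eval σ = E.n := h.size

theorem sizeExp_cost : sizeExp.cost σ ≤ 2 * unitCost B := by
  have h1 : E.n ≤ 512 * (B * B) := by have := h.sq_le; have := h.size_le; omega
  have := one_add_size_le h1
  simp only [sizeExp, NExp.cost, NExp.eval, h.size, Nat.size_zero]
  have := one_le_unitCost B
  omega

theorem pair_le {a b : ℕ} (ha : a ≤ B) (hb : b ≤ B) :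
    (a + b) * (a + b) ≤ 4 * (B * B) ∧ (a + b) * (a + b) + a ≤ 5 * (B * B) := by
  have h1 : (a + b) * (a + b) ≤ (B + B) * (B + B) := Nat.mul_le_mul (by omega) (by omega)
  have h2 : (B + B) * (B + B) = 4 * (B * B) := by ring
  have := h.sq_le
  omega

omit h in
theorem naddrExp_eval {y : NVar} {a b : NExp} :
    (naddrExp y a b).eval σ = naddr y (a.eval σ) (b.eval σ) := rfl

theorem raddrExp_eval {y : RVar} {a b : NExp} :
    (raddrExp y a b).eval σ = raddr E.n y (a.eval σ) (b.eval σ) := by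
  simp only [raddrExp, NExp.eval, h.sizeExp_eval, raddr]

theorem naddrExp_cost {y : NVar} {a b : NExp} (ha : a.eval σ ≤ B) (hb : b.eval σ ≤ B) :
    (naddrExp y a b).cost σ ≤ 8 * unitCost B + 3 * a.cost σ + 2 * b.cost σ := by
  obtain ⟨h1, h2⟩ := h.pair_le ha hb
  have h3 := y.code_lt
  have h4 := h.sq_le
  have h5 := h.one_le
  simp only [naddrExp, NExp.cost, NExp.eval]
  have c1 := one_add_size_le (B := B) (v := 2 + y.code) (by omega)
  have c2 := one_add_size_le (B := B) (v := 32) (by omega)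
  have c3 := one_add_size_le (B := B) (v := a.eval σ + b.eval σ) (by omega)
  have c4 := one_add_size_le (B := B) (v := (a.eval σ + b.eval σ) * (a.eval σ + b.eval σ))
    (by omega)
  have c5 := one_add_size_le (B := B)
    (v := (a.eval σ + b.eval σ) * (a.eval σ + b.eval σ) + a.eval σ) (by omega)
  have c6 := one_add_size_le (B := B)
    (v := 32 * ((a.eval σ + b.eval σ) * (a.eval σ + b.eval σ) + a.eval σ)) (by omega)
  have c7 := one_add_size_le (B := B) (v := 2 + y.code +
    32 * ((a.eval σ + b.eval σ) * (a.eval σ + b.eval σ) + a.eval σ)) (by omega)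
  omega

theorem raddrExp_cost {y : RVar} {a b : NExp} (ha : a.eval σ ≤ B) (hb : b.eval σ ≤ B) :
    (raddrExp y a b).cost σ ≤ 19 * unitCost B + 3 * a.cost σ + 2 * b.cost σ := by
  obtain ⟨h1, h2⟩ := h.pair_le ha hb
  have h3 := y.code_lt
  have h4 := h.sq_le
  have h5 := h.one_le
  have h6 := h.size_le
  have h7 := h.sizeExp_cost
  have h8 : E.n * E.n ≤ B * B := Nat.mul_le_mul h6 h6
  simp only [raddrExp, NExp.cost, NExp.eval, h.sizeExp_eval]
  have c1 := one_add_size_le (B := B) (v := y.code) (by omega)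
  have c2 := one_add_size_le (B := B) (v := 32) (by omega)
  have c3 := one_add_size_le (B := B) (v := a.eval σ + b.eval σ) (by omega)
  have c4 := one_add_size_le (B := B) (v := (a.eval σ + b.eval σ) * (a.eval σ + b.eval σ))
    (by omega)
  have c5 := one_add_size_le (B := B)
    (v := (a.eval σ + b.eval σ) * (a.eval σ + b.eval σ) + a.eval σ) (by omega)
  have c6 := one_add_size_le (B := B)
    (v := 32 * ((a.eval σ + b.eval σ) * (a.eval σ + b.eval σ) + a.eval σ)) (by omega)
  have c7 := one_add_size_le (B := B) (v := y.code +
    32 * ((a.eval σ + b.eval σ) * (a.eval σ + b.eval σ) + a.eval σ)) (by omega)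
  have c8 := one_add_size_le (B := B) (v := 2) (by omega)
  have c9 := one_add_size_le (B := B) (v := E.n * E.n) (by omega)
  have c10 := one_add_size_le (B := B) (v := E.n + E.n * E.n) (by omega)
  have c11 := one_add_size_le (B := B) (v := 2 + (E.n + E.n * E.n)) (by omega)
  have c12 := one_add_size_le (B := B) (v := 2 + (E.n + E.n * E.n) + (y.code +
    32 * ((a.eval σ + b.eval σ) * (a.eval σ + b.eval σ) + a.eval σ))) (by omega)
  omega

theorem comp_NX : ∀ {a : NX}, a.Fits B → a.comp.eval σ = a.eval E s ∧ a.eval E s ≤ B ∧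
    a.comp.cost σ ≤ a.nodes * unitCost B
  | .lit k, hk => by
    have : k ≤ 512 * (B * B) := by have := h.sq_le; have : k ≤ B := hk; omega
    refine ⟨rfl, hk, ?_⟩
    simpa [NX.comp, NExp.cost, NX.nodes] using one_add_size_le this
  | .size, _ => ⟨h.size, h.size_le, h.sizeExp_cost⟩
  | .get y a b, hk => by
    obtain ⟨a1, a2, a3⟩ := comp_NX hk.1
    obtain ⟨b1, b2, b3⟩ := comp_NX hk.2
    have e : (NX.get y a b).comp.eval σ = s.N y (a.eval E s) (b.eval E s) := by
      simp only [NX.comp, NExp.eval, naddrExp_eval, a1, b1, h.nat]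
    refine ⟨e, h.le _ _ _, ?_⟩
    have c1 := h.naddrExp_cost (y := y) (a1.trans_le a2) (b1.trans_le b2)
    have c2 : s.N y (a.eval E s) (b.eval E s) ≤ 512 * (B * B) := by
      have := h.le y (a.eval E s) (b.eval E s)
      have := h.sq_le
      omega
    have c3 := one_add_size_le c2
    rw [← e] at c3
    simp only [NX.comp, NX.nodes, NExp.cost, NExp.eval] at c3 ⊢
    linarith

theorem comp_RX : ∀ {x : RX}, x.Fits B → x.comp.eval σ = x.eval E s ∧
    x.comp.cost σ ≤ x.nodes * unitCost B
  | .lit q, _ => ⟨rfl, by simpa [RX.comp, RExp.cost, RX.nodes] using one_le_unitCost B⟩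
  | .eps, _ => by
    refine ⟨h.eps, ?_⟩
    have := one_le_unitCost B
    simp [RX.comp, RExp.cost, NExp.cost, RX.nodes]
    omega
  | .lam, _ => by
    refine ⟨h.lam, ?_⟩
    have c := one_add_size_le (B := B) (v := 1) (by have := h.sq_le; have := h.one_le; omega)
    have := one_le_unitCost B
    simp [RX.comp, RExp.cost, NExp.cost, RX.nodes] at c ⊢
    omega
  | .get y a b, hk => by
    obtain ⟨a1, a2, a3⟩ := h.comp_NX hk.1
    obtain ⟨b1, b2, b3⟩ := h.comp_NX hk.2
    have c1 := h.raddrExp_cost (y := y) (a1.trans_le a2) (b1.trans_le b2)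
    have := one_le_unitCost B
    refine ⟨?_, ?_⟩
    · simp only [RX.comp, RExp.eval, h.raddrExp_eval, a1, b1, h.real, RX.eval]
    · simp only [RX.comp, RExp.cost, RX.nodes]
      linarith
  | .add x y, hk => by
    obtain ⟨x1, x2⟩ := comp_RX hk.1
    obtain ⟨y1, y2⟩ := comp_RX hk.2
    have := one_le_unitCost B
    refine ⟨by simp only [RX.comp, RExp.eval, RX.eval, x1, y1], ?_⟩
    simp only [RX.comp, RExp.cost, RX.nodes]
    linarith
  | .sub x y, hk => by
    obtain ⟨x1, x2⟩ := comp_RX hk.1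
    obtain ⟨y1, y2⟩ := comp_RX hk.2
    have := one_le_unitCost B
    refine ⟨by simp only [RX.comp, RExp.eval, RX.eval, x1, y1], ?_⟩
    simp only [RX.comp, RExp.cost, RX.nodes]
    linarith
  | .mul x y, hk => by
    obtain ⟨x1, x2⟩ := comp_RX hk.1
    obtain ⟨y1, y2⟩ := comp_RX hk.2
    have := one_le_unitCost B
    refine ⟨by simp only [RX.comp, RExp.eval, RX.eval, x1, y1], ?_⟩
    simp only [RX.comp, RExp.cost, RX.nodes]
    linarith
  | .div x y, hk => by
    obtain ⟨x1, x2⟩ := comp_RX hk.1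
    obtain ⟨y1, y2⟩ := comp_RX hk.2
    have := one_le_unitCost B
    refine ⟨by simp only [RX.comp, RExp.eval, RX.eval, x1, y1], ?_⟩
    simp only [RX.comp, RExp.cost, RX.nodes]
    linarith

theorem comp_TX : ∀ {p : TX}, p.Fits B → (p.comp.holds σ ↔ p.holds E s) ∧
    p.comp.cost σ ≤ p.nodes * unitCost B
  | .le a b, hk => by
    obtain ⟨a1, a2, a3⟩ := h.comp_NX hk.1
    obtain ⟨b1, b2, b3⟩ := h.comp_NX hk.2
    have := one_le_unitCost B
    refine ⟨by simp only [TX.comp, Test.holds, TX.holds, a1, b1], ?_⟩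
    simp only [TX.comp, Test.cost, TX.nodes]
    linarith
  | .eq a b, hk => by
    obtain ⟨a1, a2, a3⟩ := h.comp_NX hk.1
    obtain ⟨b1, b2, b3⟩ := h.comp_NX hk.2
    have := one_le_unitCost B
    refine ⟨by simp only [TX.comp, Test.holds, TX.holds, a1, b1], ?_⟩
    simp only [TX.comp, Test.cost, TX.nodes]
    linarith
  | .rle a b, hk => by
    obtain ⟨a1, a3⟩ := h.comp_RX hk.1
    obtain ⟨b1, b3⟩ := h.comp_RX hk.2
    have := one_le_unitCost B
    refine ⟨by simp only [TX.comp, Test.holds, TX.holds, a1, b1], ?_⟩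
    simp only [TX.comp, Test.cost, TX.nodes]
    linarith
  | .not p, hk => by
    obtain ⟨a1, a3⟩ := comp_TX (p := p) hk
    have := one_le_unitCost B
    refine ⟨by simp only [TX.comp, Test.holds, TX.holds, a1], ?_⟩
    simp only [TX.comp, Test.cost, TX.nodes]
    linarith
  | .and p q, hk => by
    obtain ⟨a1, a3⟩ := comp_TX (p := p) hk.1
    obtain ⟨b1, b3⟩ := comp_TX (p := q) hk.2
    have := one_le_unitCost B
    refine ⟨by simp only [TX.comp, Test.holds, TX.holds, a1, b1], ?_⟩
    simp only [TX.comp, Test.cost, TX.nodes]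
    linarith

theorem comp_Bound : ∀ {m : Bound}, m.Fits E B → m.comp.eval σ = m.val E ∧ m.val E ≤ B ∧
    m.comp.cost σ ≤ m.nodes * unitCost B
  | .size, _ => ⟨h.size, h.size_le, h.sizeExp_cost⟩
  | .log, _ => by
    refine ⟨h.log, h.log_le, ?_⟩
    have c := one_add_size_le (B := B) (v := 1) (by have := h.sq_le; have := h.one_le; omega)
    have c' := one_add_size_le (B := B) (v := E.L)
      (by have := h.sq_le; have := h.log_le; omega)
    simp only [Bound.comp, NExp.cost, NExp.eval, h.log, Bound.nodes]
    omega
  | .lit k, hk => by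
    have : k ≤ 512 * (B * B) := by have := h.sq_le; have : k ≤ B := hk; omega
    refine ⟨rfl, hk, ?_⟩
    simpa [Bound.comp, NExp.cost, Bound.nodes] using one_add_size_le this
  | .mul p q, hk => by
    obtain ⟨a1, a2, a3⟩ := comp_Bound hk.1
    obtain ⟨b1, b2, b3⟩ := comp_Bound hk.2.1
    have e : (Bound.mul p q).comp.eval σ = p.val E * q.val E := by
      simp only [Bound.comp, NExp.eval, a1, b1]
    refine ⟨e, hk.2.2, ?_⟩
    have c : p.val E * q.val E ≤ 512 * (B * B) := by
      have := hk.2.2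
      have := h.sq_le
      omega
    have c' := one_add_size_le c
    simp only [Bound.comp, Bound.nodes, NExp.cost, a1, b1]
    linarith

theorem setNat (y : NVar) {a b v : ℕ} (hv : v ≤ B) :
    Encodes E B (s.setN y a b v) ⟨Function.update σ.nat (naddr y a b) v, σ.real⟩ where
  size := by rw [← h.size]; exact Function.update_of_ne (by unfold naddr; omega) _ _
  log := by rw [← h.log]; exact Function.update_of_ne (by unfold naddr; omega) _ _
  nat y' a' b' := by
    rw [Store.setN_N, ← h.nat]
    split_ifs with hc
    · obtain ⟨rfl, rfl, rfl⟩ := hc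
      exact Function.update_self _ _ _
    · exact Function.update_of_ne (fun e => hc (naddr_injective e)) _ _
  eps := h.eps
  lam := h.lam
  loop := h.loop
  edge := h.edge
  real := h.real
  le y' a' b' := by
    rw [Store.setN_N]
    split_ifs
    · exact hv
    · exact h.le _ _ _
  one_le := h.one_le
  size_le := h.size_le
  log_le := h.log_le
  loop_zero := h.loop_zero
  edge_zero := h.edge_zero

theorem setReal (y : RVar) {a b : ℕ} (v : ℝ) :
    Encodes E B (s.setR y a b v) ⟨σ.nat, Function.update σ.real (raddr E.n y a b) v⟩ where
  size := h.size
  log := h.log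
  nat := h.nat
  eps := by rw [← h.eps]; exact Function.update_of_ne (by unfold raddr; omega) _ _
  lam := by rw [← h.lam]; exact Function.update_of_ne (by unfold raddr; omega) _ _
  loop p hp := by rw [← h.loop p hp]; exact Function.update_of_ne (by unfold raddr; omega) _ _
  edge p hp q hq := by
    rw [← h.edge p hp q hq]
    refine Function.update_of_ne ?_ _ _
    have : (p + 1) * E.n ≤ E.n * E.n := Nat.mul_le_mul_right _ hp
    rw [add_mul] at this
    unfold raddr
    omega
  real y' a' b' := by
    rw [Store.setR_R, ← h.real]
    split_ifs with hc
    · obtain ⟨rfl, rfl, rfl⟩ := hc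
      exact Function.update_self _ _ _
    · exact Function.update_of_ne (fun e => hc (raddr_injective e)) _ _
  le := h.le
  one_le := h.one_le
  size_le := h.size_le
  log_le := h.log_le
  loop_zero := h.loop_zero
  edge_zero := h.edge_zero

end Encodes

end ArrayLang


/-! ### Correctness and cost of compiled programs -/

namespace ArrayLang

open RealRAM

/-- Compiled programs simulate the semantics of the language. -/
theorem Encodes.exists_runs {E : Env} {B : ℕ} : ∀ {P : Cmd} {s : Store} {σ : State},
    P.Fits E B → Encodes E B s σ →
    ∃ τ t, Runs P.comp σ τ t ∧ Encodes E B (P.den E s) τ ∧ t ≤ P.weight E * unitCost B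
  | .skip, s, σ, _, h => ⟨σ, 1, .skip σ, h, by
      simpa [Cmd.weight] using one_le_unitCost B⟩
  | .setN y a b e, s, σ, hP, h => by
    obtain ⟨a1, a2, a3⟩ := h.comp_NX hP.1
    obtain ⟨b1, b2, b3⟩ := h.comp_NX hP.2.1
    obtain ⟨e1, e2, e3⟩ := h.comp_NX hP.2.2
    refine ⟨_, _, .setNat _ _ _, ?_, ?_⟩
    · rw [naddrExp_eval, a1, b1, e1]
      exact h.setNat y e2
    · have c1 := h.naddrExp_cost (y := y) (a1.trans_le a2) (b1.trans_le b2)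
      have := one_le_unitCost B
      simp only [Cmd.weight]
      linarith
  | .setR y a b e, s, σ, hP, h => by
    obtain ⟨a1, a2, a3⟩ := h.comp_NX hP.1
    obtain ⟨b1, b2, b3⟩ := h.comp_NX hP.2.1
    obtain ⟨e1, e3⟩ := h.comp_RX hP.2.2
    refine ⟨_, _, .setReal _ _ _, ?_, ?_⟩
    · rw [h.raddrExp_eval, a1, b1, e1]
      exact h.setReal y _
    · have c1 := h.raddrExp_cost (y := y) (a1.trans_le a2) (b1.trans_le b2)
      have := one_le_unitCost B
      simp only [Cmd.weight]
      linarith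
  | .loadW y a b, s, σ, hP, h => by
    obtain ⟨a1, a2, a3⟩ := h.comp_NX hP.1
    obtain ⟨b1, b2, b3⟩ := h.comp_NX hP.2
    have c1 := h.raddrExp_cost (y := y) (a1.trans_le a2) (b1.trans_le b2)
    have c0 := one_le_unitCost B
    have hsz := h.sizeExp_cost
    have hB := h.sq_le
    have hB1 := h.one_le
    have hn := h.size_le
    have htest : (Test.and (.natLe (.add a.comp (.lit 1)) sizeExp)
        (.natLe (.add b.comp (.lit 1)) sizeExp)).cost σ ≤
          (11 + a.nodes + b.nodes) * unitCost B := by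
      have c2 := one_add_size_le (B := B) (v := a.eval E s + 1) (by omega)
      have c3 := one_add_size_le (B := B) (v := b.eval E s + 1) (by omega)
      have c4 := one_add_size_le (B := B) (v := 1) (by omega)
      simp only [Test.cost, NExp.cost, NExp.eval, a1, b1]
      linarith
    have hiff : (Test.and (.natLe (.add a.comp (.lit 1)) sizeExp)
        (.natLe (.add b.comp (.lit 1)) sizeExp)).holds σ ↔ a.eval E s < E.n ∧ b.eval E s < E.n := by
      simp only [Test.holds, NExp.eval, h.sizeExp_eval, a1, b1, Nat.succ_le_iff]
    simp only [Cmd.comp, Cmd.den, Cmd.weight]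
    by_cases hc : a.eval E s < E.n ∧ b.eval E s < E.n
    · refine ⟨_, _, .iteTrue (hiff.mpr hc) (.setReal _ _ _), ?_, ?_⟩
      · have e : (RExp.load (.add (.add (.lit 2) sizeExp) (.add (.mul a.comp sizeExp) b.comp))).eval
            σ = E.w (a.eval E s) (b.eval E s) := by
          simp only [RExp.eval, NExp.eval, h.sizeExp_eval, a1, b1, h.edge _ hc.1 _ hc.2]
        rw [h.raddrExp_eval, a1, b1, e]
        exact h.setReal y _
      · have h1 : (a.eval E s + 1) * E.n ≤ E.n * E.n := Nat.mul_le_mul_right _ hc.1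
        rw [add_mul] at h1
        have h2 : E.n * E.n ≤ B * B := Nat.mul_le_mul hn hn
        have c2 := one_add_size_le (B := B) (v := a.eval E s * E.n) (by omega)
        have c3 := one_add_size_le (B := B) (v := a.eval E s * E.n + b.eval E s) (by omega)
        have c4 := one_add_size_le (B := B) (v := 2) (by omega)
        have c5 := one_add_size_le (B := B) (v := 2 + E.n) (by omega)
        have c6 := one_add_size_le (B := B) (v := 2 + E.n + (a.eval E s * E.n + b.eval E s))
          (by omega)
        simp only [RExp.cost, NExp.cost, NExp.eval, h.sizeExp_eval, a1, b1]
        linarith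
    · refine ⟨_, _, .iteFalse (fun hh => hc (hiff.mp hh)) (.setReal _ _ _), ?_, ?_⟩
      · rw [h.raddrExp_eval, a1, b1, h.edge_zero _ _ (by omega)]
        simpa [RExp.eval] using h.setReal y (a := a.eval E s) (b := b.eval E s) 0
      · simp only [RExp.cost]
        linarith
  | .loadLoop y a, s, σ, hP, h => by
    obtain ⟨a1, a2, a3⟩ := h.comp_NX (a := a) hP
    have c1 := h.raddrExp_cost (y := y) (a := a.comp) (b := .lit 0) (a1.trans_le a2) (Nat.zero_le _)
    have c0 := one_le_unitCost B
    have hsz := h.sizeExp_cost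
    have hB := h.sq_le
    have hB1 := h.one_le
    have hn := h.size_le
    have c7 : (NExp.lit 0).cost σ ≤ unitCost B := one_add_size_le (Nat.zero_le _)
    have htest : (Test.natLe (.add a.comp (.lit 1)) sizeExp).cost σ ≤
        (5 + a.nodes) * unitCost B := by
      have c2 := one_add_size_le (B := B) (v := a.eval E s + 1) (by omega)
      have c4 := one_add_size_le (B := B) (v := 1) (by omega)
      simp only [Test.cost, NExp.cost, NExp.eval, a1]
      linarith
    have hiff : (Test.natLe (.add a.comp (.lit 1)) sizeExp).holds σ ↔ a.eval E s < E.n := by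
      simp only [Test.holds, NExp.eval, h.sizeExp_eval, a1, Nat.succ_le_iff]
    simp only [Cmd.comp, Cmd.den, Cmd.weight]
    by_cases hc : a.eval E s < E.n
    · refine ⟨_, _, .iteTrue (hiff.mpr hc) (.setReal _ _ _), ?_, ?_⟩
      · have e : (RExp.load (.add (.lit 2) a.comp)).eval σ = E.lp (a.eval E s) := by
          simp only [RExp.eval, NExp.eval, a1, h.loop _ hc]
        rw [h.raddrExp_eval, a1, e]
        exact h.setReal y _
      · have c4 := one_add_size_le (B := B) (v := 2) (by omega)
        have c5 := one_add_size_le (B := B) (v := 2 + a.eval E s) (by omega)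
        simp only [RExp.cost, NExp.cost, NExp.eval, a1]
        linarith
    · refine ⟨_, _, .iteFalse (fun hh => hc (hiff.mp hh)) (.setReal _ _ _), ?_, ?_⟩
      · rw [h.raddrExp_eval, a1, h.loop_zero _ (by omega)]
        simpa [RExp.eval, NExp.eval] using h.setReal y (a := a.eval E s) (b := 0) 0
      · simp only [RExp.cost]
        linarith
  | .seq P Q, s, σ, hP, h => by
    obtain ⟨τ, t, h1, h2, h3⟩ := exists_runs hP.1 h
    obtain ⟨υ, t', h4, h5, h6⟩ := exists_runs hP.2 h2
    refine ⟨υ, _, .seq h1 h4, h5, ?_⟩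
    have := one_le_unitCost B
    simp only [Cmd.weight]
    linarith
  | .ite p P Q, s, σ, hP, h => by
    obtain ⟨p1, p2⟩ := h.comp_TX hP.1
    have := one_le_unitCost B
    have hx : ∀ x : ℕ, 0 ≤ x * unitCost B := fun _ => Nat.zero_le _
    by_cases hp : p.holds E s
    · obtain ⟨τ, t, h1, h2, h3⟩ := exists_runs hP.2.1 h
      refine ⟨τ, _, .iteTrue (p1.mpr hp) h1, by simpa only [Cmd.den, if_pos hp] using h2, ?_⟩
      have := hx (Q.weight E)
      simp only [Cmd.weight]
      linarith
    · obtain ⟨τ, t, h1, h2, h3⟩ := exists_runs hP.2.2 h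
      refine ⟨τ, _, .iteFalse (fun hh => hp (p1.mp hh)) h1,
        by simpa only [Cmd.den, if_neg hp] using h2, ?_⟩
      have := hx (P.weight E)
      simp only [Cmd.weight]
      linarith
  | .loop y m P, s, σ, hP, h => by
    obtain ⟨hm, hy, hP⟩ := hP
    have hq := one_le_unitCost B
    have hB := h.sq_le
    have hB1 := h.one_le
    have c00 : ∀ σ : State, (NExp.lit 0).cost σ ≤ unitCost B :=
      fun _ => one_add_size_le (Nat.zero_le _)
    have c01 : ∀ σ : State, (NExp.lit 1).cost σ ≤ unitCost B :=
      fun _ => one_add_size_le (B := B) (v := 1) (by omega)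
    have hmB : m.val E ≤ B := (h.comp_Bound hm).2.1
    have haddr : ∀ {s : Store} {σ : State}, Encodes E B s σ →
        (naddrExp y (.lit 0) (.lit 0)).cost σ ≤ 13 * unitCost B := by
      intro s σ h
      have := h.naddrExp_cost (y := y) (a := .lit 0) (b := .lit 0) (Nat.zero_le _) (Nat.zero_le _)
      have := c00 σ
      omega
    have hload : ∀ {s : Store} {σ : State}, Encodes E B s σ →
        (NExp.add (.load (naddrExp y (.lit 0) (.lit 0))) (.lit 1)).eval σ = s.N y 0 0 + 1 ∧
        (NExp.add (.load (naddrExp y (.lit 0) (.lit 0))) (.lit 1)).cost σ ≤ 16 * unitCost B := by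
      intro s σ h
      have e : σ.nat ((naddrExp y (.lit 0) (.lit 0)).eval σ) = s.N y 0 0 := by
        rw [naddrExp_eval]; exact h.nat y 0 0
      have hle := h.le y 0 0
      have c2 := one_add_size_le (B := B) (v := s.N y 0 0) (by omega)
      have c3 := one_add_size_le (B := B) (v := s.N y 0 0 + 1) (by omega)
      have c4 := haddr h
      have c5 := c01 σ
      refine ⟨by simp only [NExp.eval, e], ?_⟩
      simp only [NExp.cost, NExp.eval, e] at c5 ⊢
      omega
    set body := Program.seq P.comp (.setNat (naddrExp y (.lit 0) (.lit 0))
      (.add (.load (naddrExp y (.lit 0) (.lit 0))) (.lit 1))) with hbody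
    set test := Test.natLe (.add (.load (naddrExp y (.lit 0) (.lit 0))) (.lit 1)) m.comp with htest
    have hiff : ∀ {s : Store} {σ : State}, Encodes E B s σ →
        (test.holds σ ↔ s.N y 0 0 < m.val E) ∧ test.cost σ ≤ (17 + m.nodes) * unitCost B := by
      intro s σ h
      obtain ⟨m1, m2, m3⟩ := h.comp_Bound hm
      obtain ⟨l1, l2⟩ := hload h
      refine ⟨by simp only [htest, Test.holds, l1, m1, Nat.succ_le_iff], ?_⟩
      simp only [htest, Test.cost]
      linarith
    -- the remaining iterations
    have key : ∀ k ≤ m.val E, ∀ σ' : State, Encodes E B (iterate (P.den E) y (m.val E - k) s) σ' →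
        ∃ τ t, Runs (.while test body) σ' τ t ∧ Encodes E B (iterate (P.den E) y (m.val E) s) τ ∧
          t ≤ (k * (P.weight E + (50 + m.nodes)) + (18 + m.nodes)) * unitCost B := by
      intro k
      induction k with
      | zero =>
        intro _ σ' hσ'
        obtain ⟨t1, t2⟩ := hiff hσ'
        rw [iterate_counter] at t1
        refine ⟨σ', _, .whileFalse (fun hc => absurd (t1.mp hc) (by omega)), hσ', ?_⟩
        linarith
      | succ k ih =>
        intro hk σ' hσ'
        obtain ⟨t1, t2⟩ := hiff hσ'
        rw [iterate_counter] at t1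
        obtain ⟨τ, t, r1, r2, r3⟩ := exists_runs hP hσ'
        have hcount : (P.den E (iterate (P.den E) y (m.val E - (k + 1)) s)).N y 0 0 =
            m.val E - (k + 1) := by rw [Cmd.den_N hy, iterate_counter]
        obtain ⟨l1, l2⟩ := hload r2
        rw [hcount] at l1
        have r4 : Encodes E B (iterate (P.den E) y (m.val E - k) s)
            ⟨Function.update τ.nat (naddr y 0 0) (m.val E - (k + 1) + 1), τ.real⟩ := by
          rw [show m.val E - k = m.val E - (k + 1) + 1 by omega]
          exact r2.setNat y (by omega)
        obtain ⟨υ, t', r5, r6, r7⟩ := ih (by omega) _ r4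
        have r8 := Runs.setNat (naddrExp y (.lit 0) (.lit 0))
          (.add (.load (naddrExp y (.lit 0) (.lit 0))) (.lit 1)) τ
        rw [l1, naddrExp_eval] at r8
        refine ⟨υ, _, .whileTrue (t1.mpr (by omega)) (.seq r1 r8) r5, r6, ?_⟩
        have c4 := haddr r2
        linarith
    have h0 : Encodes E B (iterate (P.den E) y (m.val E - m.val E) s)
        ⟨Function.update σ.nat (naddr y 0 0) 0, σ.real⟩ := by
      rw [Nat.sub_self]
      exact h.setNat y (Nat.zero_le _)
    obtain ⟨τ, t, r1, r2, r3⟩ := key _ le_rfl _ h0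
    refine ⟨τ, _, .seq (.setNat (naddrExp y (.lit 0) (.lit 0)) (.lit 0) σ) r1, r2, ?_⟩
    have c4 := haddr h
    have c5 := c00 σ
    have p1 : 0 ≤ m.val E * unitCost B := Nat.zero_le _
    have p2 : 0 ≤ P.weight E * unitCost B := Nat.zero_le _
    simp only [Cmd.weight]
    linarith

/-! ### Size of the bounds -/

def Bound.coef : Bound → ℕ
  | size => 1
  | log => 1
  | lit k => k + 1
  | mul p q => p.coef * q.coef

def Bound.degN : Bound → ℕ
  | size => 1
  | mul p q => p.degN + q.degN
  | _ => 0

def Bound.degL : Bound → ℕ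
  | log => 1
  | mul p q => p.degL + q.degL
  | _ => 0

def Cmd.coef : Cmd → ℕ
  | skip => 1
  | setN _ a b e => 9 + 3 * a.nodes + 2 * b.nodes + e.nodes
  | setR _ a b e => 20 + 3 * a.nodes + 2 * b.nodes + e.nodes
  | loadW _ a b => 60 + 5 * a.nodes + 4 * b.nodes
  | loadLoop _ a => 40 + 5 * a.nodes
  | seq P Q => 1 + P.coef + Q.coef
  | ite p P Q => 1 + p.nodes + P.coef + Q.coef
  | loop _ m P => m.coef * (P.coef + (60 + m.nodes))

def Cmd.degN : Cmd → ℕ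
  | seq P Q => max P.degN Q.degN
  | ite _ P Q => max P.degN Q.degN
  | loop _ m P => m.degN + P.degN
  | _ => 0

def Cmd.degL : Cmd → ℕ
  | seq P Q => max P.degL Q.degL
  | ite _ P Q => max P.degL Q.degL
  | loop _ m P => m.degL + P.degL
  | _ => 0

/-- The summand 1 accounts for the last evaluation of the loop test and makes the estimate
multiplicative, also when a bound is zero. -/
theorem Bound.val_add_one_le (E : Env) : ∀ m : Bound,
    m.val E + 1 ≤ m.coef * ((E.n + 1) ^ m.degN * (E.L + 1) ^ m.degL)
  | size => by simp [coef, degN, degL]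
  | log => by simp [coef, degN, degL]
  | lit k => by simp [coef, degN, degL]
  | mul p q => by
    have h1 := p.val_add_one_le E
    have h2 := q.val_add_one_le E
    simp only [val, coef, degN, degL]
    calc p.val E * q.val E + 1 ≤ (p.val E + 1) * (q.val E + 1) := by nlinarith
      _ ≤ _ := Nat.mul_le_mul h1 h2
      _ = _ := by ring

/-- Replaces the cost by a monomial whose degrees are computed from the nesting of the loops, so
that the exponent of the whole algorithm can be obtained by evaluation. -/
theorem Cmd.weight_le (E : Env) : ∀ P : Cmd,
    P.weight E ≤ P.coef * ((E.n + 1) ^ P.degN * (E.L + 1) ^ P.degL)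
  | skip => by simp [weight, coef, degN, degL]
  | setN .. => by simp [weight, coef, degN, degL]
  | setR .. => by simp [weight, coef, degN, degL]
  | loadW .. => by simp [weight, coef, degN, degL]
  | loadLoop .. => by simp [weight, coef, degN, degL]
  | seq P Q => by
    have h1 := P.weight_le E
    have h2 := Q.weight_le E
    simp only [weight, coef, degN, degL]
    have m1 : (E.n + 1) ^ P.degN * (E.L + 1) ^ P.degL ≤
        (E.n + 1) ^ max P.degN Q.degN * (E.L + 1) ^ max P.degL Q.degL := by
      gcongr <;> omega
    have m2 : (E.n + 1) ^ Q.degN * (E.L + 1) ^ Q.degL ≤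
        (E.n + 1) ^ max P.degN Q.degN * (E.L + 1) ^ max P.degL Q.degL := by
      gcongr <;> omega
    have m3 : 1 ≤ (E.n + 1) ^ max P.degN Q.degN * (E.L + 1) ^ max P.degL Q.degL :=
      Nat.one_le_iff_ne_zero.mpr (by positivity)
    have m4 := Nat.mul_le_mul_left P.coef m1
    have m5 := Nat.mul_le_mul_left Q.coef m2
    nlinarith
  | ite p P Q => by
    have h1 := P.weight_le E
    have h2 := Q.weight_le E
    simp only [weight, coef, degN, degL]
    have m1 : (E.n + 1) ^ P.degN * (E.L + 1) ^ P.degL ≤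
        (E.n + 1) ^ max P.degN Q.degN * (E.L + 1) ^ max P.degL Q.degL := by
      gcongr <;> omega
    have m2 : (E.n + 1) ^ Q.degN * (E.L + 1) ^ Q.degL ≤
        (E.n + 1) ^ max P.degN Q.degN * (E.L + 1) ^ max P.degL Q.degL := by
      gcongr <;> omega
    have m3 : 1 ≤ (E.n + 1) ^ max P.degN Q.degN * (E.L + 1) ^ max P.degL Q.degL :=
      Nat.one_le_iff_ne_zero.mpr (by positivity)
    have m4 := Nat.mul_le_mul_left P.coef m1
    have m5 := Nat.mul_le_mul_left Q.coef m2
    have m6 := Nat.mul_le_mul_left p.nodes m3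
    nlinarith
  | loop y m P => by
    have h1 := P.weight_le E
    have h2 := m.val_add_one_le E
    simp only [weight, coef, degN, degL]
    have m3 : 1 ≤ (E.n + 1) ^ P.degN * (E.L + 1) ^ P.degL :=
      Nat.one_le_iff_ne_zero.mpr (by positivity)
    have m6 := Nat.mul_le_mul_left (60 + m.nodes) m3
    calc (m.val E + 1) * (P.weight E + (60 + m.nodes)) ≤
          (m.coef * ((E.n + 1) ^ m.degN * (E.L + 1) ^ m.degL)) *
            ((P.coef + (60 + m.nodes)) * ((E.n + 1) ^ P.degN * (E.L + 1) ^ P.degL)) :=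
          Nat.mul_le_mul h2 (by nlinarith)
      _ = _ := by ring

end ArrayLang


/-! ### Decidable size conditions, auxiliary programs and complete programs -/

namespace ArrayLang

open RealRAM

def NX.small (k : ℕ) : NX → Bool
  | lit q => q ≤ k
  | size => true
  | get _ a b => a.small k && b.small k

def RX.small (k : ℕ) : RX → Bool
  | get _ a b => a.small k && b.small k
  | add x y => x.small k && y.small k
  | sub x y => x.small k && y.small k
  | mul x y => x.small k && y.small k
  | div x y => x.small k && y.small k
  | _ => true

def TX.small (k : ℕ) : TX → Bool
  | le a b => a.small k && b.small k
  | eq a b => a.small k && b.small k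
  | rle x y => x.small k && y.small k
  | not p => p.small k
  | and p q => p.small k && q.small k

/-- A product is accepted only if its value is at most k (n+1)² (L+1); this suffices for the 400 n²
L iterations of the search. -/
def Bound.small (k : ℕ) : Bound → Bool
  | size => true
  | log => true
  | lit q => q ≤ k
  | mul p q => p.small k && q.small k && decide (p.coef * q.coef ≤ k) &&
      decide (p.degN + q.degN ≤ 2) && decide (p.degL + q.degL ≤ 1)

def Cmd.small (k : ℕ) : Cmd → Bool
  | skip => true
  | setN _ a b e => a.small k && b.small k && e.small k
  | setR _ a b e => a.small k && b.small k && e.small k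
  | loadW _ a b => a.small k && b.small k
  | loadLoop _ a => a.small k
  | seq P Q => P.small k && Q.small k
  | ite p P Q => p.small k && P.small k && Q.small k
  | loop y m P => m.small k && !P.writesN y && P.small k

theorem NX.fits_of_small {k B : ℕ} (hk : k ≤ B) : ∀ {a : NX}, a.small k → a.Fits B
  | lit q, h => by
    have : q ≤ k := by simpa [small] using h
    exact this.trans hk
  | size, _ => trivial
  | get _ a b, h => by
    simp only [small, Bool.and_eq_true] at h
    exact ⟨fits_of_small hk h.1, fits_of_small hk h.2⟩

theorem RX.fits_of_small {k B : ℕ} (hk : k ≤ B) : ∀ {a : RX}, a.small k → a.Fits B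
  | lit q, h => trivial
  | eps, _ => trivial
  | lam, _ => trivial
  | get _ a b, h => by
    simp only [small, Bool.and_eq_true] at h
    exact ⟨NX.fits_of_small hk h.1, NX.fits_of_small hk h.2⟩
  | add x y, h | sub x y, h | mul x y, h | div x y, h => by
    simp only [small, Bool.and_eq_true] at h
    exact ⟨fits_of_small hk h.1, fits_of_small hk h.2⟩

theorem TX.fits_of_small {k B : ℕ} (hk : k ≤ B) : ∀ {a : TX}, a.small k → a.Fits B
  | le a b, h | eq a b, h => by
    simp only [small, Bool.and_eq_true] at h
    exact ⟨NX.fits_of_small hk h.1, NX.fits_of_small hk h.2⟩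
  | rle x y, h => by
    simp only [small, Bool.and_eq_true] at h
    exact ⟨RX.fits_of_small hk h.1, RX.fits_of_small hk h.2⟩
  | not p, h => fits_of_small (a := p) hk h
  | and p q, h => by
    simp only [small, Bool.and_eq_true] at h
    exact ⟨fits_of_small hk h.1, fits_of_small hk h.2⟩

/-- A bound for the numbers that occur in a program with small literals. -/
def numBound (k : ℕ) (E : Env) : ℕ := k * ((E.n + 1) ^ 2 * (E.L + 1))

theorem le_numBound (k : ℕ) (E : Env) : k ≤ numBound k E :=
  Nat.le_mul_of_pos_right _ (by positivity)

theorem Bound.fits_of_small {k : ℕ} {E : Env} : ∀ {m : Bound}, m.small k →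
    m.Fits E (numBound k E)
  | size, _ => trivial
  | log, _ => trivial
  | lit q, h => by
    have : q ≤ k := by simpa [small] using h
    exact this.trans (le_numBound k E)
  | mul p q, h => by
    simp only [small, Bool.and_eq_true, decide_eq_true_eq] at h
    obtain ⟨⟨⟨⟨h1, h2⟩, h3⟩, h4⟩, h5⟩ := h
    refine ⟨fits_of_small h1, fits_of_small h2, ?_⟩
    have h6 := (Bound.mul p q).val_add_one_le E
    simp only [val, coef, degN, degL] at h6
    refine (Nat.le_succ _).trans (h6.trans (Nat.mul_le_mul h3 ?_))
    have h7 := Nat.pow_le_pow_right (n := E.n + 1) (by omega) h4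
    have h8 := Nat.pow_le_pow_right (n := E.L + 1) (by omega) h5
    rw [pow_one] at h8
    exact Nat.mul_le_mul h7 h8

theorem Cmd.fits_of_small {k : ℕ} {E : Env} : ∀ {P : Cmd}, P.small k →
    P.Fits E (numBound k E)
  | skip, _ => trivial
  | setN .., h => by
    simp only [small, Bool.and_eq_true] at h
    have hk := le_numBound k E
    exact ⟨NX.fits_of_small hk h.1.1, NX.fits_of_small hk h.1.2, NX.fits_of_small hk h.2⟩
  | setR .., h => by
    simp only [small, Bool.and_eq_true] at h
    have hk := le_numBound k E
    exact ⟨NX.fits_of_small hk h.1.1, NX.fits_of_small hk h.1.2, RX.fits_of_small hk h.2⟩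
  | loadW .., h => by
    simp only [small, Bool.and_eq_true] at h
    have hk := le_numBound k E
    exact ⟨NX.fits_of_small hk h.1, NX.fits_of_small hk h.2⟩
  | loadLoop _ a, h => NX.fits_of_small (a := a) (le_numBound k E) h
  | seq P Q, h => by
    simp only [small, Bool.and_eq_true] at h
    exact ⟨fits_of_small h.1, fits_of_small h.2⟩
  | ite p P Q, h => by
    simp only [small, Bool.and_eq_true] at h
    exact ⟨TX.fits_of_small (le_numBound k E) h.1.1, fits_of_small h.1.2, fits_of_small h.2⟩
  | loop y m P, h => by
    simp only [small, Bool.and_eq_true, Bool.not_eq_true'] at h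
    exact ⟨Bound.fits_of_small h.1.1, h.1.2, fits_of_small h.2⟩

/-! ### The bit length of the number of vertices -/

/-- Cell 2 runs through the powers of two up to the first one beyond n while cell 1 counts. Cell 2
is cleared at the end because the variables of the main program start there and must be zero. -/
def logProgram : Program :=
  .seq (.setNat (.lit 2) (.lit 1))
    (.seq (.while (.natLe (.load (.lit 2)) (.load (.lit 0)))
      (.seq (.setNat (.lit 2) (.mul (.lit 2) (.load (.lit 2))))
        (.setNat (.lit 1) (.add (.load (.lit 1)) (.lit 1)))))
      (.setNat (.lit 2) (.lit 0)))

theorem size_le_add_two {L v : ℕ} (h : v < 2 ^ (L + 2)) : v.size ≤ L + 2 := Nat.size_le.mpr h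

theorem runs_logProgram {σ : State} {n : ℕ} (hn : σ.nat 0 = n) (h0 : ∀ x, 0 < x → σ.nat x = 0) :
    ∃ t, Runs logProgram σ ⟨Function.update σ.nat 1 n.size, σ.real⟩ t ∧
      t ≤ 100 * (n.size + 3) ^ 2 := by
  set L := n.size with hL
  let st : ℕ → State := fun k =>
    ⟨Function.update (Function.update σ.nat 1 k) 2 (2 ^ k), σ.real⟩
  have g0 : ∀ k, (st k).nat 0 = n := fun k => by simp [st, hn]
  have g1 : ∀ k, (st k).nat 1 = k := fun k => by simp [st]
  have g2 : ∀ k, (st k).nat 2 = 2 ^ k := fun k => by simp [st]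
  have hnL : n < 2 ^ L := Nat.lt_size_self n
  have hpow : ∀ k ≤ L, 2 ^ k < 2 ^ (L + 2) := fun k hk =>
    Nat.pow_lt_pow_right (by norm_num) (by omega)
  have hLp : L < 2 ^ (L + 2) := lt_trans Nat.lt_two_pow_self (hpow L le_rfl)
  have s0 : Nat.size 0 ≤ L + 2 := by simp
  have s1 : Nat.size 1 ≤ L + 2 := by simp
  have s2 : Nat.size 2 ≤ L + 2 := size_le_add_two (by
    have : 2 ^ 2 ≤ 2 ^ (L + 2) := Nat.pow_le_pow_right (by norm_num) (by omega)
    omega)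
  have sn : n.size ≤ L + 2 := by omega
  have key : ∀ j ≤ L, ∃ t, Runs (.while (.natLe (.load (.lit 2)) (.load (.lit 0)))
      (.seq (.setNat (.lit 2) (.mul (.lit 2) (.load (.lit 2))))
        (.setNat (.lit 1) (.add (.load (.lit 1)) (.lit 1))))) (st (L - j)) (st L) t ∧
      t ≤ (j + 1) * (30 * (L + 3)) := by
    intro j
    induction j with
    | zero =>
      intro _
      refine ⟨_, .whileFalse ?_, ?_⟩
      · simp only [Test.holds, NExp.eval, g0, g2]
        simpa using hnL
      · have := size_le_add_two (hpow L le_rfl)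
        simp only [Test.cost, NExp.cost, NExp.eval, g0, g2, Nat.sub_zero]
        omega
    | succ j ih =>
      intro hj
      obtain ⟨t, r, ht⟩ := ih (by omega)
      have e1 : L - j = L - (j + 1) + 1 := by omega
      set k := L - (j + 1) with hk
      have hkn : 2 ^ k ≤ n := by
        by_contra hc
        have := Nat.size_le.mpr (not_le.mp hc)
        omega
      rw [e1] at r
      have r1 := Runs.setNat (.lit 2) (.mul (.lit 2) (.load (.lit 2))) (st k)
      have r2 := Runs.setNat (.lit 1) (.add (.load (.lit 1)) (.lit 1))
        ⟨Function.update (st k).nat 2 (2 ^ (k + 1)), σ.real⟩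
      have e2 : Function.update (Function.update (st k).nat 2 (2 ^ (k + 1))) 1 (k + 1) =
          (st (k + 1)).nat := by
        funext x
        simp only [st, Function.update_apply]
        by_cases hx1 : x = 1
        · subst hx1; simp
        · by_cases hx2 : x = 2 <;> simp [hx1, hx2]
      simp only [NExp.eval, g2, Function.update_of_ne (show (1 : ℕ) ≠ 2 by norm_num), g1] at r1 r2
      rw [← pow_succ'] at r1
      rw [e2] at r2
      refine ⟨_, .whileTrue ?_ (.seq r1 r2) r, ?_⟩
      · simp only [Test.holds, NExp.eval, g0, g2]
        exact hkn
      · have p1 := size_le_add_two (hpow k (by omega))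
        have p2 := size_le_add_two (hpow (k + 1) (by omega))
        have p3 : k.size ≤ L + 2 := size_le_add_two (lt_of_le_of_lt (by omega) hLp)
        have p4 : (k + 1).size ≤ L + 2 := size_le_add_two (lt_of_le_of_lt (by omega) hLp)
        rw [pow_succ'] at p2
        simp only [Test.cost, NExp.cost, NExp.eval, g0, g2,
          Function.update_of_ne (show (1 : ℕ) ≠ 2 by norm_num), g1]
        linarith
  obtain ⟨t, r, ht⟩ := key L le_rfl
  have r0 := Runs.setNat (.lit 2) (.lit 1) σ
  have e0 : (⟨Function.update σ.nat 2 1, σ.real⟩ : State) = st (L - L) := by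
    simp only [st, Nat.sub_self, pow_zero]
    congr 2
    rw [eq_comm]
    exact Function.update_eq_self_iff.mpr (h0 1 one_pos).symm
  have r3 := Runs.setNat (.lit 2) (.lit 0) (st L)
  have e3 : Function.update (st L).nat 2 0 = Function.update σ.nat 1 L := by
    simp only [st, Function.update_idem]
    refine Function.update_eq_self_iff.mpr ?_
    rw [Function.update_of_ne (by norm_num), h0 2 two_pos]
  simp only [NExp.eval] at r0 r3
  rw [e0] at r0
  rw [e3] at r3
  refine ⟨_, .seq r0 (.seq r r3), ?_⟩
  simp only [NExp.cost]
  have : (L + 1) * (30 * (L + 3)) ≤ 30 * (L + 3) ^ 2 := by nlinarith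
  nlinarith

/-! ### Output -/

/-- The output overwrites part of the data. This is harmless, since the label of vertex k is stored
beyond cell k and is read before it can be lost. Cell 0 becomes the counter, so n is kept in a real
cell and the loop test compares reals. -/
def outputProgram : Program :=
  .seq (.setReal (.lit 0) (.ofNat (.load (.lit 0))))
    (.seq (.setNat (.lit 0) (.lit 0))
      (.while (.realLe (.add (.ofNat (.load (.lit 0))) (.lit 1)) (.load (.lit 0)))
        (.seq (.setNat (.add (.lit 1) (.load (.lit 0)))
            (.load (naddrExp .comp (.load (.lit 0)) (.lit 0))))
          (.setNat (.lit 0) (.add (.load (.lit 0)) (.lit 1))))))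

theorem runs_outputProgram {E : Env} {B : ℕ} {s : Store} {σ : State} (h : Encodes E B s σ) :
    ∃ τ t, Runs outputProgram σ τ t ∧ (∀ i < E.n, τ.nat (1 + i) = s.N .comp i 0) ∧
      t ≤ (E.n + 1) * (100 * unitCost B) := by
  have hq := one_le_unitCost B
  have hB := h.sq_le
  have hB1 := h.one_le
  have hn := h.size_le
  let st : ℕ → State := fun k =>
    ⟨fun x => if x = 0 then k else if x ≤ k then s.N .comp (x - 1) 0 else σ.nat x,
      Function.update σ.real 0 E.n⟩
  have s0 : ∀ v ≤ 512 * (B * B), 1 + v.size ≤ unitCost B := fun v hv => one_add_size_le hv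
  have g0 : ∀ k, (st k).nat 0 = k := fun k => by simp [st]
  have gr : ∀ k, (st k).real 0 = E.n := fun k => by simp [st]
  have gF : ∀ k, (st k).nat (naddr .comp k 0) = s.N .comp k 0 := fun k => by
    have h1 : naddr .comp k 0 ≠ 0 := by unfold naddr; omega
    have h2 : ¬ naddr .comp k 0 ≤ k := by unfold naddr; omega
    simp only [st, h1, h2, if_false, h.nat]
  set test := Test.realLe (.add (.ofNat (.load (.lit 0))) (.lit 1)) (.load (.lit 0)) with htest
  set body := Program.seq (.setNat (.add (.lit 1) (.load (.lit 0)))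
            (.load (naddrExp .comp (.load (.lit 0)) (.lit 0))))
          (.setNat (.lit 0) (.add (.load (.lit 0)) (.lit 1))) with hbody
  have hiff : ∀ k, test.holds (st k) ↔ k < E.n := fun k => by
    simp only [htest, Test.holds, RExp.eval, NExp.eval, g0, gr]
    rw [← Nat.succ_le_iff]
    norm_num
    exact_mod_cast Iff.rfl
  have hcost : ∀ k ≤ E.n, test.cost (st k) ≤ 10 * unitCost B := fun k hk => by
    have c1 := s0 0 (by omega)
    have c2 := s0 k (by omega)
    simp only [htest, Test.cost, RExp.cost, NExp.cost, NExp.eval, g0]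
    omega
  have key : ∀ j ≤ E.n, ∃ t, Runs (.while test body) (st (E.n - j)) (st E.n) t ∧
      t ≤ (j + 1) * (60 * unitCost B) := by
    intro j
    induction j with
    | zero =>
      intro _
      refine ⟨_, .whileFalse ?_, ?_⟩
      · rw [hiff]; simp
      · have := hcost E.n le_rfl
        rw [Nat.sub_zero]
        omega
    | succ j ih =>
      intro hj
      obtain ⟨t, r, ht⟩ := ih (by omega)
      have e1 : E.n - j = E.n - (j + 1) + 1 := by omega
      set k := E.n - (j + 1) with hk
      have hkn : k < E.n := by omega
      rw [e1] at r
      have r1 := Runs.setNat (.add (.lit 1) (.load (.lit 0)))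
            (.load (naddrExp .comp (.load (.lit 0)) (.lit 0))) (st k)
      have e2 : (NExp.load (naddrExp .comp (.load (.lit 0)) (.lit 0))).eval (st k) =
          s.N .comp k 0 := by
        have e : (naddrExp .comp (.load (.lit 0)) (.lit 0)).eval (st k) = naddr .comp k 0 := by
          rw [Encodes.naddrExp_eval]
          simp only [NExp.eval, g0]
        simp only [NExp.eval, e, gF]
      rw [e2] at r1
      have r2 := Runs.setNat (.lit 0) (.add (.load (.lit 0)) (.lit 1))
        ⟨Function.update (st k).nat (1 + k) (s.N .comp k 0), (st k).real⟩
      have e3 : Function.update (Function.update (st k).nat (1 + k) (s.N .comp k 0)) 0 (k + 1) =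
          (st (k + 1)).nat := by
        funext x
        simp only [st, Function.update_apply]
        rcases Nat.eq_zero_or_pos x with hx | hx
        · simp [hx]
        · by_cases hx1 : x = 1 + k
          · subst hx1; simp [Nat.add_comm]
          · have : (x ≤ k + 1) = (x ≤ k) := propext (by omega)
            simp [hx.ne', hx1, this]
      simp only [NExp.eval, g0, Function.update_of_ne (show (0 : ℕ) ≠ 1 + k by omega)] at r1 r2
      rw [e3] at r2
      refine ⟨_, .whileTrue ((hiff k).mpr hkn) (.seq r1 r2) r, ?_⟩
      have c0 := hcost k hkn.le
      have c1 := s0 0 (by omega)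
      have c2 := s0 k (by omega)
      have c3 := s0 (k + 1) (by omega)
      have c4 := s0 1 (by omega)
      have c5 := s0 (s.N .comp k 0) (by have := h.le .comp k 0; omega)
      obtain ⟨q1, q2⟩ := h.pair_le (hkn.le.trans hn) (Nat.zero_le B)
      have c6 : (naddrExp .comp (.load (.lit 0)) (.lit 0)).cost (st k) ≤ 20 * unitCost B := by
        have d1 := s0 (2 + NVar.comp.code) (by simp only [NVar.code]; omega)
        have d2 := s0 32 (by omega)
        have d3 := s0 (k + 0) (by omega)
        have d4 := s0 ((k + 0) * (k + 0)) (by omega)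
        have d5 := s0 ((k + 0) * (k + 0) + k) (by omega)
        have d6 := s0 (32 * ((k + 0) * (k + 0) + k)) (by omega)
        have d7 := s0 (2 + NVar.comp.code + 32 * ((k + 0) * (k + 0) + k))
          (by simp only [NVar.code]; omega)
        simp only [naddrExp, NExp.cost, NExp.eval, g0]
        omega
      have c7 : (NExp.load (naddrExp .comp (.load (.lit 0)) (.lit 0))).cost (st k) ≤
          21 * unitCost B := by
        have : (NExp.load (naddrExp .comp (.load (.lit 0)) (.lit 0))).cost (st k) =
          1 + (s.N .comp k 0).size + (naddrExp .comp (.load (.lit 0)) (.lit 0)).cost (st k) := by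
          rw [← e2]; rfl
        omega
      rw [Nat.add_comm] at c3
      have c8 : (NExp.add (.lit 1) (.load (.lit 0))).cost (st k) ≤ 5 * unitCost B := by
        have c3' := s0 (1 + k) (by omega)
        simp only [NExp.cost, NExp.eval, g0]
        omega
      have c9 : ∀ σ : State, σ.nat 0 = k →
          (NExp.add (.load (.lit 0)) (.lit 1)).cost σ ≤ 5 * unitCost B := fun σ hσ => by
        simp only [NExp.cost, NExp.eval, hσ]
        omega
      have c10 := c9 ⟨Function.update (st k).nat (1 + k) (s.N .comp k 0), (st k).real⟩
        (by simp only [Function.update_of_ne (show (0 : ℕ) ≠ 1 + k by omega), g0])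
      have c11 : ∀ σ : State, (NExp.lit 0).cost σ ≤ unitCost B := fun _ => c1
      have c12 := c11 ⟨Function.update (st k).nat (1 + k) (s.N .comp k 0), (st k).real⟩
      linarith
  obtain ⟨t, r, ht⟩ := key E.n le_rfl
  have r0 := Runs.setReal (.lit 0) (.ofNat (.load (.lit 0))) σ
  have r1 := Runs.setNat (.lit 0) (.lit 0)
    ⟨σ.nat, Function.update σ.real 0 E.n⟩
  have e0 : (⟨Function.update σ.nat 0 0, Function.update σ.real 0 E.n⟩ : State) =
      st (E.n - E.n) := by
    simp only [st, Nat.sub_self]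
    congr 1
    funext x
    rcases Nat.eq_zero_or_pos x with hx | hx
    · simp [hx]
    · have : ¬ x ≤ 0 := by omega
      simp [hx.ne']
  simp only [NExp.eval, RExp.eval, h.size] at r0 r1
  rw [e0] at r1
  refine ⟨_, _, .seq r0 (.seq r1 r), fun i hi => ?_, ?_⟩
  · have h1 : 1 + i ≤ E.n := by omega
    simp [st, h1]
  · have c1 := s0 0 (by omega)
    have c2 := s0 E.n (by omega)
    have p : 0 ≤ E.n * unitCost B := Nat.zero_le _
    simp only [NExp.cost, RExp.cost, NExp.eval, h.size]
    linarith

/-! ### Complete programs -/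

/-- All numbers are polynomial in n, so their bit lengths are of order L; here n + 1 and L + 1 are
both at most 2^L. -/
theorem unitCost_numBound_le (k : ℕ) (E : Env) (hL : E.L = E.n.size) :
    unitCost (numBound k E) ≤ (11 + 2 * k) * (E.L + 1) := by
  have h1 : E.n + 1 ≤ 2 ^ E.L := hL ▸ Nat.lt_size_self E.n
  have h2 : E.L + 1 ≤ 2 ^ E.L := Nat.lt_two_pow_self
  have h3 : k < 2 ^ k := Nat.lt_two_pow_self
  have h4 : 512 * (numBound k E * numBound k E) < 2 ^ (10 + 2 * k + 6 * E.L) := by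
    calc 512 * (numBound k E * numBound k E)
        ≤ 512 * ((2 ^ k * ((2 ^ E.L) ^ 2 * 2 ^ E.L)) * (2 ^ k * ((2 ^ E.L) ^ 2 * 2 ^ E.L))) := by
          have : numBound k E ≤ 2 ^ k * ((2 ^ E.L) ^ 2 * 2 ^ E.L) :=
            Nat.mul_le_mul h3.le (Nat.mul_le_mul (Nat.pow_le_pow_left h1 2) h2)
          exact Nat.mul_le_mul_left _ (Nat.mul_le_mul this this)
      _ = 2 ^ (9 + 2 * k + 6 * E.L) := by
          rw [show (512 : ℕ) = 2 ^ 9 by norm_num]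
          simp only [← pow_mul, ← pow_add]
          congr 1
          ring
      _ < _ := Nat.pow_lt_pow_right (by norm_num) (by omega)
  have h5 := Nat.size_le.mpr h4
  unfold unitCost
  nlinarith

/-- The machine program that evaluates a program of the language. -/
def Cmd.machine (P : Cmd) : Program := .seq logProgram (.seq P.comp outputProgram)

/-- The machine started on an input computes the final values of the variable `comp`. -/
theorem Cmd.exists_runs_machine {P : Cmd} {k : ℕ} (hP : P.small k) (hdeg : P.degN ≤ 9) (E : Env)
    (hL : E.L = E.n.size) (hE : ∀ a, E.n ≤ a → E.lp a = 0)
    (hE' : ∀ a b, E.n ≤ a ∨ E.n ≤ b → E.w a b = 0) {σ : State} (hpos : 0 < E.n) (hk : 0 < k)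
    (h0 : σ.nat 0 = E.n) (h1 : ∀ x, 0 < x → σ.nat x = 0) (h2 : σ.real 0 = E.eps)
    (h3 : σ.real 1 = E.lam) (h4 : ∀ a < E.n, σ.real (2 + a) = E.lp a)
    (h5 : ∀ a < E.n, ∀ b < E.n, σ.real (2 + E.n + a * E.n + b) = E.w a b)
    (h6 : ∀ x, 2 + E.n + E.n * E.n ≤ x → σ.real x = 0) :
    ∃ τ t, Runs P.machine σ τ t ∧
      (∀ i < E.n, τ.nat (1 + i) = (P.den E ⟨fun _ _ _ => 0, fun _ _ _ => 0⟩).N .comp i 0) ∧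
      t ≤ 3000 * ((P.coef + 1) * (k + 1)) * ((E.n + 1) ^ 9 * (E.L + 1) ^ (P.degL + 2)) := by
  obtain ⟨t₁, r₁, c₁⟩ := runs_logProgram h0 h1
  have henc : Encodes E (numBound k E) ⟨fun _ _ _ => 0, fun _ _ _ => 0⟩
      ⟨Function.update σ.nat 1 E.n.size, σ.real⟩ :=
    { size := by simpa using h0
      log := by simp [hL]
      nat := fun y a b => by
        have : naddr y a b ≠ 1 := by unfold naddr; omega
        simp only [Function.update_of_ne this]
        exact h1 _ (by unfold naddr; omega)
      eps := h2
      lam := h3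
      loop := h4
      edge := fun a ha b hb => by rw [← h5 a ha b hb, add_assoc (2 + E.n)]
      real := fun y a b => h6 _ (by unfold raddr; omega)
      le := fun _ _ _ => Nat.zero_le _
      one_le := le_trans (by omega) (le_numBound k E)
      size_le := by
        unfold numBound
        calc E.n ≤ (E.n + 1) ^ 2 := by nlinarith
          _ ≤ (E.n + 1) ^ 2 * (E.L + 1) := Nat.le_mul_of_pos_right _ (by omega)
          _ ≤ _ := Nat.le_mul_of_pos_left _ hk
      log_le := by
        unfold numBound
        calc E.L ≤ E.L + 1 := Nat.le_succ _
          _ ≤ (E.n + 1) ^ 2 * (E.L + 1) := Nat.le_mul_of_pos_left _ (by positivity)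
          _ ≤ _ := Nat.le_mul_of_pos_left _ hk
      loop_zero := hE
      edge_zero := hE' }
  obtain ⟨τ₂, t₂, r₂, e₂, c₂⟩ := Encodes.exists_runs (Cmd.fits_of_small hP) henc
  obtain ⟨τ₃, t₃, r₃, o₃, c₃⟩ := runs_outputProgram e₂
  refine ⟨τ₃, _, .seq r₁ (.seq r₂ r₃), o₃, ?_⟩
  have hU := unitCost_numBound_le k E hL
  have hw := P.weight_le E
  set U := unitCost (numBound k E)
  set X := (E.n + 1) ^ 9 * (E.L + 1) ^ (P.degL + 1) with hX
  set Y := E.L + 1 with hY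
  have hXY : (E.n + 1) ^ 9 * Y ^ (P.degL + 2) = X * Y := by rw [hX]; ring
  have hY1 : 1 ≤ Y := by omega
  have hYX : Y ≤ X := by
    rw [hX]
    calc Y = Y ^ 1 := (pow_one _).symm
      _ ≤ Y ^ (P.degL + 1) := Nat.pow_le_pow_right hY1 (by omega)
      _ ≤ _ := Nat.le_mul_of_pos_left _ (by positivity)
  have hnX : E.n + 1 ≤ X := by
    rw [hX]
    calc E.n + 1 = (E.n + 1) ^ 1 := (pow_one _).symm
      _ ≤ (E.n + 1) ^ 9 := Nat.pow_le_pow_right (by omega) (by norm_num)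
      _ ≤ _ := Nat.le_mul_of_pos_right _ (by positivity)
  have hwX : P.weight E ≤ P.coef * X := by
    refine hw.trans (Nat.mul_le_mul_left _ (Nat.mul_le_mul
      (Nat.pow_le_pow_right (by omega) hdeg) (Nat.pow_le_pow_right hY1 (by omega))))
  have b1 : t₁ ≤ 900 * (X * Y) := by
    rw [← hL] at c₁
    have : (E.L + 3) ^ 2 ≤ 9 * (X * Y) := by
      calc (E.L + 3) ^ 2 ≤ (3 * Y) ^ 2 := Nat.pow_le_pow_left (by omega) 2
        _ = 9 * (Y * Y) := by ring
        _ ≤ _ := Nat.mul_le_mul_left _ (Nat.mul_le_mul_right _ hYX)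
    omega
  have b2 : t₂ ≤ P.coef * (11 + 2 * k) * (X * Y) := by
    calc t₂ ≤ _ := c₂
      _ ≤ (P.coef * X) * ((11 + 2 * k) * Y) := Nat.mul_le_mul hwX hU
      _ = _ := by ring
  have b3 : t₃ ≤ 100 * (11 + 2 * k) * (X * Y) := by
    calc t₃ ≤ _ := c₃
      _ ≤ X * (100 * ((11 + 2 * k) * Y)) := Nat.mul_le_mul hnX (Nat.mul_le_mul_left _ hU)
      _ = _ := by ring
  have b4 : 1 ≤ X * Y := Nat.one_le_iff_ne_zero.mpr (by positivity)
  have b5 : 902 + P.coef * (11 + 2 * k) + 100 * (11 + 2 * k) ≤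
      3000 * ((P.coef + 1) * (k + 1)) := by nlinarith [Nat.zero_le (P.coef * k)]
  rw [hXY]
  refine le_trans ?_ (Nat.mul_le_mul_right _ b5)
  linarith

end ArrayLang


namespace ArrayLang

/-! ## The decomposition program -/

def NX.var (y : NVar) : NX := .get y (.lit 0) (.lit 0)

def NX.at (y k : NVar) : NX := .get y (.var k) (.lit 0)

def RX.var (y : RVar) : RX := .get y (.lit 0) (.lit 0)

def RX.at (y : RVar) (k : NVar) : RX := .get y (.var k) (.lit 0)

def RX.at₂ (y : RVar) (k l : NVar) : RX := .get y (.var k) (.var l)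

def TX.or (p q : TX) : TX := .not (.and (.not p) (.not q))

def TX.xor (p q : TX) : TX := .or (.and p (.not q)) (.and (.not p) q)

def TX.lt (a b : NX) : TX := .not (.le b a)

def TX.rlt (x y : RX) : TX := .not (.rle y x)

/-- The variable, or the entry of an array, has the value `1`. -/
def TX.one (a : NX) : TX := .eq a (.lit 1)

def Cmd.set (y : NVar) (e : NX) : Cmd := .setN y (.lit 0) (.lit 0) e

def Cmd.setAt (y k : NVar) (e : NX) : Cmd := .setN y (.var k) (.lit 0) e

def Cmd.setReal (y : RVar) (e : RX) : Cmd := .setR y (.lit 0) (.lit 0) e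

infixr:60 " ;; " => Cmd.seq

section eval

variable (E : Env) (s : Store)

@[simp] theorem NX.eval_var (y : NVar) : (NX.var y).eval E s = s.N y 0 0 := rfl
@[simp] theorem NX.eval_at (y k : NVar) : (NX.at y k).eval E s = s.N y (s.N k 0 0) 0 := rfl
@[simp] theorem RX.eval_var (y : RVar) : (RX.var y).eval E s = s.R y 0 0 := rfl
@[simp] theorem RX.eval_at (y : RVar) (k : NVar) :
    (RX.at y k).eval E s = s.R y (s.N k 0 0) 0 := rfl
@[simp] theorem RX.eval_at₂ (y : RVar) (k l : NVar) :
    (RX.at₂ y k l).eval E s = s.R y (s.N k 0 0) (s.N l 0 0) := rfl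

@[simp] theorem TX.holds_or (p q : TX) : (TX.or p q).holds E s ↔ p.holds E s ∨ q.holds E s := by
  simp only [TX.or, TX.holds]; tauto

@[simp] theorem TX.holds_xor (p q : TX) :
    (TX.xor p q).holds E s ↔ ¬ (p.holds E s ↔ q.holds E s) := by
  simp only [TX.xor, TX.holds_or, TX.holds]; tauto

@[simp] theorem TX.holds_lt (a b : NX) : (TX.lt a b).holds E s ↔ a.eval E s < b.eval E s := by
  simp [TX.lt]

@[simp] theorem TX.holds_rlt (a b : RX) : (TX.rlt a b).holds E s ↔ a.eval E s < b.eval E s := by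
  simp [TX.rlt]

@[simp] theorem TX.holds_one (a : NX) : (TX.one a).holds E s ↔ a.eval E s = 1 := Iff.rfl

@[simp] theorem Cmd.den_skip : Cmd.skip.den E s = s := rfl
@[simp] theorem Cmd.den_seq (P Q : Cmd) : (P ;; Q).den E s = Q.den E (P.den E s) := rfl
@[simp] theorem Cmd.den_setN (y : NVar) (a b e : NX) :
    (Cmd.setN y a b e).den E s = s.setN y (a.eval E s) (b.eval E s) (e.eval E s) := rfl
@[simp] theorem Cmd.den_setR (y : RVar) (a b : NX) (e : RX) :
    (Cmd.setR y a b e).den E s = s.setR y (a.eval E s) (b.eval E s) (e.eval E s) := rfl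
@[simp] theorem Cmd.den_loadW (y : RVar) (a b : NX) : (Cmd.loadW y a b).den E s =
    s.setR y (a.eval E s) (b.eval E s) (E.w (a.eval E s) (b.eval E s)) := rfl
@[simp] theorem Cmd.den_loadLoop (y : RVar) (a : NX) : (Cmd.loadLoop y a).den E s =
    s.setR y (a.eval E s) 0 (E.lp (a.eval E s)) := rfl
@[simp] theorem Cmd.den_set (y : NVar) (e : NX) :
    (Cmd.set y e).den E s = s.setN y 0 0 (e.eval E s) := rfl
@[simp] theorem Cmd.den_setAt (y k : NVar) (e : NX) :
    (Cmd.setAt y k e).den E s = s.setN y (s.N k 0 0) 0 (e.eval E s) := rfl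
@[simp] theorem Cmd.den_setReal (y : RVar) (e : RX) :
    (Cmd.setReal y e).den E s = s.setR y 0 0 (e.eval E s) := rfl

theorem Cmd.den_ite_pos {p : TX} {P Q : Cmd} (h : p.holds E s) :
    (Cmd.ite p P Q).den E s = P.den E s := if_pos h

theorem Cmd.den_ite_neg {p : TX} {P Q : Cmd} (h : ¬ p.holds E s) :
    (Cmd.ite p P Q).den E s = Q.den E s := if_neg h

end eval

/-! ### Frequent loops -/

/-- Add up the values of `x` for the indices that satisfy `p`. -/
def sumLoop (y : RVar) (k : NVar) (P : Cmd) (p : TX) (x : RX) : Cmd :=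
  .setReal y (.lit 0) ;;
    .loop k .size (P ;; .ite p (.setReal y (.add (.var y) x)) .skip)

/-- Is there an index that satisfies `p`? -/
def existsLoop (y k : NVar) (m : Bound) (P : Cmd) (p : TX) : Cmd :=
  .set y (.lit 0) ;; .loop k m (P ;; .ite p (.set y (.lit 1)) .skip)

/-- The first index that satisfies `p`. -/
def firstLoop (y k : NVar) (p : TX) : Cmd :=
  .set y .size ;; .loop k .size (.ite (.and (.eq (.var y) .size) p) (.set y (.var k)) .skip)

variable {E : Env}

open Classical in
-- The test and the summand need to be evaluated only in stores that agree with the initial one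
-- outside of the variables written by the loop. Offering these frame conditions to the hypothesis
-- lets loops be nested.
theorem den_sumLoop {y : RVar} {k : NVar} {P : Cmd} {p : TX} {x : RX} {s : Store}
    {p' : ℕ → Prop} {f : ℕ → ℝ} (hy : P.writesR y = false)
    (h : ∀ j < E.n, ∀ s' : Store, s'.N k 0 0 = j →
      (∀ z, (sumLoop y k P p x).writesN z = false → s'.N z = s.N z) →
      (∀ z, (sumLoop y k P p x).writesR z = false → s'.R z = s.R z) →
      (p.holds E (P.den E s') ↔ p' j) ∧ x.eval E (P.den E s') = f j) :
    ((sumLoop y k P p x).den E s).R y 0 0 = ∑ j ∈ Finset.range E.n, if p' j then f j else 0 := by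
  rw [sumLoop, Cmd.den_seq]
  refine loop_induct (E := E) (m := .size)
    (I := fun m s' => s'.R y 0 0 = ∑ j ∈ Finset.range m, if p' j then f j else 0) ?_ ?_
  · simp
  · intro j hj s' hjk hN hR ih
    obtain ⟨h1, h2⟩ := h j hj s' hjk (fun z hz => by
      rw [sumLoop, Cmd.writesN, Bool.or_eq_false_iff] at hz
      rw [hN z hz.2]; rfl) (fun z hz => by
      rw [sumLoop, Cmd.writesR, Bool.or_eq_false_iff] at hz
      rw [hR z hz.2]
      have : y ≠ z := by simpa [Cmd.setReal, Cmd.writesR] using hz.1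
      funext a b
      simp [Cmd.setReal, this.symm])
    have h3 : (P.den E s').R y = s'.R y := Cmd.den_R hy
    rw [Finset.sum_range_succ, ← ih, Cmd.den_seq]
    by_cases hp : p' j
    · rw [Cmd.den_ite_pos _ _ (h1.mpr hp), if_pos hp]
      simp [h2, h3]
    · rw [Cmd.den_ite_neg _ _ (fun hc => hp (h1.mp hc)), if_neg hp]
      simp [h3]

theorem den_existsLoop {y k : NVar} {m : Bound} {P : Cmd} {p : TX} {s : Store}
    {p' : ℕ → Prop} (hy : P.writesN y = false) (hyk : y ≠ k)
    (h : ∀ j < m.val E, ∀ s' : Store, s'.N k 0 0 = j →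
      (∀ z, (existsLoop y k m P p).writesN z = false → s'.N z = s.N z) →
      (∀ z, (existsLoop y k m P p).writesR z = false → s'.R z = s.R z) →
      (p.holds E (P.den E s') ↔ p' j)) :
    ((existsLoop y k m P p).den E s).N y 0 0 = 1 ↔ ∃ j < m.val E, p' j := by
  rw [existsLoop, Cmd.den_seq]
  refine loop_induct (E := E) (m := m)
    (I := fun m s' => s'.N y 0 0 = 1 ↔ ∃ j < m, p' j) ?_ ?_
  · simp [hyk]
  · intro j hj s' hjk hN hR ih
    have h1 := h j hj s' hjk (fun z hz => by
      rw [existsLoop, Cmd.writesN, Bool.or_eq_false_iff] at hz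
      rw [hN z hz.2]
      have : y ≠ z := by simpa [Cmd.set, Cmd.writesN] using hz.1
      funext a b
      simp [Cmd.set, this.symm]) (fun z hz => by
      rw [existsLoop, Cmd.writesR, Bool.or_eq_false_iff] at hz
      rw [hR z hz.2]
      rfl)
    have h3 : (P.den E s').N y = s'.N y := Cmd.den_N hy
    rw [Cmd.den_seq]
    by_cases hp : p' j
    · rw [Cmd.den_ite_pos _ _ (h1.mpr hp)]
      simp only [Cmd.den_set, NX.eval, Store.setN_N, hyk, false_and, if_false, true_and, if_true,
        true_iff]
      exact ⟨j, Nat.lt_succ_self j, hp⟩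
    · rw [Cmd.den_ite_neg _ _ (fun hc => hp (h1.mp hc))]
      simp only [Cmd.den_skip, Store.setN_N, hyk, false_and, if_false, h3, ih]
      constructor
      · rintro ⟨i, hi, hpi⟩
        exact ⟨i, by omega, hpi⟩
      · rintro ⟨i, hi, hpi⟩
        refine ⟨i, lt_of_le_of_ne (by omega) fun e => hp (e ▸ hpi), hpi⟩

theorem den_firstLoop {y k : NVar} {p : TX} {s : Store} {p' : ℕ → Prop} (hyk : y ≠ k)
    (h : ∀ j < E.n, ∀ s' : Store, s'.N k 0 0 = j →
      (∀ z, (firstLoop y k p).writesN z = false → s'.N z = s.N z) →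
      (∀ z, (firstLoop y k p).writesR z = false → s'.R z = s.R z) → (p.holds E s' ↔ p' j)) :
    ((((firstLoop y k p).den E s).N y 0 0 < E.n ∧ p' (((firstLoop y k p).den E s).N y 0 0) ∧
      ∀ j < ((firstLoop y k p).den E s).N y 0 0, ¬ p' j)) ∨
    (((firstLoop y k p).den E s).N y 0 0 = E.n ∧ ∀ j < E.n, ¬ p' j) := by
  rw [firstLoop, Cmd.den_seq]
  refine loop_induct (E := E) (m := .size)
    (I := fun m s' => (s'.N y 0 0 < E.n ∧ p' (s'.N y 0 0) ∧ ∀ j < s'.N y 0 0, ¬ p' j) ∨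
      (s'.N y 0 0 = E.n ∧ ∀ j < m, ¬ p' j)) ?_ ?_
  · right
    simp [hyk]
  · intro j hj s' hjk hN hR ih
    have h1 := h j hj s' hjk (fun z hz => by
      rw [firstLoop, Cmd.writesN, Bool.or_eq_false_iff] at hz
      rw [hN z hz.2]
      have : y ≠ z := by simpa [Cmd.set, Cmd.writesN] using hz.1
      funext a b
      simp [Cmd.set, this.symm]) (fun z hz => by
      rw [firstLoop, Cmd.writesR, Bool.or_eq_false_iff] at hz
      rw [hR z hz.2]
      rfl)
    simp only [Bound.val] at hj
    rcases ih with ⟨i1, i2, i3⟩ | ⟨i1, i2⟩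
    · left
      rw [Cmd.den_ite_neg]
      · simpa [hyk] using ⟨i1, i2, i3⟩
      · simp [i1.ne]
    · by_cases hp : p' j
      · left
        rw [Cmd.den_ite_pos]
        · simpa [hyk, hjk] using ⟨hj, hp, i2⟩
        · simp only [TX.holds, NX.eval_var, NX.eval]
          exact ⟨i1, h1.mpr hp⟩
      · right
        rw [Cmd.den_ite_neg]
        · simp only [Cmd.den_skip, Store.setN_N, hyk, false_and, if_false]
          refine ⟨i1, fun i hi => ?_⟩
          rcases Nat.lt_succ_iff_lt_or_eq.mp hi with hi | rfl
          · exact i2 i hi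
          · exact hp
        · simp only [TX.holds]
          exact fun hc => hp (h1.mp hc.2)

/-! ### The program -/

def inPiece (k : NVar) : TX := .eq (.at .piece k) (.var .root)

def initCmd : Cmd :=
  .loop .u .size
    (.loop .v .size (.loadW .w (.var .u) (.var .v)) ;;
      .loadLoop .loop (.var .u) ;; .setAt .piece .u (.lit 0) ;; .setAt .atom .u (.lit 0) ;;
      .setAt .done .u (.lit 0))

/-- Find a piece that is not finished. -/
def findRoot : Cmd :=
  firstLoop .root .u (.and (.eq (.at .piece .u) (.var .u)) (.eq (.at .done .u) (.lit 0)))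

/-- The weights of the edges that leave the piece. -/
def masses : Cmd :=
  .loop .v .size
      (sumLoop .acc .u .skip (.not (inPiece .u)) (.at₂ .w .v .u) ;;
        .setR .mass (.var .v) (.lit 0) (.add (.at .loop .v) (.var .acc))) ;;
    sumLoop .total .v .skip (inPiece .v) (.at .mass .v)

def initLengths : Cmd :=
  .loop .u .size (.loop .v .size (.setR .len (.var .u) (.var .v) (.div (.lit 1) (.at₂ .w .u .v))))

def crossTest : TX :=
  .and (.one (.at .reach .u)) (.and (inPiece .v) (.and (.not (.one (.at .reach .v)))
    (.rlt (.lit 0) (.at₂ .w .u .v))))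

/-- Find a shortest edge that leaves the tree. -/
def findEdge : Cmd :=
  .set .flag (.lit 0) ;;
    .loop .u .size (.loop .v .size
      (.ite (.and crossTest (.or (.eq (.var .flag) (.lit 0))
          (.rlt (.at₂ .len .u .v) (.get .len (.var .bu) (.var .bv)))))
        (.set .flag (.lit 1) ;; .set .bu (.var .u) ;; .set .bv (.var .v)) .skip))

/-- If no edge leaves the tree, the entry n, which is not a vertex, marks an idle step. -/
def primStep : Cmd :=
  findEdge ;;
    .ite (.one (.var .flag))
      (.setAt .vert .i (.var .bv) ;; .setAt .par .i (.var .bu) ;; .setAt .reach .bv (.lit 1))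
      (.setAt .vert .i .size)

def prim : Cmd :=
  .loop .v .size (.setAt .reach .v (.lit 0)) ;; .setAt .reach .root (.lit 1) ;;
    .loop .i .size primStep

def isChosen : TX :=
  .or (.eq (.var .i) (.var .a)) (.or (.eq (.var .i) (.var .b))
    (.or (.eq (.var .i) (.var .c)) (.eq (.var .i) (.var .d))))

/-- Steps are visited in the order of Prim's algorithm, so the side of the parent is known already;
the new vertex takes the other side precisely if the edge is chosen. -/
def sideStep : Cmd :=
  .ite (.lt (.at .vert .i) .size)
    (.ite (.xor (.one (.get .side (.at .par .i) (.lit 0))) isChosen)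
      (.setN .side (.at .vert .i) (.lit 0) (.lit 1))
      (.setN .side (.at .vert .i) (.lit 0) (.lit 0))) .skip

/-- The side of the cut that crosses precisely the chosen edges of the tree. -/
def buildSide : Cmd :=
  .loop .v .size (.ite (.and (inPiece .v) (.not (.one (.at .reach .v))))
      (.setAt .side .v (.lit 1)) (.setAt .side .v (.lit 0))) ;;
    .loop .i .size sideStep

/-- The pieces, the atoms and the finished pieces number at most n each, and every useful round adds
to one of these counts. -/
def rounds : Bound := .mul (.lit 3) .size

/-- The lower bound λ̃/1.01 for the minimum cut, by which all thresholds are scaled. -/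
def unit : RX := .div .lam (.lit (101 / 100))

/-- The flag `mixed` tells that the side is not a union of atoms, and `near` that it is within εl/2
of a cut stored for the same piece in an earlier round. -/
def evalSide : Cmd :=
  existsLoop .flag .v .size .skip (.one (.at .side .v)) ;;
  sumLoop .cutVal .u (sumLoop .acc .v .skip (.and (inPiece .v) (.not (.one (.at .side .v))))
    (.at₂ .w .u .v)) (.one (.at .side .u)) (.var .acc) ;;
  sumLoop .inner .v .skip (.one (.at .side .v)) (.at .mass .v) ;;
  .setReal .outer (.sub (.var .total) (.var .inner)) ;;
  existsLoop .mixed .u .size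
    (existsLoop .fu .v .size .skip (.and (inPiece .v) (.and (.not (.one (.at .side .v)))
      (.eq (.at .atom .u) (.at .atom .v)))))
    (.and (.one (.at .side .u)) (.one (.var .fu))) ;;
  existsLoop .near .x rounds
    (sumLoop .acc .v .skip (.and (inPiece .v) (.xor (.one (.at .side .v))
      (.one (.get .stored (.var .x) (.var .v))))) (.at .mass .v))
    (.and (.lt (.var .x) (.var .round)) (.and (.eq (.at .owner .x) (.var .root))
      (.rle (.var .acc) (.mul (.div .eps (.lit 2)) unit))))

/-- Three alternatives: a very light cut; a sparse cut of a piece with a large boundary; a cut of a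
piece with a small boundary that the net does not yet approximate. -/
def candTest : TX :=
  .and (.one (.var .flag)) (.or (.rlt (.var .cutVal) (.mul (.lit (49 / 100)) unit)) (.or
    (.and (.rlt (.mul (.lit 4) unit) (.var .total))
      (.and (.rle (.var .cutVal) (.mul (.lit (101 / 100)) .lam))
      (.and (.rlt (.var .cutVal) (.mul (.sub (.lit 1) .eps) (.var .inner)))
        (.rlt (.var .cutVal) (.mul (.sub (.lit 1) .eps) (.var .outer))))))
    (.and (.rle (.var .total) (.mul (.lit 4) unit))
      (.and (.rle (.var .cutVal) (.mul (.lit (103 / 100)) unit))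
      (.and (.rlt (.mul (.div .eps (.lit 2)) unit) (.var .inner))
      (.and (.one (.var .mixed)) (.not (.one (.var .near)))))))))

def updateBest : Cmd :=
  .ite (.and candTest (.or (.not (.one (.var .found))) (.rlt (.var .cutVal) (.var .bestVal))))
    (.set .found (.lit 1) ;; .setReal .bestVal (.var .cutVal) ;;
      .loop .v .size (.setAt .best .v (.at .side .v))) .skip

def trySide : Cmd := buildSide ;; evalSide ;; updateBest

def trySides : Cmd :=
  .loop .a .size (.loop .b .size (.loop .c .size (.loop .d .size trySide)))

def treeWeight : RX := .get .w (.at .par .i) (.at .vert .i)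

def findBottleneck : Cmd :=
  .set .flag (.lit 0) ;;
    .loop .i .size (.ite (.and (.lt (.at .vert .i) .size)
        (.or (.eq (.var .flag) (.lit 0)) (.rlt treeWeight (.var .bottle))))
      (.set .flag (.lit 1) ;; .setReal .bottle treeWeight) .skip)

def lengthen (x y : NX) : Cmd :=
  .setR .len x y (.mul (.get .len x y) (.add (.lit 1) (.mul (.lit (1 / 10))
    (.div (.var .bottle) (.get .w x y)))))

def reweight : Cmd :=
  findBottleneck ;;
    .loop .i .size (.ite (.lt (.at .vert .i) .size)
      (lengthen (.at .par .i) (.at .vert .i) ;; lengthen (.at .vert .i) (.at .par .i)) .skip)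

/-- The number of trees that `exists_crossing_le` asks for. -/
def iterations : Bound := .mul (.mul .size .size) (.mul (.lit 400) .log)

/-- Look for the smallest eligible cut of the piece. -/
def search : Cmd :=
  .set .found (.lit 0) ;; .setReal .bestVal (.lit 0) ;;
    .loop .iter iterations (prim ;; trySides ;; reweight)

/-- Labels are least vertices of their classes. They are collected in `tmp` first, as all
comparisons must use the old labels. -/
def refine (y : NVar) : Cmd :=
  .loop .u .size (firstLoop .flag .v (.and (.eq (.at y .v) (.at y .u))
      (.eq (.at .best .v) (.at .best .u))) ;; .setAt .tmp .u (.var .flag)) ;;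
    .loop .u .size (.setAt y .u (.at .tmp .u))

def storeBest : Cmd :=
  .setAt .owner .round (.var .root) ;;
    .loop .v .size (.setN .stored (.var .round) (.var .v) (.at .best .v))

/-- The atoms are refined in both cases, whether the piece is split or the cut is only stored. -/
def act : Cmd :=
  .ite (.one (.var .found))
    (.ite (.or (.rlt (.var .bestVal) (.mul (.lit (49 / 100)) unit))
        (.rlt (.mul (.lit 4) unit) (.var .total))) (refine .piece) storeBest ;;
      refine .atom)
    (.setAt .done .root (.lit 1))

/-- Setting the owner to n, which is not the root of a piece, declares in advance that the round
stores nothing. -/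
def roundCmd : Cmd :=
  .setAt .owner .round .size ;; findRoot ;;
    .ite (.lt (.var .root) .size) (masses ;; initLengths ;; search ;; act) .skip

/-- Every vertex starts as its own class; for each edge inside an atom the class of one end is
renamed to that of the other. -/
def components : Cmd :=
  .loop .u .size (.setAt .comp .u (.var .u)) ;;
    .loop .u .size (.loop .v .size
      (.ite (.and (.eq (.at .atom .u) (.at .atom .v)) (.rlt (.lit 0) (.at₂ .w .u .v)))
        (.set .fu (.at .comp .u) ;; .set .fv (.at .comp .v) ;;
          .loop .x .size (.ite (.eq (.at .comp .x) (.var .fu))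
            (.setAt .comp .x (.var .fv)) .skip)) .skip))

def decomposition : Cmd :=
  initCmd ;; .ite (.rlt (.lit 0) .lam) (.loop .round rounds roundCmd) .skip ;; components

/-- The number 401 is the coefficient assigned to the bound 400 n² L. -/
theorem decomposition_small : decomposition.small 401 = true := by decide

/-- The nesting is 1 (rounds) + 2 (trees) + 4 (choices of edges) + 2 (evaluation of a cut). -/
theorem decomposition_degN : decomposition.degN = 9 := by decide

end ArrayLang


namespace ArrayLang

open WeightedGraph

/-! ### Searching for a cut of a piece -/

/-- A piece `C` with root `r`, the weights `b` of the edges that leave `C`, a partition of `C`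
into atoms, and the cuts which are known already. -/
structure Task where
  C : Finset ℕ
  r : ℕ
  b : ℕ → ℝ
  atom : ℕ → ℕ
  stored : Set (Finset ℕ)

/-- The side `S` is a union of atoms. -/
def Task.InAlgebra (T : Task) (S : Finset ℕ) : Prop :=
  ∀ u ∈ S, ∀ v ∈ T.C, T.atom u = T.atom v → v ∈ S

/-- The eligible cuts of a piece. -/
def Task.Eligible (T : Task) (G : WeightedGraph ℕ) (ε lam : ℝ) (S : Finset ℕ) : Prop :=
  S ⊆ T.C ∧ T.r ∉ S ∧ S.Nonempty ∧
    (G.inducedBoundary T.C S < 49 / 100 * (lam / (101 / 100)) ∨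
      (4 * (lam / (101 / 100)) < ∑ v ∈ T.C, T.b v ∧
        G.inducedBoundary T.C S ≤ 101 / 100 * lam ∧
        G.inducedBoundary T.C S < (1 - ε) * ∑ v ∈ S, T.b v ∧
        G.inducedBoundary T.C S < (1 - ε) * ∑ v ∈ T.C \ S, T.b v) ∨
      (∑ v ∈ T.C, T.b v ≤ 4 * (lam / (101 / 100)) ∧
        G.inducedBoundary T.C S ≤ 103 / 100 * (lam / (101 / 100)) ∧
        ε / 2 * (lam / (101 / 100)) < ∑ v ∈ S, T.b v ∧ ¬ T.InAlgebra S ∧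
        ∀ N ∈ T.stored, ε / 2 * (lam / (101 / 100)) < ∑ v ∈ symmDiff S N, T.b v))

/-- The store `s` describes the task `T`. -/
structure Task.Repr (T : Task) (E : Env) (G : WeightedGraph ℕ) (s : Store) : Prop where
  lt : ∀ v ∈ T.C, v < E.n
  mem_iff : ∀ v < E.n, s.N .piece v 0 = s.N .root 0 0 ↔ v ∈ T.C
  root : s.N .root 0 0 = T.r
  root_mem : T.r ∈ T.C
  w : ∀ u < E.n, ∀ v < E.n, s.R .w u v = G.w u v
  mass : ∀ v ∈ T.C, s.R .mass v 0 = T.b v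
  total : s.R .total 0 0 = ∑ v ∈ T.C, T.b v
  atom : ∀ v < E.n, s.N .atom v 0 = T.atom v
  stored : ∀ S, S ∈ T.stored ↔ ∃ i < 3 * E.n, i < s.N .round 0 0 ∧
    s.N .owner i 0 = s.N .root 0 0 ∧ S = T.C.filter fun v => s.N .stored i v = 1

/-- The program does not change the description of the task. -/
def Cmd.keepsTask (P : Cmd) : Bool :=
  !P.writesN .piece && !P.writesN .root && !P.writesN .atom && !P.writesN .round &&
    !P.writesN .owner && !P.writesN .stored && !P.writesR .w && !P.writesR .mass &&
    !P.writesR .total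

theorem Task.Repr.frame {T : Task} {E : Env} {G : WeightedGraph ℕ} {s s' : Store}
    (h : T.Repr E G s) (P : Cmd) (hP : P.keepsTask = true)
    (hN : ∀ z, P.writesN z = false → s'.N z = s.N z)
    (hR : ∀ z, P.writesR z = false → s'.R z = s.R z) : T.Repr E G s' := by
  simp only [Cmd.keepsTask, Bool.and_eq_true, Bool.not_eq_true'] at hP
  obtain ⟨⟨⟨⟨⟨⟨⟨⟨h1, h2⟩, h3⟩, h4⟩, h5⟩, h6⟩, h7⟩, h8⟩, h9⟩ := hP
  refine ⟨h.lt, ?_, ?_, h.root_mem, ?_, ?_, ?_, ?_, ?_⟩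
  · rw [hN _ h1, hN _ h2]; exact h.mem_iff
  · rw [hN _ h2]; exact h.root
  · rw [hR _ h7]; exact h.w
  · rw [hR _ h8]; exact h.mass
  · rw [hR _ h9]; exact h.total
  · rw [hN _ h3]; exact h.atom
  · rw [hN _ h4, hN _ h5, hN _ h6, hN _ h2]; exact h.stored

theorem Task.Repr.den {T : Task} {E : Env} {G : WeightedGraph ℕ} {s : Store}
    (h : T.Repr E G s) (P : Cmd) (hP : P.keepsTask = true) : T.Repr E G (P.den E s) :=
  h.frame P hP (fun _ hz => Cmd.den_N hz) fun _ hz => Cmd.den_R hz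

section Prim

variable {T : Task} {E : Env} {G : WeightedGraph ℕ} {s : Store}

/-- The edge `uv` leaves the tree. -/
def Leaves (T : Task) (E : Env) (G : WeightedGraph ℕ) (s : Store) (u v : ℕ) : Prop :=
  u < E.n ∧ v < E.n ∧ s.N .reach u 0 = 1 ∧ v ∈ T.C ∧ s.N .reach v 0 ≠ 1 ∧ 0 < G.w u v

/-- The variables `flag`, `bu` and `bv` describe a shortest edge in `D` that leaves the tree. -/
def IsShortest (T : Task) (E : Env) (G : WeightedGraph ℕ) (s : Store) (D : ℕ → ℕ → Prop)
    (s' : Store) : Prop :=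
  (s'.N .flag 0 0 = 0 ∧ ∀ u v, D u v → ¬ Leaves T E G s u v) ∨
    (s'.N .flag 0 0 = 1 ∧ Leaves T E G s (s'.N .bu 0 0) (s'.N .bv 0 0) ∧
      ∀ u v, D u v → Leaves T E G s u v →
        s.R .len (s'.N .bu 0 0) (s'.N .bv 0 0) ≤ s.R .len u v)

/-- Both loops maintain the same assertion for the set D of pairs scanned so far; a single execution
of the body adds one pair to D. -/
theorem findEdge_spec (h : T.Repr E G s) :
    IsShortest T E G s (fun u v => u < E.n ∧ v < E.n) (findEdge.den E s) := by
  have step : ∀ (s' : Store) (u v : ℕ) (D D' : ℕ → ℕ → Prop), T.Repr E G s' → u < E.n → v < E.n →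
      s'.N .u 0 0 = u → s'.N .v 0 0 = v → s'.N .reach = s.N .reach → s'.R .len = s.R .len →
      (∀ x y, D' x y ↔ D x y ∨ (x = u ∧ y = v)) → IsShortest T E G s D s' →
      IsShortest T E G s D' (Store.setN (Cmd.den E
        (.ite (.and crossTest (.or (.eq (.var .flag) (.lit 0))
          (.rlt (.at₂ .len .u .v) (.get .len (.var .bu) (.var .bv)))))
        (.set .flag (.lit 1) ;; .set .bu (.var .u) ;; .set .bv (.var .v)) .skip) s')
          .v 0 0 (v + 1)) := by
    intro s' u v D D' hr hu hv hsu hsv hreach hlen hD hI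
    have hcross : crossTest.holds E s' ↔ Leaves T E G s u v := by
      simp only [crossTest, inPiece, TX.holds, TX.holds_one, NX.eval_at, NX.eval_var,
        TX.holds_rlt, RX.eval, RX.eval_at₂, hsu, hsv, hr.mem_iff v hv, hr.w u hu v hv, hreach,
        Leaves, hu, hv, true_and, Rat.cast_zero]
    by_cases hx : Leaves T E G s u v
    · by_cases hb : s'.N .flag 0 0 = 0 ∨
          s.R .len u v < s.R .len (s'.N .bu 0 0) (s'.N .bv 0 0)
      · rw [Cmd.den_ite_pos _ _ (by
          refine ⟨hcross.mpr hx, ?_⟩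
          simpa [hsu, hsv, hlen] using hb)]
        right
        refine ⟨by simp, ?_, ?_⟩
        · simpa [hsu, hsv] using hx
        · intro x y hxy hl
          simp only [Cmd.den_seq, Cmd.den_set, NX.eval, NX.eval_var, Store.setN_N, reduceCtorEq,
            false_and, if_false, if_true, and_self, hsu, hsv]
          rcases (hD x y).mp hxy with hd | ⟨rfl, rfl⟩
          · rcases hI with ⟨_, h2⟩ | ⟨h1, h2, h3⟩
            · exact absurd hl (h2 x y hd)
            · rcases hb with hb | hb
              · omega
              · exact hb.le.trans (h3 x y hd hl)
          · exact le_rfl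
      · rw [Cmd.den_ite_neg _ _ (by
          rintro ⟨_, hc⟩
          exact hb (by simpa [hsu, hsv, hlen] using hc))]
        push Not at hb
        rcases hI with ⟨h1, h2⟩ | ⟨h1, h2, h3⟩
        · exact absurd h1 hb.1
        · right
          refine ⟨by simpa using h1, by simpa using h2, ?_⟩
          intro x y hxy hl
          simp only [Cmd.den_skip, Store.setN_N, reduceCtorEq, false_and, if_false]
          rcases (hD x y).mp hxy with hd | ⟨rfl, rfl⟩
          · exact h3 x y hd hl
          · exact hb.2
    · rw [Cmd.den_ite_neg _ _ (by rintro ⟨hc, _⟩; exact hx (hcross.mp hc))]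
      have hD2 : ∀ x y, D' x y → Leaves T E G s x y → D x y := by
        intro x y hxy hl
        rcases (hD x y).mp hxy with hd | ⟨rfl, rfl⟩
        · exact hd
        · exact absurd hl hx
      rcases hI with ⟨h1, h2⟩ | ⟨h1, h2, h3⟩
      · left
        exact ⟨by simpa using h1, fun x y hxy hl => h2 x y (hD2 x y hxy hl) hl⟩
      · right
        refine ⟨by simpa using h1, by simpa using h2, fun x y hxy hl => ?_⟩
        simpa using h3 x y (hD2 x y hxy hl) hl
  rw [findEdge, Cmd.den_seq]
  refine loop_induct (E := E) (m := .size)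
    (I := fun k s' => IsShortest T E G s (fun u v => u < k ∧ v < E.n) s') ?_ ?_
  · left
    exact ⟨by simp, fun u v huv => absurd huv.1 (by omega)⟩
  · intro i hi s₁ hs₁ hN₁ hR₁ ih
    have hr₁ : T.Repr E G s₁ := (h.den (.set .flag (.lit 0)) (by decide)).frame _ (by decide) hN₁ hR₁
    have key := loop_induct (E := E) (m := .size) (y := .v) (s := s₁)
      (P := .ite (.and crossTest (.or (.eq (.var .flag) (.lit 0))
          (.rlt (.at₂ .len .u .v) (.get .len (.var .bu) (.var .bv)))))
        (.set .flag (.lit 1) ;; .set .bu (.var .u) ;; .set .bv (.var .v)) .skip)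
      (fun k s' => IsShortest T E G s (fun u v => (u < i ∧ v < E.n) ∨ (u = i ∧ v < k)) s')
      (by
        rcases ih with ⟨h1, h2⟩ | ⟨h1, h2, h3⟩
        · left
          refine ⟨by simpa using h1, ?_⟩
          rintro u v (huv | ⟨_, hv⟩)
          · exact h2 u v huv
          · omega
        · right
          refine ⟨by simpa using h1, by simpa using h2, ?_⟩
          rintro u v (huv | ⟨_, hv⟩)
          · simpa using h3 u v huv
          · omega)
      (by
        intro j hj s' hs' hN hR ih'
        refine step s' i j _ _ (hr₁.frame _ (by decide) hN hR) hi hj ?_ hs' ?_ ?_ ?_ ih'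
        · rw [hN _ (by decide), hs₁]
        · rw [hN _ (by decide), hN₁ _ (by decide), Cmd.den_N (by decide)]
        · rw [hR _ (by decide), hR₁ _ (by decide), Cmd.den_R (by decide)]
        · intro x y
          rw [Nat.lt_succ_iff_lt_or_eq]
          tauto)
    have e : (fun u v => (u < i ∧ v < E.n) ∨ (u = i ∧ v < E.n)) =
        fun u v => u < i + 1 ∧ v < E.n := by
      funext u v
      rw [Nat.lt_succ_iff_lt_or_eq]
      exact propext (by tauto)
    simp only [Bound.val] at key
    rw [e] at key
    simpa [IsShortest] using key

end Prim

end ArrayLang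

/-! ### Extending runs of Prim's algorithm, and the program that performs them -/

namespace WeightedGraph

variable {α : Type*} [DecidableEq α] {G : WeightedGraph α} {C : Finset α} {ℓ : α → α → ℝ} {r : α}
  {vt pa vt' pa' : ℕ → α} {m : ℕ}

theorem reached_congr {i : ℕ} (h : ∀ j < i, vt j = vt' j) : reached r vt i = reached r vt' i := by
  unfold reached
  congr 1
  exact Finset.image_congr fun j hj => h j (by simpa using hj)

theorem reached_succ (i : ℕ) : reached r vt (i + 1) = insert (vt i) (reached r vt i) := by
  unfold reached
  rw [Finset.range_add_one, Finset.image_insert, Finset.insert_comm]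

theorem IsPrimRun.congr (h : G.IsPrimRun C ℓ r vt pa m) (hv : ∀ j < m, vt j = vt' j)
    (hp : ∀ j < m, pa j = pa' j) : G.IsPrimRun C ℓ r vt' pa' m := by
  have hr : ∀ i < m, reached r vt' i = reached r vt i := fun i hi =>
    (reached_congr fun j hj => hv j (hj.trans hi)).symm
  refine ⟨h.root, fun i hi => ?_, fun i hi => ?_, fun i hi => ?_, fun i hi => ?_, fun i hi => ?_⟩
  · rw [← hv i hi]; exact h.mem i hi
  · rw [← hv i hi, hr i hi]; exact h.fresh i hi
  · rw [← hp i hi, hr i hi]; exact h.parent i hi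
  · rw [← hv i hi, ← hp i hi]; exact h.pos i hi
  · rw [← hv i hi, ← hp i hi, hr i hi]; exact h.min i hi

theorem IsPrimRun.succ (h : G.IsPrimRun C ℓ r vt pa m) (h1 : vt m ∈ C)
    (h2 : vt m ∉ reached r vt m) (h3 : pa m ∈ reached r vt m) (h4 : 0 < G.w (pa m) (vt m))
    (h5 : ∀ u ∈ reached r vt m, ∀ v ∈ C, v ∉ reached r vt m → 0 < G.w u v →
      ℓ (pa m) (vt m) ≤ ℓ u v) : G.IsPrimRun C ℓ r vt pa (m + 1) := by
  have key : ∀ {p : ℕ → Prop}, (∀ i < m, p i) → p m → ∀ i < m + 1, p i := fun h hm i hi => by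
    rcases Nat.lt_succ_iff_lt_or_eq.mp hi with hi | rfl
    · exact h i hi
    · exact hm
  exact ⟨h.root, key h.mem h1, key h.fresh h2, key h.parent h3, key h.pos h4, key h.min h5⟩

theorem IsPrimRun.reached_subset (h : G.IsPrimRun C ℓ r vt pa m) : reached r vt m ⊆ C := by
  intro v hv
  rcases Finset.mem_insert.mp hv with rfl | hv
  · exact h.root
  · obtain ⟨j, hj, rfl⟩ := Finset.mem_image.mp hv
    exact h.mem j (Finset.mem_range.mp hj)

theorem IsPrimRun.card_reached (h : G.IsPrimRun C ℓ r vt pa m) : (reached r vt m).card = m + 1 := by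
  have : ∀ i ≤ m, (reached r vt i).card = i + 1 := by
    intro i
    induction i with
    | zero => intro _; simp [reached]
    | succ i ih =>
      intro hi
      rw [reached_succ, Finset.card_insert_of_notMem (h.fresh i hi), ih (by omega)]
  exact this m le_rfl

end WeightedGraph

namespace ArrayLang

open WeightedGraph

section Prim

variable {T : Task} {E : Env} {G : WeightedGraph ℕ} {s : Store}

def Store.vert (s : Store) (i : ℕ) : ℕ := s.N .vert i 0

def Store.par (s : Store) (i : ℕ) : ℕ := s.N .par i 0

/-- The store describes a tree with `m` edges. -/
structure Task.HasTree (T : Task) (E : Env) (G : WeightedGraph ℕ) (ℓ : ℕ → ℕ → ℝ) (m : ℕ)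
    (s : Store) : Prop where
  tree : G.IsPrimTree T.C ℓ T.r s.vert s.par m
  lt : m < E.n
  vert_lt : ∀ i < E.n, s.N .vert i 0 < E.n ↔ i < m
  reach : ∀ v < E.n, s.N .reach v 0 = 1 ↔ v ∈ reached T.r s.vert m

/-- After k steps the tree has m ≤ k edges, and m = k unless it cannot be extended. A tree with m
edges has m + 1 vertices, so m < n after n steps, and the tree is maximal. -/
theorem prim_spec (h : T.Repr E G s) : ∃ m, T.HasTree E G (s.R .len) m (prim.den E s) := by
  set s₁ := (Cmd.setAt .reach .root (.lit 1)).den E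
    ((Cmd.loop .v .size (.setAt .reach .v (.lit 0))).den E s) with hs₁
  have hreach : ∀ v < E.n, s₁.N .reach v 0 = 1 ↔ v = T.r := by
    have h0 : ∀ v < E.n, ((Cmd.loop .v .size (.setAt .reach .v (.lit 0))).den E s).N .reach v 0 =
        0 := by
      refine loop_induct (E := E) (m := .size)
        (I := fun k s' => ∀ v < k, s'.N .reach v 0 = 0) (by omega) ?_
      intro k hk s' hs' _ _ ih v hv
      rcases Nat.lt_succ_iff_lt_or_eq.mp hv with hv | rfl
      · simp [ih v hv]
      · simp [hs']
    intro v hv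
    have hroot : ((Cmd.loop .v .size (.setAt .reach .v (.lit 0))).den E s).N .root 0 0 = T.r := by
      rw [Cmd.den_N (by decide), h.root]
    simp only [hs₁, Cmd.den_setAt, hroot, NX.eval, Store.setN_N, true_and, and_true]
    split_ifs with hc
    · simp [hc]
    · simp [h0 v hv, hc]
  have hr₁ : T.Repr E G s₁ := (h.den _ (by decide)).den _ (by decide)
  have hlen₁ : s₁.R .len = s.R .len := by
    rw [hs₁, Cmd.den_R (by decide), Cmd.den_R (by decide)]
  have key := loop_induct (E := E) (m := .size) (y := .i) (P := primStep) (s := s₁)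
    (fun k s' => ∃ m ≤ k, G.IsPrimRun T.C (s.R .len) T.r s'.vert s'.par m ∧
      (m = k ∨ ∀ u ∈ reached T.r s'.vert m, ∀ v ∈ T.C, v ∉ reached T.r s'.vert m → G.w u v = 0) ∧
      (∀ i < k, s'.N .vert i 0 < E.n ↔ i < m) ∧
      (∀ v < E.n, s'.N .reach v 0 = 1 ↔ v ∈ reached T.r s'.vert m)) ?_ ?_
  · obtain ⟨m, hm, h1, h2, h3, h4⟩ := key
    have hlt : m < E.n := by
      have h5 := h1.card_reached
      have h6 : reached T.r (prim.den E s).vert m ⊆ Finset.range E.n := fun v hv =>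
        Finset.mem_range.mpr (h.lt v (h1.reached_subset hv))
      have h7 := Finset.card_le_card h6
      rw [Finset.card_range] at h7
      have h5' : (reached T.r (prim.den E s).vert m).card = m + 1 := h5
      omega
    refine ⟨m, ⟨⟨h1, ?_⟩, hlt, h3, h4⟩⟩
    exact h2.resolve_left (fun hc => hlt.ne hc)
  · refine ⟨0, le_rfl, ⟨h.root_mem, ?_, ?_, ?_, ?_, ?_⟩, Or.inl rfl, ?_, ?_⟩ <;> try omega
    intro v hv
    simpa [reached] using hreach v hv
  · rintro k hk s₂ hs₂ hN hR ⟨m, hm, h1, h2, h3, h4⟩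
    simp only [Bound.val] at hk
    have hr₂ : T.Repr E G s₂ := hr₁.frame _ (by decide) hN hR
    have hlen₂ : s₂.R .len = s.R .len := by rw [hR _ (by decide), hlen₁]
    set s₃ := findEdge.den E s₂ with hs₃
    have hsh := findEdge_spec hr₂
    rw [← hs₃] at hsh
    have e_reach : s₃.N .reach = s₂.N .reach := Cmd.den_N (by decide)
    have e_vert : s₃.N .vert = s₂.N .vert := Cmd.den_N (by decide)
    have e_par : s₃.N .par = s₂.N .par := Cmd.den_N (by decide)
    have e_i : s₃.N .i 0 0 = k := by rw [hs₃, Cmd.den_N (by decide), hs₂]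
    rw [primStep, Cmd.den_seq, ← hs₃]
    have hleaves : ∀ u v, Leaves T E G s₂ u v ↔
        u ∈ reached T.r s₂.vert m ∧ v ∈ T.C ∧ v ∉ reached T.r s₂.vert m ∧ 0 < G.w u v := by
      intro u v
      constructor
      · rintro ⟨hu, hv, hru, hvC, hrv, hw⟩
        exact ⟨(h4 u hu).mp hru, hvC, fun hc => hrv ((h4 v hv).mpr hc), hw⟩
      · rintro ⟨hu, hvC, hv, hw⟩
        have hu' := h.lt u (h1.reached_subset hu)
        have hv' := h.lt v hvC
        exact ⟨hu', hv', (h4 u hu').mpr hu, hvC, fun hc => hv ((h4 v hv').mp hc), hw⟩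
    rcases hsh with ⟨f0, hno⟩ | ⟨f1, hlv, hmin⟩
    · rw [Cmd.den_ite_neg _ _ (by simp [f0])]
      have hmax : ∀ u ∈ reached T.r s₂.vert m, ∀ v ∈ T.C, v ∉ reached T.r s₂.vert m →
          G.w u v = 0 := by
        intro u hu v hv hvr
        by_contra hw
        exact hno u v ⟨h.lt u (h1.reached_subset hu), h.lt v hv⟩ ((hleaves u v).mpr
          ⟨hu, hv, hvr, lt_of_le_of_ne (G.nonneg u v) (Ne.symm hw)⟩)
      have ev : ∀ j < m, s₂.vert j = Store.vert (((Cmd.setAt .vert .i .size).den E s₃).setN .i 0 0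
          (k + 1)) j := by
        intro j hj
        have : j ≠ k := by omega
        simp [Store.vert, e_i, this, e_vert]
      have ep : ∀ j < m, s₂.par j = Store.par (((Cmd.setAt .vert .i .size).den E s₃).setN .i 0 0
          (k + 1)) j := by
        intro j hj
        simp [Store.par, e_par]
      refine ⟨m, by omega, h1.congr ev ep, Or.inr ?_, ?_, ?_⟩
      · rw [← reached_congr ev]; exact hmax
      · intro i hi
        rcases Nat.lt_succ_iff_lt_or_eq.mp hi with hi | rfl
        · have : i ≠ k := by omega
          simpa [e_i, this, e_vert] using h3 i hi
        · simp [e_i]; omega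
      · rw [← reached_congr ev]
        simpa [e_reach] using h4
    · rw [Cmd.den_ite_pos _ _ (by simp [f1])]
      set bu := s₃.N .bu 0 0 with hbu
      set bv := s₃.N .bv 0 0 with hbv
      obtain ⟨g1, g2, g3, g4⟩ := (hleaves _ _).mp hlv
      have hmk : m = k := by
        rcases h2 with h2 | h2
        · exact h2
        · exact absurd (h2 _ g1 _ g2 g3) g4.ne'
      subst hmk
      set s₄ := ((Cmd.setAt .vert .i (.var .bv) ;; .setAt .par .i (.var .bu) ;;
        .setAt .reach .bv (.lit 1)).den E s₃).setN .i 0 0 (m + 1) with hs₄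
      have ev : ∀ j < m, s₂.vert j = s₄.vert j := by
        intro j hj
        have : j ≠ m := by omega
        simp [Store.vert, hs₄, e_i, this, e_vert]
      have ep : ∀ j < m, s₂.par j = s₄.par j := by
        intro j hj
        have : j ≠ m := by omega
        simp [Store.par, hs₄, e_i, this, e_par]
      have evm : s₄.vert m = bv := by simp [Store.vert, hs₄, e_i, hbv]
      have epm : s₄.par m = bu := by simp [Store.par, hs₄, e_i, hbu]
      have er : reached T.r s₂.vert m = reached T.r s₄.vert m := reached_congr ev
      refine ⟨m + 1, le_rfl, (h1.congr ev ep).succ ?_ ?_ ?_ ?_ ?_, Or.inl rfl, ?_, ?_⟩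
      · rw [evm]; exact g2
      · rw [evm, ← er]; exact g3
      · rw [epm, ← er]; exact g1
      · rw [epm, evm]; exact g4
      · rw [epm, evm, ← er, ← hlen₂]
        intro u hu v hv hvr hw
        exact hmin u v ⟨h.lt u (h1.reached_subset hu), h.lt v hv⟩ ((hleaves u v).mpr
          ⟨hu, hv, hvr, hw⟩)
      · intro i hi
        rcases Nat.lt_succ_iff_lt_or_eq.mp hi with hi' | rfl
        · have := ev i hi'
          simp only [Store.vert] at this
          rw [← this]
          simpa [hi] using (h3 i hi').mpr hi'
        · have := evm
          simp only [Store.vert] at this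
          rw [this]
          simpa using h.lt _ g2
      · intro v hv
        rw [reached_succ, ← er, evm, Finset.mem_insert]
        have : s₄.N .reach v 0 = if v = bv then 1 else s₂.N .reach v 0 := by
          simp [hs₄, e_reach, hbv]
        rw [this]
        split_ifs with hc
        · simp [hc]
        · simp [hc, h4 v hv]

end Prim

end ArrayLang


namespace ArrayLang

open WeightedGraph

/-! ### Cuts described by few tree edges, and their evaluation -/

section Side

variable {T : Task} {E : Env} {G : WeightedGraph ℕ} {s : Store}

def Store.sideSet (E : Env) (s : Store) : Finset ℕ :=
  (Finset.range E.n).filter fun v => s.N .side v 0 = 1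

/-- The set `S` is the side of a cut that crosses precisely the edges of the tree in `D`;
vertices which are not reached by the tree belong to `S`. -/
structure Task.Follows (T : Task) (vt pa : ℕ → ℕ) (m : ℕ) (D : ℕ → Prop) (S : Finset ℕ) :
    Prop where
  subset : S ⊆ T.C
  root : T.r ∉ S
  cross : ∀ i < m, ((pa i ∈ S ↔ vt i ∈ S) ↔ ¬ D i)
  rest : ∀ v ∈ T.C, v ∉ reached T.r vt m → v ∈ S

/-- The side of the root is prescribed, the sides of the other reached vertices follow along the
tree, and the unreached vertices are assigned by convention. -/
theorem Task.Follows.unique {vt pa : ℕ → ℕ} {m : ℕ} {D D' : ℕ → Prop} {S S' : Finset ℕ}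
    {ℓ : ℕ → ℕ → ℝ} (hT : G.IsPrimTree T.C ℓ T.r vt pa m) (h : T.Follows vt pa m D S)
    (h' : T.Follows vt pa m D' S') (hD : ∀ i < m, (D i ↔ D' i)) : S = S' := by
  have key : ∀ j ≤ m, ∀ v ∈ reached T.r vt j, (v ∈ S ↔ v ∈ S') := by
    intro j
    induction j with
    | zero =>
      intro _ v hv
      have : v = T.r := by simpa [reached] using hv
      subst this
      exact iff_of_false h.root h'.root
    | succ j ih =>
      intro hj v hv
      rw [reached_succ, Finset.mem_insert] at hv
      rcases hv with rfl | hv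
      · have h1 := ih (by omega) _ (hT.parent j hj)
        have h2 := h.cross j hj
        have h3 := h'.cross j hj
        have h4 := hD j hj
        tauto
      · exact ih (by omega) v hv
  ext v
  by_cases hv : v ∈ T.C
  · by_cases hr : v ∈ reached T.r vt m
    · exact key m le_rfl v hr
    · exact iff_of_true (h.rest v hv hr) (h'.rest v hv hr)
  · exact iff_of_false (fun hc => hv (h.subset hc)) fun hc => hv (h'.subset hc)

/-- The chosen edges of the tree. -/
def Chosen (a b c d : ℕ) (i : ℕ) : Prop := i = a ∨ i = b ∨ i = c ∨ i = d

/-- A step changes only the entry of its new vertex, which is not an end of an earlier tree edge, so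
what has been achieved for the earlier edges is preserved. -/
theorem buildSide_spec {ℓ : ℕ → ℕ → ℝ} {m : ℕ} (h : T.Repr E G s) (ht : T.HasTree E G ℓ m s) :
    T.Follows s.vert s.par m
      (Chosen (s.N .a 0 0) (s.N .b 0 0) (s.N .c 0 0) (s.N .d 0 0))
      ((buildSide.den E s).sideSet E) := by
  have hT := ht.tree
  set D := Chosen (s.N .a 0 0) (s.N .b 0 0) (s.N .c 0 0) (s.N .d 0 0) with hD
  set s₁ := (Cmd.loop .v .size (.ite (.and (inPiece .v) (.not (.one (.at .reach .v))))
      (.setAt .side .v (.lit 1)) (.setAt .side .v (.lit 0)))).den E s with hs₁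
  have h0 : ∀ v < E.n, s₁.N .side v 0 = 1 ↔ v ∈ T.C ∧ v ∉ reached T.r s.vert m := by
    refine loop_induct (E := E) (m := .size)
      (I := fun k s' => ∀ v < k, s'.N .side v 0 = 1 ↔ v ∈ T.C ∧ v ∉ reached T.r s.vert m)
      (by omega) ?_
    intro k hk s' hs' hN hR ih v hv
    have hr' := h.frame _ (by decide) hN hR
    have hk : k < E.n := hk
    have e : TX.holds E s' (.and (inPiece .v) (.not (.one (.at .reach .v)))) ↔
        k ∈ T.C ∧ k ∉ reached T.r s.vert m := by
      simp only [inPiece, TX.holds, TX.holds_one, NX.eval_at, NX.eval_var, hs',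
        hr'.mem_iff k hk, hN .reach (by decide), ht.reach k hk]
    by_cases hc : k ∈ T.C ∧ k ∉ reached T.r s.vert m
    · rw [Cmd.den_ite_pos _ _ (e.mpr hc)]
      rcases Nat.lt_succ_iff_lt_or_eq.mp hv with hv | rfl
      · simpa [hs', hv.ne] using ih v hv
      · simpa [hs'] using hc
    · rw [Cmd.den_ite_neg _ _ (fun hh => hc (e.mp hh))]
      rcases Nat.lt_succ_iff_lt_or_eq.mp hv with hv | rfl
      · simpa [hs', hv.ne] using ih v hv
      · simpa [hs'] using hc
  have hvC : ∀ i < m, s.vert i ∈ T.C := hT.mem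
  have hvr : ∀ i < m, s.vert i ≠ T.r := fun i hi hc =>
    hT.fresh i hi (hc ▸ Finset.mem_insert_self _ _)
  have hpv : ∀ k < m, ∀ i ≤ k, s.par i ≠ s.vert k := fun k hk i hi hc =>
    hT.fresh k hk (hc ▸ reached_mono _ _ hi (hT.parent i (lt_of_le_of_lt hi hk)))
  have hvv : ∀ k < m, ∀ i < k, s.vert i ≠ s.vert k := fun k hk i hi => hT.vt_ne hi hk
  have key := loop_induct (E := E) (m := .size) (y := .i) (P := sideStep) (s := s₁)
    (fun k s' => (∀ v < E.n, v ∉ T.C → s'.N .side v 0 ≠ 1) ∧ s'.N .side T.r 0 ≠ 1 ∧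
      (∀ i < k, i < m → ((s'.N .side (s.par i) 0 = 1 ↔ s'.N .side (s.vert i) 0 = 1) ↔ ¬ D i)) ∧
      ∀ v ∈ T.C, v ∉ reached T.r s.vert m → s'.N .side v 0 = 1) ?_ ?_
  · obtain ⟨k1, k2, k3, k4⟩ := key
    have hmem : ∀ v ∈ T.C, v ∈ (buildSide.den E s).sideSet E ↔
        (buildSide.den E s).N .side v 0 = 1 := fun v hv => by
      simp [Store.sideSet, h.lt v hv]
    refine ⟨fun v hv => ?_, fun hc => ?_, fun i hi => ?_, fun v hv hr => ?_⟩
    · obtain ⟨h1, h2⟩ := Finset.mem_filter.mp hv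
      by_contra hc
      exact k1 v (Finset.mem_range.mp h1) hc h2
    · exact k2 ((hmem _ h.root_mem).mp hc)
    · rw [hmem _ (hT.parent_mem hi), hmem _ (hvC i hi)]
      exact k3 i (hi.trans ht.lt) hi
    · exact (hmem v hv).mpr (k4 v hv hr)
  · refine ⟨fun v hv hc => ?_, ?_, by omega, fun v hv hr => ?_⟩
    · have := h0 v hv
      simp [this, hc]
    · have := h0 T.r (h.lt _ h.root_mem)
      simp [this, reached]
    · simpa using (h0 v (h.lt v hv)).mpr ⟨hv, hr⟩
  · rintro k hk s' hs' hN hR ⟨i1, i2, i3, i4⟩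
    have e_vert : s'.N .vert = s.N .vert := by rw [hN _ (by decide), Cmd.den_N (by decide)]
    have e_par : s'.N .par = s.N .par := by rw [hN _ (by decide), Cmd.den_N (by decide)]
    have e_a : s'.N .a = s.N .a := by rw [hN _ (by decide), Cmd.den_N (by decide)]
    have e_b : s'.N .b = s.N .b := by rw [hN _ (by decide), Cmd.den_N (by decide)]
    have e_c : s'.N .c = s.N .c := by rw [hN _ (by decide), Cmd.den_N (by decide)]
    have e_d : s'.N .d = s.N .d := by rw [hN _ (by decide), Cmd.den_N (by decide)]
    have hk : k < E.n := hk
    by_cases hkm : k < m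
    · have hx : TX.holds E s' (.xor (.one (.get .side (.at .par .i) (.lit 0))) isChosen) ↔
          ¬ (s'.N .side (s.par k) 0 = 1 ↔ D k) := by
        simp [isChosen, hs', e_par, Store.par, hD, Chosen, e_a, e_b, e_c, e_d]
      obtain ⟨z, hz, e⟩ : ∃ z : ℕ, (z = 1 ↔ ¬ (s'.N .side (s.par k) 0 = 1 ↔ D k)) ∧
          ∀ x y, (sideStep.den E s').N .side x y = if x = s.vert k ∧ y = 0 then z
            else s'.N .side x y := by
        rw [sideStep, Cmd.den_ite_pos _ _ (by simpa [hs', e_vert] using (ht.vert_lt k hk).mpr hkm)]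
        by_cases hc : ¬ (s'.N .side (s.par k) 0 = 1 ↔ D k)
        · rw [Cmd.den_ite_pos _ _ (hx.mpr hc)]
          exact ⟨1, by simpa using hc, fun x y => by simp [hs', e_vert, Store.vert]; rfl⟩
        · rw [Cmd.den_ite_neg _ _ (fun hh => hc (hx.mp hh))]
          exact ⟨0, by simpa using hc, fun x y => by simp [hs', e_vert, Store.vert]; rfl⟩
      have e' : ∀ x, ((sideStep.den E s').setN .i 0 0 (k + 1)).N .side x 0 = if x = s.vert k then
          z else s'.N .side x 0 := by
        intro x
        simp only [Store.setN_N, reduceCtorEq, false_and, if_false, e, and_true]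
      refine ⟨fun v hv hc => ?_, ?_, fun i hi him => ?_, fun v hv hr => ?_⟩
      · rw [e', if_neg (fun hh : v = s.vert k => hc (hh ▸ hvC k hkm))]
        exact i1 v hv hc
      · rw [e', if_neg (hvr k hkm).symm]
        exact i2
      · rcases Nat.lt_succ_iff_lt_or_eq.mp hi with hi | rfl
        · rw [e', e', if_neg (hpv k hkm i hi.le), if_neg (hvv k hkm i hi)]
          exact i3 i hi him
        · rw [e', e', if_neg (hpv i hkm i le_rfl), if_pos rfl]
          tauto
      · rw [e', if_neg (fun hh : v = s.vert k => hr (hh ▸ mem_reached_of_lt _ _ hkm))]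
        exact i4 v hv hr
    · have e : sideStep.den E s' = s' := by
        rw [sideStep, Cmd.den_ite_neg]
        · rfl
        · have := (ht.vert_lt k hk).not.mpr hkm
          simpa [hs', e_vert] using this
      rw [e]
      refine ⟨by simpa using i1, by simpa using i2, fun i hi him => ?_, by simpa using i4⟩
      have := i3 i (by omega) him
      simpa using this

open Classical in
theorem sum_range_ite {n : ℕ} {X : Finset ℕ} (hX : ∀ v ∈ X, v < n) (f : ℕ → ℝ) {p : ℕ → Prop}
    (hp : ∀ v < n, (p v ↔ v ∈ X)) :
    ∑ v ∈ Finset.range n, (if p v then f v else 0) = ∑ v ∈ X, f v := by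
  rw [← Finset.sum_filter]
  refine Finset.sum_congr ?_ fun _ _ => rfl
  ext v
  simp only [Finset.mem_filter, Finset.mem_range]
  constructor
  · rintro ⟨h1, h2⟩; exact (hp v h1).mp h2
  · exact fun h => ⟨hX v h, (hp v (hX v h)).mpr h⟩

open Classical in
theorem sum_ite_masses {S : Finset ℕ} (h : T.Repr E G s) (hS : S ⊆ T.C) {p : ℕ → Prop}
    (hp : ∀ v < E.n, (p v ↔ v ∈ S)) :
    ∑ v ∈ Finset.range E.n, (if p v then s.R .mass v 0 else 0) = ∑ v ∈ S, T.b v := by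
  rw [sum_range_ite (fun v hv => h.lt v (hS hv)) _ hp]
  exact Finset.sum_congr rfl fun v hv => h.mass v (hS hv)

/-- The result of the evaluation of a cut. -/
structure Task.Evaluated (T : Task) (E : Env) (G : WeightedGraph ℕ) (S : Finset ℕ) (s : Store) :
    Prop where
  flag : s.N .flag 0 0 = 1 ↔ S.Nonempty
  cutVal : s.R .cutVal 0 0 = G.inducedBoundary T.C S
  inner : s.R .inner 0 0 = ∑ v ∈ S, T.b v
  outer : s.R .outer 0 0 = ∑ v ∈ T.C \ S, T.b v
  mixed : s.N .mixed 0 0 = 1 ↔ ¬ T.InAlgebra S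
  near : s.N .near 0 0 = 1 ↔
    ∃ N ∈ T.stored, ∑ v ∈ symmDiff S N, T.b v ≤ E.eps / 2 * (E.lam / (101 / 100))

theorem evalSide_spec (h : T.Repr E G s) (hS : s.sideSet E ⊆ T.C) :
    T.Evaluated E G (s.sideSet E) (evalSide.den E s) := by
  set S := s.sideSet E with hSdef
  have hside : ∀ v < E.n, s.N .side v 0 = 1 ↔ v ∈ S := fun v hv => by
    simp [hSdef, Store.sideSet, hv]
  have hlt : ∀ v ∈ S, v < E.n := fun v hv => h.lt v (hS hv)
  set P1 := existsLoop .flag .v .size .skip (.one (.at .side .v)) with hP1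
  set P2 := sumLoop .cutVal .u (sumLoop .acc .v .skip
    (.and (inPiece .v) (.not (.one (.at .side .v)))) (.at₂ .w .u .v)) (.one (.at .side .u))
    (.var .acc) with hP2
  set P3 := sumLoop .inner .v .skip (.one (.at .side .v)) (.at .mass .v) with hP3
  set P4 : Cmd := .setReal .outer (.sub (.var .total) (.var .inner)) with hP4
  set P5 := existsLoop .mixed .u .size
    (existsLoop .fu .v .size .skip (.and (inPiece .v) (.and (.not (.one (.at .side .v)))
      (.eq (.at .atom .u) (.at .atom .v)))))
    (.and (.one (.at .side .u)) (.one (.var .fu))) with hP5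
  set P6 := existsLoop .near .x rounds
    (sumLoop .acc .v .skip (.and (inPiece .v) (.xor (.one (.at .side .v))
      (.one (.get .stored (.var .x) (.var .v))))) (.at .mass .v))
    (.and (.lt (.var .x) (.var .round)) (.and (.eq (.at .owner .x) (.var .root))
      (.rle (.var .acc) (.mul (.div .eps (.lit 2)) unit)))) with hP6
  have hE : evalSide.den E s = P6.den E (P5.den E (P4.den E (P3.den E (P2.den E (P1.den E s))))) :=
    rfl
  set s₁ := P1.den E s with hs₁
  set s₂ := P2.den E s₁ with hs₂
  set s₃ := P3.den E s₂ with hs₃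
  set s₄ := P4.den E s₃ with hs₄
  set s₅ := P5.den E s₄ with hs₅
  have r₁ : T.Repr E G s₁ := h.den _ (by decide)
  have r₂ : T.Repr E G s₂ := r₁.den _ (by decide)
  have r₃ : T.Repr E G s₃ := r₂.den _ (by decide)
  have r₄ : T.Repr E G s₄ := r₃.den _ (by decide)
  have r₅ : T.Repr E G s₅ := r₄.den _ (by decide)
  have d₁ : s₁.N .side = s.N .side := Cmd.den_N (by decide)
  have d₂ : s₂.N .side = s.N .side := by rw [hs₂, Cmd.den_N (by decide), d₁]
  have d₃ : s₃.N .side = s.N .side := by rw [hs₃, Cmd.den_N (by decide), d₂]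
  have d₄ : s₄.N .side = s.N .side := by rw [hs₄, Cmd.den_N (by decide), d₃]
  have d₅ : s₅.N .side = s.N .side := by rw [hs₅, Cmd.den_N (by decide), d₄]
  have c1 : s₁.N .flag 0 0 = 1 ↔ S.Nonempty := by
    rw [hs₁, hP1, den_existsLoop (p' := fun j => j ∈ S) rfl (by decide) ?_]
    · exact ⟨fun ⟨j, _, hj⟩ => ⟨j, hj⟩, fun ⟨j, hj⟩ => ⟨j, hlt j hj, hj⟩⟩
    · intro j hj s' hs' hN hR
      simp [hs', hN .side (by decide), hside j hj]
  have c2 : s₂.R .cutVal 0 0 = G.inducedBoundary T.C S := by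
    rw [hs₂, hP2, den_sumLoop (p' := fun j => j ∈ S)
      (f := fun u => ∑ v ∈ T.C \ S, G.w u v) (by decide) ?_,
      sum_range_ite (p := fun j => j ∈ S) hlt _ (fun _ _ => Iff.rfl)]
    · rfl
    · intro j hj s' hs' hN hR
      refine ⟨?_, ?_⟩
      · have : (Cmd.den E (sumLoop .acc .v .skip
          (.and (inPiece .v) (.not (.one (.at .side .v)))) (.at₂ .w .u .v)) s').N .u = s'.N .u :=
          Cmd.den_N (by decide)
        have h2 : (Cmd.den E (sumLoop .acc .v .skip
          (.and (inPiece .v) (.not (.one (.at .side .v)))) (.at₂ .w .u .v)) s').N .side = s'.N .side :=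
          Cmd.den_N (by decide)
        simp [this, h2, hs', hN .side (by decide), d₁, hside j hj]
      · rw [RX.eval_var]
        have r' := r₁.frame _ (by decide) hN hR
        rw [den_sumLoop (p' := fun v => v ∈ T.C \ S) (f := fun v => G.w j v) rfl ?_,
          sum_range_ite (p := fun v => v ∈ T.C \ S)
            (fun v hv => h.lt v (Finset.mem_sdiff.mp hv).1) _ (fun _ _ => Iff.rfl)]
        intro v hv s'' hs'' hN' hR'
        have r'' := r'.frame _ (by decide) hN' hR'
        refine ⟨?_, ?_⟩
        · simp only [Cmd.den_skip, inPiece, TX.holds, TX.holds_one, NX.eval_at, NX.eval_var, hs'',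
            r''.mem_iff v hv, hN' .side (by decide), hN .side (by decide), d₁, hside v hv,
            Finset.mem_sdiff]
        · simp only [Cmd.den_skip, RX.eval_at₂, hs'', hN' .u (by decide), hs', r''.w j hj v hv]
  have c3 : s₃.R .inner 0 0 = ∑ v ∈ S, T.b v := by
    rw [hs₃, hP3, den_sumLoop (p' := fun j => j ∈ S) (f := fun v => s₂.R .mass v 0) rfl ?_,
      sum_ite_masses (p := fun j => j ∈ S) r₂ hS (fun _ _ => Iff.rfl)]
    intro v hv s' hs' hN hR
    simp [hs', hN .side (by decide), d₂, hside v hv, hR .mass (by decide)]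
  have c4 : s₄.R .outer 0 0 = ∑ v ∈ T.C \ S, T.b v := by
    have := Finset.sum_sdiff (f := T.b) hS
    rw [hs₄, hP4]
    simp [r₃.total, c3]
    linarith
  have c5 : s₅.N .mixed 0 0 = 1 ↔ ¬ T.InAlgebra S := by
    rw [hs₅, hP5, den_existsLoop (p' := fun u => u ∈ S ∧ ∃ v < E.n, v ∈ T.C ∧ v ∉ S ∧
      T.atom u = T.atom v) (by decide) (by decide) ?_]
    · simp only [Task.InAlgebra, not_forall, exists_prop]
      constructor
      · rintro ⟨u, _, hu, v, _, hv, hvS, ha⟩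
        exact ⟨u, hu, v, hv, ha, hvS⟩
      · rintro ⟨u, hu, v, hv, ha, hvS⟩
        exact ⟨u, hlt u hu, hu, v, h.lt v hv, hv, hvS, ha⟩
    · intro u hu s' hs' hN hR
      have r' := r₄.frame _ (by decide) hN hR
      have e1 : (Cmd.den E (existsLoop .fu .v .size .skip (.and (inPiece .v)
        (.and (.not (.one (.at .side .v))) (.eq (.at .atom .u) (.at .atom .v))))) s').N .u =
          s'.N .u := Cmd.den_N (by decide)
      have e2 : (Cmd.den E (existsLoop .fu .v .size .skip (.and (inPiece .v)
        (.and (.not (.one (.at .side .v))) (.eq (.at .atom .u) (.at .atom .v))))) s').N .side =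
          s'.N .side := Cmd.den_N (by decide)
      have e3 := den_existsLoop (E := E) (y := .fu) (k := .v) (m := .size) (P := .skip)
        (p := .and (inPiece .v) (.and (.not (.one (.at .side .v)))
          (.eq (.at .atom .u) (.at .atom .v)))) (s := s')
        (p' := fun v => v ∈ T.C ∧ v ∉ S ∧ T.atom u = T.atom v) rfl (by decide) (by
          intro v hv s'' hs'' hN' hR'
          have r'' := r'.frame _ (by decide) hN' hR'
          have hv : v < E.n := hv
          simp only [Cmd.den_skip, inPiece, TX.holds, TX.holds_one, NX.eval_at, NX.eval_var, hs'',
            r''.mem_iff v hv, hN' .side (by decide), hN .side (by decide), d₄, hside v hv,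
            hN' .u (by decide), hs', r''.atom v hv, r''.atom u hu])
      simp only [TX.holds, TX.holds_one, NX.eval_at, NX.eval_var, e1, e2, e3, hs',
        hN .side (by decide), d₄, hside u hu, Bound.val]
  have c6 : (P6.den E s₅).N .near 0 0 = 1 ↔
      ∃ N ∈ T.stored, ∑ v ∈ symmDiff S N, T.b v ≤ E.eps / 2 * (E.lam / (101 / 100)) := by
    -- Masses are computed only for vertices of the piece, so all sets whose mass is added up have
    -- to lie in it.
    have hsub : ∀ i, symmDiff S (T.C.filter fun v => s₅.N .stored i v = 1) ⊆ T.C := fun i v hv => by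
      rcases Finset.mem_symmDiff.mp hv with ⟨h1, _⟩ | ⟨h1, _⟩
      · exact hS h1
      · exact (Finset.mem_filter.mp h1).1
    rw [hP6, den_existsLoop (p' := fun i => i < s₅.N .round 0 0 ∧
      s₅.N .owner i 0 = s₅.N .root 0 0 ∧
      ∑ v ∈ symmDiff S (T.C.filter fun v => s₅.N .stored i v = 1), T.b v ≤
        E.eps / 2 * (E.lam / (101 / 100))) (by decide) (by decide) ?_]
    · constructor
      · rintro ⟨i, hi, h1, h2, h3⟩
        exact ⟨_, (r₅.stored _).mpr ⟨i, hi, h1, h2, rfl⟩, h3⟩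
      · rintro ⟨N, hN, h3⟩
        obtain ⟨i, hi, h1, h2, rfl⟩ := (r₅.stored _).mp hN
        exact ⟨i, hi, h1, h2, h3⟩
    · intro i hi s' hs' hN hR
      have r' := r₅.frame _ (by decide) hN hR
      set Q := sumLoop .acc .v .skip (.and (inPiece .v) (.xor (.one (.at .side .v))
        (.one (.get .stored (.var .x) (.var .v))))) (.at .mass .v) with hQ
      have e1 : (Q.den E s').N .x = s'.N .x := Cmd.den_N (by decide)
      have e2 : (Q.den E s').N .round = s'.N .round := Cmd.den_N (by decide)
      have e3 : (Q.den E s').N .owner = s'.N .owner := Cmd.den_N (by decide)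
      have e4 : (Q.den E s').N .root = s'.N .root := Cmd.den_N (by decide)
      have e5 : (Q.den E s').R .acc 0 0 =
          ∑ v ∈ symmDiff S (T.C.filter fun v => s₅.N .stored i v = 1), T.b v := by
        rw [hQ, den_sumLoop (p' := fun v => v ∈ symmDiff S
            (T.C.filter fun v => s₅.N .stored i v = 1)) (f := fun v => s'.R .mass v 0) rfl ?_,
          sum_ite_masses (p := fun v => v ∈ symmDiff S
            (T.C.filter fun v => s₅.N .stored i v = 1)) r' (hsub i) (fun _ _ => Iff.rfl)]
        intro v hv s'' hs'' hN' hR'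
        have r'' := r'.frame _ (by decide) hN' hR'
        refine ⟨?_, by simp [hs'', hR' .mass (by decide)]⟩
        simp only [Cmd.den_skip, inPiece, TX.holds, TX.holds_xor, TX.holds_one, NX.eval_at,
          NX.eval_var, NX.eval, hs'', r''.mem_iff v hv, hN' .side (by decide),
          hN .side (by decide), d₅, hside v hv, hN' .x (by decide), hs',
          hN' .stored (by decide), hN .stored (by decide), Finset.mem_symmDiff, Finset.mem_filter]
        have := @hS v
        tauto
      simp only [TX.holds, TX.holds_lt, NX.eval_var, NX.eval_at, RX.eval_var, RX.eval, unit, e1, e2,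
        e3, e4, e5, hs', hN .round (by decide), hN .owner (by decide), hN .root (by decide)]
      norm_num
  rw [hE]
  refine ⟨?_, ?_, ?_, ?_, ?_, c6⟩
  · rw [Cmd.den_N (by decide), hs₅, Cmd.den_N (by decide), hs₄, Cmd.den_N (by decide), hs₃,
      Cmd.den_N (by decide), hs₂, Cmd.den_N (by decide)]
    exact c1
  · rw [Cmd.den_R (by decide), hs₅, Cmd.den_R (by decide), hs₄, Cmd.den_R (by decide), hs₃,
      Cmd.den_R (by decide)]
    exact c2
  · rw [Cmd.den_R (by decide), hs₅, Cmd.den_R (by decide), hs₄, Cmd.den_R (by decide)]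
    exact c3
  · rw [Cmd.den_R (by decide), hs₅, Cmd.den_R (by decide)]
    exact c4
  · rw [Cmd.den_N (by decide)]
    exact c5

end Side

end ArrayLang


namespace ArrayLang

open WeightedGraph

/-! ### Keeping the best eligible cut -/

section Search

variable {T : Task} {E : Env} {G : WeightedGraph ℕ} {s : Store}

/-- The entries are exactly 0 or 1, so that later two vertices are on the same side of the best cut
if and only if their entries are equal, as `refine` requires. -/
theorem buildSide_le_one (E : Env) (s : Store) : ∀ v < E.n, (buildSide.den E s).N .side v 0 ≤ 1 := by
  rw [buildSide, Cmd.den_seq]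
  refine loop_induct (E := E) (m := .size) (I := fun _ s' => ∀ v < E.n, s'.N .side v 0 ≤ 1) ?_ ?_
  · intro v hv
    have := loop_induct (E := E) (m := .size) (y := .v) (s := s)
      (P := .ite (.and (inPiece .v) (.not (.one (.at .reach .v))))
        (.setAt .side .v (.lit 1)) (.setAt .side .v (.lit 0)))
      (fun k s' => ∀ v < k, s'.N .side v 0 ≤ 1) (by omega) (by
        intro k hk s' hs' _ _ ih v hv
        have hcase : ∀ x ≤ 1, (((Cmd.setAt .side .v (.lit x)).den E s').setN .v 0 0 (k + 1)).N
            .side v 0 ≤ 1 := by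
          intro x hx
          rcases Nat.lt_succ_iff_lt_or_eq.mp hv with hv | rfl
          · simpa [hs', hv.ne] using ih v hv
          · simpa [hs'] using hx
        by_cases hc : TX.holds E s' (.and (inPiece .v) (.not (.one (.at .reach .v))))
        · rw [Cmd.den_ite_pos _ _ hc]
          exact hcase 1 le_rfl
        · rw [Cmd.den_ite_neg _ _ hc]
          exact hcase 0 zero_le_one)
    simpa using this v hv
  · intro k hk s' hs' _ _ ih v hv
    have hcase : ∀ x ≤ 1, ((Cmd.setN .side (.at .vert .i) (.lit 0) (.lit x)).den E s').N
        .side v 0 ≤ 1 := by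
      intro x hx
      have := ih v hv
      simp only [Cmd.den_setN, Store.setN_N]
      split_ifs
      · exact hx
      · exact this
    have e : (sideStep.den E s').N .side v 0 ≤ 1 := by
      rw [sideStep]
      by_cases h1 : TX.holds E s' (.lt (.at .vert .i) .size)
      · rw [Cmd.den_ite_pos _ _ h1]
        by_cases h2 : TX.holds E s' (.xor (.one (.get .side (.at .par .i) (.lit 0))) isChosen)
        · rw [Cmd.den_ite_pos _ _ h2]
          exact hcase 1 le_rfl
        · rw [Cmd.den_ite_neg _ _ h2]
          exact hcase 0 zero_le_one
      · rw [Cmd.den_ite_neg _ _ h1]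
        exact ih v hv
    simpa using e

theorem candTest_holds {S : Finset ℕ} (h : T.Repr E G s) (he : T.Evaluated E G S s)
    (hS : S ⊆ T.C) (hr : T.r ∉ S) : candTest.holds E s ↔ T.Eligible G E.eps E.lam S := by
  simp only [candTest, unit, TX.holds, TX.holds_one, TX.holds_or, TX.holds_rlt, RX.eval,
    RX.eval_var, NX.eval_var, he.flag, he.cutVal, he.inner, he.outer, he.mixed, he.near, h.total,
    Task.Eligible, hS, hr, not_false_eq_true, true_and]
  push_cast
  simp only [not_exists, not_and, not_le]

/-- The best cut that has been found. All eligible cuts in `𝒢` have been considered. -/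
structure Task.Best (T : Task) (E : Env) (G : WeightedGraph ℕ) (𝒢 : Finset ℕ → Prop) (s : Store) :
    Prop where
  sound : s.N .found 0 0 = 1 → ∃ S, T.Eligible G E.eps E.lam S ∧
    s.R .bestVal 0 0 = G.inducedBoundary T.C S ∧
    ∀ v < E.n, s.N .best v 0 ≤ 1 ∧ (s.N .best v 0 = 1 ↔ v ∈ S)
  complete : ∀ S, 𝒢 S → T.Eligible G E.eps E.lam S →
    s.N .found 0 0 = 1 ∧ s.R .bestVal 0 0 ≤ G.inducedBoundary T.C S

theorem Task.Best.frame {𝒢 : Finset ℕ → Prop} {s' : Store} (h : T.Best E G 𝒢 s)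
    (h1 : s'.N .found = s.N .found) (h2 : s'.N .best = s.N .best)
    (h3 : s'.R .bestVal = s.R .bestVal) : T.Best E G 𝒢 s' := by
  refine ⟨?_, ?_⟩
  · rw [h1, h2, h3]; exact h.sound
  · rw [h1, h3]; exact h.complete

theorem Task.Best.mono {𝒢 𝒢' : Finset ℕ → Prop} (h : T.Best E G 𝒢 s) (hsub : ∀ S, 𝒢' S → 𝒢 S) :
    T.Best E G 𝒢' s := ⟨h.sound, fun S hS => h.complete S (hsub S hS)⟩

theorem updateBest_spec {𝒢 : Finset ℕ → Prop} (h : T.Repr E G s)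
    (he : T.Evaluated E G (s.sideSet E) s) (hS : s.sideSet E ⊆ T.C) (hr : T.r ∉ s.sideSet E)
    (hle : ∀ v < E.n, s.N .side v 0 ≤ 1) (hb : T.Best E G 𝒢 s) :
    T.Best E G (fun S => 𝒢 S ∨ S = s.sideSet E) (updateBest.den E s) := by
  have hc := candTest_holds h he hS hr
  have hor : TX.holds E s (.or (.not (.one (.var .found))) (.rlt (.var .cutVal) (.var .bestVal))) ↔
      (s.N .found 0 0 ≠ 1 ∨ G.inducedBoundary T.C (s.sideSet E) < s.R .bestVal 0 0) := by
    simp [he.cutVal]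
  have hand : TX.holds E s (.and candTest (.or (.not (.one (.var .found)))
      (.rlt (.var .cutVal) (.var .bestVal)))) ↔ candTest.holds E s ∧ (s.N .found 0 0 ≠ 1 ∨
      G.inducedBoundary T.C (s.sideSet E) < s.R .bestVal 0 0) := and_congr Iff.rfl hor
  by_cases ht : candTest.holds E s ∧ (s.N .found 0 0 ≠ 1 ∨
      G.inducedBoundary T.C (s.sideSet E) < s.R .bestVal 0 0)
  · rw [updateBest, Cmd.den_ite_pos _ _ (hand.mpr ht)]
    set s₁ := (Cmd.setReal .bestVal (.var .cutVal)).den E ((Cmd.set .found (.lit 1)).den E s)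
      with hs₁
    have hf : ((Cmd.loop .v .size (.setAt .best .v (.at .side .v))).den E s₁).N .found = s₁.N .found :=
      Cmd.den_N (by decide)
    have hv : ((Cmd.loop .v .size (.setAt .best .v (.at .side .v))).den E s₁).R .bestVal =
        s₁.R .bestVal := Cmd.den_R (by decide)
    have hbest : ∀ v < E.n, ((Cmd.loop .v .size (.setAt .best .v (.at .side .v))).den E s₁).N
        .best v 0 = s.N .side v 0 := by
      refine loop_induct (E := E) (m := .size)
        (I := fun k s' => ∀ v < k, s'.N .best v 0 = s.N .side v 0) (by omega) ?_
      intro k hk s' hs' hN hR ih v hv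
      rcases Nat.lt_succ_iff_lt_or_eq.mp hv with hv | rfl
      · simpa [hs', hv.ne] using ih v hv
      · simp [hs', hN .side (by decide), hs₁]
    refine ⟨fun _ => ⟨_, hc.mp ht.1, ?_, fun v hv => ?_⟩, fun S hS hel => ?_⟩
    · simp only [Cmd.den_seq]
      rw [← hs₁, hv, hs₁]
      simp [he.cutVal]
    · simp only [Cmd.den_seq]
      rw [← hs₁, hbest v hv]
      exact ⟨hle v hv, by simp [Store.sideSet, hv]⟩
    · simp only [Cmd.den_seq]
      rw [← hs₁, hv, hf, hs₁]
      refine ⟨by simp, ?_⟩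
      simp only [Cmd.den_setReal, Cmd.den_set, Store.setR_R, and_self, if_true,
        RX.eval_var, Store.setN_R, he.cutVal]
      rcases hS with hS | rfl
      · obtain ⟨h1, h2⟩ := hb.complete S hS hel
        exact (ht.2.resolve_left (not_not.mpr h1)).le.trans h2
      · exact le_rfl
  · rw [updateBest, Cmd.den_ite_neg _ _ (fun hh => ht (hand.mp hh)), Cmd.den_skip]
    refine ⟨hb.sound, fun S hS hel => ?_⟩
    rcases hS with hS | rfl
    · exact hb.complete S hS hel
    · have h1 : ¬ (_ ∨ _) := fun hh => ht ⟨hc.mpr hel, hh⟩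
      rwa [not_or, not_not, not_lt] at h1

theorem Task.HasTree.frame {ℓ : ℕ → ℕ → ℝ} {m : ℕ} {s' : Store} (h : T.HasTree E G ℓ m s)
    (h1 : s'.N .vert = s.N .vert) (h2 : s'.N .par = s.N .par) (h3 : s'.N .reach = s.N .reach) :
    T.HasTree E G ℓ m s' := by
  have e1 : s'.vert = s.vert := by unfold Store.vert; rw [h1]
  have e2 : s'.par = s.par := by unfold Store.par; rw [h2]
  exact ⟨by rw [e1, e2]; exact h.tree, h.lt, by rw [h1]; exact h.vert_lt,
    by rw [h3, e1]; exact h.reach⟩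

theorem trySide_spec {ℓ : ℕ → ℕ → ℝ} {m : ℕ} {𝒢 : Finset ℕ → Prop} (h : T.Repr E G s)
    (ht : T.HasTree E G ℓ m s) (hb : T.Best E G 𝒢 s) :
    T.Best E G (fun S => 𝒢 S ∨ T.Follows s.vert s.par m
      (Chosen (s.N .a 0 0) (s.N .b 0 0) (s.N .c 0 0) (s.N .d 0 0)) S) (trySide.den E s) := by
  set s₁ := buildSide.den E s with hs₁
  have hf := buildSide_spec h ht
  rw [← hs₁] at hf
  have r₁ : T.Repr E G s₁ := h.den _ (by decide)
  have he := evalSide_spec r₁ hf.subset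
  have e : (evalSide.den E s₁).N .side = s₁.N .side := Cmd.den_N (by decide)
  have e' : (evalSide.den E s₁).sideSet E = s₁.sideSet E := by unfold Store.sideSet; rw [e]
  rw [← e'] at he
  have hb₁ : T.Best E G 𝒢 (evalSide.den E s₁) := (hb.frame (s' := s₁) (Cmd.den_N (by decide))
    (Cmd.den_N (by decide)) (Cmd.den_R (by decide))).frame (Cmd.den_N (by decide))
    (Cmd.den_N (by decide)) (Cmd.den_R (by decide))
  have := updateBest_spec (r₁.den evalSide (by decide)) he (e' ▸ hf.subset) (e' ▸ hf.root)
    (fun v hv => by rw [e]; exact buildSide_le_one E s v hv) hb₁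
  refine this.mono fun S hS => hS.imp_right fun h' => ?_
  rw [e']
  exact h'.unique ht.tree hf fun _ _ => Iff.rfl

/-- In the presence of the tree `vt`, `pa` the program considers the cuts in `F s`. -/
def Task.Covers (T : Task) (E : Env) (G : WeightedGraph ℕ) (ℓ : ℕ → ℕ → ℝ) (m : ℕ)
    (vt pa : ℕ → ℕ) (P : Cmd) (F : Store → Finset ℕ → Prop) : Prop :=
  ∀ s 𝒢, T.Repr E G s → T.HasTree E G ℓ m s → s.vert = vt → s.par = pa → T.Best E G 𝒢 s →
    T.Best E G (fun S => 𝒢 S ∨ F s S) (P.den E s)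

/-- Lets the four nested loops over the chosen edges be treated one after another: the loop covers
the union of what its body covers for the values of the counter. -/
theorem Task.Covers.loop {ℓ : ℕ → ℕ → ℝ} {m : ℕ} {vt pa : ℕ → ℕ} {P : Cmd}
    {F : Store → Finset ℕ → Prop} (hc : T.Covers E G ℓ m vt pa P F) (y : NVar)
    (Φ : Store → ℕ → Finset ℕ → Prop) (h1 : (Cmd.loop y .size P).keepsTask = true)
    (h2 : (Cmd.loop y .size P).writesN .vert = false)
    (h3 : (Cmd.loop y .size P).writesN .par = false)
    (h4 : (Cmd.loop y .size P).writesN .reach = false) (h5 : y ≠ .found) (h6 : y ≠ .best)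
    (hΦ : ∀ s s' : Store, (∀ z, (Cmd.loop y .size P).writesN z = false → s'.N z = s.N z) →
      ∀ S, Φ s (s'.N y 0 0) S → F s' S) :
    T.Covers E G ℓ m vt pa (.loop y .size P) fun s S => ∃ k < E.n, Φ s k S := by
  intro s 𝒢 hr ht hvt hpa hb
  refine loop_induct (E := E) (m := .size)
    (I := fun j s' => T.Best E G (fun S => 𝒢 S ∨ ∃ k < j, Φ s k S) s') ?_ ?_
  · have h0 : ∀ z, y ≠ z → (s.setN y 0 0 0).N z = s.N z := fun z hz => by
      funext a b
      simp [hz.symm]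
    refine (hb.frame (h0 _ h5) (h0 _ h6) rfl).mono ?_
    rintro S (hS | ⟨k, hk, _⟩)
    · exact hS
    · omega
  · intro j hj s' hs' hN hR ih
    have hw := hc s' _ (hr.frame _ h1 hN hR) (ht.frame (hN _ h2) (hN _ h3) (hN _ h4))
      (by unfold Store.vert; rw [hN _ h2]; exact hvt) (by unfold Store.par; rw [hN _ h3]; exact hpa)
      ih
    have h0 : ∀ z, y ≠ z → ((P.den E s').setN y 0 0 (j + 1)).N z = (P.den E s').N z :=
      fun z hz => by
        funext a b
        simp [hz.symm]
    refine (hw.frame (h0 _ h5) (h0 _ h6) rfl).mono ?_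
    rintro S (hS | ⟨k, hk, hS⟩)
    · exact Or.inl (Or.inl hS)
    · rcases Nat.lt_succ_iff_lt_or_eq.mp hk with hk | rfl
      · exact Or.inl (Or.inr ⟨k, hk, hS⟩)
      · exact Or.inr (hΦ s s' hN S (by rw [hs']; exact hS))

theorem trySides_spec {ℓ : ℕ → ℕ → ℝ} {m : ℕ} {𝒢 : Finset ℕ → Prop} (h : T.Repr E G s)
    (ht : T.HasTree E G ℓ m s) (hb : T.Best E G 𝒢 s) :
    T.Best E G (fun S => 𝒢 S ∨ ∃ a < E.n, ∃ b < E.n, ∃ c < E.n, ∃ d < E.n,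
      T.Follows s.vert s.par m (Chosen a b c d) S) (trySides.den E s) := by
  have c0 : T.Covers E G ℓ m s.vert s.par trySide fun s' S => T.Follows s.vert s.par m
      (Chosen (s'.N .a 0 0) (s'.N .b 0 0) (s'.N .c 0 0) (s'.N .d 0 0)) S :=
    fun s' 𝒢 hr ht hvt hpa hb => by
      have := trySide_spec hr ht hb
      rwa [hvt, hpa] at this
  have c1 := c0.loop .d (fun s' k S => T.Follows s.vert s.par m
      (Chosen (s'.N .a 0 0) (s'.N .b 0 0) (s'.N .c 0 0) k) S) (by decide) (by decide) (by decide)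
      (by decide) (by decide) (by decide) (fun s s' hN S hS => by
        rw [hN .a (by decide), hN .b (by decide), hN .c (by decide)]; exact hS)
  have c2 := c1.loop .c (fun s' k S => ∃ d < E.n, T.Follows s.vert s.par m
      (Chosen (s'.N .a 0 0) (s'.N .b 0 0) k d) S) (by decide) (by decide) (by decide)
      (by decide) (by decide) (by decide) (fun s s' hN S hS => by
        rw [hN .a (by decide), hN .b (by decide)]; exact hS)
  have c3 := c2.loop .b (fun s' k S => ∃ c < E.n, ∃ d < E.n, T.Follows s.vert s.par m
      (Chosen (s'.N .a 0 0) k c d) S) (by decide) (by decide) (by decide)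
      (by decide) (by decide) (by decide) (fun s s' hN S hS => by
        rw [hN .a (by decide)]; exact hS)
  have c4 := c3.loop .a (fun s' k S => ∃ b < E.n, ∃ c < E.n, ∃ d < E.n,
      T.Follows s.vert s.par m (Chosen k b c d) S) (by decide) (by decide) (by decide)
      (by decide) (by decide) (by decide) (fun s s' hN S hS => hS)
  exact c4 s 𝒢 h ht rfl rfl hb

end Search

end ArrayLang


namespace ArrayLang

open WeightedGraph

/-! ### Reweighting, and completeness of the search -/

section Search

variable {T : Task} {E : Env} {G : WeightedGraph ℕ} {s : Store} {ℓ : ℕ → ℕ → ℝ} {m : ℕ}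

theorem findBottleneck_spec (h : T.Repr E G s) (ht : T.HasTree E G ℓ m s) :
    (∀ i < m, (findBottleneck.den E s).R .bottle 0 0 ≤ G.w (s.par i) (s.vert i)) ∧
    (0 < m → ∃ i < m, (findBottleneck.den E s).R .bottle 0 0 = G.w (s.par i) (s.vert i)) := by
  have main := loop_induct (E := E) (m := .size) (y := .i) (s := (Cmd.set .flag (.lit 0)).den E s)
    (P := .ite (.and (.lt (.at .vert .i) .size)
        (.or (.eq (.var .flag) (.lit 0)) (.rlt treeWeight (.var .bottle))))
      (.set .flag (.lit 1) ;; .setReal .bottle treeWeight) .skip)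
    (fun k s' => (s'.N .flag 0 0 = 0 ∧ ∀ i < k, ¬ i < m) ∨ (s'.N .flag 0 0 = 1 ∧
      (∃ i < m, s'.R .bottle 0 0 = G.w (s.par i) (s.vert i)) ∧
      ∀ i < k, i < m → s'.R .bottle 0 0 ≤ G.w (s.par i) (s.vert i)))
    (Or.inl ⟨by simp, by omega⟩) (by
      intro k hk s' hs' hN hR ih
      have hk : k < E.n := hk
      have e_vert : s'.N .vert = s.N .vert := by rw [hN _ (by decide), Cmd.den_N (by decide)]
      have e_par : s'.N .par = s.N .par := by rw [hN _ (by decide), Cmd.den_N (by decide)]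
      have e_w : s'.R .w = s.R .w := by rw [hR _ (by decide), Cmd.den_R (by decide)]
      have hw : k < m → treeWeight.eval E s' = G.w (s.par k) (s.vert k) := fun hkm => by
        simp only [treeWeight, RX.eval, NX.eval_at, hs', e_vert, e_par, e_w]
        exact h.w _ (h.lt _ (ht.tree.parent_mem hkm)) _ (h.lt _ (ht.tree.mem k hkm))
      have hcond : TX.holds E s' (.and (.lt (.at .vert .i) .size)
          (.or (.eq (.var .flag) (.lit 0)) (.rlt treeWeight (.var .bottle)))) ↔
          k < m ∧ (s'.N .flag 0 0 = 0 ∨ treeWeight.eval E s' < s'.R .bottle 0 0) := by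
        simp [hs', e_vert, ht.vert_lt k hk]
      by_cases hc : k < m ∧ (s'.N .flag 0 0 = 0 ∨ treeWeight.eval E s' < s'.R .bottle 0 0)
      · rw [Cmd.den_ite_pos _ _ (hcond.mpr hc)]
        right
        have e1 : (((Cmd.set .flag (.lit 1) ;; .setReal .bottle treeWeight).den E s').setN .i 0 0
            (k + 1)).R .bottle 0 0 = G.w (s.par k) (s.vert k) := by
          rw [← hw hc.1]
          simp [treeWeight]
        refine ⟨by simp, ⟨k, hc.1, e1⟩, fun i hi him => ?_⟩
        rw [e1]
        rcases Nat.lt_succ_iff_lt_or_eq.mp hi with hi | rfl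
        · rcases ih with ⟨_, i2⟩ | ⟨i1, _, i3⟩
          · exact absurd him (i2 i hi)
          · rw [← hw hc.1]
            exact (hc.2.resolve_left (by omega)).le.trans (i3 i hi him)
        · exact le_rfl
      · rw [Cmd.den_ite_neg _ _ (fun hh => hc (hcond.mp hh))]
        rcases ih with ⟨i1, i2⟩ | ⟨i1, i2, i3⟩
        · left
          refine ⟨by simpa using i1, fun i hi => ?_⟩
          rcases Nat.lt_succ_iff_lt_or_eq.mp hi with hi | rfl
          · exact i2 i hi
          · exact fun him => hc ⟨him, Or.inl i1⟩
        · right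
          refine ⟨by simpa using i1, by simpa using i2, fun i hi him => ?_⟩
          rcases Nat.lt_succ_iff_lt_or_eq.mp hi with hi | rfl
          · simpa using i3 i hi him
          · have h4 := fun hh => hc ⟨him, Or.inr hh⟩
            rw [hw him] at h4
            simpa using h4)
  change (((findBottleneck.den E s).N .flag 0 0 = 0 ∧ ∀ i < E.n, ¬ i < m) ∨ _) at main
  rcases main with ⟨_, h2⟩ | ⟨_, h2, h3⟩
  · have : m = 0 := by
      by_contra hm
      exact h2 0 (by have := ht.lt; omega) (by omega)
    subst this
    exact ⟨by omega, by omega⟩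
  · exact ⟨fun i hi => h3 i (hi.trans ht.lt) hi, fun _ => h2⟩

open Classical in
-- The new vertex of a step occurs in no earlier tree edge, so each edge is lengthened by one step
-- only, and both of its orders receive the same factor.
theorem reweight_spec (h : T.Repr E G s) (ht : T.HasTree E G ℓ m s) {u v : ℕ} (hu : u < E.n)
    (hv : v < E.n) : (reweight.den E s).R .len u v = if TreeEdge s.vert s.par m u v then
      s.R .len u v * (1 + 0.1 * ((findBottleneck.den E s).R .bottle 0 0 / G.w u v))
      else s.R .len u v := by
  set s₁ := findBottleneck.den E s with hs₁
  have main := loop_induct (E := E) (m := .size) (y := .i) (s := s₁)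
    (P := .ite (.lt (.at .vert .i) .size)
      (lengthen (.at .par .i) (.at .vert .i) ;; lengthen (.at .vert .i) (.at .par .i)) .skip)
    (fun k s' => ∀ u < E.n, ∀ v < E.n, s'.R .len u v =
      if TreeEdge s.vert s.par (min k m) u v then
        s.R .len u v * (1 + 0.1 * (s₁.R .bottle 0 0 / G.w u v)) else s.R .len u v)
    (by
      intro u hu v hv
      rw [if_neg]
      · simp only [Store.setN_R, hs₁]
        rw [Cmd.den_R (by decide)]
      · rintro ⟨i, hi, _⟩
        simp at hi)
    (by
      intro k hk s' hs' hN hR ih u hu v hv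
      have hk : k < E.n := hk
      have e_vert : s'.N .vert = s.N .vert := by rw [hN _ (by decide), hs₁, Cmd.den_N (by decide)]
      have e_par : s'.N .par = s.N .par := by rw [hN _ (by decide), hs₁, Cmd.den_N (by decide)]
      have e_w : s'.R .w = s.R .w := by rw [hR _ (by decide), hs₁, Cmd.den_R (by decide)]
      have e_bottle : s'.R .bottle = s₁.R .bottle := hR _ (by decide)
      have hcond : TX.holds E s' (.lt (.at .vert .i) .size) ↔ k < m := by
        simp [hs', e_vert, ht.vert_lt k hk]
      rw [Store.setN_R]
      by_cases hkm : k < m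
      · rw [Cmd.den_ite_pos _ _ (hcond.mpr hkm)]
        have hpv : s.par k ≠ s.vert k := fun hc => ht.tree.fresh k hkm (hc ▸ ht.tree.parent k hkm)
        have hp : s.par k < E.n := h.lt _ (ht.tree.parent_mem hkm)
        have hvk : s.vert k < E.n := h.lt _ (ht.tree.mem k hkm)
        have hfresh : ¬ TreeEdge s.vert s.par k (s.par k) (s.vert k) := by
          rintro ⟨i, hi, ⟨_, h2⟩ | ⟨h1, _⟩⟩
          · exact ht.tree.vt_ne hi hkm h2
          · exact ht.tree.fresh k hkm (h1 ▸ reached_mono _ _ hi.le (ht.tree.parent i (hi.trans hkm)))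
        have hmin : min (k + 1) m = k + 1 := by omega
        have hmin' : min k m = k := by omega
        have hsucc : TreeEdge s.vert s.par (k + 1) u v ↔ TreeEdge s.vert s.par k u v ∨
            ((s.par k = u ∧ s.vert k = v) ∨ (s.par k = v ∧ s.vert k = u)) := by
          constructor
          · rintro ⟨i, hi, hh⟩
            rcases Nat.lt_succ_iff_lt_or_eq.mp hi with hi | rfl
            · exact Or.inl ⟨i, hi, hh⟩
            · exact Or.inr hh
          · rintro (⟨i, hi, hh⟩ | hh)
            · exact ⟨i, hi.trans (Nat.lt_succ_self k), hh⟩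
            · exact ⟨k, Nat.lt_succ_self k, hh⟩
        have i0 := ih u hu v hv
        rw [hmin'] at i0
        rw [hmin]
        have e : ((lengthen (.at .par .i) (.at .vert .i) ;;
            lengthen (.at .vert .i) (.at .par .i)).den E s').R .len u v =
            if (s.par k = u ∧ s.vert k = v) ∨ (s.par k = v ∧ s.vert k = u) then
              s'.R .len u v * (1 + 0.1 * (s₁.R .bottle 0 0 / G.w u v)) else s'.R .len u v := by
          have hw := h.w _ hp _ hvk
          have hw' := h.w _ hvk _ hp
          simp only [lengthen, Cmd.den_seq, Cmd.den_setR, RX.eval, NX.eval_at, RX.eval_var,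
            Store.setR_R, Store.setR_N, hs', e_vert, e_par, e_w, e_bottle, reduceCtorEq, false_and,
            if_false, true_and]
          change (if u = s.vert k ∧ v = s.par k then (if s.vert k = s.par k ∧ s.par k = s.vert k
            then _ else s'.R .len (s.vert k) (s.par k)) * (_ + _ *
              (_ / s.R .w (s.vert k) (s.par k))) else if u = s.par k ∧ v = s.vert k then
              s'.R .len (s.par k) (s.vert k) * (_ + _ * (_ / s.R .w (s.par k) (s.vert k)))
              else _) = _
          rw [hw, hw']
          by_cases h1 : u = s.vert k ∧ v = s.par k
          · obtain ⟨rfl, rfl⟩ := h1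
            rw [if_pos ⟨rfl, rfl⟩, if_neg (fun hc => hpv hc.2)]
            norm_num
          · rw [if_neg h1]
            by_cases h2 : u = s.par k ∧ v = s.vert k
            · obtain ⟨rfl, rfl⟩ := h2
              norm_num
            · rw [if_neg h2, if_neg]
              rintro (⟨rfl, rfl⟩ | ⟨rfl, rfl⟩)
              · exact h2 ⟨rfl, rfl⟩
              · exact h1 ⟨rfl, rfl⟩
        rw [e, hsucc, i0]
        by_cases hh : (s.par k = u ∧ s.vert k = v) ∨ (s.par k = v ∧ s.vert k = u)
        · have hno : ¬ TreeEdge s.vert s.par k u v := by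
            rcases hh with ⟨rfl, rfl⟩ | ⟨rfl, rfl⟩
            · exact hfresh
            · exact fun hc => hfresh hc.symm
          rw [if_pos hh, if_neg hno, if_pos (Or.inr hh)]
        · rw [if_neg hh]
          simp only [hh, or_false]
      · rw [Cmd.den_ite_neg _ _ (fun hh => hkm (hcond.mp hh))]
        have : min (k + 1) m = min k m := by omega
        rw [this]
        exact ih u hu v hv)
  have := main u hu v hv
  rwa [show min (Bound.val E .size) m = m from min_eq_right ht.lt.le] at this

/-- A set of fewer than four edges is padded with n - 1, which is at least m and so is not the index
of an edge of the tree. -/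
theorem exists_chosen {n m : ℕ} (hm : m < n) {D : Finset ℕ} (hD : D ⊆ Finset.range m)
    (hcard : D.card ≤ 4) :
    ∃ a < n, ∃ b < n, ∃ c < n, ∃ d < n, ∀ i < m, (Chosen a b c d i ↔ i ∈ D) := by
  set f : ℕ → ℕ := fun k => D.toList.getD k (n - 1) with hf
  have hlen : D.toList.length = D.card := Finset.length_toList D
  have hmem : ∀ k (hk : k < D.toList.length), f k ∈ D := fun k hk => by
    rw [hf]
    simp only [List.getD_eq_getElem _ _ hk]
    exact Finset.mem_toList.mp (List.getElem_mem hk)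
  have hout : ∀ k, ¬ k < D.toList.length → f k = n - 1 := fun k hk =>
    List.getD_eq_default _ _ (not_lt.mp hk)
  have hlt : ∀ k, f k < n := fun k => by
    by_cases hk : k < D.toList.length
    · exact (Finset.mem_range.mp (hD (hmem k hk))).trans hm
    · rw [hout k hk]; omega
  refine ⟨f 0, hlt 0, f 1, hlt 1, f 2, hlt 2, f 3, hlt 3, fun i hi => ⟨fun hc => ?_, fun hiD => ?_⟩⟩
  · have : ∃ k, i = f k := by
      rcases hc with h | h | h | h <;> exact ⟨_, h⟩
    obtain ⟨k, rfl⟩ := this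
    by_cases hk : k < D.toList.length
    · exact hmem k hk
    · rw [hout k hk] at hi
      omega
  · obtain ⟨k, hk, hki⟩ := List.getElem_of_mem (Finset.mem_toList.mpr hiD)
    have hfk : f k = i := by
      rw [hf]
      simp only [List.getD_eq_getElem _ _ hk, hki]
    have hk4 : k < 4 := by omega
    unfold Chosen
    interval_cases k <;> simp [hfk]

/-- The cuts that are considered for one of the trees `vt t`, `pa t`. -/
def Task.Considered (T : Task) (E : Env) (vt pa : ℕ → ℕ → ℕ) (m : ℕ → ℕ) (q : ℕ) (S : Finset ℕ) :
    Prop :=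
  ∃ t < q, ∃ a < E.n, ∃ b < E.n, ∃ c < E.n, ∃ d < E.n,
    T.Follows (vt t) (pa t) (m t) (Chosen a b c d) S

/-- The stores at the successive iterations of the search realise a tree packing. For a tree without
edges the variable `bottle` has no meaning, and the bottleneck is taken to be 0. -/
theorem exists_packing (h : T.Repr E G s)
    (hlen : ∀ u ∈ T.C, ∀ v ∈ T.C, s.R .len u v = (G.w u v)⁻¹) :
    ∃ (ℓ : ℕ → ℕ → ℕ → ℝ) (vt pa : ℕ → ℕ → ℕ) (m : ℕ → ℕ) (c : ℕ → ℝ),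
      G.IsTreePacking T.C T.r ℓ vt pa m c (iterations.val E) ∧ (∀ t, m t < E.n) ∧
      T.Best E G (T.Considered E vt pa m (iterations.val E)) (search.den E s) := by
  classical
  set s₀ := (Cmd.setReal .bestVal (.lit 0)).den E ((Cmd.set .found (.lit 0)).den E s) with hs₀
  set st : ℕ → Store := fun t => iterate ((prim ;; trySides ;; reweight).den E) .iter t s₀ with hst
  have r₀ : T.Repr E G s₀ := (h.den _ (by decide)).den _ (by decide)
  have hr : ∀ t, T.Repr E G (st t) := fun t =>
    r₀.frame (.loop .iter iterations (prim ;; trySides ;; reweight)) (by decide)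
      (fun z hz => by
        simp only [Cmd.writesN, Bool.or_eq_false_iff, decide_eq_false_iff_not] at hz
        exact iterate_N (by simp [Cmd.writesN, hz]) hz.1 t s₀)
      (fun z hz => by
        simp only [Cmd.writesR, Bool.or_eq_false_iff] at hz
        exact iterate_R (by simp [Cmd.writesR, hz]) t s₀)
  choose m hm using fun t => prim_spec (hr t)
  set p : ℕ → Store := fun t => trySides.den E (prim.den E (st t)) with hp
  have hrp : ∀ t, T.Repr E G (p t) := fun t => ((hr t).den _ (by decide)).den _ (by decide)
  have hmp : ∀ t, T.HasTree E G ((st t).R .len) (m t) (p t) := fun t =>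
    (hm t).frame (Cmd.den_N (by decide)) (Cmd.den_N (by decide)) (Cmd.den_N (by decide))
  have hsucc : ∀ t, st (t + 1) = (reweight.den E (p t)).setN .iter 0 0 (t + 1) := fun t => rfl
  have hplen : ∀ t, (p t).R .len = (st t).R .len := fun t => by
    rw [hp, Cmd.den_R (by decide), Cmd.den_R (by decide)]
  have evert : ∀ t, (prim.den E (st t)).vert = (p t).vert := fun t => by
    unfold Store.vert
    rw [hp, Cmd.den_N (P := trySides) (by decide)]
  have epar : ∀ t, (prim.den E (st t)).par = (p t).par := fun t => by
    unfold Store.par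
    rw [hp, Cmd.den_N (P := trySides) (by decide)]
  refine ⟨fun t => (st t).R .len, fun t => (p t).vert, fun t => (p t).par, m,
    fun t => if m t = 0 then 0 else (findBottleneck.den E (p t)).R .bottle 0 0,
    ⟨?_, ?_, ?_, ?_, ?_, ?_⟩, fun t => (hm t).lt, ?_⟩
  · intro u hu v hv
    have : (st 0).R .len = s.R .len := by
      rw [hst]
      simp only [iterate, Store.setN_R]
      rw [hs₀, Cmd.den_R (by decide), Cmd.den_R (by decide)]
    simp only [this]
    exact hlen u hu v hv
  · exact fun t _ => (hmp t).tree
  · intro t _ u hu v hv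
    simp only [hsucc, Store.setN_R]
    rw [reweight_spec (hrp t) (hmp t) (h.lt u hu) (h.lt v hv), hplen]
    by_cases hc : m t = 0
    · rw [if_neg, if_neg] <;>
      · rintro ⟨i, hi, _⟩
        omega
    · rw [if_neg hc]
  · intro t _ i hi
    rw [if_neg (by omega)]
    exact (findBottleneck_spec (hrp t) (hmp t)).1 i hi
  · intro t _ h0
    rw [if_neg (by omega)]
    exact (findBottleneck_spec (hrp t) (hmp t)).2 h0
  · intro t _
    split_ifs with hc
    · exact le_rfl
    · obtain ⟨i, _, hi⟩ := (findBottleneck_spec (hrp t) (hmp t)).2 (by omega)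
      rw [hi]
      exact G.nonneg _ _
  · have key : ∀ q, T.Best E G (T.Considered E (fun t => (p t).vert) (fun t => (p t).par) m q)
        (st q) := by
      intro q
      induction q with
      | zero =>
        refine ⟨fun hf => ?_, ?_⟩
        · have : (st 0).N .found 0 0 = 0 := by
            rw [hst]
            simp [iterate, hs₀]
          omega
        · rintro S ⟨t, ht, _⟩
          omega
      | succ q ih =>
        have hb := trySides_spec ((hr q).den prim (by decide)) (hm q)
          (ih.frame (Cmd.den_N (by decide)) (Cmd.den_N (by decide)) (Cmd.den_R (by decide)))
        have h0 : ∀ z, NVar.iter ≠ z → reweight.writesN z = false →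
            (st (q + 1)).N z = (p q).N z := fun z hz hw => by
          rw [hsucc]
          funext a b
          simp only [Store.setN_N, hz.symm, false_and, if_false]
          rw [Cmd.den_N hw]
        refine (hb.frame (h0 _ (by decide) (by decide)) (h0 _ (by decide) (by decide)) ?_).mono ?_
        · rw [hsucc, Store.setN_R, Cmd.den_R (by decide)]
        · rintro S ⟨t, ht, hS⟩
          rcases Nat.lt_succ_iff_lt_or_eq.mp ht with ht | rfl
          · exact Or.inl ⟨t, ht, hS⟩
          · right
            rw [evert, epar]
            exact hS
    exact key _

theorem inducedBoundary_eq_zero_iff {C U : Finset ℕ} :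
    G.inducedBoundary C U = 0 ↔ ∀ u ∈ U, ∀ v ∈ C, v ∉ U → G.w u v = 0 := by
  unfold inducedBoundary cut
  rw [Finset.sum_eq_zero_iff_of_nonneg fun u _ => Finset.sum_nonneg fun v _ => G.nonneg u v]
  refine forall₂_congr fun u _ => ?_
  rw [Finset.sum_eq_zero_iff_of_nonneg fun v _ => G.nonneg u v]
  simp [Finset.mem_sdiff]

/-- A tree that reaches all vertices meets every nontrivial cut. -/
theorem exists_empty_side {vt pa : ℕ → ℕ} (hT : G.IsPrimTree T.C ℓ T.r vt pa m) {U : Finset ℕ}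
    (hU : U ⊆ T.C) (hne : U.Nonempty) (hne' : U ≠ T.C) (h0 : G.inducedBoundary T.C U = 0) :
    (T.C \ reached T.r vt m).Nonempty := by
  rw [inducedBoundary_eq_zero_iff] at h0
  have hpar : ∀ j ≤ m, ∀ v ∈ reached T.r vt j, (v ∈ U ↔ T.r ∈ U) := by
    intro j
    induction j with
    | zero =>
      intro _ v hv
      have : v = T.r := by simpa [reached] using hv
      rw [this]
    | succ j ih =>
      intro hj v hv
      rw [reached_succ, Finset.mem_insert] at hv
      rcases hv with rfl | hv
      · have h1 := ih (by omega) _ (hT.parent j hj)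
        have h2 := hT.pos j hj
        rw [← h1]
        constructor
        · intro hvU
          by_contra hc
          have := h0 _ hvU _ (hT.parent_mem hj) hc
          rw [G.symm] at this
          exact h2.ne' this
        · intro hpU
          by_contra hc
          exact h2.ne' (h0 _ hpU _ (hT.mem j hj) hc)
      · exact ih (by omega) v hv
  by_contra hc
  rw [Finset.not_nonempty_iff_eq_empty, Finset.sdiff_eq_empty_iff_subset] at hc
  have hall : ∀ v ∈ T.C, (v ∈ U ↔ T.r ∈ U) := fun v hv => hpar m le_rfl v (hc hv)
  obtain ⟨u, hu⟩ := hne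
  have hr := (hall u (hU hu)).mp hu
  exact hne' (Finset.Subset.antisymm hU fun v hv => (hall v hv).mpr hr)

theorem log_le_size {n N : ℕ} (h : n ≤ N) : Real.log n ≤ (N.size : ℝ) := by
  rcases Nat.eq_zero_or_pos n with rfl | hn
  · simp
  have h1 : (n : ℝ) ≤ 2 ^ N.size := by exact_mod_cast h.trans (Nat.lt_size_self N).le
  have h2 := Real.log_le_log (by exact_mod_cast hn) h1
  rw [Real.log_pow] at h2
  have h3 : Real.log 2 ≤ 1 := Real.log_two_lt_d9.le.trans (by norm_num)
  have h4 : (0 : ℝ) ≤ N.size := Nat.cast_nonneg _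
  nlinarith

/-- The search finds a small cut if there is one. Otherwise it finds the smallest eligible cut. -/
theorem search_spec (h : T.Repr E G s) (hL : E.L = E.n.size) (hlam : 0 < E.lam)
    (hlen : ∀ u ∈ T.C, ∀ v ∈ T.C, s.R .len u v = (G.w u v)⁻¹) :
    ∃ 𝒢, T.Best E G 𝒢 (search.den E s) ∧
      ((∃ S, 𝒢 S ∧ T.Eligible G E.eps E.lam S ∧
          G.inducedBoundary T.C S < 49 / 100 * (E.lam / (101 / 100))) ∨
        ((∀ U ⊆ T.C, U.Nonempty → U ≠ T.C →
            49 / 100 * (E.lam / (101 / 100)) ≤ G.inducedBoundary T.C U) ∧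
          ∀ S, T.Eligible G E.eps E.lam S → 𝒢 S)) := by
  obtain ⟨ℓ, vt, pa, m, c, hpack, hm, hbest⟩ := exists_packing h hlen
  refine ⟨_, hbest, ?_⟩
  have hn : 0 < E.n := lt_of_le_of_lt (Nat.zero_le _) (h.lt _ h.root_mem)
  have hCn : T.C.card ≤ E.n := by
    have : T.C ⊆ Finset.range E.n := fun v hv => Finset.mem_range.mpr (h.lt v hv)
    simpa using Finset.card_le_card this
  have hL1 : 1 ≤ E.L := by
    rw [hL]
    exact Nat.size_pos.mpr hn
  have hlogC : Real.log T.C.card ≤ E.L := by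
    rw [hL]
    exact log_le_size hCn
  have hit : iterations.val E = E.n * E.n * (400 * E.L) := rfl
  have hq : 400 * T.C.card ^ 2 * E.L ≤ iterations.val E := by
    rw [hit]
    have : T.C.card ^ 2 ≤ E.n * E.n := by
      rw [sq]
      exact Nat.mul_le_mul hCn hCn
    calc 400 * T.C.card ^ 2 * E.L ≤ 400 * (E.n * E.n) * E.L := by gcongr
      _ = _ := by ring
  have hq0 : 0 < iterations.val E := by
    rw [hit]
    positivity
  have hsmall : ∀ S, S ⊆ T.C → T.r ∉ S → S.Nonempty →
      G.inducedBoundary T.C S < 49 / 100 * (E.lam / (101 / 100)) → T.Eligible G E.eps E.lam S :=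
    fun S h1 h2 h3 h4 => ⟨h1, h2, h3, Or.inl h4⟩
  -- The program does not know κ: any lower bound for the cuts of G[C] may be chosen in the
  -- analysis.
  have hcons : ∀ κ, 0 < κ → (∀ U ⊆ T.C, U.Nonempty → U ≠ T.C → κ ≤ G.inducedBoundary T.C U) →
      ∀ S ⊆ T.C, T.r ∉ S → G.inducedBoundary T.C S ≤ 2.103 * κ →
        T.Considered E vt pa m (iterations.val E) S := by
    intro κ hκ0 hκ S hS hrS hx
    obtain ⟨t, ht, hcard⟩ := hpack.exists_crossing_le h.root_mem hκ hκ0 hlogC hL1 hq hS hx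
    have hT := hpack.tree t ht
    obtain ⟨a, ha, b, hb, c', hc, d, hd, hch⟩ := exists_chosen (hm t) (Finset.filter_subset _ _) hcard
    refine ⟨t, ht, a, ha, b, hb, c', hc, d, hd, hS, hrS, fun i hi => ?_, fun v hv hvr => ?_⟩
    · rw [hch i hi, Finset.mem_filter, Finset.mem_range]
      simp [hi]
    · rw [hT.reached_eq fun U h1 h2 h3 => hκ0.trans_le (hκ U h1 h2 h3)] at hvr
      exact absurd hv hvr
  by_cases hex : ∃ U ⊆ T.C, U.Nonempty ∧ U ≠ T.C ∧
      G.inducedBoundary T.C U < 49 / 100 * (E.lam / (101 / 100))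
  · left
    -- Here κ is the minimum cut of G[C]; a minimum cut has weight 1 · κ and is therefore
    -- considered.
    set 𝒰 := T.C.powerset.filter fun U => U.Nonempty ∧ U ≠ T.C with h𝒰
    obtain ⟨U₁, hU₁, hne₁, hnC₁, hlt₁⟩ := hex
    obtain ⟨U, hU, hmin⟩ := 𝒰.exists_min_image (fun U => G.inducedBoundary T.C U)
      ⟨U₁, by simp [h𝒰, hU₁, hne₁, hnC₁]⟩
    simp only [h𝒰, Finset.mem_filter, Finset.mem_powerset] at hU hmin
    obtain ⟨hUC, hUne, hUnC⟩ := hU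
    have hlt := (hmin U₁ ⟨hU₁, hne₁, hnC₁⟩).trans_lt hlt₁
    rcases (G.inducedBoundary_nonneg T.C U).eq_or_lt with h0 | hpos
    -- If G[C] is disconnected, the first tree does not span C, and the vertices that it misses form
    -- a cut of weight zero. It is considered with no edge chosen; this is why unreached vertices
    -- are put on the side S.
    · have hT := hpack.tree 0 hq0
      have hne := exists_empty_side hT hUC hUne hUnC h0.symm
      have hzero : G.inducedBoundary T.C (T.C \ reached T.r (vt 0) (m 0)) = 0 := by
        rw [G.inducedBoundary_sdiff (hT.reached_subset le_rfl), inducedBoundary_eq_zero_iff]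
        exact hT.maximal
      have hroot : T.r ∉ T.C \ reached T.r (vt 0) (m 0) := fun hc =>
        (Finset.mem_sdiff.mp hc).2 (Finset.mem_insert_self _ _)
      have hlt0 : G.inducedBoundary T.C (T.C \ reached T.r (vt 0) (m 0)) <
          49 / 100 * (E.lam / (101 / 100)) := by
        rw [hzero]
        positivity
      refine ⟨_, ?_, hsmall _ Finset.sdiff_subset hroot hne hlt0, hlt0⟩
      have hn1 : E.n - 1 < E.n := by omega
      refine ⟨0, hq0, E.n - 1, hn1, E.n - 1, hn1, E.n - 1, hn1, E.n - 1, hn1,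
        Finset.sdiff_subset, hroot, fun i hi => ?_, fun v hv hvr => Finset.mem_sdiff.mpr ⟨hv, hvr⟩⟩
      have hmn := hm 0
      have h1 : pa 0 i ∉ T.C \ reached T.r (vt 0) (m 0) := fun hc =>
        (Finset.mem_sdiff.mp hc).2 (reached_mono _ _ hi.le (hT.parent i hi))
      have h2 : vt 0 i ∉ T.C \ reached T.r (vt 0) (m 0) := fun hc =>
        (Finset.mem_sdiff.mp hc).2 (mem_reached_of_lt _ _ hi)
      have h3 : ¬ Chosen (E.n - 1) (E.n - 1) (E.n - 1) (E.n - 1) i := by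
        unfold Chosen
        omega
      tauto
    · have hκ : ∀ W ⊆ T.C, W.Nonempty → W ≠ T.C →
          G.inducedBoundary T.C U ≤ G.inducedBoundary T.C W := fun W h1 h2 h3 => hmin W ⟨h1, h2, h3⟩
      obtain ⟨S, hS, hrS, hSne, hSx⟩ : ∃ S ⊆ T.C, T.r ∉ S ∧ S.Nonempty ∧
          G.inducedBoundary T.C S = G.inducedBoundary T.C U := by
        by_cases hr : T.r ∈ U
        · refine ⟨T.C \ U, Finset.sdiff_subset, fun hc => (Finset.mem_sdiff.mp hc).2 hr, ?_,
            G.inducedBoundary_sdiff hUC⟩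
          rw [Finset.sdiff_nonempty]
          exact fun hc => hUnC (Finset.Subset.antisymm hUC hc)
        · exact ⟨U, hUC, hr, hUne, rfl⟩
      refine ⟨S, hcons _ hpos hκ S hS hrS (by rw [hSx]; linarith), hsmall S hS hrS hSne ?_, ?_⟩ <;>
      · rw [hSx]
        exact hlt
  · right
    push Not at hex
    refine ⟨fun U h1 h2 h3 => hex U h1 h2 h3, fun S hS => ?_⟩
    -- Now κ = 0.49 l, and 2.103 · 0.49 > 1.03 > 1.01²: every eligible cut is within the range of
    -- the packing.
    refine hcons _ (by positivity) (fun U h1 h2 h3 => hex U h1 h2 h3) S hS.1 hS.2.1 ?_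
    obtain ⟨_, _, _, h4 | ⟨_, h4, _⟩ | ⟨_, h4, _⟩⟩ := hS
    · linarith
    · have : E.lam = 101 / 100 * (E.lam / (101 / 100)) := by ring
      linarith
    · linarith

end Search

end ArrayLang


namespace ArrayLang

open WeightedGraph

/-! ### Specifications of the other subprograms -/

section Round

variable {E : Env} {G : WeightedGraph ℕ} {s : Store}

/-- The vertices with the label `p`. -/
def Store.piece (E : Env) (s : Store) (p : ℕ) : Finset ℕ :=
  (Finset.range E.n).filter fun v => s.N .piece v 0 = p

/-- The weight of the edges from `v` to vertices outside of `C`. -/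
def outerWeight (E : Env) (G : WeightedGraph ℕ) (C : Finset ℕ) (v : ℕ) : ℝ :=
  E.lp v + ∑ u ∈ Finset.range E.n \ C, G.w v u

/-- The cuts that have been stored for the piece `p` in the first `k` rounds. -/
def Store.storedCuts (E : Env) (s : Store) (k p : ℕ) : Finset (Finset ℕ) :=
  ((Finset.range k).filter fun i => s.N .owner i 0 = p).image fun i =>
    (s.piece E p).filter fun v => s.N .stored i v = 1

def Store.task (E : Env) (G : WeightedGraph ℕ) (s : Store) (k p : ℕ) : Task where
  C := s.piece E p
  r := p
  b := outerWeight E G (s.piece E p)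
  atom := fun v => s.N .atom v 0
  stored := {S | S ∈ s.storedCuts E k p}

theorem Store.mem_piece {p v : ℕ} : v ∈ s.piece E p ↔ v < E.n ∧ s.N .piece v 0 = p := by
  simp [Store.piece]

theorem findRoot_spec (E : Env) (s : Store) :
    ((findRoot.den E s).N .root 0 0 < E.n ∧
      s.N .piece ((findRoot.den E s).N .root 0 0) 0 = (findRoot.den E s).N .root 0 0 ∧
      s.N .done ((findRoot.den E s).N .root 0 0) 0 = 0) ∨
    ((findRoot.den E s).N .root 0 0 = E.n ∧
      ∀ p < E.n, s.N .piece p 0 = p → s.N .done p 0 ≠ 0) := by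
  have := den_firstLoop (E := E) (y := .root) (k := .u)
    (p := .and (.eq (.at .piece .u) (.var .u)) (.eq (.at .done .u) (.lit 0))) (s := s)
    (p' := fun j => s.N .piece j 0 = j ∧ s.N .done j 0 = 0) (by decide) (by
      intro j hj s' hs' hN hR
      simp [hs', hN .piece (by decide), hN .done (by decide)])
  rcases this with ⟨h1, h2, _⟩ | ⟨h1, h2⟩
  · exact Or.inl ⟨h1, h2⟩
  · exact Or.inr ⟨h1, fun p hp h3 h4 => h2 p hp ⟨h3, h4⟩⟩

/-- The store describes a graph with loops. -/
structure Store.HasGraph (E : Env) (G : WeightedGraph ℕ) (s : Store) : Prop where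
  w : ∀ u < E.n, ∀ v < E.n, s.R .w u v = G.w u v
  loop : ∀ v < E.n, s.R .loop v 0 = E.lp v

theorem Store.HasGraph.frame {s' : Store} (h : s.HasGraph E G) (hw : s'.R .w = s.R .w)
    (hl : s'.R .loop = s.R .loop) : s'.HasGraph E G :=
  ⟨by rw [hw]; exact h.w, by rw [hl]; exact h.loop⟩

theorem masses_spec (h : s.HasGraph E G) :
    (∀ v < E.n, (masses.den E s).R .mass v 0 =
      outerWeight E G (s.piece E (s.N .root 0 0)) v) ∧
    (masses.den E s).R .total 0 0 = ∑ v ∈ s.piece E (s.N .root 0 0),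
      outerWeight E G (s.piece E (s.N .root 0 0)) v := by
  set C := s.piece E (s.N .root 0 0) with hC
  set P := Cmd.loop .v .size
      (sumLoop .acc .u .skip (.not (inPiece .u)) (.at₂ .w .v .u) ;;
        .setR .mass (.var .v) (.lit 0) (.add (.at .loop .v) (.var .acc))) with hP
  have key : ∀ v < E.n, (P.den E s).R .mass v 0 = outerWeight E G C v := by
    refine loop_induct (E := E) (m := .size)
      (I := fun k s' => ∀ v < k, s'.R .mass v 0 = outerWeight E G C v) (by omega) ?_
    intro k hk s' hs' hN hR ih v hv
    have hk : k < E.n := hk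
    set s₁ := (sumLoop .acc .u .skip (.not (inPiece .u)) (.at₂ .w .v .u)).den E s' with hs₁
    have e1 : s₁.R .acc 0 0 = ∑ u ∈ Finset.range E.n \ C, G.w k u := by
      rw [hs₁, den_sumLoop (p' := fun u => u ∈ Finset.range E.n \ C) (f := fun u => G.w k u) rfl ?_,
        sum_range_ite (p := fun u => u ∈ Finset.range E.n \ C)
          (fun v hv => Finset.mem_range.mp (Finset.mem_sdiff.mp hv).1) _ (fun _ _ => Iff.rfl)]
      intro u hu s'' hs'' hN' hR'
      refine ⟨?_, ?_⟩
      · simp [inPiece, hs'', hN' .piece (by decide), hN .piece (by decide), hN' .root (by decide),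
          hN .root (by decide), hC, Store.mem_piece, hu]
      · simp only [Cmd.den_skip, RX.eval_at₂, hs'', hN' .v (by decide), hs', hR' .w (by decide),
          hR .w (by decide), h.w k hk u hu]
    have e2 : s₁.N .v = s'.N .v := Cmd.den_N (by decide)
    have e3 : s₁.R .loop = s.R .loop := by rw [hs₁, Cmd.den_R (by decide), hR _ (by decide)]
    have e4 : s₁.R .mass = s'.R .mass := Cmd.den_R (by decide)
    rw [Cmd.den_seq, ← hs₁]
    rcases Nat.lt_succ_iff_lt_or_eq.mp hv with hv | rfl
    · simpa [e2, hs', hv.ne, e4] using ih v hv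
    · simp [e2, hs', e1, e3, outerWeight, h.loop v hk]
  have e5 : (masses.den E s).R .mass = (P.den E s).R .mass := Cmd.den_R (s := P.den E s) (by decide)
  refine ⟨by rw [e5]; exact key, ?_⟩
  have e6 : (P.den E s).N .piece = s.N .piece := Cmd.den_N (by decide)
  have e7 : (P.den E s).N .root = s.N .root := Cmd.den_N (by decide)
  change ((sumLoop .total .v .skip (inPiece .v) (.at .mass .v)).den E (P.den E s)).R _ _ _ = _
  rw [den_sumLoop (p' := fun u => u ∈ C) (f := fun u => (P.den E s).R .mass u 0) rfl ?_,
    sum_range_ite (p := fun u => u ∈ C) (fun v hv => (Store.mem_piece.mp hv).1) _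
      (fun _ _ => Iff.rfl)]
  · exact Finset.sum_congr rfl fun v hv => key v (Store.mem_piece.mp hv).1
  · intro v hv s' hs' hN hR
    refine ⟨?_, ?_⟩
    · simp [inPiece, hs', hN .piece (by decide), e6, hN .root (by decide), e7, hC, Store.mem_piece, hv]
    · simp [hs', hR .mass (by decide)]

theorem initLengths_spec (h : s.HasGraph E G) :
    ∀ u < E.n, ∀ v < E.n, (initLengths.den E s).R .len u v = (G.w u v)⁻¹ := by
  refine loop_induct (E := E) (m := .size)
    (I := fun k s' => ∀ u < k, ∀ v < E.n, s'.R .len u v = (G.w u v)⁻¹) (by omega) ?_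
  intro k hk s₁ hs₁ hN₁ hR₁ ih
  have hk : k < E.n := hk
  have key := loop_induct (E := E) (m := .size) (y := .v) (s := s₁)
    (P := .setR .len (.var .u) (.var .v) (.div (.lit 1) (.at₂ .w .u .v)))
    (fun j s' => (∀ u < k, ∀ v < E.n, s'.R .len u v = (G.w u v)⁻¹) ∧
      ∀ v < j, s'.R .len k v = (G.w k v)⁻¹) ⟨by simpa using ih, by omega⟩ (by
      rintro j hj s' hs' hN hR ⟨i1, i2⟩
      have hj : j < E.n := hj
      have e1 : s'.N .u 0 0 = k := by rw [hN _ (by decide), hs₁]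
      have e2 : s'.R .w k j = G.w k j := by rw [hR _ (by decide), hR₁ _ (by decide), h.w k hk j hj]
      refine ⟨fun u hu v hv => ?_, fun v hv => ?_⟩
      · simpa [e1, hs', hu.ne] using i1 u hu v hv
      · rcases Nat.lt_succ_iff_lt_or_eq.mp hv with hv | rfl
        · simpa [e1, hs', hv.ne] using i2 v hv
        · simp [e1, hs', e2])
  intro u hu v hv
  rcases Nat.lt_succ_iff_lt_or_eq.mp hu with hu | rfl
  · simpa using key.1 u hu v hv
  · simpa using key.2 v hv

/-- The new label of a vertex is the first vertex with the same old label on the same side of the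
best cut. -/
theorem refine_spec {y : NVar} (hy : y = .piece ∨ y = .atom) :
    ∀ u < E.n, ((refine y).den E s).N y u 0 ≤ u ∧
      s.N y (((refine y).den E s).N y u 0) 0 = s.N y u 0 ∧
      s.N .best (((refine y).den E s).N y u 0) 0 = s.N .best u 0 ∧
      ∀ j < ((refine y).den E s).N y u 0,
        ¬ (s.N y j 0 = s.N y u 0 ∧ s.N .best j 0 = s.N .best u 0) := by
  set Φ : ℕ → ℕ → Prop := fun u x => x ≤ u ∧ s.N y x 0 = s.N y u 0 ∧
    s.N .best x 0 = s.N .best u 0 ∧ ∀ j < x, ¬ (s.N y j 0 = s.N y u 0 ∧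
      s.N .best j 0 = s.N .best u 0) with hΦ
  set P := Cmd.loop .u .size (firstLoop .flag .v (.and (.eq (.at y .v) (.at y .u))
      (.eq (.at .best .v) (.at .best .u))) ;; .setAt .tmp .u (.var .flag)) with hP
  have hwr : ∀ z : NVar, z = .piece ∨ z = .atom ∨ z = .best → P.writesN z = false := by
    rintro z (rfl | rfl | rfl) <;> rfl
  have key : ∀ u < E.n, Φ u ((P.den E s).N .tmp u 0) := by
    refine loop_induct (E := E) (m := .size) (I := fun k s' => ∀ u < k, Φ u (s'.N .tmp u 0))
      (by omega) ?_
    intro k hk s' hs' hN hR ih u hu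
    have hk : k < E.n := hk
    set Q := firstLoop .flag .v (.and (.eq (.at y .v) (.at y .u))
      (.eq (.at .best .v) (.at .best .u))) with hQ
    have e1 : (Q.den E s').N .tmp = s'.N .tmp := Cmd.den_N rfl
    have e2 : (Q.den E s').N .u = s'.N .u := Cmd.den_N rfl
    have hy' : P.writesN y = false := hwr y (by tauto)
    have e3 : Φ k ((Q.den E s').N .flag 0 0) := by
      have := den_firstLoop (E := E) (y := .flag) (k := .v) (s := s')
        (p := .and (.eq (.at y .v) (.at y .u)) (.eq (.at .best .v) (.at .best .u)))
        (p' := fun j => s.N y j 0 = s.N y k 0 ∧ s.N .best j 0 = s.N .best k 0) (by decide) (by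
          intro j hj s'' hs'' hN' hR'
          have h1 : s''.N y = s.N y := by
            rw [hN' _ (by rcases hy with rfl | rfl <;> rfl), hN _ hy']
          have h2 : s''.N .best = s.N .best := by rw [hN' _ rfl, hN _ (hwr _ (by tauto))]
          simp [hs'', h1, h2, hN' .u rfl, hs'])
      rcases this with ⟨h1, h2, h3⟩ | ⟨_, h2⟩
      · refine ⟨?_, h2.1, h2.2, h3⟩
        by_contra hc
        exact h3 k (not_le.mp hc) ⟨rfl, rfl⟩
      · exact absurd ⟨rfl, rfl⟩ (h2 k hk)
    rw [Cmd.den_seq]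
    rcases Nat.lt_succ_iff_lt_or_eq.mp hu with hu | rfl
    · simpa [e1, e2, hs', hu.ne] using ih u hu
    · simpa [e1, e2, hs'] using e3
  have fin : ∀ u < E.n, ((refine y).den E s).N y u 0 = (P.den E s).N .tmp u 0 := by
    refine loop_induct (E := E) (m := .size) (s := P.den E s)
      (I := fun k s' => ∀ u < k, s'.N y u 0 = (P.den E s).N .tmp u 0) (by omega) ?_
    intro k hk s' hs' hN hR ih u hu
    have hyu : y ≠ .u := by rcases hy with rfl | rfl <;> decide
    have ht : s'.N .tmp = (P.den E s).N .tmp := hN _ (by rcases hy with rfl | rfl <;> rfl)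
    rcases Nat.lt_succ_iff_lt_or_eq.mp hu with hu | rfl
    · simpa [hyu, hs', hu.ne] using ih u hu
    · simp [hyu, hs', ht]
  intro u hu
  rw [fin u hu]
  exact key u hu

theorem refine_eq_iff {y : NVar} (hy : y = .piece ∨ y = .atom) {u v : ℕ} (hu : u < E.n)
    (hv : v < E.n) : ((refine y).den E s).N y u 0 = ((refine y).den E s).N y v 0 ↔
      s.N y u 0 = s.N y v 0 ∧ s.N .best u 0 = s.N .best v 0 := by
  obtain ⟨_, a2, a3, a4⟩ := refine_spec (E := E) (s := s) hy u hu
  obtain ⟨_, b2, b3, b4⟩ := refine_spec (E := E) (s := s) hy v hv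
  constructor
  · intro h
    rw [h] at a2 a3
    exact ⟨a2.symm.trans b2, a3.symm.trans b3⟩
  · rintro ⟨h1, h2⟩
    rw [← h1] at b2 b4
    rw [← h2] at b3 b4
    rcases lt_trichotomy (((refine y).den E s).N y u 0) (((refine y).den E s).N y v 0) with h | h | h
    · exact absurd ⟨a2, a3⟩ (b4 _ h)
    · exact h
    · exact absurd ⟨b2, b3⟩ (a4 _ h)

theorem storeBest_spec (E : Env) (s : Store) {k : ℕ} (hk : s.N .round 0 0 = k) :
    (storeBest.den E s).N .owner k 0 = s.N .root 0 0 ∧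
    (∀ i, i ≠ k → (storeBest.den E s).N .owner i 0 = s.N .owner i 0) ∧
    (∀ v < E.n, (storeBest.den E s).N .stored k v = s.N .best v 0) ∧
    ∀ i, i ≠ k → ∀ v, (storeBest.den E s).N .stored i v = s.N .stored i v := by
  set s₁ := (Cmd.setAt .owner .round (.var .root)).den E s with hs₁
  have e1 : (storeBest.den E s).N .owner = s₁.N .owner := Cmd.den_N (s := s₁) (by decide)
  have key := loop_induct (E := E) (m := .size) (y := .v) (s := s₁)
    (P := .setN .stored (.var .round) (.var .v) (.at .best .v))
    (fun j s' => (∀ v < j, s'.N .stored k v = s.N .best v 0) ∧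
      ∀ i, i ≠ k → ∀ v, s'.N .stored i v = s.N .stored i v)
    ⟨by omega, fun i hi v => by simp [hs₁]⟩ (by
      rintro j hj s' hs' hN hR ⟨i1, i2⟩
      have e2 : s'.N .round 0 0 = k := by rw [hN _ (by decide), hs₁]; simp [hk]
      have e3 : s'.N .best = s.N .best := by rw [hN _ (by decide), hs₁, Cmd.den_N (by decide)]
      refine ⟨fun v hv => ?_, fun i hi v => ?_⟩
      · rcases Nat.lt_succ_iff_lt_or_eq.mp hv with hv | rfl
        · simpa [e2, hs', hv.ne] using i1 v hv
        · simp [e2, hs', e3]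
      · simpa [e2, hi] using i2 i hi v)
  refine ⟨?_, fun i hi => ?_, key.1, key.2⟩
  · rw [e1, hs₁]
    simp [hk]
  · rw [e1, hs₁]
    simp [hk, hi]

/-- Both vertices belong to the same atom and are joined by an edge. -/
def AtomEdge (E : Env) (G : WeightedGraph ℕ) (s : Store) (x y : ℕ) : Prop :=
  x < E.n ∧ y < E.n ∧ s.N .atom x 0 = s.N .atom y 0 ∧ 0 < G.w x y

/-- Two assertions are maintained: the ends of the edges processed so far have equal labels, and
equal labels imply connectedness within the atom. As a whole class is renamed at once, edges
processed earlier stay satisfied. -/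
theorem components_spec (h : s.HasGraph E G) :
    (∀ u < E.n, ∀ v < E.n, s.N .atom u 0 = s.N .atom v 0 → 0 < G.w u v →
      (components.den E s).N .comp u 0 = (components.den E s).N .comp v 0) ∧
    ∀ u < E.n, ∀ v < E.n, (components.den E s).N .comp u 0 = (components.den E s).N .comp v 0 →
      Relation.EqvGen (AtomEdge E G s) u v := by
  set I : (ℕ → ℕ → Prop) → Store → Prop := fun D s' =>
    (∀ u v, D u v → AtomEdge E G s u v → s'.N .comp u 0 = s'.N .comp v 0) ∧
    ∀ u < E.n, ∀ v < E.n, s'.N .comp u 0 = s'.N .comp v 0 → Relation.EqvGen (AtomEdge E G s) u v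
    with hI
  set s₀ := (Cmd.loop .u .size (.setAt .comp .u (.var .u))).den E s with hs₀
  set B : Cmd := .set .fu (.at .comp .u) ;; .set .fv (.at .comp .v) ;;
    .loop .x .size (.ite (.eq (.at .comp .x) (.var .fu)) (.setAt .comp .x (.var .fv)) .skip) with hB
  have hbody : ∀ s' : Store, ∀ x < E.n, (B.den E s').N .comp x 0 =
      if s'.N .comp x 0 = s'.N .comp (s'.N .u 0 0) 0 then s'.N .comp (s'.N .v 0 0) 0
      else s'.N .comp x 0 := by
    intro s' x hx
    set s₂ := (Cmd.set .fv (.at .comp .v)).den E ((Cmd.set .fu (.at .comp .u)).den E s') with hs₂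
    have f1 : s₂.N .fu 0 0 = s'.N .comp (s'.N .u 0 0) 0 := by simp [hs₂]
    have f2 : s₂.N .fv 0 0 = s'.N .comp (s'.N .v 0 0) 0 := by simp [hs₂]
    have f3 : ∀ x, s₂.N .comp x 0 = s'.N .comp x 0 := by simp [hs₂]
    have := loop_induct (E := E) (m := .size) (y := .x) (s := s₂)
      (P := .ite (.eq (.at .comp .x) (.var .fu)) (.setAt .comp .x (.var .fv)) .skip)
      (fun j s₃ => ∀ x, s₃.N .comp x 0 = if x < j ∧ s'.N .comp x 0 = s'.N .comp (s'.N .u 0 0) 0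
        then s'.N .comp (s'.N .v 0 0) 0 else s'.N .comp x 0) (by simpa using f3) (by
        intro j hj s₃ hs₃ hN hR ih x
        have g1 : s₃.N .fu 0 0 = s'.N .comp (s'.N .u 0 0) 0 := by rw [hN _ (by decide), f1]
        have g2 : s₃.N .fv 0 0 = s'.N .comp (s'.N .v 0 0) 0 := by rw [hN _ (by decide), f2]
        have g3 : s₃.N .comp j 0 = s'.N .comp j 0 := by rw [ih]; simp
        have ht : TX.holds E s₃ (.eq (.at .comp .x) (.var .fu)) ↔
            s'.N .comp j 0 = s'.N .comp (s'.N .u 0 0) 0 := by simp [hs₃, g1, g3]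
        by_cases hc : s'.N .comp j 0 = s'.N .comp (s'.N .u 0 0) 0
        · rw [Cmd.den_ite_pos _ _ (ht.mpr hc)]
          by_cases hxj : x = j
          · subst hxj
            simp [hs₃, g2, hc]
          · have h1 : x < j + 1 ↔ x < j := by omega
            simp [hs₃, hxj, ih, h1]
        · rw [Cmd.den_ite_neg _ _ (fun hh => hc (ht.mp hh))]
          by_cases hxj : x = j
          · subst hxj
            simp [ih, hc]
          · have h1 : x < j + 1 ↔ x < j := by omega
            simp [ih, h1])
    have := this x
    simp only [Bound.val, hx, true_and] at this
    exact this
  have hstep : ∀ (s' : Store) (u v : ℕ) (D D' : ℕ → ℕ → Prop), s'.HasGraph E G →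
      s'.N .atom = s.N .atom → u < E.n → v < E.n → s'.N .u 0 0 = u → s'.N .v 0 0 = v →
      (∀ x y, D' x y ↔ D x y ∨ (x = u ∧ y = v)) → I D s' →
      I D' ((Cmd.den E (.ite (.and (.eq (.at .atom .u) (.at .atom .v)) (.rlt (.lit 0)
        (.at₂ .w .u .v))) B .skip) s').setN .v 0 0 (v + 1)) := by
    intro s' u v D D' hg hatom hu hv hsu hsv hD hi
    have hset : ∀ s₁ : Store, I D' s₁ → I D' (s₁.setN .v 0 0 (v + 1)) := by
      intro s₁ h1
      simpa [hI] using h1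
    apply hset
    have ht : TX.holds E s' (.and (.eq (.at .atom .u) (.at .atom .v)) (.rlt (.lit 0)
        (.at₂ .w .u .v))) ↔ AtomEdge E G s u v := by
      simp [hsu, hsv, hatom, AtomEdge, hu, hv, hg.w u hu v hv]
    by_cases hc : AtomEdge E G s u v
    · rw [Cmd.den_ite_pos _ _ (ht.mpr hc)]
      have hb := hbody s'
      rw [hsu, hsv] at hb
      refine ⟨fun x y hxy he => ?_, fun x hx y hy hxy => ?_⟩
      · rw [hb x he.1, hb y he.2.1]
        rcases (hD x y).mp hxy with hd | ⟨rfl, rfl⟩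
        · rw [hi.1 x y hd he]
        · simp
      · rw [hb x hx, hb y hy] at hxy
        have huv := Relation.EqvGen.rel _ _ hc
        split_ifs at hxy with h1 h2 h2
        · exact hi.2 x hx y hy (h1.trans h2.symm)
        · exact ((hi.2 x hx u hu h1).trans _ _ _ huv).trans _ _ _ (hi.2 v hv y hy hxy)
        · exact ((hi.2 x hx v hv hxy).trans _ _ _ (huv.symm _ _)).trans _ _ _ (hi.2 u hu y hy h2.symm)
        · exact hi.2 x hx y hy hxy
    · rw [Cmd.den_ite_neg _ _ (fun hh => hc (ht.mp hh))]
      refine ⟨fun x y hxy he => ?_, hi.2⟩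
      rcases (hD x y).mp hxy with hd | ⟨rfl, rfl⟩
      · exact hi.1 x y hd he
      · exact absurd he hc
  have h0 : ∀ u < E.n, s₀.N .comp u 0 = u := by
    refine loop_induct (E := E) (m := .size) (I := fun k s' => ∀ u < k, s'.N .comp u 0 = u)
      (by omega) ?_
    intro k hk s' hs' _ _ ih u hu
    rcases Nat.lt_succ_iff_lt_or_eq.mp hu with hu | rfl
    · simpa [hs', hu.ne] using ih u hu
    · simp [hs']
  have hg₀ : s₀.HasGraph E G := h.frame (Cmd.den_R (by decide)) (Cmd.den_R (by decide))
  have hatom₀ : s₀.N .atom = s.N .atom := Cmd.den_N (by decide)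
  have main := loop_induct (E := E) (m := .size) (y := .u) (s := s₀)
    (P := .loop .v .size (.ite (.and (.eq (.at .atom .u) (.at .atom .v)) (.rlt (.lit 0)
        (.at₂ .w .u .v))) B .skip))
    (fun k s' => I (fun u v => u < k ∧ v < E.n) s') ⟨by omega, fun u hu v hv huv => by
      simp only [Store.setN_N, reduceCtorEq, false_and, if_false, h0 u hu, h0 v hv] at huv
      rw [huv]
      exact Relation.EqvGen.refl _⟩ (by
      intro k hk s₁ hs₁ hN₁ hR₁ ih
      have hk : k < E.n := hk
      have hg₁ : s₁.HasGraph E G := hg₀.frame (hR₁ _ (by decide)) (hR₁ _ (by decide))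
      have key := loop_induct (E := E) (m := .size) (y := .v) (s := s₁)
        (P := .ite (.and (.eq (.at .atom .u) (.at .atom .v)) (.rlt (.lit 0)
          (.at₂ .w .u .v))) B .skip)
        (fun j s' => I (fun u v => (u < k ∧ v < E.n) ∨ (u = k ∧ v < j)) s')
        (by
          have : (fun u v => (u < k ∧ v < E.n) ∨ (u = k ∧ v < 0)) = fun u v => u < k ∧ v < E.n := by
            funext u v
            simp
          rw [this]
          simpa [hI] using ih)
        (by
          intro j hj s' hs' hN hR ih'
          refine hstep s' k j _ _ (hg₁.frame (hR _ (by decide)) (hR _ (by decide))) ?_ hk hj ?_ hs' ?_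
            ih'
          · rw [hN _ (by decide), hN₁ _ (by decide), hatom₀]
          · rw [hN _ (by decide), hs₁]
          · intro x y
            rw [Nat.lt_succ_iff_lt_or_eq]
            tauto)
      have e : (fun u v => (u < k ∧ v < E.n) ∨ (u = k ∧ v < E.n)) =
          fun u v => u < k + 1 ∧ v < E.n := by
        funext u v
        rw [Nat.lt_succ_iff_lt_or_eq]
        exact propext (by tauto)
      simp only [Bound.val] at key
      rw [e] at key
      simpa [hI] using key)
  exact ⟨fun u hu v hv ha hw => main.1 u v ⟨hu, hv⟩ ⟨hu, hv, ha, hw⟩, main.2⟩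

theorem initCmd_spec (hG : ∀ u < E.n, ∀ v < E.n, E.w u v = G.w u v) :
    (initCmd.den E ⟨fun _ _ _ => 0, fun _ _ _ => 0⟩).HasGraph E G ∧
    ∀ y : NVar, y = .piece ∨ y = .atom ∨ y = .done →
      ∀ v, (initCmd.den E ⟨fun _ _ _ => 0, fun _ _ _ => 0⟩).N y v 0 = 0 := by
  have main := loop_induct (E := E) (m := .size) (y := .u)
    (s := ⟨fun _ _ _ => 0, fun _ _ _ => 0⟩)
    (P := .loop .v .size (.loadW .w (.var .u) (.var .v)) ;;
      .loadLoop .loop (.var .u) ;; .setAt .piece .u (.lit 0) ;; .setAt .atom .u (.lit 0) ;;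
      .setAt .done .u (.lit 0))
    (fun k s' => (∀ u < k, ∀ v < E.n, s'.R .w u v = G.w u v) ∧ (∀ u < k, s'.R .loop u 0 = E.lp u) ∧
      ∀ y : NVar, y = .piece ∨ y = .atom ∨ y = .done → ∀ v, s'.N y v 0 = 0)
    ⟨by omega, by omega, by rintro y (rfl | rfl | rfl) v <;> simp⟩ (by
      rintro k hk s₁ hs₁ hN₁ hR₁ ⟨i1, i2, i3⟩
      have hk : k < E.n := hk
      set s₂ := (Cmd.loop .v .size (.loadW .w (.var .u) (.var .v))).den E s₁ with hs₂
      have e1 : s₂.N .u 0 0 = k := by rw [hs₂, Cmd.den_N (by decide), hs₁]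
      have e2 : s₂.R .loop = s₁.R .loop := Cmd.den_R (by decide)
      have e3 : ∀ y : NVar, y = .piece ∨ y = .atom ∨ y = .done → s₂.N y = s₁.N y := by
        rintro y (rfl | rfl | rfl) <;> exact Cmd.den_N rfl
      have key : (∀ u < k, ∀ v < E.n, s₂.R .w u v = G.w u v) ∧ ∀ v < E.n, s₂.R .w k v = G.w k v :=
        loop_induct (E := E) (m := .size) (y := .v) (s := s₁) (P := .loadW .w (.var .u) (.var .v))
          (fun j s' => (∀ u < k, ∀ v < E.n, s'.R .w u v = G.w u v) ∧
            ∀ v < j, s'.R .w k v = G.w k v) ⟨i1, by omega⟩ (by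
            rintro j hj s' hs' hN hR ⟨j1, j2⟩
            have hj : j < E.n := hj
            have e4 : s'.N .u 0 0 = k := by rw [hN _ (by decide), hs₁]
            refine ⟨fun u hu v hv => ?_, fun v hv => ?_⟩
            · simpa [e4, hs', hu.ne] using j1 u hu v hv
            · rcases Nat.lt_succ_iff_lt_or_eq.mp hv with hv | rfl
              · simpa [e4, hs', hv.ne] using j2 v hv
              · simp [e4, hs', hG k hk v hj])
      refine ⟨fun u hu v hv => ?_, fun u hu => ?_, fun y hy v => ?_⟩
      · rcases Nat.lt_succ_iff_lt_or_eq.mp hu with hu | rfl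
        · simpa using key.1 u hu v hv
        · simpa using key.2 v hv
      · rcases Nat.lt_succ_iff_lt_or_eq.mp hu with hu | rfl
        · simpa [← hs₂, e1, e2, hu.ne] using i2 u hu
        · simp [← hs₂, e1]
      · have h1 := i3 y hy v
        have h2 := e3 y hy
        rcases hy with rfl | rfl | rfl <;> simp [← hs₂, h2, h1])
  exact ⟨⟨main.1, main.2.1⟩, main.2.2⟩

end Round

end ArrayLang


namespace ArrayLang

open WeightedGraph

/-! ### What is known about a single piece -/

section Piece

variable {E : Env} {G : WeightedGraph ℕ} {C : Finset ℕ} {r : ℕ} {𝒩 : Finset (Finset ℕ)}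
  {fin : Prop}

/-- The lower bound for the minimum cut. -/
noncomputable def Env.unit (E : Env) : ℝ := E.lam / (101 / 100)

theorem outerWeight_nonneg (hlp : ∀ v, 0 ≤ E.lp v) (C : Finset ℕ) (v : ℕ) :
    0 ≤ outerWeight E G C v :=
  add_nonneg (hlp v) (Finset.sum_nonneg fun u _ => G.nonneg v u)

/-- An edge that leaves U ends in C \ U or leaves C. -/
theorem sum_outerWeight_of_subset {U : Finset ℕ} (hC : C ⊆ Finset.range E.n) (hU : U ⊆ C) :
    ∑ v ∈ U, outerWeight E G U v = G.inducedBoundary C U + ∑ v ∈ U, outerWeight E G C v := by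
  unfold inducedBoundary cut
  rw [← Finset.sum_add_distrib]
  refine Finset.sum_congr rfl fun v _ => ?_
  have : Finset.range E.n \ U = (C \ U) ∪ (Finset.range E.n \ C) := by
    ext x
    have h1 := @hC x
    have h2 := @hU x
    simp only [Finset.mem_sdiff, Finset.mem_union]
    tauto
  unfold outerWeight
  rw [this, Finset.sum_union]
  · ring
  · rw [Finset.disjoint_left]
    intro x
    simp only [Finset.mem_sdiff]
    tauto

/-- The set `S` is a union of classes of the partition of `C` generated by the family `𝒩`. -/
def InFamily (C : Finset ℕ) (𝒩 : Finset (Finset ℕ)) (S : Finset ℕ) : Prop :=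
  ∀ u ∈ S, ∀ v ∈ C, (∀ N ∈ 𝒩, (u ∈ N ↔ v ∈ N)) → v ∈ S

theorem InFamily.sdiff {S : Finset ℕ} (h : InFamily C 𝒩 S) : InFamily C 𝒩 (C \ S) := by
  intro u hu v hv huv
  obtain ⟨h1, h2⟩ := Finset.mem_sdiff.mp hu
  exact Finset.mem_sdiff.mpr ⟨hv, fun hc => h2 (h v hc u h1 fun N hN => (huv N hN).symm)⟩

theorem InFamily.insert {S N : Finset ℕ} (h : InFamily C 𝒩 S) : InFamily C (insert N 𝒩) S :=
  fun u hu v hv huv => h u hu v hv fun M hM => huv M (Finset.mem_insert_of_mem hM)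

theorem inFamily_of_mem {N : Finset ℕ} (h : N ∈ 𝒩) : InFamily C 𝒩 N :=
  fun _ hu _ _ huv => (huv N h).mp hu

/-- The cuts which lead to further steps of the algorithm for the piece `C` with root `r`, if the
cuts in `𝒩` have been stored. -/
def Candidate (E : Env) (G : WeightedGraph ℕ) (C : Finset ℕ) (r : ℕ) (𝒩 : Finset (Finset ℕ))
    (S : Finset ℕ) : Prop :=
  S ⊆ C ∧ r ∉ S ∧ S.Nonempty ∧
    (G.inducedBoundary C S < 49 / 100 * E.unit ∨
      (4 * E.unit < ∑ v ∈ C, outerWeight E G C v ∧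
        G.inducedBoundary C S ≤ 101 / 100 * E.lam ∧
        G.inducedBoundary C S < (1 - E.eps) * ∑ v ∈ S, outerWeight E G C v ∧
        G.inducedBoundary C S < (1 - E.eps) * ∑ v ∈ C \ S, outerWeight E G C v) ∨
      (∑ v ∈ C, outerWeight E G C v ≤ 4 * E.unit ∧
        G.inducedBoundary C S ≤ 103 / 100 * E.unit ∧
        E.eps / 2 * E.unit < ∑ v ∈ S, outerWeight E G C v ∧ ¬ InFamily C 𝒩 S ∧
        ∀ N ∈ 𝒩, E.eps / 2 * E.unit < ∑ v ∈ symmDiff S N, outerWeight E G C v))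

theorem eligible_iff_candidate {T : Task} (hC : T.C = C) (hr : T.r = r)
    (hb : T.b = outerWeight E G C) (hs : T.stored = {N | N ∈ 𝒩})
    (ha : ∀ u ∈ C, ∀ v ∈ C, T.atom u = T.atom v ↔ ∀ N ∈ 𝒩, (u ∈ N ↔ v ∈ N)) (S : Finset ℕ) :
    T.Eligible G E.eps E.lam S ↔ Candidate E G C r 𝒩 S := by
  unfold Task.Eligible Candidate Env.unit
  rw [hC, hr, hb, hs]
  refine and_congr_right fun hS => ?_
  have : T.InAlgebra S ↔ InFamily C 𝒩 S := by
    unfold Task.InAlgebra InFamily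
    rw [hC]
    exact forall₄_congr fun u hu v hv => by rw [ha u (hS hu) v hv]
  rw [this]
  rfl

/-- The state of knowledge about the piece `C` with root `r`. -/
structure PieceInvariant (E : Env) (G : WeightedGraph ℕ) (C : Finset ℕ) (r : ℕ)
    (𝒩 : Finset (Finset ℕ)) (fin : Prop) : Prop where
  root : r ∈ C
  stored : ∀ N ∈ 𝒩, N ⊆ C ∧ r ∉ N ∧ G.inducedBoundary C N ≤ 103 / 100 * E.unit ∧
    E.eps / 2 * E.unit < ∑ v ∈ N, outerWeight E G C v
  separated : ∀ N ∈ 𝒩, ∀ N' ∈ 𝒩, N ≠ N' →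
    E.eps / 2 * E.unit ≤ ∑ v ∈ symmDiff N N', outerWeight E G C v
  tight : 𝒩.Nonempty → ∑ v ∈ C, outerWeight E G C v ≤ 4 * E.unit ∧
    ∀ U ⊆ C, U.Nonempty → U ≠ C → 49 / 100 * E.unit ≤ G.inducedBoundary C U
  -- A small cut either may still be stored or is approximated by a union of atoms that is no
  -- heavier. When no candidate remains, this is the net property.
  cover : ∀ Q ⊆ C, r ∉ Q → G.inducedBoundary C Q ≤ 103 / 100 * E.unit →
    (E.eps / 2 * E.unit < ∑ v ∈ Q, outerWeight E G C v ∧ ¬ InFamily C 𝒩 Q ∧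
      ∀ N ∈ 𝒩, E.eps / 2 * E.unit < ∑ v ∈ symmDiff Q N, outerWeight E G C v) ∨
    ∃ N ⊆ C, InFamily C 𝒩 N ∧ G.inducedBoundary C N ≤ G.inducedBoundary C Q ∧
      ∑ v ∈ symmDiff N Q, outerWeight E G C v ≤ E.eps / 2 * E.unit
  final : fin → (∀ U ⊆ C, U.Nonempty → U ≠ C → 49 / 100 * E.unit ≤ G.inducedBoundary C U) ∧
    ∀ S, ¬ Candidate E G C r 𝒩 S

/-- Before any cut is stored, a cut of mass at most εl/2 is approximated by the empty set. -/
theorem PieceInvariant.initial (hε : 0 ≤ E.eps) (hl : 0 ≤ E.unit) (hr : r ∈ C) (hfin : ¬ fin) :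
    PieceInvariant E G C r ∅ fin := by
  have hδ : 0 ≤ E.eps / 2 * E.unit := by positivity
  refine ⟨hr, by simp, by simp, by simp, fun Q hQ _ _ => ?_, fun h => absurd h hfin⟩
  rw [or_iff_not_imp_left]
  intro hc
  by_cases h1 : E.eps / 2 * E.unit < ∑ v ∈ Q, outerWeight E G C v
  · have h2 : InFamily C ∅ Q := by
      by_contra h2
      exact hc ⟨h1, h2, by simp⟩
    exact ⟨Q, hQ, h2, le_rfl, by simpa using hδ⟩
  · refine ⟨∅, Finset.empty_subset _, fun u hu => absurd hu (Finset.notMem_empty u), ?_, ?_⟩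
    · simpa [inducedBoundary] using G.inducedBoundary_nonneg C Q
    · rw [← Finset.bot_eq_empty, bot_symmDiff]
      exact not_lt.mp h1

theorem PieceInvariant.finish {fin' : Prop} (h : PieceInvariant E G C r 𝒩 fin)
    (h1 : ∀ U ⊆ C, U.Nonempty → U ≠ C → 49 / 100 * E.unit ≤ G.inducedBoundary C U)
    (h2 : ∀ S, ¬ Candidate E G C r 𝒩 S) : PieceInvariant E G C r 𝒩 fin' :=
  ⟨h.root, h.stored, h.separated, h.tight, h.cover, fun _ => ⟨h1, h2⟩⟩

/-- If Q stops being storable because it is close to the new cut S, then Q was a candidate before,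
so ∂S ≤ ∂Q by minimality and S itself approximates Q. If it stops because it has become a union of
atoms, Q approximates itself. -/
theorem PieceInvariant.store {fin' : Prop} (h : PieceInvariant E G C r 𝒩 fin) (hε : 0 ≤ E.eps)
    (hl : 0 ≤ E.unit) {S : Finset ℕ} (hS : Candidate E G C r 𝒩 S)
    (hcut : ∀ U ⊆ C, U.Nonempty → U ≠ C → 49 / 100 * E.unit ≤ G.inducedBoundary C U)
    (hsmall : ∑ v ∈ C, outerWeight E G C v ≤ 4 * E.unit)
    (hmin : ∀ Q, Candidate E G C r 𝒩 Q → G.inducedBoundary C S ≤ G.inducedBoundary C Q)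
    (hfin : ¬ fin') : PieceInvariant E G C r (insert S 𝒩) fin' := by
  have hδ : 0 ≤ E.eps / 2 * E.unit := by positivity
  obtain ⟨hSC, hrS, hne, h1 | ⟨h1, _⟩ | ⟨_, hx, hbS, _, hfar⟩⟩ := hS
  · have := hcut S hSC hne (fun hc => hrS (hc ▸ h.root))
    linarith
  · linarith
  refine ⟨h.root, fun N hN => ?_, fun N hN N' hN' hne' => ?_, fun _ => ⟨hsmall, hcut⟩,
    fun Q hQ hrQ hxQ => ?_, fun hf => absurd hf hfin⟩
  · rcases Finset.mem_insert.mp hN with rfl | hN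
    · exact ⟨hSC, hrS, hx, hbS⟩
    · exact h.stored N hN
  · rcases Finset.mem_insert.mp hN with e | h1 <;> rcases Finset.mem_insert.mp hN' with e' | h2
    · exact absurd (e.trans e'.symm) hne'
    · rw [e]
      exact (hfar N' h2).le
    · rw [symmDiff_comm, e']
      exact (hfar N h1).le
    · exact h.separated N h1 N' h2 hne'
  · rw [or_iff_not_imp_left]
    intro hc
    rcases h.cover Q hQ hrQ hxQ with ⟨h1, h2, h3⟩ | ⟨N, hN, hNf, hNx, hNb⟩
    · by_cases h4 : InFamily C (insert S 𝒩) Q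
      · exact ⟨Q, hQ, h4, le_rfl, by simpa using hδ⟩
      · have h5 : ∑ v ∈ symmDiff Q S, outerWeight E G C v ≤ E.eps / 2 * E.unit := by
          by_contra h5
          refine hc ⟨h1, h4, fun N hN => ?_⟩
          rcases Finset.mem_insert.mp hN with rfl | hN
          · exact not_le.mp h5
          · exact h3 N hN
        refine ⟨S, hSC, inFamily_of_mem (Finset.mem_insert_self _ _), hmin Q ?_, ?_⟩
        · refine ⟨hQ, hrQ, ?_, Or.inr (Or.inr ⟨hsmall, hxQ, h1, h2, h3⟩)⟩
          rw [Finset.nonempty_iff_ne_empty]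
          rintro rfl
          simp only [Finset.sum_empty] at h1
          linarith
        · rw [symmDiff_comm]
          exact h5
    · exact ⟨N, hN, hNf.insert, hNx, hNb⟩

/-- Every small cut of a finished piece can be uncrossed. -/
theorem PieceInvariant.exists_bipartition (h : PieceInvariant E G C r 𝒩 True) (hε : 0 < E.eps)
    (hε1 : E.eps ≤ 1 / 100) (hl : 0 < E.unit) (hlp : ∀ v, 0 ≤ E.lp v)
    (hlow : (∀ U ⊆ C, U.Nonempty →
        E.unit ≤ G.inducedBoundary C U + ∑ v ∈ U, outerWeight E G C v) ∨
      ∀ v ∈ C, outerWeight E G C v = 0)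
    {S : Finset ℕ} (hS : S ⊆ C) (hx : G.inducedBoundary C S ≤ 101 / 100 * E.lam) :
    ∃ T ⊆ C, InFamily C 𝒩 T ∧ G.NonsparseIn C (outerWeight E G C) (1 - E.eps) T S ∧
      G.NonsparseIn C (outerWeight E G C) (1 - E.eps) (C \ T) S := by
  have hself : InFamily C 𝒩 C := fun _ _ v hv _ => hv
  have hempty : G.NonsparseIn C (outerWeight E G C) (1 - E.eps) (C \ C) S := by
    unfold NonsparseIn
    simp
  have hlam : 101 / 100 * E.lam = 10201 / 10000 * E.unit := by
    unfold Env.unit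
    ring
  rcases hlow with hlow | hzero
  swap
  · refine ⟨C, Finset.Subset.refl _, hself, ?_, hempty⟩
    unfold NonsparseIn
    rw [Finset.inter_eq_left.mpr hS, Finset.sdiff_self, Finset.sum_eq_zero fun v hv => hzero v (hS hv),
      Finset.sum_eq_zero fun v hv => hzero v (Finset.mem_sdiff.mp hv).1]
    have := G.cut_nonneg S (C \ S)
    simpa using this
  obtain ⟨hcut, hno⟩ := h.final trivial
  rcases lt_or_ge (4 * E.unit) (∑ v ∈ C, outerWeight E G C v) with hbig | hsmall
  · refine ⟨C, Finset.Subset.refl _, hself, ?_, hempty⟩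
    unfold NonsparseIn
    rw [Finset.inter_eq_left.mpr hS, Finset.sdiff_self, cut_empty_right, cut_empty_right, add_zero,
      add_zero]
    intro hsp
    have hpos : (0 : ℝ) < 1 - E.eps := by linarith
    have h1 : G.inducedBoundary C S < (1 - E.eps) * ∑ v ∈ S, outerWeight E G C v :=
      hsp.trans_le (mul_le_mul_of_nonneg_left (min_le_left _ _) hpos.le)
    have h2 : G.inducedBoundary C S < (1 - E.eps) * ∑ v ∈ C \ S, outerWeight E G C v :=
      hsp.trans_le (mul_le_mul_of_nonneg_left (min_le_right _ _) hpos.le)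
    have h0 := G.inducedBoundary_nonneg C S
    have hne : ∀ X : Finset ℕ,
        G.inducedBoundary C S < (1 - E.eps) * ∑ v ∈ X, outerWeight E G C v → X.Nonempty := by
      intro X hX
      rw [Finset.nonempty_iff_ne_empty]
      rintro rfl
      simp only [Finset.sum_empty, mul_zero] at hX
      linarith
    by_cases hr : r ∈ S
    · refine hno (C \ S) ⟨Finset.sdiff_subset, fun hc => (Finset.mem_sdiff.mp hc).2 hr, hne _ h2,
        Or.inr (Or.inl ⟨hbig, ?_, ?_, ?_⟩)⟩
      · rwa [G.inducedBoundary_sdiff hS]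
      · rwa [G.inducedBoundary_sdiff hS]
      · rwa [G.inducedBoundary_sdiff hS, Finset.sdiff_sdiff_eq_self hS]
    · exact hno S ⟨hS, hr, hne _ h1, Or.inr (Or.inl ⟨hbig, hx, h1, h2⟩)⟩
  · have hδ : 0 ≤ E.eps / 2 * E.unit := by positivity
    have hnet' : ∀ Q ⊆ C, r ∉ Q → G.inducedBoundary C Q ≤ 103 / 100 * E.unit →
        ∃ N ⊆ C, InFamily C 𝒩 N ∧ G.inducedBoundary C N ≤ G.inducedBoundary C Q ∧
          ∑ v ∈ symmDiff N Q, outerWeight E G C v ≤ E.eps / 2 * E.unit := by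
      intro Q hQ hrQ hxQ
      rcases h.cover Q hQ hrQ hxQ with ⟨h1, h2, h3⟩ | hh
      · refine absurd ⟨hQ, hrQ, ?_, Or.inr (Or.inr ⟨hsmall, hxQ, h1, h2, h3⟩)⟩ (hno Q)
        rw [Finset.nonempty_iff_ne_empty]
        rintro rfl
        simp only [Finset.sum_empty] at h1
        linarith
      · exact hh
    -- The thresholds fit because 1.01² + ε/2 ≤ 1.03. The net consists of all unions of atoms, hence
    -- is closed under complements, which deals with cuts that contain the root.
    obtain ⟨T, ⟨hTC, hTf⟩, h1, h2⟩ := G.exists_nonsparse_bipartition (C := C)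
      (b := outerWeight E G C) (l := E.unit) (ε := E.eps) (δ := E.eps / 2 * E.unit)
      (θ := 10201 / 10000 * E.unit) (θ' := 103 / 100 * E.unit) hε (by linarith) le_rfl hδ
      (by nlinarith) (outerWeight_nonneg hlp C) hlow {N | N ⊆ C ∧ InFamily C 𝒩 N}
      (fun N hN => hN.1) (by
        intro Q hQ hxQ
        by_cases hr : r ∈ Q
        · obtain ⟨N, hN, hNf, hNx, hNb⟩ := hnet' (C \ Q) Finset.sdiff_subset
            (fun hc => (Finset.mem_sdiff.mp hc).2 hr) (by rwa [G.inducedBoundary_sdiff hQ])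
          refine ⟨C \ N, ⟨Finset.sdiff_subset, hNf.sdiff⟩, ?_, ?_⟩
          · rwa [G.inducedBoundary_sdiff hN, ← G.inducedBoundary_sdiff hQ]
          · refine le_trans (le_of_eq ?_) hNb
            refine Finset.sum_congr ?_ fun _ _ => rfl
            ext v
            have a1 := @hN v
            have a2 := @hQ v
            simp only [Finset.mem_symmDiff, Finset.mem_sdiff]
            tauto
        · obtain ⟨N, hN, hNf, hNx, hNb⟩ := hnet' Q hQ hr hxQ
          exact ⟨N, ⟨hN, hNf⟩, hNx, hNb⟩) hS (by linarith)
    exact ⟨T, hTC, hTf, h1, h2⟩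

/-- The number of stored cuts is bounded. -/
theorem PieceInvariant.card_le (h : PieceInvariant E G C r 𝒩 fin) (hε : 0 < E.eps)
    (hl : 0 < E.unit) (hlp : ∀ v, 0 ≤ E.lp v)
    (hlow : ∀ U ⊆ C, U.Nonempty → E.unit ≤ G.inducedBoundary C U + ∑ v ∈ U, outerWeight E G C v)
    {Λ : ℝ} (hΛ : 31 * Real.log (C.card + 1) ≤ Λ) :
    (𝒩.card : ℝ) ≤ (800 * Λ + 2) ^ 31 * (16 / E.eps * Λ + 2) ^ 2 := by
  have hΛ0 : 0 ≤ Λ := by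
    refine le_trans (mul_nonneg (by norm_num) (Real.log_nonneg ?_)) hΛ
    linarith [Nat.cast_nonneg (α := ℝ) C.card]
  rcases 𝒩.eq_empty_or_nonempty with h0 | h0
  · rw [h0]
    simp only [Finset.card_empty, Nat.cast_zero]
    positivity
  · obtain ⟨h1, h2⟩ := h.tight h0
    refine G.card_le_of_separated_cuts hl hε (outerWeight_nonneg hlp C) h1 hlow ?_ h.root 𝒩 ?_
      h.separated hΛ
    · intro U hU hne hne'
      have := h2 U hU hne hne'
      linarith
    · intro Q hQ
      obtain ⟨a1, a2, a3, _⟩ := h.stored Q hQ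
      exact ⟨a1, a2, by linarith⟩

end Piece

/-! ### The potential that pays for the splits -/

/-- The potential of a piece with a boundary of weight `x`. -/
noncomputable def potential (l ε c x : ℝ) : ℝ := c * (x - 98 / 100 * l) + 3 * c / ε * max 0 (x - 3 * l)

/-- The potential does not increase if a piece is split along a very small cut, or along a sparse
cut of a piece with a large boundary. -/
theorem potential_add_le {l ε c x b₁ b₂ : ℝ} (hl : 0 < l) (hε : 0 < ε) (hε1 : ε ≤ 1 / 100)
    (hc : 0 ≤ c) (h₁ : l ≤ b₁ + x) (h₂ : l ≤ b₂ + x)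
    (h : x < 49 / 100 * l ∨ (4 * l < b₁ + b₂ ∧ x ≤ 10201 / 10000 * l ∧ x < (1 - ε) * b₁ ∧
      x < (1 - ε) * b₂)) :
    potential l ε c (b₁ + x) + potential l ε c (b₂ + x) ≤ potential l ε c (b₁ + b₂) := by
  -- The claim after cancellation of the common linear terms and division by 3c/ε: the first product
  -- is the change of the linear part.
  have hkey : (2 * x - 98 / 100 * l) * (ε / 3) + (max 0 (b₁ + x - 3 * l) + max 0 (b₂ + x - 3 * l)) ≤
      max 0 (b₁ + b₂ - 3 * l) := by
    have m0 := le_max_right 0 (b₁ + b₂ - 3 * l)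
    have m1 := le_max_left 0 (b₁ + b₂ - 3 * l)
    rcases h with h | ⟨h4, hx, hx1, hx2⟩
    · have e0 : (2 * x - 98 / 100 * l) * (ε / 3) ≤ 0 :=
        mul_nonpos_of_nonpos_of_nonneg (by linarith) (by linarith)
      rcases max_cases 0 (b₁ + x - 3 * l) with ⟨e1, _⟩ | ⟨e1, _⟩ <;>
      rcases max_cases 0 (b₂ + x - 3 * l) with ⟨e2, _⟩ | ⟨e2, _⟩ <;>
      · rw [e1, e2]
        linarith
    · have e0 : (2 * x - 98 / 100 * l) * (ε / 3) ≤ 36 / 100 * (ε * l) := by nlinarith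
      have e3 : ε * l ≤ 1 / 100 * l := by nlinarith
      -- For a sparse cut, b > x and b + x ≥ l give b > l/2, so b exceeds x by more than εl/2. Hence
      -- the total excess over 3l drops by at least 0.36 εl, which pays for the growth of the linear
      -- part.
      have key : ∀ b, l ≤ b + x → x < (1 - ε) * b → x + 36 / 100 * (ε * l) ≤ b := by
        intro b hb hxb
        have hb0 : l / 2 ≤ b := by
          by_contra hc
          push Not at hc
          nlinarith
        nlinarith
      have k1 := key b₁ h₁ hx1
      have k2 := key b₂ h₂ hx2
      rcases max_cases 0 (b₁ + x - 3 * l) with ⟨e1, _⟩ | ⟨e1, _⟩ <;>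
      rcases max_cases 0 (b₂ + x - 3 * l) with ⟨e2, _⟩ | ⟨e2, _⟩ <;>
      · rw [e1, e2]
        linarith
  have hmul := mul_le_mul_of_nonneg_left hkey (show (0 : ℝ) ≤ 3 * c / ε by positivity)
  have e : 3 * c / ε * ((2 * x - 98 / 100 * l) * (ε / 3) +
      (max 0 (b₁ + x - 3 * l) + max 0 (b₂ + x - 3 * l))) = c * (2 * x - 98 / 100 * l) +
      (3 * c / ε * max 0 (b₁ + x - 3 * l) + 3 * c / ε * max 0 (b₂ + x - 3 * l)) := by
    field_simp
  rw [e] at hmul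
  unfold potential
  linarith

/-- Since x ≥ l, the difference x - 0.98 l is at least x/50; the credit 0.98 l is less than l for
this purpose. -/
theorem le_potential {l ε c x : ℝ} (hε : 0 < ε) (hc : 0 ≤ c) (hx : l ≤ x) :
    c / 50 * x ≤ potential l ε c x := by
  have h1 : 0 ≤ 3 * c / ε * max 0 (x - 3 * l) := by positivity
  unfold potential
  nlinarith

theorem potential_le {l ε c x : ℝ} (hε : 0 < ε) (hε1 : ε ≤ 1 / 100) (hc : 0 ≤ c) (hx : 0 ≤ x)
    (hl : 0 < l) : potential l ε c x ≤ 4 * c / ε * x := by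
  have h1 : max 0 (x - 3 * l) ≤ x := max_le hx (by linarith)
  have h2 : 3 * c / ε * max 0 (x - 3 * l) ≤ 3 * c / ε * x :=
    mul_le_mul_of_nonneg_left h1 (by positivity)
  have h3 : c ≤ c / ε := by
    rw [le_div_iff₀ hε]
    nlinarith
  have h4 : 4 * c / ε * x = 3 * c / ε * x + c / ε * x := by ring
  have h5 : c * x ≤ c / ε * x := mul_le_mul_of_nonneg_right h3 hx
  unfold potential
  nlinarith

end ArrayLang


/-! ### The invariant of the main loop, and rounds that do not split a piece -/

namespace ArrayLang

open WeightedGraph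

theorem card_image_le_of_refines {f g : ℕ → ℕ} {A : Finset ℕ}
    (h : ∀ u ∈ A, ∀ v ∈ A, g u = g v → f u = f v) : (A.image f).card ≤ (A.image g).card := by
  classical
  have : ∀ y ∈ A.image f, ∃ x ∈ A, f x = y := fun y hy => Finset.mem_image.mp hy
  choose! φ hφ hφ' using this
  refine Finset.card_le_card_of_injOn (fun y => g (φ y))
    (fun y hy => Finset.mem_coe.mpr (Finset.mem_image_of_mem _ (hφ y hy))) ?_
  intro y hy z hz hyz
  rw [← hφ' y hy, ← hφ' z hz]
  exact h _ (hφ y hy) _ (hφ z hz) hyz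

theorem card_image_lt_of_refines {f g : ℕ → ℕ} {A : Finset ℕ}
    (h : ∀ u ∈ A, ∀ v ∈ A, g u = g v → f u = f v) {u v : ℕ} (hu : u ∈ A) (hv : v ∈ A)
    (hf : f u = f v) (hg : g u ≠ g v) : (A.image f).card < (A.image g).card := by
  classical
  have : ∀ y ∈ A.image f, ∃ x ∈ A, f x = y ∧ g x ≠ g v := by
    intro y hy
    obtain ⟨x, hx, rfl⟩ := Finset.mem_image.mp hy
    by_cases hc : g x = g v
    · exact ⟨u, hu, hf.trans (h x hx v hv hc).symm, hg⟩
    · exact ⟨x, hx, rfl, hc⟩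
  choose! φ hφ hφ' hφv using this
  have hsub : (A.image f).card ≤ ((A.image g).erase (g v)).card := by
    refine Finset.card_le_card_of_injOn (fun y => g (φ y)) (fun y hy => Finset.mem_coe.mpr
      (Finset.mem_erase.mpr ⟨hφv y hy, Finset.mem_image_of_mem _ (hφ y hy)⟩)) ?_
    intro y hy z hz hyz
    rw [← hφ' y hy, ← hφ' z hz]
    exact h _ (hφ y hy) _ (hφ z hz) hyz
  exact hsub.trans_lt (Finset.card_erase_lt_of_mem (Finset.mem_image_of_mem _ hv))

/-- The hypotheses on the input. -/
structure Env.Valid (E : Env) (G : WeightedGraph ℕ) : Prop where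
  pos : 0 < E.n
  size : E.L = E.n.size
  lam_pos : 0 < E.lam
  eps_pos : 0 < E.eps
  eps_le : E.eps ≤ 1 / 100
  lp_nonneg : ∀ v, 0 ≤ E.lp v
  w : ∀ u < E.n, ∀ v < E.n, E.w u v = G.w u v
  low : ∀ U ⊆ Finset.range E.n, U.Nonempty → U ≠ Finset.range E.n →
    E.unit ≤ ∑ v ∈ U, outerWeight E G U v
  -- The second alternative is the case A = V, in which no edge leaves A and the minimum cut says
  -- nothing about A itself.
  whole : E.unit ≤ ∑ v ∈ Finset.range E.n, E.lp v ∨ ∀ v < E.n, E.lp v = 0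

section Invariant

variable {E : Env} {G : WeightedGraph ℕ} {s s' : Store} {c : ℝ} {k r : ℕ} {S : Finset ℕ}

theorem Env.Valid.unit_pos (hE : E.Valid G) : 0 < E.unit := by
  have := hE.lam_pos
  unfold Env.unit
  positivity

theorem outerWeight_range (v : ℕ) : outerWeight E G (Finset.range E.n) v = E.lp v := by
  simp [outerWeight]

theorem Env.Valid.low' (hE : E.Valid G) {C : Finset ℕ} (hC : C ⊆ Finset.range E.n)
    (h : E.unit ≤ ∑ v ∈ Finset.range E.n, E.lp v ∨ C ≠ Finset.range E.n) :
    ∀ U ⊆ C, U.Nonempty → E.unit ≤ G.inducedBoundary C U + ∑ v ∈ U, outerWeight E G C v := by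
  intro U hU hne
  rw [← sum_outerWeight_of_subset hC hU]
  by_cases hUn : U = Finset.range E.n
  · rcases h with h | h
    · subst hUn
      simpa only [outerWeight_range] using h
    · exact absurd (Finset.Subset.antisymm hC (hUn ▸ hU)) h
  · exact hE.low U (hU.trans hC) hne hUn

/-- The pieces. -/
def Store.roots (E : Env) (s : Store) : Finset ℕ :=
  (Finset.range E.n).filter fun p => s.N .piece p 0 = p

noncomputable def Store.weight (E : Env) (G : WeightedGraph ℕ) (s : Store) (p : ℕ) : ℝ :=
  ∑ v ∈ s.piece E p, outerWeight E G (s.piece E p) v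

/-- The invariant of the main loop. -/
structure Store.Inv (E : Env) (G : WeightedGraph ℕ) (c : ℝ) (k : ℕ) (s : Store) : Prop where
  graph : s.HasGraph E G
  round : s.N .round 0 0 = k
  canon : ∀ v < E.n, s.N .piece v 0 ≤ v ∧ s.N .piece (s.N .piece v 0) 0 = s.N .piece v 0
  atom : ∀ u < E.n, ∀ v < E.n, s.N .atom u 0 = s.N .atom v 0 ↔ s.N .piece u 0 = s.N .piece v 0 ∧
    ∀ N ∈ s.storedCuts E k (s.N .piece u 0), (u ∈ N ↔ v ∈ N)
  owner : ∀ i < k, s.N .owner i 0 < E.n → s.N .piece (s.N .owner i 0) 0 = s.N .owner i 0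
  done : ∀ p < E.n, s.N .done p 0 ≠ 0 → s.N .piece p 0 = p
  inv : ∀ p < E.n, s.N .piece p 0 = p →
    PieceInvariant E G (s.piece E p) p (s.storedCuts E k p) (s.N .done p 0 ≠ 0)
  pot : E.unit ≤ ∑ v ∈ Finset.range E.n, E.lp v →
    ∑ p ∈ s.roots E, potential E.unit E.eps c (s.weight E G p) ≤
      potential E.unit E.eps c (∑ v ∈ Finset.range E.n, E.lp v)
  whole : (∀ v < E.n, E.lp v = 0) → ∀ v < E.n, s.N .piece v 0 = 0
  -- Each round creates a piece or an atom, or finishes a piece, unless all pieces are finished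
  -- already.
  progress : k ≤ ((Finset.range E.n).image fun v => s.N .piece v 0).card +
      ((Finset.range E.n).image fun v => s.N .atom v 0).card +
      ((Finset.range E.n).filter fun v => s.N .done v 0 ≠ 0).card ∨
    ∀ p < E.n, s.N .piece p 0 = p → s.N .done p 0 ≠ 0

/-- What all kinds of rounds have in common. -/
structure Store.Next (E : Env) (G : WeightedGraph ℕ) (k : ℕ) (s s' : Store) : Prop where
  graph : s'.HasGraph E G
  round : s'.N .round 0 0 = k + 1
  owner : ∀ i < k, s'.N .owner i 0 = s.N .owner i 0
  stored : ∀ i < k, ∀ v < E.n, s'.N .stored i v = s.N .stored i v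

theorem Store.Next.storedCuts_eq (h : s.Next E G k s') {p : ℕ} (hp : s'.piece E p = s.piece E p)
    (hk : s'.N .owner k 0 ≠ p) : s'.storedCuts E (k + 1) p = s.storedCuts E k p := by
  unfold Store.storedCuts
  have e : ((Finset.range (k + 1)).filter fun i => s'.N .owner i 0 = p) =
      (Finset.range k).filter fun i => s.N .owner i 0 = p := by
    ext i
    simp only [Finset.mem_filter, Finset.mem_range]
    constructor
    · rintro ⟨h1, h2⟩
      rcases Nat.lt_succ_iff_lt_or_eq.mp h1 with h1 | rfl
      · exact ⟨h1, h.owner i h1 ▸ h2⟩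
      · exact absurd h2 hk
    · rintro ⟨h1, h2⟩
      exact ⟨by omega, (h.owner i h1).trans h2⟩
  rw [e, hp]
  refine Finset.image_congr fun i hi => Finset.filter_congr fun v hv => ?_
  rw [h.stored i (Finset.mem_range.mp (Finset.mem_filter.mp hi).1) v (Store.mem_piece.mp hv).1]

theorem Store.Next.storedCuts_insert (h : s.Next E G k s') (hp : s'.piece E r = s.piece E r)
    (hk : s'.N .owner k 0 = r) : s'.storedCuts E (k + 1) r =
      insert ((s.piece E r).filter fun v => s'.N .stored k v = 1) (s.storedCuts E k r) := by
  unfold Store.storedCuts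
  have e : ((Finset.range (k + 1)).filter fun i => s'.N .owner i 0 = r) =
      insert k ((Finset.range k).filter fun i => s.N .owner i 0 = r) := by
    ext i
    simp only [Finset.mem_filter, Finset.mem_range, Finset.mem_insert]
    constructor
    · rintro ⟨h1, h2⟩
      rcases Nat.lt_succ_iff_lt_or_eq.mp h1 with h1 | rfl
      · exact Or.inr ⟨h1, h.owner i h1 ▸ h2⟩
      · exact Or.inl rfl
    · rintro (rfl | ⟨h1, h2⟩)
      · exact ⟨by omega, hk⟩
      · exact ⟨by omega, (h.owner i h1).trans h2⟩
  rw [e, Finset.image_insert, hp]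
  congr 1
  refine Finset.image_congr fun i hi => Finset.filter_congr fun v hv => ?_
  rw [h.stored i (Finset.mem_range.mp (Finset.mem_filter.mp hi).1) v (Store.mem_piece.mp hv).1]

theorem Store.Inv.piece_lt (h : s.Inv E G c k) {v : ℕ} (hv : v < E.n) : s.N .piece v 0 < E.n :=
  (h.canon v hv).1.trans_lt hv

theorem piece_congr (h : ∀ v < E.n, s'.N .piece v 0 = s.N .piece v 0) (p : ℕ) :
    s'.piece E p = s.piece E p :=
  Finset.filter_congr fun v hv => by rw [h v (Finset.mem_range.mp hv)]

theorem roots_congr (h : ∀ v < E.n, s'.N .piece v 0 = s.N .piece v 0) :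
    s'.roots E = s.roots E :=
  Finset.filter_congr fun v hv => by rw [h v (Finset.mem_range.mp hv)]

/-- A round after the end of the main phase. -/
theorem Store.Inv.idle (h : s.Inv E G c k) (hn : s.Next E G k s')
    (hpiece : ∀ v < E.n, s'.N .piece v 0 = s.N .piece v 0)
    (hatom : ∀ v < E.n, s'.N .atom v 0 = s.N .atom v 0)
    (hdone : ∀ v < E.n, s'.N .done v 0 = s.N .done v 0) (howner : s'.N .owner k 0 = E.n)
    (hall : ∀ p < E.n, s.N .piece p 0 = p → s.N .done p 0 ≠ 0) : s'.Inv E G c (k + 1) := by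
  have hcuts : ∀ p < E.n, s'.storedCuts E (k + 1) p = s.storedCuts E k p := fun p hp =>
    hn.storedCuts_eq (piece_congr hpiece p) (by omega)
  refine ⟨hn.graph, hn.round, fun v hv => ?_, fun u hu v hv => ?_, fun i hi hin => ?_,
    fun p hp hd => ?_, fun p hp hpp => ?_, fun hlp => ?_, fun hz v hv => ?_, Or.inr fun p hp hpp => ?_⟩
  · rw [hpiece v hv, hpiece _ (h.piece_lt hv)]
    exact h.canon v hv
  · rw [hatom u hu, hatom v hv, hpiece u hu, hpiece v hv, hcuts _ (h.piece_lt hu)]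
    exact h.atom u hu v hv
  · rcases Nat.lt_succ_iff_lt_or_eq.mp hi with hi | rfl
    · rw [hn.owner i hi] at hin ⊢
      rw [hpiece _ hin]
      exact h.owner i hi hin
    · omega
  · rw [hdone p hp] at hd
    rw [hpiece p hp]
    exact h.done p hp hd
  · rw [hpiece p hp] at hpp
    rw [piece_congr hpiece, hcuts p hp, hdone p hp]
    exact h.inv p hp hpp
  · unfold Store.weight
    simp only [roots_congr hpiece, piece_congr hpiece]
    exact h.pot hlp
  · rw [hpiece v hv]
    exact h.whole hz v hv
  · rw [hpiece p hp] at hpp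
    rw [hdone p hp]
    exact hall p hp hpp

/-- A round which finishes the piece with root `r`. -/
theorem Store.Inv.finish (h : s.Inv E G c k) (hn : s.Next E G k s') (hr : r < E.n)
    (hrr : s.N .piece r 0 = r) (hrd : s.N .done r 0 = 0)
    (hpiece : ∀ v < E.n, s'.N .piece v 0 = s.N .piece v 0)
    (hatom : ∀ v < E.n, s'.N .atom v 0 = s.N .atom v 0)
    (hdone : ∀ v < E.n, s'.N .done v 0 = if v = r then 1 else s.N .done v 0)
    (howner : s'.N .owner k 0 = E.n)
    (hcut : ∀ U ⊆ s.piece E r, U.Nonempty → U ≠ s.piece E r →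
      49 / 100 * E.unit ≤ G.inducedBoundary (s.piece E r) U)
    (hno : ∀ S, ¬ Candidate E G (s.piece E r) r (s.storedCuts E k r) S) :
    s'.Inv E G c (k + 1) := by
  have hcuts : ∀ p < E.n, s'.storedCuts E (k + 1) p = s.storedCuts E k p := fun p hp =>
    hn.storedCuts_eq (piece_congr hpiece p) (by omega)
  refine ⟨hn.graph, hn.round, fun v hv => ?_, fun u hu v hv => ?_, fun i hi hin => ?_,
    fun p hp hd => ?_, fun p hp hpp => ?_, fun hlp => ?_, fun hz v hv => ?_, ?_⟩
  · rw [hpiece v hv, hpiece _ (h.piece_lt hv)]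
    exact h.canon v hv
  · rw [hatom u hu, hatom v hv, hpiece u hu, hpiece v hv, hcuts _ (h.piece_lt hu)]
    exact h.atom u hu v hv
  · rcases Nat.lt_succ_iff_lt_or_eq.mp hi with hi | rfl
    · rw [hn.owner i hi] at hin ⊢
      rw [hpiece _ hin]
      exact h.owner i hi hin
    · omega
  · rw [hpiece p hp]
    by_cases hpr : p = r
    · rw [hpr, hrr]
    · rw [hdone p hp, if_neg hpr] at hd
      exact h.done p hp hd
  · rw [hpiece p hp] at hpp
    rw [piece_congr hpiece, hcuts p hp, hdone p hp]
    by_cases hpr : p = r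
    · subst hpr
      exact (h.inv p hp hpp).finish hcut hno
    · rw [if_neg hpr]
      exact h.inv p hp hpp
  · unfold Store.weight
    simp only [roots_congr hpiece, piece_congr hpiece]
    exact h.pot hlp
  · rw [hpiece v hv]
    exact h.whole hz v hv
  · rcases h.progress with hp | hp
    · left
      have e1 : ((Finset.range E.n).image fun v => s'.N .piece v 0) =
          (Finset.range E.n).image fun v => s.N .piece v 0 :=
        Finset.image_congr fun v hv => hpiece v (Finset.mem_range.mp hv)
      have e2 : ((Finset.range E.n).image fun v => s'.N .atom v 0) =
          (Finset.range E.n).image fun v => s.N .atom v 0 :=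
        Finset.image_congr fun v hv => hatom v (Finset.mem_range.mp hv)
      have e3 : ((Finset.range E.n).filter fun v => s.N .done v 0 ≠ 0).card <
          ((Finset.range E.n).filter fun v => s'.N .done v 0 ≠ 0).card := by
        refine Finset.card_lt_card ((Finset.ssubset_iff_of_subset fun v hv => ?_).mpr ⟨r, ?_, ?_⟩)
        · obtain ⟨h1, h2⟩ := Finset.mem_filter.mp hv
          refine Finset.mem_filter.mpr ⟨h1, ?_⟩
          rw [hdone v (Finset.mem_range.mp h1)]
          split_ifs
          · exact one_ne_zero
          · exact h2
        · simp [hr, hdone r hr]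
        · simp [hrd]
      rw [e1, e2]
      omega
    · exact absurd hrd (hp r hr hrr)

/-- A round which stores the cut `S` of the piece with root `r`. -/
theorem Store.Inv.store (hE : E.Valid G) (h : s.Inv E G c k) (hn : s.Next E G k s') (hr : r < E.n)
    (hrr : s.N .piece r 0 = r) (hrd : s.N .done r 0 = 0)
    (hpiece : ∀ v < E.n, s'.N .piece v 0 = s.N .piece v 0)
    (hdone : ∀ v < E.n, s'.N .done v 0 = s.N .done v 0)
    (howner : s'.N .owner k 0 = r)
    (hstored : ∀ v < E.n, s'.N .stored k v = 1 ↔ v ∈ S)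
    (hatom : ∀ u < E.n, ∀ v < E.n, s'.N .atom u 0 = s'.N .atom v 0 ↔
      s.N .atom u 0 = s.N .atom v 0 ∧ (u ∈ S ↔ v ∈ S))
    (hS : Candidate E G (s.piece E r) r (s.storedCuts E k r) S)
    (hcut : ∀ U ⊆ s.piece E r, U.Nonempty → U ≠ s.piece E r →
      49 / 100 * E.unit ≤ G.inducedBoundary (s.piece E r) U)
    (hsmall : s.weight E G r ≤ 4 * E.unit)
    (hmin : ∀ Q, Candidate E G (s.piece E r) r (s.storedCuts E k r) Q →
      G.inducedBoundary (s.piece E r) S ≤ G.inducedBoundary (s.piece E r) Q) :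
    s'.Inv E G c (k + 1) := by
  have hSC := hS.1
  have hcuts : ∀ p < E.n, p ≠ r → s'.storedCuts E (k + 1) p = s.storedCuts E k p := fun p hp hpr =>
    hn.storedCuts_eq (piece_congr hpiece p) (by rw [howner]; exact hpr.symm)
  have hcutsr : s'.storedCuts E (k + 1) r = insert S (s.storedCuts E k r) := by
    rw [hn.storedCuts_insert (piece_congr hpiece r) howner]
    congr 1
    ext v
    simp only [Finset.mem_filter]
    constructor
    · rintro ⟨h1, h2⟩
      exact (hstored v (Store.mem_piece.mp h1).1).mp h2
    · exact fun hv => ⟨hSC hv, (hstored v (Store.mem_piece.mp (hSC hv)).1).mpr hv⟩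
  -- A cut that is stored is not a union of atoms, so it splits an atom; this is the progress made
  -- by the round.
  have hmix : ∃ u ∈ S, ∃ v ∈ s.piece E r, s.N .atom u 0 = s.N .atom v 0 ∧ v ∉ S := by
    obtain ⟨_, hrS, hne, h1 | ⟨h1, _⟩ | ⟨_, _, _, hmix, _⟩⟩ := hS
    · have := hcut S hSC hne (fun hc => hrS (hc ▸ Store.mem_piece.mpr ⟨hr, hrr⟩))
      linarith
    · exact absurd h1 (not_lt.mpr hsmall)
    · unfold InFamily at hmix
      push Not at hmix
      obtain ⟨u, hu, v, hv, huv, hvS⟩ := hmix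
      obtain ⟨hu1, hu2⟩ := Store.mem_piece.mp (hSC hu)
      obtain ⟨hv1, hv2⟩ := Store.mem_piece.mp hv
      refine ⟨u, hu, v, hv, (h.atom u hu1 v hv1).mpr ⟨hu2.trans hv2.symm, ?_⟩, hvS⟩
      rw [hu2]
      exact huv
  refine ⟨hn.graph, hn.round, fun v hv => ?_, fun u hu v hv => ?_, fun i hi hin => ?_,
    fun p hp hd => ?_, fun p hp hpp => ?_, fun hlp => ?_, fun hz v hv => ?_, ?_⟩
  · rw [hpiece v hv, hpiece _ (h.piece_lt hv)]
    exact h.canon v hv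
  · rw [hatom u hu v hv, hpiece u hu, hpiece v hv, h.atom u hu v hv, and_assoc]
    refine and_congr_right fun huv => ?_
    by_cases hur : s.N .piece u 0 = r
    · rw [hur, hcutsr, Finset.forall_mem_insert, and_comm]
    · rw [hcuts _ (h.piece_lt hu) hur]
      have h1 : u ∉ S := fun hc => hur (Store.mem_piece.mp (hSC hc)).2
      have h2 : v ∉ S := fun hc => hur (huv.trans (Store.mem_piece.mp (hSC hc)).2)
      simp [h1, h2]
  · rcases Nat.lt_succ_iff_lt_or_eq.mp hi with hi | rfl
    · rw [hn.owner i hi] at hin ⊢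
      rw [hpiece _ hin]
      exact h.owner i hi hin
    · rw [howner, hpiece r hr, hrr]
  · rw [hdone p hp] at hd
    rw [hpiece p hp]
    exact h.done p hp hd
  · rw [hpiece p hp] at hpp
    rw [piece_congr hpiece, hdone p hp]
    by_cases hpr : p = r
    · subst hpr
      rw [hcutsr]
      exact (h.inv p hp hpp).store hE.eps_pos.le hE.unit_pos.le hS hcut hsmall hmin
        (not_not.mpr hrd)
    · rw [hcuts p hp hpr]
      exact h.inv p hp hpp
  · unfold Store.weight
    simp only [roots_congr hpiece, piece_congr hpiece]
    exact h.pot hlp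
  · rw [hpiece v hv]
    exact h.whole hz v hv
  · rcases h.progress with hp | hp
    · left
      have e1 : ((Finset.range E.n).image fun v => s'.N .piece v 0) =
          (Finset.range E.n).image fun v => s.N .piece v 0 :=
        Finset.image_congr fun v hv => hpiece v (Finset.mem_range.mp hv)
      have e3 : ((Finset.range E.n).filter fun v => s'.N .done v 0 ≠ 0) =
          (Finset.range E.n).filter fun v => s.N .done v 0 ≠ 0 :=
        Finset.filter_congr fun v hv => by rw [hdone v (Finset.mem_range.mp hv)]
      obtain ⟨u, hu, v, hv, huv, hvS⟩ := hmix
      have hu1 := (Store.mem_piece.mp (hSC hu)).1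
      have hv1 := (Store.mem_piece.mp hv).1
      have e2 := card_image_lt_of_refines (f := fun v => s.N .atom v 0)
        (g := fun v => s'.N .atom v 0) (A := Finset.range E.n)
        (fun x hx y hy hxy => ((hatom x (Finset.mem_range.mp hx) y (Finset.mem_range.mp hy)).mp
          hxy).1) (Finset.mem_range.mpr hu1) (Finset.mem_range.mpr hv1) huv
        (fun hc => hvS (((hatom u hu1 v hv1).mp hc).2.mp hu))
      rw [e1, e3]
      omega
    · exact absurd hrd (hp r hr hrr)

end Invariant

end ArrayLang


namespace ArrayLang

open WeightedGraph

/-! ### Rounds that split a piece -/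

section Split

variable {E : Env} {G : WeightedGraph ℕ} {s s' : Store} {c : ℝ} {k r : ℕ} {S : Finset ℕ}

theorem Store.piece_subset (s : Store) (p : ℕ) : s.piece E p ⊆ Finset.range E.n :=
  Finset.filter_subset _ _

/-- A round which splits the piece with root `r` along the cut `S`. -/
theorem Store.Inv.split (hE : E.Valid G) (hc : 0 ≤ c) (h : s.Inv E G c k) (hn : s.Next E G k s')
    (hr : r < E.n) (hrr : s.N .piece r 0 = r) (hrd : s.N .done r 0 = 0)
    (hpiece : ∀ u < E.n, ∀ v < E.n, s'.N .piece u 0 = s'.N .piece v 0 ↔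
      s.N .piece u 0 = s.N .piece v 0 ∧ (u ∈ S ↔ v ∈ S))
    (hpiece_le : ∀ u < E.n, s'.N .piece u 0 ≤ u)
    (hpiece_idem : ∀ u < E.n, s'.N .piece (s'.N .piece u 0) 0 = s'.N .piece u 0)
    (hdone : ∀ v < E.n, s'.N .done v 0 = s.N .done v 0)
    (howner : s'.N .owner k 0 = E.n)
    (hatom : ∀ u < E.n, ∀ v < E.n, s'.N .atom u 0 = s'.N .atom v 0 ↔
      s.N .atom u 0 = s.N .atom v 0 ∧ (u ∈ S ↔ v ∈ S))
    (hS : Candidate E G (s.piece E r) r (s.storedCuts E k r) S)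
    (hx : G.inducedBoundary (s.piece E r) S < 49 / 100 * E.unit ∨ 4 * E.unit < s.weight E G r) :
    s'.Inv E G c (k + 1) := by
  set C := s.piece E r with hC
  obtain ⟨hSC, hrS, hSne, hcases⟩ := hS
  have hrC : r ∈ C := Store.mem_piece.mpr ⟨hr, hrr⟩
  have hCn : C ⊆ Finset.range E.n := s.piece_subset r
  have hlt : ∀ v ∈ C, v < E.n := fun v hv => (Store.mem_piece.mp hv).1
  have hl := hE.unit_pos
  -- nothing is stored for the piece
  have hempty : s.storedCuts E k r = ∅ := by
    by_contra hne
    obtain ⟨h1, h2⟩ := (h.inv r hr hrr).tight (Finset.nonempty_iff_ne_empty.mpr hne)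
    have h3 := h2 S hSC hSne (fun hc => hrS (hc ▸ hrC))
    rcases hx with hx | hx
    · linarith
    · exact absurd hx (not_lt.mpr h1)
  have hphi : G.inducedBoundary C S < 49 / 100 * E.unit ∨
      (4 * E.unit < s.weight E G r ∧ G.inducedBoundary C S ≤ 101 / 100 * E.lam ∧
        G.inducedBoundary C S < (1 - E.eps) * ∑ v ∈ S, outerWeight E G C v ∧
        G.inducedBoundary C S < (1 - E.eps) * ∑ v ∈ C \ S, outerWeight E G C v) := by
    rcases hcases with h1 | h1 | ⟨h1, _⟩
    · exact Or.inl h1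
    · exact Or.inr h1
    · rcases hx with hx | hx
      · exact Or.inl hx
      · exact absurd hx (not_lt.mpr h1)
  -- When no edge leaves A, no split occurs: A is still a single piece with zero boundary, and a cut
  -- below 0.49 l would contradict the minimum cut.
  have hlp : ¬ ∀ v < E.n, E.lp v = 0 := by
    intro hz
    have hCall : C = Finset.range E.n := by
      refine Finset.Subset.antisymm hCn fun v hv => Store.mem_piece.mpr ⟨Finset.mem_range.mp hv, ?_⟩
      rw [h.whole hz v (Finset.mem_range.mp hv), ← hrr, h.whole hz r hr]
    have hb : ∀ X ⊆ C, ∑ v ∈ X, outerWeight E G C v = 0 := fun X hX =>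
      Finset.sum_eq_zero fun v hv => by
        rw [hCall, outerWeight_range]
        exact hz v (hlt v (hX hv))
    rcases hphi with h1 | ⟨h1, _⟩
    · have h2 := hE.low S (hSC.trans hCn) hSne (fun hc => hrS (hc ▸ hCn hrC))
      rw [sum_outerWeight_of_subset hCn hSC, hb S hSC] at h2
      linarith
    · have : s.weight E G r = 0 := hb C (Finset.Subset.refl _)
      linarith
  have hwhole : E.unit ≤ ∑ v ∈ Finset.range E.n, E.lp v := hE.whole.resolve_right hlp
  -- the new pieces
  obtain ⟨u₀, hu₀⟩ := hSne
  have hu₀n := hlt u₀ (hSC hu₀)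
  set q := s'.N .piece u₀ 0 with hq
  have hqn : q < E.n := (hpiece_le u₀ hu₀n).trans_lt hu₀n
  have hqq : s'.N .piece q 0 = q := hpiece_idem u₀ hu₀n
  obtain ⟨hq1, hq2⟩ := (hpiece q hqn u₀ hu₀n).mp hqq
  have hqS : q ∈ S := hq2.mpr hu₀
  have hqr : s.N .piece q 0 = r := (Store.mem_piece.mp (hSC hqS)).2
  have hqne : q ≠ r := fun hc => hrS (hc ▸ hqS)
  have hmemS : ∀ v ∈ S, s.N .piece v 0 = r := fun v hv => (Store.mem_piece.mp (hSC hv)).2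
  have hroot : ∀ p < E.n, s.N .piece p 0 = p → s'.N .piece p 0 = p := by
    intro p hp hpp
    refine le_antisymm (hpiece_le p hp) ?_
    have hp' : s'.N .piece p 0 < E.n := (hpiece_le p hp).trans_lt hp
    have h1 := ((hpiece _ hp' p hp).mp (hpiece_idem p hp)).1
    have h2 := (h.canon _ hp').1
    rw [h1, hpp] at h2
    exact h2
  -- Labels are least vertices of their classes. As r is not in S, the piece C \ S keeps the root r,
  -- and q, the least vertex of S, is the only new root.
  have hroot' : ∀ p < E.n, s'.N .piece p 0 = p → s.N .piece p 0 = p ∨ p = q := by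
    intro p hp hpp
    rw [or_iff_not_imp_left]
    intro hne
    obtain ⟨h1, h2⟩ := h.canon p hp
    have hp0 : s.N .piece p 0 < E.n := h.piece_lt hp
    have h3 : ¬ (s.N .piece p 0 ∈ S ↔ p ∈ S) := fun hh => by
      have h4 := (hpiece _ hp0 p hp).mpr ⟨h2, hh⟩
      have h5 := hpiece_le _ hp0
      rw [h4, hpp] at h5
      exact hne (le_antisymm h1 h5)
    have hpS : p ∈ S := by
      by_contra hc
      have h4 : s.N .piece p 0 ∈ S := by tauto
      have h5 := hmemS _ h4
      rw [h2] at h5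
      exact hrS (h5 ▸ h4)
    have h6 := (hpiece p hp u₀ hu₀n).mpr ⟨(hmemS p hpS).trans (hmemS u₀ hu₀).symm,
      iff_of_true hpS hu₀⟩
    rw [← hpp, h6]
  have hnotS : ∀ v, s.N .piece v 0 ≠ r → v ∉ S := fun v hv hc => hv (hmemS v hc)
  have hpq : s'.piece E q = S := by
    ext v
    rw [Store.mem_piece]
    constructor
    · rintro ⟨h1, h2⟩
      rw [hq] at h2
      exact ((hpiece v h1 u₀ hu₀n).mp h2).2.mpr hu₀
    · intro hv
      have hvn := hlt v (hSC hv)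
      exact ⟨hvn, (hpiece v hvn u₀ hu₀n).mpr ⟨(hmemS v hv).trans (hmemS u₀ hu₀).symm,
        iff_of_true hv hu₀⟩⟩
  have hrr' := hroot r hr hrr
  have hpr : s'.piece E r = C \ S := by
    ext v
    rw [Store.mem_piece, Finset.mem_sdiff, Store.mem_piece]
    constructor
    · rintro ⟨h1, h2⟩
      obtain ⟨h3, h4⟩ := (hpiece v h1 r hr).mp (h2.trans hrr'.symm)
      exact ⟨⟨h1, h3.trans hrr⟩, fun hc => hrS (h4.mp hc)⟩
    · rintro ⟨⟨h1, h2⟩, h3⟩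
      exact ⟨h1, ((hpiece v h1 r hr).mpr ⟨h2.trans hrr.symm, iff_of_false h3 hrS⟩).trans hrr'⟩
  have hpp' : ∀ p < E.n, s.N .piece p 0 = p → p ≠ r → s'.piece E p = s.piece E p := by
    intro p hp hpp hpr
    have hpS : p ∉ S := hnotS p (by rw [hpp]; exact hpr)
    ext v
    rw [Store.mem_piece, Store.mem_piece]
    refine and_congr_right fun hv => ?_
    have h1 : s'.N .piece v 0 = p ↔ s'.N .piece v 0 = s'.N .piece p 0 := by rw [hroot p hp hpp]
    rw [h1, hpiece v hv p hp, hpp]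
    constructor
    · exact fun hh => hh.1
    · intro hh
      exact ⟨hh, iff_of_false (hnotS v (by rw [hh]; exact hpr)) hpS⟩
  have hown : ∀ p < E.n, p = r ∨ p = q → s'.storedCuts E (k + 1) p = ∅ := by
    intro p hp hpp
    unfold Store.storedCuts
    rw [Finset.image_eq_empty, Finset.filter_eq_empty_iff]
    intro i hi hip
    rcases Nat.lt_succ_iff_lt_or_eq.mp (Finset.mem_range.mp hi) with hi | rfl
    · rw [hn.owner i hi] at hip
      rcases hpp with rfl | rfl
      · have : (s.piece E p).filter (fun v => s.N .stored i v = 1) ∈ s.storedCuts E k p :=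
          Finset.mem_image_of_mem _ (Finset.mem_filter.mpr ⟨Finset.mem_range.mpr hi, hip⟩)
        rw [hempty] at this
        exact absurd this (Finset.notMem_empty _)
      · have := h.owner i hi (hip ▸ hp)
        rw [hip, hqr] at this
        exact hqne this.symm
    · omega
  have hcuts : ∀ p < E.n, s.N .piece p 0 = p → p ≠ r →
      s'.storedCuts E (k + 1) p = s.storedCuts E k p := fun p hp hpp hpr =>
    hn.storedCuts_eq (hpp' p hp hpp hpr) (by omega)
  refine ⟨hn.graph, hn.round, fun v hv => ⟨hpiece_le v hv, hpiece_idem v hv⟩,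
    fun u hu v hv => ?_, fun i hi hin => ?_, fun p hp hd => ?_, fun p hp hpp => ?_, fun _ => ?_,
    fun hz => absurd hz hlp, ?_⟩
  · rw [hatom u hu v hv, hpiece u hu v hv, h.atom u hu v hv, and_assoc, and_assoc]
    refine and_congr_right fun huv => ?_
    rw [and_comm]
    refine and_congr_right fun hSS => ?_
    by_cases hur : s.N .piece u 0 = r
    · have hur' : s'.N .piece u 0 = r ∨ s'.N .piece u 0 = q := by
        by_cases huS : u ∈ S
        · exact Or.inr (Store.mem_piece.mp (hpq ▸ huS : u ∈ s'.piece E q)).2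
        · refine Or.inl (Store.mem_piece.mp (?_ : u ∈ s'.piece E r)).2
          rw [hpr]
          exact Finset.mem_sdiff.mpr ⟨Store.mem_piece.mpr ⟨hu, hur⟩, huS⟩
      rw [hur, hempty, hown _ ((hpiece_le u hu).trans_lt hu) hur']
    · have h1 := (h.canon u hu).2
      have h2 := h.piece_lt hu
      have h3 : u ∈ s'.piece E (s.N .piece u 0) := by
        rw [hpp' _ h2 h1 hur]
        exact Store.mem_piece.mpr ⟨hu, rfl⟩
      rw [(Store.mem_piece.mp h3).2, hcuts _ h2 h1 hur]
  · rcases Nat.lt_succ_iff_lt_or_eq.mp hi with hi | rfl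
    · rw [hn.owner i hi] at hin ⊢
      exact hroot _ hin (h.owner i hi hin)
    · omega
  · rw [hdone p hp] at hd
    exact hroot p hp (h.done p hp hd)
  · by_cases hpr' : p = r
    · rw [hown p hp (Or.inl hpr'), hdone p hp, hpr', hpr]
      exact .initial hE.eps_pos.le hl.le (Finset.mem_sdiff.mpr ⟨hrC, hrS⟩) (not_not.mpr hrd)
    · by_cases hpq' : p = q
      · rw [hown p hp (Or.inr hpq'), hdone p hp, hpq', hpq]
        refine .initial hE.eps_pos.le hl.le hqS fun hd => hqne ?_
        rw [← hqr, h.done q hqn hd]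
      · have hpp0 := (hroot' p hp hpp).resolve_right hpq'
        rw [hpp' p hp hpp0 hpr', hcuts p hp hpp0 hpr', hdone p hp]
        exact h.inv p hp hpp0
  · have hroots : s'.roots E = insert q (s.roots E) := by
      ext p
      simp only [Store.roots, Finset.mem_filter, Finset.mem_range, Finset.mem_insert]
      constructor
      · rintro ⟨h1, h2⟩
        rcases hroot' p h1 h2 with h3 | h3
        · exact Or.inr ⟨h1, h3⟩
        · exact Or.inl h3
      · rintro (rfl | ⟨h1, h2⟩)
        · exact ⟨hqn, hqq⟩
        · exact ⟨h1, hroot p h1 h2⟩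
    have hqroots : q ∉ s.roots E := fun hc =>
      hqne (((Finset.mem_filter.mp hc).2).symm.trans hqr)
    have hrroots : r ∈ s.roots E := Finset.mem_filter.mpr ⟨Finset.mem_range.mpr hr, hrr⟩
    have hold := h.pot hwhole
    rw [hroots, Finset.sum_insert hqroots]
    rw [← Finset.add_sum_erase _ _ hrroots] at hold ⊢
    have hrest : ∑ p ∈ (s.roots E).erase r, potential E.unit E.eps c (s'.weight E G p) =
        ∑ p ∈ (s.roots E).erase r, potential E.unit E.eps c (s.weight E G p) := by
      refine Finset.sum_congr rfl fun p hp => ?_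
      obtain ⟨h1, h2⟩ := Finset.mem_erase.mp hp
      obtain ⟨h3, h4⟩ := Finset.mem_filter.mp h2
      unfold Store.weight
      rw [hpp' p (Finset.mem_range.mp h3) h4 h1]
    rw [hrest]
    have hlow := hE.low' hCn (Or.inl hwhole)
    have w1 : s'.weight E G q = ∑ v ∈ S, outerWeight E G C v + G.inducedBoundary C S := by
      unfold Store.weight
      rw [hpq, sum_outerWeight_of_subset hCn hSC, add_comm]
    have w2 : s'.weight E G r = ∑ v ∈ C \ S, outerWeight E G C v + G.inducedBoundary C S := by
      unfold Store.weight
      rw [hpr, sum_outerWeight_of_subset hCn Finset.sdiff_subset, G.inducedBoundary_sdiff hSC,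
        add_comm]
    have w3 : s.weight E G r = ∑ v ∈ S, outerWeight E G C v + ∑ v ∈ C \ S, outerWeight E G C v := by
      unfold Store.weight
      rw [add_comm]
      exact (Finset.sum_sdiff hSC).symm
    have hlam : 101 / 100 * E.lam = 10201 / 10000 * E.unit := by
      unfold Env.unit
      ring
    have hpot := potential_add_le (c := c) (x := G.inducedBoundary C S)
      (b₁ := ∑ v ∈ S, outerWeight E G C v) (b₂ := ∑ v ∈ C \ S, outerWeight E G C v)
      hl hE.eps_pos hE.eps_le hc
      (by
        have := hlow S hSC ⟨u₀, hu₀⟩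
        linarith)
      (by
        have := hlow (C \ S) Finset.sdiff_subset ⟨r, Finset.mem_sdiff.mpr ⟨hrC, hrS⟩⟩
        rw [G.inducedBoundary_sdiff hSC] at this
        linarith)
      (by
        rw [← w3, ← hlam]
        exact hphi)
    rw [w1, w2]
    rw [w3] at hold
    linarith
  · rcases h.progress with hp | hp
    · left
      have e1 := card_image_lt_of_refines (f := fun v => s.N .piece v 0)
        (g := fun v => s'.N .piece v 0) (A := Finset.range E.n)
        (fun x hx y hy hxy => ((hpiece x (Finset.mem_range.mp hx) y (Finset.mem_range.mp hy)).mp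
          hxy).1) (Finset.mem_range.mpr hqn) (Finset.mem_range.mpr hr) (hqr.trans hrr.symm)
        (fun hc => hqne (hqq.symm.trans (hc.trans hrr')))
      have e2 := card_image_le_of_refines (f := fun v => s.N .atom v 0)
        (g := fun v => s'.N .atom v 0) (A := Finset.range E.n)
        (fun x hx y hy hxy => ((hatom x (Finset.mem_range.mp hx) y (Finset.mem_range.mp hy)).mp
          hxy).1)
      have e3 : ((Finset.range E.n).filter fun v => s'.N .done v 0 ≠ 0) =
          (Finset.range E.n).filter fun v => s.N .done v 0 ≠ 0 :=
        Finset.filter_congr fun v hv => by rw [hdone v (Finset.mem_range.mp hv)]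
      rw [e3]
      omega
    · exact absurd hrd (hp r hr hrr)

end Split

end ArrayLang


namespace ArrayLang

open WeightedGraph

/-! ### The effect of one round and of the main loop -/

section RoundSpec

variable {E : Env} {G : WeightedGraph ℕ} {s s' : Store} {c : ℝ} {k r : ℕ} {S : Finset ℕ}

/-- After `findRoot`, `masses` and `initLengths` the store describes the task. -/
theorem Store.Inv.repr (hI : s.Inv E G c k) (hk : k < 3 * E.n)
    (hr : (findRoot.den E ((Cmd.setAt .owner .round .size).den E s)).N .root 0 0 = r)
    (hrn : r < E.n) (hrr : s.N .piece r 0 = r) :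
    (s.task E G k r).Repr E G (initLengths.den E (masses.den E
      (findRoot.den E ((Cmd.setAt .owner .round .size).den E s)))) := by
  set s₀ := (Cmd.setAt .owner .round .size).den E s with hs₀
  set s₁ := findRoot.den E s₀ with hs₁
  have hround : s.N .round 0 0 = k := hI.round
  have n1 : ∀ z, findRoot.writesN z = false → NVar.owner ≠ z → s₁.N z = s.N z := fun z h1 h2 => by
    rw [hs₁, Cmd.den_N h1, hs₀]
    funext a b
    simp [h2.symm]
  have hg₁ : s₁.HasGraph E G := hI.graph.frame (by rw [hs₁, Cmd.den_R (by decide)]; rfl)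
    (by rw [hs₁, Cmd.den_R (by decide)]; rfl)
  have hC : s₁.piece E r = s.piece E r :=
    piece_congr (fun v _ => by rw [n1 .piece (by decide) (by decide)]) r
  obtain ⟨m1, m2⟩ := masses_spec hg₁
  rw [hr, hC] at m1 m2
  set s₂ := masses.den E s₁ with hs₂
  set s₃ := initLengths.den E s₂ with hs₃
  have n3 : ∀ z, masses.writesN z = false → initLengths.writesN z = false → s₃.N z = s₁.N z :=
    fun z h1 h2 => by rw [hs₃, Cmd.den_N h2, hs₂, Cmd.den_N h1]
  have r3 : ∀ z, initLengths.writesR z = false → s₃.R z = s₂.R z :=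
    fun z h2 => by rw [hs₃, Cmd.den_R h2]
  have e_piece : s₃.N .piece = s.N .piece := by
    rw [n3 _ (by decide) (by decide), n1 _ (by decide) (by decide)]
  have e_root : s₃.N .root 0 0 = r := by rw [n3 _ (by decide) (by decide), hr]
  have e_round : s₃.N .round 0 0 = k := by
    rw [n3 _ (by decide) (by decide), n1 _ (by decide) (by decide), hround]
  have e_owner : ∀ i < k, s₃.N .owner i 0 = s.N .owner i 0 := fun i hi => by
    rw [n3 _ (by decide) (by decide), hs₁, Cmd.den_N (by decide), hs₀]
    simp [hround, hi.ne]
  have e_stored : s₃.N .stored = s.N .stored := by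
    rw [n3 _ (by decide) (by decide), n1 _ (by decide) (by decide)]
  refine ⟨fun v hv => (Store.mem_piece.mp hv).1, fun v hv => ?_, e_root,
    Store.mem_piece.mpr ⟨hrn, hrr⟩, ?_, fun v hv => ?_, ?_, fun v hv => ?_, fun S => ?_⟩
  · rw [e_piece, e_root]
    exact ⟨fun hh => Store.mem_piece.mpr ⟨hv, hh⟩, fun hh => (Store.mem_piece.mp hh).2⟩
  · rw [r3 _ (by decide), hs₂, Cmd.den_R (by decide)]
    exact hg₁.w
  · rw [r3 _ (by decide)]
    exact m1 v (Store.mem_piece.mp hv).1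
  · rw [r3 _ (by decide)]
    exact m2
  · rw [n3 _ (by decide) (by decide), n1 _ (by decide) (by decide)]
    rfl
  · rw [e_round, e_root, e_stored]
    simp only [Store.task, Store.storedCuts, Set.mem_ofPred_eq, Finset.mem_image, Finset.mem_filter,
      Finset.mem_range]
    constructor
    · rintro ⟨i, ⟨h1, h2⟩, rfl⟩
      exact ⟨i, by omega, h1, (e_owner i h1).trans h2, rfl⟩
    · rintro ⟨i, _, h1, h2, rfl⟩
      exact ⟨i, ⟨h1, (e_owner i h1).symm.trans h2⟩, rfl⟩

/-- There are four outcomes: no unfinished piece, no eligible cut, a split, a stored cut.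
Completeness of the search is needed for the second, where no candidate may exist, and for the
fourth, where the stored cut must be the cheapest candidate. -/
theorem Store.Inv.round_step (hE : E.Valid G) (hc : 0 ≤ c) (hI : s.Inv E G c k)
    (hk : k < 3 * E.n) : ((roundCmd.den E s).setN .round 0 0 (k + 1)).Inv E G c (k + 1) := by
  set s₀ := (Cmd.setAt .owner .round .size).den E s with hs₀
  set s₁ := findRoot.den E s₀ with hs₁
  have hround : s.N .round 0 0 = k := hI.round
  have n1 : ∀ z, findRoot.writesN z = false → NVar.owner ≠ z → s₁.N z = s.N z := fun z h1 h2 => by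
    rw [hs₁, Cmd.den_N h1, hs₀]
    funext a b
    simp [h2.symm]
  have o1 : ∀ i, s₁.N .owner i 0 = if i = k then E.n else s.N .owner i 0 := fun i => by
    rw [hs₁, Cmd.den_N (by decide), hs₀]
    simp [hround]
  have hset : ∀ (x : Store) (z : NVar), NVar.round ≠ z →
      (x.setN .round 0 0 (k + 1)).N z = x.N z := fun x z hz => by
    funext a b
    simp [hz.symm]
  have hp0 : s₀.N .piece = s.N .piece := by
    funext a b
    simp [hs₀]
  have hd0 : s₀.N .done = s.N .done := by
    funext a b
    simp [hs₀]
  have hfind := findRoot_spec E s₀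
  rw [← hs₁, hp0, hd0] at hfind
  have hround_cmd : roundCmd.den E s = (Cmd.ite (.lt (.var .root) .size)
      (masses ;; initLengths ;; search ;; act) .skip).den E s₁ := rfl
  rcases hfind with ⟨hrn, hrr, hrd⟩ | ⟨hrn, hall⟩
  swap
  · rw [hround_cmd, Cmd.den_ite_neg _ _ (by simp [hrn]), Cmd.den_skip]
    have e : ∀ z, findRoot.writesN z = false → NVar.owner ≠ z → NVar.round ≠ z →
        (s₁.setN .round 0 0 (k + 1)).N z = s.N z := fun z h1 h2 h3 => by
      rw [hset _ _ h3, n1 z h1 h2]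
    refine hI.idle ⟨hI.graph.frame ?_ ?_, by simp, fun i hi => ?_, fun i _ v _ => ?_⟩
      (fun v _ => by rw [e _ (by decide) (by decide) (by decide)])
      (fun v _ => by rw [e _ (by decide) (by decide) (by decide)])
      (fun v _ => by rw [e _ (by decide) (by decide) (by decide)]) ?_ hall
    · rw [Store.setN_R, hs₁, Cmd.den_R (by decide)]
      rfl
    · rw [Store.setN_R, hs₁, Cmd.den_R (by decide)]
      rfl
    · rw [hset _ _ (by decide), o1, if_neg hi.ne]
    · rw [e _ (by decide) (by decide) (by decide)]
    · rw [hset _ _ (by decide), o1, if_pos rfl]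
  set r := s₁.N .root 0 0 with hr
  have hrepr := hI.repr hk hr.symm hrn hrr
  rw [← hs₀, ← hs₁] at hrepr
  rw [hround_cmd, Cmd.den_ite_pos _ _ (by simpa using hrn)]
  set s₃ := initLengths.den E (masses.den E s₁) with hs₃
  set s₄ := search.den E s₃ with hs₄
  have hden : (masses ;; initLengths ;; search ;; act).den E s₁ = act.den E s₄ := rfl
  rw [hden]
  set C := s.piece E r with hC
  set 𝒩 := s.storedCuts E k r with h𝒩
  have hrC : r ∈ C := Store.mem_piece.mpr ⟨hrn, hrr⟩
  have hlt : ∀ v ∈ C, v < E.n := fun v hv => (Store.mem_piece.mp hv).1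
  have hg₁ : s₁.HasGraph E G := hI.graph.frame (by rw [hs₁, Cmd.den_R (by decide)]; rfl)
    (by rw [hs₁, Cmd.den_R (by decide)]; rfl)
  have hg₂ : (masses.den E s₁).HasGraph E G :=
    hg₁.frame (Cmd.den_R (by decide)) (Cmd.den_R (by decide))
  have hlen : ∀ u ∈ C, ∀ v ∈ C, s₃.R .len u v = (G.w u v)⁻¹ := fun u hu v hv =>
    initLengths_spec hg₂ u (hlt u hu) v (hlt v hv)
  obtain ⟨𝒢, hbest, halt⟩ := search_spec hrepr hE.size hE.lam_pos hlen
  rw [← hs₄] at hbest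
  have hcand : ∀ S, (s.task E G k r).Eligible G E.eps E.lam S ↔ Candidate E G C r 𝒩 S := by
    refine eligible_iff_candidate rfl rfl rfl rfl fun u hu v hv => ?_
    obtain ⟨hu1, hu2⟩ := Store.mem_piece.mp hu
    obtain ⟨hv1, hv2⟩ := Store.mem_piece.mp hv
    have := hI.atom u hu1 v hv1
    rw [hu2, hv2] at this
    simp only [true_and] at this
    exact this
  have n4 : ∀ z, findRoot.writesN z = false → NVar.owner ≠ z → masses.writesN z = false →
      initLengths.writesN z = false → search.writesN z = false → s₄.N z = s.N z :=
    fun z h1 h2 h3 h4 h5 => by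
      rw [hs₄, Cmd.den_N h5, hs₃, Cmd.den_N h4, Cmd.den_N h3, n1 z h1 h2]
  have e_piece : s₄.N .piece = s.N .piece :=
    n4 _ (by decide) (by decide) (by decide) (by decide) (by decide)
  have e_atom : s₄.N .atom = s.N .atom :=
    n4 _ (by decide) (by decide) (by decide) (by decide) (by decide)
  have e_done : s₄.N .done = s.N .done :=
    n4 _ (by decide) (by decide) (by decide) (by decide) (by decide)
  have e_stored : s₄.N .stored = s.N .stored :=
    n4 _ (by decide) (by decide) (by decide) (by decide) (by decide)
  have e_round : s₄.N .round 0 0 = k := by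
    rw [n4 _ (by decide) (by decide) (by decide) (by decide) (by decide), hround]
  have e_owner : ∀ i, s₄.N .owner i 0 = if i = k then E.n else s.N .owner i 0 := fun i => by
    rw [hs₄, Cmd.den_N (by decide), hs₃, Cmd.den_N (by decide), Cmd.den_N (by decide), o1]
  have hrepr₄ : (s.task E G k r).Repr E G s₄ := hrepr.den _ (by decide)
  have e_root : s₄.N .root 0 0 = r := hrepr₄.root
  have e_total : s₄.R .total 0 0 = s.weight E G r := hrepr₄.total
  have hg₄ : s₄.HasGraph E G := by
    have hg₃ : s₃.HasGraph E G := hg₂.frame (Cmd.den_R (by decide)) (Cmd.den_R (by decide))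
    exact hg₃.frame (Cmd.den_R (by decide)) (Cmd.den_R (by decide))
  by_cases hfound : s₄.N .found 0 0 = 1
  swap
  · -- the piece is finished
    have hact : act.den E s₄ = (Cmd.setAt .done .root (.lit 1)).den E s₄ := by
      rw [act, Cmd.den_ite_neg _ _ (by simpa using hfound)]
    rw [hact]
    have hright := halt.resolve_left (fun ⟨S, h1, h2, _⟩ => hfound (hbest.complete S h1 h2).1)
    have e : ∀ z, NVar.done ≠ z → NVar.round ≠ z →
        (((Cmd.setAt .done .root (.lit 1)).den E s₄).setN .round 0 0 (k + 1)).N z = s₄.N z :=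
      fun z h1 h2 => by
        rw [hset _ _ h2]
        funext a b
        simp [h1.symm]
    refine hI.finish ⟨hg₄.frame rfl rfl, by simp, fun i hi => ?_, fun i _ v _ => ?_⟩ hrn hrr hrd
      (fun v _ => by rw [e _ (by decide) (by decide), e_piece])
      (fun v _ => by rw [e _ (by decide) (by decide), e_atom]) (fun v _ => ?_) ?_ hright.1
      (fun S hS => ?_)
    · rw [e _ (by decide) (by decide), e_owner, if_neg hi.ne]
    · rw [e _ (by decide) (by decide), e_stored]
    · rw [hset _ _ (by decide)]
      simp [e_root, e_done]
    · rw [e _ (by decide) (by decide), e_owner, if_pos rfl]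
    · have hel := (hcand S).mpr hS
      exact hfound (hbest.complete S (hright.2 S hel) hel).1
  · obtain ⟨S, hel, hval, hside⟩ := hbest.sound hfound
    have hS := (hcand S).mp hel
    have hsides : ∀ u < E.n, ∀ v < E.n, (s₄.N .best u 0 = s₄.N .best v 0 ↔ (u ∈ S ↔ v ∈ S)) := by
      intro u hu v hv
      obtain ⟨a1, a2⟩ := hside u hu
      obtain ⟨b1, b2⟩ := hside v hv
      rw [← a2, ← b2]
      omega
    have htest : TX.holds E s₄ (.or (.rlt (.var .bestVal) (.mul (.lit (49 / 100)) unit))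
        (.rlt (.mul (.lit 4) unit) (.var .total))) ↔
        (G.inducedBoundary C S < 49 / 100 * E.unit ∨ 4 * E.unit < s.weight E G r) := by
      simp only [unit, TX.holds_or, TX.holds_rlt, RX.eval, RX.eval_var, hval, e_total, Env.unit]
      push_cast
      rfl
    by_cases hx : G.inducedBoundary C S < 49 / 100 * E.unit ∨ 4 * E.unit < s.weight E G r
    · -- the piece is split
      have hact : act.den E s₄ = (refine .atom).den E ((refine .piece).den E s₄) := by
        rw [act, Cmd.den_ite_pos _ _ (by simpa using hfound), Cmd.den_seq,
          Cmd.den_ite_pos _ _ (htest.mpr hx)]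
      rw [hact]
      set s₅ := (refine .piece).den E s₄ with hs₅
      have n6 : ∀ z, (refine .piece).writesN z = false → (refine .atom).writesN z = false →
          NVar.round ≠ z → (((refine .atom).den E s₅).setN .round 0 0 (k + 1)).N z = s₄.N z :=
        fun z h1 h2 h3 => by rw [hset _ _ h3, Cmd.den_N h2, hs₅, Cmd.den_N h1]
      have hpc : ∀ u, (((refine .atom).den E s₅).setN .round 0 0 (k + 1)).N .piece u 0 =
          s₅.N .piece u 0 := fun u => by
        rw [hset _ _ (by decide), Cmd.den_N (by decide)]
      have hle : ∀ u < E.n, s₅.N .piece u 0 ≤ u := fun u hu => (refine_spec (Or.inl rfl) u hu).1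
      have hiff : ∀ u < E.n, ∀ v < E.n, s₅.N .piece u 0 = s₅.N .piece v 0 ↔
          s.N .piece u 0 = s.N .piece v 0 ∧ (u ∈ S ↔ v ∈ S) := fun u hu v hv => by
        rw [hs₅, refine_eq_iff (Or.inl rfl) hu hv, e_piece, hsides u hu v hv]
      refine hI.split hE hc ⟨?_, by simp, fun i hi => ?_, fun i _ v _ => ?_⟩ hrn hrr hrd
        (S := S) (fun u hu v hv => ?_) (fun u hu => ?_) (fun u hu => ?_) (fun v _ => ?_) ?_
        (fun u hu v hv => ?_) hS hx
      · refine hg₄.frame ?_ ?_ <;>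
        · rw [Store.setN_R, Cmd.den_R (by decide), hs₅, Cmd.den_R (by decide)]
      · rw [n6 _ (by decide) (by decide) (by decide), e_owner, if_neg hi.ne]
      · rw [n6 _ (by decide) (by decide) (by decide), e_stored]
      · rw [hpc, hpc, hiff u hu v hv]
      · rw [hpc]
        exact hle u hu
      · rw [hpc, hpc]
        obtain ⟨h1, h2, h3, _⟩ := refine_spec (E := E) (s := s₄) (Or.inl rfl) u hu
        rw [← hs₅] at h1 h2 h3
        rw [hs₅, refine_eq_iff (Or.inl rfl) (h1.trans_lt hu) hu]
        exact ⟨h2, h3⟩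
      · rw [n6 _ (by decide) (by decide) (by decide), e_done]
      · rw [n6 _ (by decide) (by decide) (by decide), e_owner, if_pos rfl]
      · rw [hset _ _ (by decide), refine_eq_iff (Or.inr rfl) hu hv]
        have h1 : s₅.N .atom = s.N .atom := by rw [hs₅, Cmd.den_N (by decide), e_atom]
        have h2 : s₅.N .best = s₄.N .best := by rw [hs₅, Cmd.den_N (by decide)]
        rw [h1, h2, hsides u hu v hv]
    · -- the cut is stored
      have hact : act.den E s₄ = (refine .atom).den E (storeBest.den E s₄) := by
        rw [act, Cmd.den_ite_pos _ _ (by simpa using hfound), Cmd.den_seq,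
          Cmd.den_ite_neg _ _ (fun hh => hx (htest.mp hh))]
      rw [hact]
      push Not at hx
      -- The cut found is the best one and is not below 0.49 l, so the piece has no cut below 0.49 l
      -- and the search was exhaustive.
      have hright := halt.resolve_left (fun ⟨Q, h1, h2, h3⟩ => by
        have h4 := (hbest.complete Q h1 h2).2
        rw [hval] at h4
        exact absurd (h4.trans_lt h3) (not_lt.mpr hx.1))
      obtain ⟨st1, st2, st3, st4⟩ := storeBest_spec E s₄ e_round
      set s₅ := storeBest.den E s₄ with hs₅
      have n6 : ∀ z, (refine .atom).writesN z = false → NVar.round ≠ z →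
          (((refine .atom).den E s₅).setN .round 0 0 (k + 1)).N z = s₅.N z :=
        fun z h2 h3 => by rw [hset _ _ h3, Cmd.den_N h2]
      have n5 : ∀ z, storeBest.writesN z = false → s₅.N z = s₄.N z := fun z hz => Cmd.den_N hz
      refine hI.store hE ⟨?_, by simp, fun i hi => ?_, fun i hi v _ => ?_⟩ hrn hrr hrd
        (S := S) (fun v _ => ?_) (fun v _ => ?_) ?_ (fun v hv => ?_)
        (fun u hu v hv => ?_) hS hright.1 hx.2 (fun Q hQ => ?_)
      · refine hg₄.frame ?_ ?_ <;>
        · rw [Store.setN_R, Cmd.den_R (by decide), hs₅, Cmd.den_R (by decide)]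
      · rw [n6 _ (by decide) (by decide), st2 i hi.ne, e_owner, if_neg hi.ne]
      · rw [n6 _ (by decide) (by decide), st4 i hi.ne, e_stored]
      · rw [n6 _ (by decide) (by decide), n5 _ (by decide), e_piece]
      · rw [n6 _ (by decide) (by decide), n5 _ (by decide), e_done]
      · rw [n6 _ (by decide) (by decide), st1, e_root]
      · rw [n6 _ (by decide) (by decide), st3 v hv]
        exact (hside v hv).2
      · rw [hset _ _ (by decide), refine_eq_iff (Or.inr rfl) hu hv, n5 _ (by decide),
          n5 _ (by decide), e_atom, hsides u hu v hv]
      · have hel := (hcand Q).mpr hQ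
        exact hval.symm.le.trans (hbest.complete Q (hright.2 Q hel) hel).2

theorem inv_init (hE : E.Valid G) :
    ((initCmd.den E ⟨fun _ _ _ => 0, fun _ _ _ => 0⟩).setN .round 0 0 0).Inv E G c 0 := by
  obtain ⟨hg, h0⟩ := initCmd_spec hE.w
  set s := (initCmd.den E ⟨fun _ _ _ => 0, fun _ _ _ => 0⟩).setN .round 0 0 0 with hs
  have hp : ∀ v, s.N .piece v 0 = 0 := fun v => by simpa [hs] using h0 .piece (by tauto) v
  have ha : ∀ v, s.N .atom v 0 = 0 := fun v => by simpa [hs] using h0 .atom (by tauto) v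
  have hd : ∀ v, s.N .done v 0 = 0 := fun v => by simpa [hs] using h0 .done (by tauto) v
  have hcuts : ∀ p, s.storedCuts E 0 p = ∅ := fun p => by simp [Store.storedCuts]
  have hpiece : s.piece E 0 = Finset.range E.n := by
    ext v
    simp [Store.mem_piece, hp]
  refine ⟨hg.frame rfl rfl, by simp [hs], fun v _ => by simp [hp], fun u _ v _ => ?_, by omega,
    fun p _ hpd => absurd (hd p) hpd, fun p hpn hpp => ?_, fun _ => ?_, fun _ v _ => hp v,
    Or.inl (Nat.zero_le _)⟩
  · simp [ha, hp, hcuts]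
  · rw [hcuts]
    have hp0 : p = 0 := hpp.symm.trans (hp p)
    subst hp0
    exact .initial hE.eps_pos.le hE.unit_pos.le (Store.mem_piece.mpr ⟨hpn, hpp⟩)
      (not_not.mpr (hd 0))
  · have hroots : s.roots E = {0} := by
      ext p
      simp only [Store.roots, Finset.mem_filter, Finset.mem_range, Finset.mem_singleton, hp]
      have := hE.pos
      constructor
      · exact fun hh => hh.2.symm
      · rintro rfl
        exact ⟨this, rfl⟩
    rw [hroots, Finset.sum_singleton]
    unfold Store.weight
    rw [hpiece]
    simp only [outerWeight_range, le_refl]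

/-- The state after the main loop. -/
theorem inv_final (hE : E.Valid G) (hc : 0 ≤ c) :
    let s := (Cmd.loop .round rounds roundCmd).den E
      (initCmd.den E ⟨fun _ _ _ => 0, fun _ _ _ => 0⟩)
    s.Inv E G c (3 * E.n) ∧ ∀ p < E.n, s.N .piece p 0 = p → s.N .done p 0 ≠ 0 := by
  intro s
  have key : s.Inv E G c (3 * E.n) := by
    refine loop_induct (E := E) (m := rounds) (I := fun k s' => s'.Inv E G c k) (inv_init hE) ?_
    intro k hk s' _ _ _ ih
    exact ih.round_step hE hc hk
  refine ⟨key, ?_⟩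
  -- Three counts of at most n each that add up to at least 3n are all equal to n; in particular
  -- every vertex is marked as done.
  rcases key.progress with h | h
  · have h1 : ((Finset.range E.n).image fun v => s.N .piece v 0).card ≤ E.n := by
      simpa using Finset.card_image_le (s := Finset.range E.n) (f := fun v => s.N .piece v 0)
    have h2 : ((Finset.range E.n).image fun v => s.N .atom v 0).card ≤ E.n := by
      simpa using Finset.card_image_le (s := Finset.range E.n) (f := fun v => s.N .atom v 0)
    have h3 : ((Finset.range E.n).filter fun v => s.N .done v 0 ≠ 0).card ≤ E.n := by
      simpa using Finset.card_filter_le (Finset.range E.n) fun v => s.N .done v 0 ≠ 0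
    have h4 : ((Finset.range E.n).filter fun v => s.N .done v 0 ≠ 0) = Finset.range E.n :=
      Finset.eq_of_subset_of_card_le (Finset.filter_subset _ _) (by
        rw [Finset.card_range]
        omega)
    intro p hp _
    exact (Finset.mem_filter.mp (h4.symm.subset (Finset.mem_range.mpr hp))).2
  · exact h

end RoundSpec

end ArrayLang


namespace ArrayLang

open WeightedGraph

/-! ### Properties of the computed labels -/

section Final

variable {E : Env} {G : WeightedGraph ℕ} {s : Store} {c : ℝ} {k : ℕ} {S : Finset ℕ}

theorem sum_outerWeight_sub_set {T C X : Finset ℕ} (hC : C ⊆ Finset.range E.n) (hT : T ⊆ C) :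
    ∑ v ∈ X, outerWeight E G T v = ∑ v ∈ X, outerWeight E G C v + G.cut X (C \ T) := by
  have e : Finset.range E.n \ T = (Finset.range E.n \ C) ∪ (C \ T) := by
    ext v
    simp only [Finset.mem_sdiff, Finset.mem_union]
    have h1 := @hC v
    have h2 := @hT v
    tauto
  have hd : Disjoint (Finset.range E.n \ C) (C \ T) :=
    Finset.disjoint_left.mpr fun v h1 h2 => (Finset.mem_sdiff.mp h1).2 (Finset.mem_sdiff.mp h2).1
  unfold outerWeight cut
  rw [← Finset.sum_add_distrib]
  refine Finset.sum_congr rfl fun v _ => ?_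
  rw [e, Finset.sum_union hd]
  ring

theorem Store.Inv.piece_eq_range (hI : s.Inv E G c k) (h : ∀ v < E.n, E.lp v = 0) {p : ℕ}
    (hp : p < E.n) (hpp : s.N .piece p 0 = p) : s.piece E p = Finset.range E.n := by
  ext v
  rw [Store.mem_piece, Finset.mem_range, and_iff_left_iff_imp]
  intro hv
  rw [hI.whole h v hv, ← hpp, hI.whole h p hp]

/-- The label `g` describes a partition that uncrosses `S`. -/
def Uncrosses (E : Env) (G : WeightedGraph ℕ) (S : Finset ℕ) (g : ℕ → ℕ) : Prop :=
  ∀ u < E.n, ∀ Q, Q = (Finset.range E.n).filter (fun v => g v = g u) →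
    ¬ G.cut (S ∩ Q) (Q \ S) < (1 - E.eps) *
      min (∑ v ∈ S ∩ Q, outerWeight E G Q v) (∑ v ∈ Q \ S, outerWeight E G Q v)

/-- The cut that S induces in a piece is no heavier than S, so each finished piece C has a
bipartition into unions of atoms by `PieceInvariant.exists_bipartition`. The sums of masses there,
together with the cut to the other half, are the full weights to the outside of the half. -/
theorem Store.Inv.exists_uncrosses (hE : E.Valid G) (hI : s.Inv E G c k)
    (hd : ∀ p < E.n, s.N .piece p 0 = p → s.N .done p 0 ≠ 0)
    (hx : G.inducedBoundary (Finset.range E.n) S ≤ 101 / 100 * E.lam) :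
    ∃ g : ℕ → ℕ, (∀ u < E.n, ∀ v < E.n, s.N .atom u 0 = s.N .atom v 0 → g u = g v) ∧
      Uncrosses E G S g := by
  classical
  have main : ∀ p, p < E.n ∧ s.N .piece p 0 = p → ∃ T ⊆ s.piece E p,
      InFamily (s.piece E p) (s.storedCuts E k p) T ∧ ∀ Q, Q = T ∨ Q = s.piece E p \ T →
        ¬ G.cut (S ∩ Q) (Q \ S) < (1 - E.eps) *
          min (∑ v ∈ S ∩ Q, outerWeight E G Q v) (∑ v ∈ Q \ S, outerWeight E G Q v) := by
    rintro p ⟨hp, hpp⟩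
    have h1 := hI.inv p hp hpp
    obtain ⟨f1, f2⟩ := h1.final (hd p hp hpp)
    have hlow : (∀ U ⊆ s.piece E p, U.Nonempty →
          E.unit ≤ G.inducedBoundary (s.piece E p) U + ∑ v ∈ U, outerWeight E G (s.piece E p) v) ∨
        ∀ v ∈ s.piece E p, outerWeight E G (s.piece E p) v = 0 := by
      rcases hE.whole with h | h
      · exact Or.inl (hE.low' (Store.piece_subset s p) (Or.inl h))
      · refine Or.inr fun v hv => ?_
        rw [hI.piece_eq_range h hp hpp, outerWeight_range]
        exact h v (Store.mem_piece.mp hv).1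
    obtain ⟨T, hT, hT1, hT2, hT3⟩ := (h1.finish f1 f2 (fin' := True)).exists_bipartition hE.eps_pos
      hE.eps_le hE.unit_pos hE.lp_nonneg hlow (S := S ∩ s.piece E p) Finset.inter_subset_right
      ((G.inducedBoundary_mono (Store.piece_subset s p)).trans hx)
    refine ⟨T, hT, hT1, fun Q hQ => ?_⟩
    have hQC : Q ⊆ s.piece E p := by
      rcases hQ with rfl | rfl
      exacts [hT, Finset.sdiff_subset]
    have hn : G.NonsparseIn (s.piece E p) (outerWeight E G (s.piece E p)) (1 - E.eps) Q
        (S ∩ s.piece E p) := by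
      rcases hQ with rfl | rfl
      exacts [hT2, hT3]
    have e1 : S ∩ s.piece E p ∩ Q = S ∩ Q := by
      rw [Finset.inter_assoc, Finset.inter_eq_right.mpr hQC]
    have e2 : Q \ (S ∩ s.piece E p) = Q \ S := by
      ext v
      have := @hQC v
      simp only [Finset.mem_sdiff, Finset.mem_inter]
      tauto
    unfold NonsparseIn at hn
    rw [e1, e2] at hn
    rwa [sum_outerWeight_sub_set (Store.piece_subset s p) hQC,
      sum_outerWeight_sub_set (Store.piece_subset s p) hQC]
  choose! T hT hT1 hT2 using main
  have hroot : ∀ v < E.n, s.N .piece v 0 < E.n ∧ s.N .piece (s.N .piece v 0) 0 = s.N .piece v 0 :=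
    fun v hv => ⟨(hI.canon v hv).1.trans_lt hv, (hI.canon v hv).2⟩
  -- The quotient of the label by 2 names the piece and its parity the half.
  refine ⟨fun v => 2 * s.N .piece v 0 + if v ∈ T (s.N .piece v 0) then 1 else 0,
    fun u hu v hv huv => ?_, fun u hu Q hQ => ?_⟩
  · obtain ⟨h1, h2⟩ := (hI.atom u hu v hv).mp huv
    have h3 := hT1 _ (hroot u hu)
    have : u ∈ T (s.N .piece u 0) ↔ v ∈ T (s.N .piece u 0) :=
      ⟨fun h => h3 u h v (Store.mem_piece.mpr ⟨hv, h1.symm⟩) h2,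
        fun h => h3 v h u (Store.mem_piece.mpr ⟨hu, rfl⟩) fun N hN => (h2 N hN).symm⟩
    simp only [← h1, this]
  · refine hT2 _ (hroot u hu) Q ?_
    have hsub := @hT _ (hroot u hu)
    by_cases hu' : u ∈ T (s.N .piece u 0)
    · left
      ext v
      have := @hsub v
      simp only [hQ, Finset.mem_filter, Finset.mem_range, hu', if_true, Store.mem_piece] at this ⊢
      refine ⟨fun ⟨_, h2⟩ => ?_, fun h => ⟨(this h).1, by rw [(this h).2, if_pos h]⟩⟩
      have h3 : s.N .piece v 0 = s.N .piece u 0 ∧ v ∈ T (s.N .piece v 0) := by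
        split_ifs at h2 with h
        · exact ⟨by omega, h⟩
        · omega
      exact h3.1 ▸ h3.2
    · right
      ext v
      simp only [hQ, Finset.mem_filter, Finset.mem_range, hu', if_false, Finset.mem_sdiff,
        Store.mem_piece]
      refine ⟨fun ⟨h1, h2⟩ => ?_, fun ⟨⟨h1, h2⟩, h3⟩ => ⟨h1, by rw [h2, if_neg h3]⟩⟩
      have h3 : s.N .piece v 0 = s.N .piece u 0 ∧ v ∉ T (s.N .piece v 0) := by
        split_ifs at h2 with h
        · omega
        · exact ⟨by omega, h⟩
      exact ⟨⟨h1, h3.1⟩, h3.1 ▸ h3.2⟩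

/-- The bound for the number of stored cuts of a piece. -/
noncomputable def cutBound (n : ℕ) (ε : ℝ) : ℝ :=
  (800 * (31 * Real.log (n + 1)) + 2) ^ 31 * (16 / ε * (31 * Real.log (n + 1)) + 2) ^ 2

theorem cutBound_nonneg (n : ℕ) {ε : ℝ} : 0 ≤ cutBound n ε := by
  have : 0 ≤ Real.log ((n : ℝ) + 1) := Real.log_nonneg (by linarith [Nat.cast_nonneg (α := ℝ) n])
  unfold cutBound
  positivity

/-- An edge between different atoms leaves its piece or is cut by a stored cut. The constant c is
chosen such that c/50 times the boundary x ≥ l of a piece pays for x and for at most M stored cuts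
of weight 1.03 l, each counted in both orders; the potential then transfers the charge to ∂A. -/
theorem Store.Inv.sum_atom_le (hE : E.Valid G)
    (hI : s.Inv E G (50 * (1 + 103 / 50 * cutBound E.n E.eps)) k) :
    ∑ v ∈ Finset.range E.n, E.lp v + ∑ u ∈ Finset.range E.n, ∑ v ∈ Finset.range E.n,
      (if s.N .atom u 0 = s.N .atom v 0 then 0 else G.w u v) ≤
    4 * (50 * (1 + 103 / 50 * cutBound E.n E.eps)) / E.eps * ∑ v ∈ Finset.range E.n, E.lp v := by
  classical
  set M := cutBound E.n E.eps with hM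
  have hM0 : 0 ≤ M := cutBound_nonneg _
  have hl := hE.unit_pos
  rcases hE.whole with h | h
  · refine le_trans ?_ ((hI.pot h).trans (potential_le hE.eps_pos hE.eps_le (by positivity)
      (Finset.sum_nonneg fun v _ => hE.lp_nonneg v) hl))
    rw [← Finset.sum_add_distrib, ← Finset.sum_fiberwise_of_maps_to (s := Finset.range E.n)
      (t := s.roots E) (g := fun v => s.N .piece v 0)]
    swap
    · intro v hv
      have hv' := Finset.mem_range.mp hv
      exact Finset.mem_filter.mpr ⟨Finset.mem_range.mpr ((hI.canon v hv').1.trans_lt hv'),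
        (hI.canon v hv').2⟩
    refine Finset.sum_le_sum fun p hp => ?_
    obtain ⟨hpn, hpp⟩ := Finset.mem_filter.mp hp
    have hinv := hI.inv p (Finset.mem_range.mp hpn) hpp
    have hlow := hE.low' (Store.piece_subset s p) (Or.inl h)
    set C := s.piece E p with hC
    set 𝒩 := s.storedCuts E k p with h𝒩
    have hw : E.unit ≤ s.weight E G p := by
      simpa [inducedBoundary, Store.weight] using hlow C subset_rfl ⟨p, hinv.root⟩
    have hcard : (𝒩.card : ℝ) ≤ M := by
      refine hinv.card_le hE.eps_pos hl hE.lp_nonneg hlow ?_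
      have : C.card ≤ E.n := by simpa using Finset.card_le_card (Store.piece_subset s p)
      gcongr
    refine le_trans ?_ (le_potential hE.eps_pos (by positivity) hw)
    have hu : ∀ u ∈ C, E.lp u + ∑ v ∈ Finset.range E.n,
        (if s.N .atom u 0 = s.N .atom v 0 then 0 else G.w u v) ≤
        outerWeight E G C u + ∑ N ∈ 𝒩, ∑ v ∈ C, if (u ∈ N ↔ v ∈ N) then 0 else G.w u v := by
      intro u hu
      rw [← Finset.sum_sdiff (Store.piece_subset s p), ← hC, Finset.sum_comm (s := 𝒩)]
      unfold outerWeight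
      have h1 : ∑ v ∈ Finset.range E.n \ C,
          (if s.N .atom u 0 = s.N .atom v 0 then 0 else G.w u v) ≤
          ∑ v ∈ Finset.range E.n \ C, G.w u v :=
        Finset.sum_le_sum fun v _ => by
          split_ifs
          exacts [G.nonneg _ _, le_rfl]
      have h2 : ∑ v ∈ C, (if s.N .atom u 0 = s.N .atom v 0 then 0 else G.w u v) ≤
          ∑ v ∈ C, ∑ N ∈ 𝒩, if (u ∈ N ↔ v ∈ N) then 0 else G.w u v := by
        refine Finset.sum_le_sum fun v hv => ?_
        have hnn : ∀ N ∈ 𝒩, 0 ≤ if (u ∈ N ↔ v ∈ N) then 0 else G.w u v := fun N _ => by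
          split_ifs
          exacts [le_rfl, G.nonneg _ _]
        split_ifs with hat
        · exact Finset.sum_nonneg hnn
        · obtain ⟨hu1, hu2⟩ := Store.mem_piece.mp hu
          obtain ⟨hv1, hv2⟩ := Store.mem_piece.mp hv
          rw [hI.atom u hu1 v hv1, hu2, hv2] at hat
          simp only [true_and, not_forall] at hat
          obtain ⟨N, hN, hN'⟩ := hat
          refine le_trans ?_ (Finset.single_le_sum hnn hN)
          rw [if_neg hN']
      linarith
    calc _ ≤ ∑ u ∈ C, (outerWeight E G C u +
            ∑ N ∈ 𝒩, ∑ v ∈ C, if (u ∈ N ↔ v ∈ N) then 0 else G.w u v) := Finset.sum_le_sum hu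
      _ = s.weight E G p + ∑ N ∈ 𝒩, 2 * G.inducedBoundary C N := by
          rw [Finset.sum_add_distrib, Finset.sum_comm (s := C)]
          congr 1
          exact Finset.sum_congr rfl fun N hN =>
            (G.two_mul_inducedBoundary (hinv.stored N hN).1).symm
      _ ≤ s.weight E G p + ∑ N ∈ 𝒩, 103 / 50 * E.unit := by
          refine add_le_add_right (Finset.sum_le_sum fun N hN => ?_) _
          have := (hinv.stored N hN).2.2.1
          linarith
      _ ≤ 50 * (1 + 103 / 50 * M) / 50 * s.weight E G p := by
          rw [Finset.sum_const, nsmul_eq_mul]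
          have : (𝒩.card : ℝ) * (103 / 50 * E.unit) ≤ M * (103 / 50 * s.weight E G p) := by gcongr
          linarith
  -- For A = V nothing can have been stored, as stored cuts have positive mass; so there is a single
  -- atom and both sides vanish.
  · have h0 : ∑ v ∈ Finset.range E.n, E.lp v = 0 :=
      Finset.sum_eq_zero fun v hv => h v (Finset.mem_range.mp hv)
    rw [h0, zero_add, mul_zero]
    refine (Finset.sum_eq_zero fun u hu => Finset.sum_eq_zero fun v hv => if_pos ?_).le
    rw [Finset.mem_range] at hu hv
    rw [hI.atom u hu v hv, hI.whole h u hu, hI.whole h v hv]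
    refine ⟨rfl, fun N hN => ?_⟩
    have hC := hI.piece_eq_range h hE.pos (hI.whole h 0 hE.pos)
    obtain ⟨a1, _, _, a4⟩ := (hI.inv 0 hE.pos (hI.whole h 0 hE.pos)).stored N hN
    rw [hC] at a1 a4
    rw [Finset.sum_eq_zero fun v hv => by
      rw [outerWeight_range, h v (Finset.mem_range.mp (a1 hv))]] at a4
    have := mul_pos (half_pos hE.eps_pos) hl
    linarith

/-- The labels that the algorithm computes. -/
noncomputable def Env.label (E : Env) (v : ℕ) : ℕ :=
  (decomposition.den E ⟨fun _ _ _ => 0, fun _ _ _ => 0⟩).N .comp v 0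

/-- Components refine atoms, so groups of atoms are groups of components; and no edge inside an atom
joins two components, so the boundary sum does not grow. For λ̃ ≤ 0 the main loop is skipped and
there is one atom. -/
theorem label_spec (hε : 0 < E.eps) (hε1 : E.eps ≤ 1 / 100)
    (hlp : ∀ v, 0 ≤ E.lp v) (hw : ∀ u < E.n, ∀ v < E.n, E.w u v = G.w u v)
    (hE : 0 < E.lam → E.Valid G) :
    (∀ u < E.n, ∀ v < E.n, E.label u = E.label v → Relation.EqvGen
      (fun x y => x < E.n ∧ y < E.n ∧ E.label x = E.label y ∧ 0 < G.w x y) u v) ∧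
    (∀ S ⊆ Finset.range E.n, G.inducedBoundary (Finset.range E.n) S ≤ 101 / 100 * E.lam →
      ∃ g : ℕ → ℕ, (∀ u < E.n, ∀ v < E.n, E.label u = E.label v → g u = g v) ∧
        Uncrosses E G S g) ∧
    ∑ v ∈ Finset.range E.n, E.lp v + ∑ u ∈ Finset.range E.n, ∑ v ∈ Finset.range E.n,
      (if E.label u = E.label v then 0 else G.w u v) ≤
    4 * (50 * (1 + 103 / 50 * cutBound E.n E.eps)) / E.eps * ∑ v ∈ Finset.range E.n, E.lp v := by
  have hM0 : 0 ≤ cutBound E.n E.eps := cutBound_nonneg _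
  obtain ⟨s, hs, hlab, hsum, hunc⟩ : ∃ s : Store, s.HasGraph E G ∧
      (∀ v, E.label v = (components.den E s).N .comp v 0) ∧
      (∑ v ∈ Finset.range E.n, E.lp v + ∑ u ∈ Finset.range E.n, ∑ v ∈ Finset.range E.n,
        (if s.N .atom u 0 = s.N .atom v 0 then 0 else G.w u v) ≤
        4 * (50 * (1 + 103 / 50 * cutBound E.n E.eps)) / E.eps *
          ∑ v ∈ Finset.range E.n, E.lp v) ∧
      (0 < E.lam → ∀ S, G.inducedBoundary (Finset.range E.n) S ≤ 101 / 100 * E.lam →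
        ∃ g : ℕ → ℕ, (∀ u < E.n, ∀ v < E.n, s.N .atom u 0 = s.N .atom v 0 → g u = g v) ∧
          Uncrosses E G S g) := by
    obtain ⟨i1, i2⟩ := initCmd_spec hw
    by_cases hlam : 0 < E.lam
    · obtain ⟨h1, h2⟩ := inv_final (hE hlam)
        (show 0 ≤ 50 * (1 + 103 / 50 * cutBound E.n E.eps) by positivity)
      refine ⟨_, h1.graph, fun v => ?_, h1.sum_atom_le (hE hlam),
        fun _ S hS => h1.exists_uncrosses (hE hlam) h2 hS⟩
      rw [Env.label, decomposition, Cmd.den_seq, Cmd.den_seq, Cmd.den_ite_pos]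
      simpa using hlam
    · refine ⟨_, i1, fun v => ?_, ?_, fun h => absurd h hlam⟩
      · rw [Env.label, decomposition, Cmd.den_seq, Cmd.den_seq, Cmd.den_ite_neg, Cmd.den_skip]
        simpa using hlam
      · rw [Finset.sum_eq_zero (f := fun u => ∑ v ∈ Finset.range E.n, _) fun u _ =>
          Finset.sum_eq_zero fun v _ => if_pos (by simp [i2]), add_zero]
        refine le_mul_of_one_le_left (Finset.sum_nonneg fun v _ => hlp v) ?_
        rw [le_div_iff₀ hε]
        linarith
  obtain ⟨c1, c2⟩ := components_spec hs
  simp only [← hlab] at c1 c2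
  have hatom : ∀ u v, Relation.EqvGen (AtomEdge E G s) u v → s.N .atom u 0 = s.N .atom v 0 := by
    intro u v h
    induction h with
    | rel x y h => exact h.2.2.1
    | refl => rfl
    | symm _ _ _ ih => exact ih.symm
    | trans _ _ _ _ _ ih₁ ih₂ => exact ih₁.trans ih₂
  have hconn : ∀ u < E.n, ∀ v < E.n, E.label u = E.label v → Relation.EqvGen
      (fun x y => x < E.n ∧ y < E.n ∧ E.label x = E.label y ∧ 0 < G.w x y) u v :=
    fun u hu v hv huv => Relation.EqvGen.mono (fun x y (h : AtomEdge E G s x y) =>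
      ⟨h.1, h.2.1, c1 x h.1 y h.2.1 h.2.2.1 h.2.2.2, h.2.2.2⟩) u v (c2 u hu v hv huv)
  refine ⟨hconn, fun S hSn hS => ?_, le_trans ?_ hsum⟩
  · by_cases hlam : 0 < E.lam
    · obtain ⟨g, hg, hg'⟩ := hunc hlam S hS
      exact ⟨g, fun u hu v hv huv => hg u hu v hv (hatom u v (c2 u hu v hv huv)), hg'⟩
    · refine ⟨E.label, fun _ _ _ _ h => h, fun u hu Q hQ => not_lt.mpr ?_⟩
      -- No edge crosses S, so each component lies on one side of S and one of the two terms in the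
      -- minimum is zero.
      have h0 : G.inducedBoundary (Finset.range E.n) S ≤ 0 := by linarith
      have hedge : ∀ x y, Relation.EqvGen
          (fun x y => x < E.n ∧ y < E.n ∧ E.label x = E.label y ∧ 0 < G.w x y) x y →
          (x ∈ S ↔ y ∈ S) := by
        have key : ∀ x y, y < E.n → 0 < G.w x y → x ∈ S → y ∈ S := by
          intro x y hy hxy hx
          by_contra hyS
          have h1 : G.w x y ≤ ∑ v ∈ Finset.range E.n \ S, G.w x v :=
            Finset.single_le_sum (fun v _ => G.nonneg x v)
              (Finset.mem_sdiff.mpr ⟨Finset.mem_range.mpr hy, hyS⟩)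
          have h2 : ∑ v ∈ Finset.range E.n \ S, G.w x v ≤
              G.inducedBoundary (Finset.range E.n) S :=
            Finset.single_le_sum (f := fun x => ∑ v ∈ Finset.range E.n \ S, G.w x v)
              (fun v _ => Finset.sum_nonneg fun _ _ => G.nonneg _ _) hx
          linarith
        intro x y h
        induction h with
        | rel x y h => exact ⟨key x y h.2.1 h.2.2.2, key y x h.1 (G.symm x y ▸ h.2.2.2)⟩
        | refl => rfl
        | symm _ _ _ ih => exact ih.symm
        | trans _ _ _ _ _ ih₁ ih₂ => exact ih₁.trans ih₂
      refine le_trans (mul_nonpos_of_nonneg_of_nonpos (by linarith) ?_) (G.cut_nonneg _ _)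
      have hQ' : ∀ v ∈ Q, (u ∈ S ↔ v ∈ S) := fun v hv => by
        rw [hQ, Finset.mem_filter, Finset.mem_range] at hv
        exact hedge u v (hconn u hu v hv.1 hv.2.symm)
      by_cases huS : u ∈ S
      · refine (min_le_right _ _).trans (Finset.sum_eq_zero fun v hv => ?_).le
        obtain ⟨h1, h2⟩ := Finset.mem_sdiff.mp hv
        exact absurd ((hQ' v h1).mp huS) h2
      · refine (min_le_left _ _).trans (Finset.sum_eq_zero fun v hv => ?_).le
        obtain ⟨h1, h2⟩ := Finset.mem_inter.mp hv
        exact absurd ((hQ' v h2).mpr h1) huS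
  · gcongr with u hu v hv
    rw [Finset.mem_range] at hu hv
    split_ifs with h1 h2 h2
    · exact le_rfl
    · exact G.nonneg _ _
    · by_contra hc
      exact h1 (c1 u hu v hv h2 (not_le.mp hc))
    · exact le_rfl

end Final

end ArrayLang


namespace WeightedGraph

/-! ### From labels to partitions -/

section Fibers

variable {V : Type*} [DecidableEq V] {A B : Finset V} {F : V → ℕ} {u v : V}

open Classical in
/-- The partition of `A` into the fibers of `F`. -/
noncomputable def fibers {β : Type*} [DecidableEq β] (F : β → ℕ) (A : Finset β) :
    Finpartition A :=
  Finpartition.ofSetSetoid (Setoid.ker F) A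

theorem mem_fibers : B ∈ (fibers F A).parts ↔ ∃ u ∈ A, (A.filter fun v => F v = F u) = B := by
  classical
  simp only [fibers, Finpartition.ofSetSetoid_parts, Finset.mem_image]
  refine exists_congr fun u => and_congr_right fun _ => ?_
  have : A.filter ((Setoid.ker F) u) = A.filter fun v => F v = F u :=
    Finset.filter_congr fun v _ => eq_comm
  rw [this]

theorem fibers_part_eq_iff (hu : u ∈ A) (hv : v ∈ A) :
    (fibers F A).part u = (fibers F A).part v ↔ F u = F v := by
  simp only [Finset.ext_iff, fibers, Finpartition.mem_part_ofSetSetoid_iff_rel, hu, hv, true_and]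
  refine ⟨fun h => ?_, fun h b => and_congr_right fun _ => ?_⟩
  · exact (((h u).mp ⟨hu, rfl⟩).2 : F v = F u).symm
  · change F u = F b ↔ F v = F b
    rw [h]

/-- A coarser labelling groups the fibers. -/
theorem exists_grouping {g : V → ℕ} (hg : ∀ u ∈ A, ∀ v ∈ A, F u = F v → g u = g v) :
    ∃ 𝒢 : Finpartition (fibers F A).parts, ∀ Q ∈ 𝒢.parts, ∃ u ∈ A,
      Q.sup id = A.filter fun v => g v = g u := by
  classical
  -- The label g of an arbitrary element of a part; by hypothesis it does not depend on the element.
  -- The value 0 at the empty set is never used, as parts are nonempty.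
  set Γ : Finset V → ℕ := fun B => if h : B.Nonempty then g h.choose else 0 with hΓ
  have key : ∀ u ∈ A, Γ (A.filter fun v => F v = F u) = g u := by
    intro u hu
    have h : (A.filter fun v => F v = F u).Nonempty := ⟨u, by simpa using hu⟩
    obtain ⟨h1, h2⟩ := Finset.mem_filter.mp h.choose_spec
    rw [hΓ]
    simp only [dif_pos h]
    exact hg _ h1 u hu h2
  refine ⟨fibers Γ _, fun Q hQ => ?_⟩
  simp only [fibers, Finpartition.ofSetSetoid_parts, Finset.mem_image] at hQ
  obtain ⟨_, ⟨u, hu, rfl⟩, rfl⟩ := hQ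
  have e : ∀ u, (A.filter fun v => (Setoid.ker F).r u v) = A.filter fun v => F v = F u :=
    fun u => Finset.filter_congr fun v _ => eq_comm
  refine ⟨u, hu, ?_⟩
  ext v
  simp only [Finset.mem_sup, Finset.mem_filter, Finset.mem_image, id]
  constructor
  · rintro ⟨_, ⟨⟨x, hx, rfl⟩, h1⟩, hv⟩
    have h2 : Γ (A.filter fun v => (Setoid.ker F).r u v) = Γ _ := h1
    rw [e, e, key u hu, key x hx] at h2
    obtain ⟨h3, h4⟩ := Finset.mem_filter.mp hv
    exact ⟨h3, (hg x hx v h3 h4).symm.trans h2.symm⟩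
  · rintro ⟨hv, h⟩
    refine ⟨_, ⟨⟨v, hv, rfl⟩, ?_⟩, Finset.mem_filter.mpr ⟨hv, rfl⟩⟩
    change Γ _ = Γ _
    rw [e, e, key u hu, key v hv, h]

variable {G : WeightedGraph V}

/-- All edges that do not have both ends in B are deleted. Then B cannot be left, and the chains of
edges between equally labelled vertices stay inside B and connect it. -/
theorem isComponent_of_eqvGen (hu : u ∈ B) (h : ∀ v ∈ B,
    Relation.EqvGen (fun x y => x ∈ A ∧ y ∈ A ∧ F x = F y ∧ 0 < G.w x y) u v)
    (hB : B = A.filter fun v => F v = F u) : G.IsComponent B := by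
  set H := G.graph.deleteEdges {e | ¬ ∀ x ∈ e, x ∈ B} with hH
  have hadj : ∀ x y, H.Adj x y ↔ 0 < G.w x y ∧ x ∈ B ∧ y ∈ B := fun x y => by
    rw [hH, SimpleGraph.deleteEdges_adj]
    simp [graph]
  refine ⟨_, H.connectedComponentMk u, ?_⟩
  ext v
  rw [SimpleGraph.ConnectedComponent.mem_supp_iff, SimpleGraph.ConnectedComponent.eq,
    Finset.mem_coe]
  constructor
  · intro hv
    rw [SimpleGraph.reachable_comm, SimpleGraph.reachable_iff_reflTransGen] at hv
    induction hv with
    | refl => exact hu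
    | tail _ h _ => exact ((hadj _ _).mp h).2.2
  · intro hv
    have key : ∀ x y, Relation.EqvGen (fun x y => x ∈ A ∧ y ∈ A ∧ F x = F y ∧ 0 < G.w x y) x y →
        F x = F y ∧ (F x = F u → H.Reachable x y) := by
      intro x y hxy
      induction hxy with
      | rel x y h =>
        refine ⟨h.2.2.1, fun hx => SimpleGraph.Adj.reachable ((hadj x y).mpr ⟨h.2.2.2, ?_⟩)⟩
        rw [hB, Finset.mem_filter, Finset.mem_filter]
        exact ⟨⟨h.1, hx⟩, h.2.1, h.2.2.1.symm.trans hx⟩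
      | refl => exact ⟨rfl, fun _ => SimpleGraph.Reachable.rfl⟩
      | symm _ _ _ ih => exact ⟨ih.1.symm, fun hx => (ih.2 (ih.1.trans hx)).symm⟩
      | trans _ _ _ _ _ ih₁ ih₂ =>
        exact ⟨ih₁.1.trans ih₂.1, fun hx => (ih₁.2 hx).trans (ih₂.2 (ih₁.1.symm.trans hx))⟩
    exact ((key u v (h v hv)).2 rfl).symm

variable [Fintype V]

/-- The self-loops restore the degrees of G, so the volume of a set of vertices does not depend on
the surrounding set and is monotone. -/
theorem isStrong_of_subset {δ s : ℝ} (h : B ⊆ A) (hA : G.IsStrong δ s A) : G.IsStrong δ s B := by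
  have hvol : ∀ C X : Finset V, G.volIn C X = ∑ v ∈ X, ∑ u, G.w v u := fun C X =>
    Finset.sum_congr rfl fun v _ => Finset.sum_add_sum_compl C _
  have hmono : ∀ X Y : Finset V, X ⊆ Y → G.volIn B X ≤ G.volIn A Y := fun X Y hXY => by
    rw [hvol, hvol]
    exact Finset.sum_le_sum_of_subset_of_nonneg hXY fun v _ _ =>
      Finset.sum_nonneg fun u _ => G.nonneg v u
  intro S h1 h2 h3
  exact (min_le_min (hmono _ _ (Finset.inter_subset_inter_left h))
    (hmono _ _ (Finset.sdiff_subset_sdiff h subset_rfl))).trans (hA S h1 h2 h3)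

/-- The boundary of A is counted once, and an edge between two parts once from each of them, as in
the sum over ordered pairs. -/
theorem sum_boundary_fibers : ∑ B ∈ (fibers F A).parts, G.boundary B =
    G.boundary A + ∑ u ∈ A, ∑ v ∈ A, if F u = F v then 0 else G.w u v := by
  have h := Finset.sum_biUnion (s := (fibers F A).parts) (t := id)
    (f := fun u => ∑ v ∈ Aᶜ, G.w u v + ∑ v ∈ A, if F u = F v then 0 else G.w u v)
    (fibers F A).disjoint
  rw [(fibers F A).biUnion_parts, Finset.sum_add_distrib] at h
  unfold boundary cut
  rw [h]
  refine Finset.sum_congr rfl fun B hB => Finset.sum_congr rfl fun u hu => ?_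
  obtain ⟨x, _, rfl⟩ := mem_fibers.mp hB
  have hu' := (Finset.mem_filter.mp hu).2
  rw [Finset.sum_ite, Finset.sum_const_zero, zero_add, ← Finset.sum_union
    (Finset.disjoint_left.mpr fun v h1 h2 =>
      (Finset.mem_compl.mp h1) (Finset.mem_filter.mp h2).1)]
  refine Finset.sum_congr ?_ fun _ _ => rfl
  ext v
  simp only [Finset.mem_compl, Finset.mem_filter, Finset.mem_union, hu']
  tauto

end Fibers

/-! ### Transfer from the numbers of the vertices to the vertices -/

section Enumeration

variable {V : Type*} [DecidableEq V] (G : WeightedGraph V) {n : ℕ} {ι : ℕ → V} {A : Finset V}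

/-- The graph on the numbers of vertices. -/
noncomputable def pull (n : ℕ) (ι : ℕ → V) : WeightedGraph ℕ where
  w i j := if i < n ∧ j < n then G.w (ι i) (ι j) else 0
  symm i j := by simp only [G.symm (ι i), and_comm]
  nonneg i j := by
    split_ifs
    exacts [G.nonneg _ _, le_rfl]
  loopless i := by simp [G.loopless]

theorem sum_image_enum (hι : Set.InjOn ι (Finset.range n)) {X : Finset ℕ} (hX : X ⊆ Finset.range n)
    (f : V → ℝ) : ∑ v ∈ X.image ι, f v = ∑ i ∈ X, f (ι i) :=
  Finset.sum_image fun _ hi _ hj h => hι (hX hi) (hX hj) h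

theorem cut_pull (hι : Set.InjOn ι (Finset.range n)) {X Y : Finset ℕ} (hX : X ⊆ Finset.range n)
    (hY : Y ⊆ Finset.range n) : (G.pull n ι).cut X Y = G.cut (X.image ι) (Y.image ι) := by
  unfold cut
  rw [sum_image_enum hι hX]
  refine Finset.sum_congr rfl fun i hi => ?_
  rw [sum_image_enum hι hY]
  exact Finset.sum_congr rfl fun j hj =>
    if_pos ⟨Finset.mem_range.mp (hX hi), Finset.mem_range.mp (hY hj)⟩

variable [Fintype V]

/-- The input of the algorithm. -/
noncomputable def env (A : Finset V) (ι : ℕ → V) (ε lam : ℝ) : ArrayLang.Env where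
  n := A.card
  L := A.card.size
  w := (G.pull A.card ι).w
  lp i := if i < A.card then G.loopWeight A (ι i) else 0
  eps := ε
  lam := lam

variable {G} {ε lam : ℝ}

open ArrayLang

theorem env_lp_nonneg (v : ℕ) : 0 ≤ (G.env A ι ε lam).lp v := by
  simp only [env]
  split_ifs
  exacts [Finset.sum_nonneg fun _ _ => G.nonneg _ _, le_rfl]

theorem sum_outerWeight_env (hι : Set.InjOn ι (Finset.range A.card))
    (hA : (Finset.range A.card).image ι = A) {X Q : Finset ℕ} (hX : X ⊆ Finset.range A.card)
    (hQ : Q ⊆ Finset.range A.card) :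
    ∑ v ∈ X, outerWeight (G.env A ι ε lam) (G.pull A.card ι) Q v =
      G.cut (X.image ι) (Q.image ι)ᶜ := by
  have e : (Q.image ι)ᶜ = Aᶜ ∪ (Finset.range A.card \ Q).image ι := by
    rw [Finset.image_sdiff_of_injOn hι hQ, hA]
    have := hA ▸ Finset.image_subset_image (f := ι) hQ
    ext v
    have := @this v
    simp only [Finset.mem_compl, Finset.mem_union, Finset.mem_sdiff]
    tauto
  have hd : Disjoint Aᶜ ((Finset.range A.card \ Q).image ι) :=
    Finset.disjoint_left.mpr fun v h1 h2 => Finset.mem_compl.mp h1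
      (hA ▸ Finset.image_subset_image Finset.sdiff_subset h2)
  rw [e, cut_union_right _ _ hd, ← cut_pull G hι hX Finset.sdiff_subset]
  unfold cut outerWeight
  rw [sum_image_enum hι hX, ← Finset.sum_add_distrib]
  refine Finset.sum_congr rfl fun i hi => ?_
  simp [env, loopWeight, Finset.mem_range.mp (hX hi)]

theorem sum_lp_env (hι : Set.InjOn ι (Finset.range A.card))
    (hA : (Finset.range A.card).image ι = A) :
    ∑ v ∈ Finset.range A.card, (G.env A ι ε lam).lp v = G.boundary A := by
  have := sum_outerWeight_env (G := G) (ε := ε) (lam := lam) hι hA subset_rfl subset_rfl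
  rw [hA] at this
  simpa [outerWeight, env, boundary] using this

theorem minCut_le_boundary {U : Finset V} (h : U.Nonempty) (h' : U ≠ Finset.univ) :
    G.minCut ≤ G.boundary U :=
  csInf_le ⟨0, by rintro x ⟨S, _, _, rfl⟩; exact G.cut_nonneg _ _⟩ ⟨U, h, h', rfl⟩

/-- The only place where λ̃ ≤ 1.01 λ is used: it makes λ̃/1.01 a lower bound for the boundary of
every nonempty proper subset of V. Proper subsets of A are proper in V; A itself need not be, which
leads to the two alternatives for the whole set. -/
theorem env_valid (hι : Set.InjOn ι (Finset.range A.card))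
    (hA : (Finset.range A.card).image ι = A) (hne : A.Nonempty) (hε : 0 < ε) (hε1 : ε ≤ 0.01)
    (hlam : lam ≤ 1.01 * G.minCut) (h0 : 0 < lam) :
    (G.env A ι ε lam).Valid (G.pull A.card ι) := by
  have hunit : ∀ U : Finset V, U.Nonempty → U ≠ Finset.univ →
      (G.env A ι ε lam).unit ≤ G.boundary U := fun U h h' => by
    refine le_trans ?_ (minCut_le_boundary h h')
    unfold Env.unit
    rw [div_le_iff₀ (by norm_num)]
    refine hlam.trans (le_of_eq ?_)
    ring
  refine ⟨Finset.card_pos.mpr hne, rfl, h0, hε, hε1.trans (by norm_num), env_lp_nonneg,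
    fun _ _ _ _ => rfl, fun U hU hUne hUn => ?_, ?_⟩
  · rw [sum_outerWeight_env hι hA hU hU]
    refine hunit _ (hUne.image _) fun hc => ?_
    have h1 : U ⊂ Finset.range A.card := Finset.ssubset_iff_subset_ne.mpr ⟨hU, hUn⟩
    have h2 := Finset.card_lt_card h1
    have h3 : (U.image ι).card ≤ U.card := Finset.card_image_le
    rw [hc, Finset.card_univ] at h3
    have h4 := Finset.card_le_univ A
    rw [Finset.card_range] at h2
    omega
  · change _ ≤ ∑ v ∈ Finset.range A.card, _ ∨ _
    rw [sum_lp_env hι hA]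
    by_cases hc : A = Finset.univ
    · refine Or.inr fun v _ => ?_
      simp [env, loopWeight, hc]
    · exact Or.inl (hunit A hne hc)

theorem exists_decomposition (hι : Set.InjOn ι (Finset.range A.card))
    (hA : (Finset.range A.card).image ι = A) (hne : A.Nonempty) (hε : 0 < ε) (hε1 : ε ≤ 0.01)
    (hlam : lam ≤ 1.01 * G.minCut) :
    ∃ 𝒜 : Finpartition A,
      (∀ i < A.card, ∀ j < A.card, (G.env A ι ε lam).label i = (G.env A ι ε lam).label j ↔
        𝒜.part (ι i) = 𝒜.part (ι j)) ∧
      (∀ δ s : ℝ, 0 ≤ δ → 0 ≤ s → G.IsStrong δ s A → ∀ B ∈ 𝒜.parts, G.IsCluster δ s B) ∧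
      (∀ S : Finset V, S ⊆ A → G.inducedBoundary A S ≤ 1.01 * lam →
        ∃ 𝒢 : Finpartition 𝒜.parts, ∀ Q ∈ 𝒢.parts,
          ¬ G.BoundarySparse (1 - ε) (Q.sup id) (S ∩ Q.sup id)) ∧
      ∑ B ∈ 𝒜.parts, G.boundary B ≤
        4 * (50 * (1 + 103 / 50 * cutBound A.card ε)) / ε * G.boundary A := by
  set E := G.env A ι ε lam with hE
  set R := Finset.range A.card with hR
  obtain ⟨h1, h2, h3⟩ := label_spec (E := E) (G := G.pull A.card ι) hε (hε1.trans (by norm_num))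
    env_lp_nonneg (fun _ _ _ _ => rfl) (env_valid hι hA hne hε hε1 hlam)
  change ∀ u < A.card, ∀ v < A.card, _ at h1
  change ∀ S ⊆ R, (G.pull A.card ι).cut S (R \ S) ≤ _ * lam → _ at h2
  change ∑ v ∈ R, E.lp v + ∑ u ∈ R, ∑ v ∈ R, _ ≤
    4 * (50 * (1 + 103 / 50 * cutBound A.card ε)) / ε * ∑ v ∈ R, E.lp v at h3
  have hpull : ∀ i < A.card, ∀ j < A.card, (G.pull A.card ι).w i j = G.w (ι i) (ι j) :=
    fun i hi j hj => if_pos ⟨hi, hj⟩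
  obtain ⟨num, hnum⟩ : ∃ num : V → ℕ, ∀ i < A.card, num (ι i) = i :=
    ⟨Function.invFunOn ι R, fun i hi => hι.leftInvOn_invFunOn (Finset.mem_range.mpr hi)⟩
  have hmem : ∀ i < A.card, ι i ∈ A := fun i hi =>
    hA ▸ Finset.mem_image_of_mem _ (Finset.mem_range.mpr hi)
  have hsurj : ∀ v ∈ A, ∃ i < A.card, ι i = v := fun v hv => by
    rw [← hA] at hv
    simpa [hR] using hv
  set F : V → ℕ := fun v => E.label (num v) with hF
  have hFι : ∀ i < A.card, F (ι i) = E.label i := fun i hi => by rw [hF]; simp only [hnum i hi]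
  refine ⟨fibers F A, fun i hi j hj => ?_, fun δ s _ _ hs B hB => ?_, fun S hS hx => ?_, ?_⟩
  · rw [fibers_part_eq_iff (hmem i hi) (hmem j hj), hFι i hi, hFι j hj]
  · obtain ⟨u, hu, rfl⟩ := mem_fibers.mp hB
    refine ⟨isComponent_of_eqvGen (A := A) (F := F) (u := u) (by simpa using hu)
      (fun v hv => ?_) rfl, isStrong_of_subset (Finset.filter_subset _ _) hs⟩
    obtain ⟨hv', huv⟩ := Finset.mem_filter.mp hv
    obtain ⟨i, hi, rfl⟩ := hsurj u hu
    obtain ⟨j, hj, rfl⟩ := hsurj v hv'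
    rw [hFι i hi, hFι j hj] at huv
    have := h1 i hi j hj huv.symm
    generalize i = i, j = j at this
    clear huv hi hj hu hv hv' hB
    induction this with
    | rel x y h =>
      obtain ⟨hx, hy, hxy, hw⟩ := h
      refine Relation.EqvGen.rel _ _ ⟨hmem x hx, hmem y hy, ?_, ?_⟩
      · rw [hFι x hx, hFι y hy, hxy]
      · rwa [hpull x hx y hy] at hw
    | refl => exact Relation.EqvGen.refl _
    | symm _ _ _ ih => exact ih.symm
    | trans _ _ _ _ _ ih₁ ih₂ => exact ih₁.trans _ _ _ ih₂
  · set S' := R.filter fun i => ι i ∈ S with hS'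
    have hS'R : S' ⊆ R := Finset.filter_subset _ _
    -- Sets of vertices are obtained as images of sets of numbers; both S and the groups are
    -- translated in this way.
    have himg : ∀ P : V → Prop, [DecidablePred P] →
        (R.filter fun i => P (ι i)).image ι = A.filter P := fun P _ => by
      rw [← hA, Finset.filter_image]
    have eS : S'.image ι = S := by
      rw [himg (· ∈ S), Finset.filter_mem_eq_inter, Finset.inter_eq_right.mpr hS]
    obtain ⟨g, hg, hg'⟩ := h2 S' hS'R (by
      rw [cut_pull G hι hS'R Finset.sdiff_subset, Finset.image_sdiff_of_injOn hι hS'R, hA, eS]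
      refine hx.trans (le_of_eq ?_)
      ring)
    obtain ⟨𝒢, h𝒢⟩ := exists_grouping (F := F) (g := fun v => g (num v)) (A := A) (by
      intro u hu v hv huv
      obtain ⟨i, hi, rfl⟩ := hsurj u hu
      obtain ⟨j, hj, rfl⟩ := hsurj v hv
      rw [hFι i hi, hFι j hj] at huv
      simpa only [hnum i hi, hnum j hj] using hg i hi j hj huv)
    refine ⟨𝒢, fun Q hQ => ?_⟩
    obtain ⟨u, hu, hQu⟩ := h𝒢 Q hQ
    obtain ⟨i, hi, rfl⟩ := hsurj u hu
    set T := R.filter fun j => g j = g i with hT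
    have hTR : T ⊆ R := Finset.filter_subset _ _
    have eT : T.image ι = Q.sup id := by
      rw [hQu, ← himg fun v => g (num v) = g (num (ι i)), hT]
      congr 1
      exact Finset.filter_congr fun j hj => by rw [hnum i hi, hnum j (Finset.mem_range.mp hj)]
    have e1 : (S' ∩ T).image ι = S ∩ Q.sup id := by
      rw [Finset.image_inter_of_injOn _ _ (hι.mono (by
        rw [← Finset.coe_union]; exact Finset.coe_subset.mpr (Finset.union_subset hS'R hTR))), eS, eT]
    have e2 : (T \ S').image ι = Q.sup id \ (S ∩ Q.sup id) := by
      rw [show T \ S' = T \ (S' ∩ T) by simp, Finset.image_sdiff_of_injOn (hι.mono (Finset.coe_subset.mpr hTR)) Finset.inter_subset_right, e1, eT]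
    have hi1 : S' ∩ T ⊆ R := Finset.inter_subset_right.trans hTR
    have hi2 : T \ S' ⊆ R := Finset.sdiff_subset.trans hTR
    have := hg' i hi T rfl
    rwa [cut_pull G hι hi1 hi2, sum_outerWeight_env hι hA hi1 hTR,
      sum_outerWeight_env hι hA hi2 hTR, e1, e2, eT] at this
  · rw [sum_boundary_fibers]
    rw [sum_lp_env hι hA] at h3
    refine le_trans (le_of_eq ?_) h3
    congr 1
    conv_lhs => rw [← hA]
    rw [sum_image_enum hι subset_rfl]
    refine Finset.sum_congr rfl fun i hi => ?_
    rw [sum_image_enum hι subset_rfl]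
    refine Finset.sum_congr rfl fun j hj => ?_
    have hi := Finset.mem_range.mp hi
    have hj := Finset.mem_range.mp hj
    rw [hFι i hi, hFι j hj, hpull i hi j hj]

end Enumeration

end WeightedGraph


/-! ### Numerical bounds -/

section Bounds

open ArrayLang

theorem log_add_one_le {n : ℕ} (hn : 0 < n) : Real.log ((n : ℝ) + 1) ≤ 1 + Real.log n := by
  have hn' : (1 : ℝ) ≤ n := by exact_mod_cast hn
  calc Real.log ((n : ℝ) + 1) ≤ Real.log (2 * n) := Real.log_le_log (by linarith) (by linarith)
    _ = Real.log 2 + Real.log n := Real.log_mul (by norm_num) (by linarith)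
    _ ≤ 1 + Real.log n := by linarith [Real.log_two_lt_d9]

theorem size_add_one_le {n : ℕ} (hn : 0 < n) : (n.size : ℝ) + 1 ≤ 2 * (1 + Real.log n) := by
  obtain ⟨m, hm⟩ : ∃ m, n.size = m + 1 := ⟨n.size - 1, by have := Nat.size_pos.mpr hn; omega⟩
  have h1 : 2 ^ m ≤ n := Nat.lt_size.mp (by omega)
  have h2 : (m : ℝ) * Real.log 2 ≤ Real.log n := by
    rw [← Real.log_pow]
    exact Real.log_le_log (by positivity) (by exact_mod_cast h1)
  have h3 := Real.log_two_gt_d9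
  rw [hm]
  push_cast
  nlinarith [Nat.cast_nonneg (α := ℝ) m]

/-- Two factors 1/ε come from the number of stored cuts and one from the potential; the exponent 33
is 31 + 2. The constants are 24802 = 800 · 31 + 2 and 498 = 16 · 31 + 2. -/
theorem boundary_factor_le {n : ℕ} (hn : 0 < n) {ε : ℝ} (hε : 0 < ε) (hε1 : ε ≤ 1) :
    4 * (50 * (1 + 103 / 50 * cutBound n ε)) / ε ≤
      200 * (1 + 103 / 50 * (24802 ^ 31 * 498 ^ 2)) * (ε ^ 3)⁻¹ * (1 + Real.log n) ^ 33 := by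
  have hlog := log_add_one_le hn
  have h0 : 0 ≤ Real.log ((n : ℝ) + 1) := Real.log_nonneg (by linarith [Nat.cast_nonneg (α := ℝ) n])
  have h1 : 0 ≤ Real.log n := Real.log_natCast_nonneg n
  unfold cutBound
  set x := Real.log ((n : ℝ) + 1)
  set t := 1 + Real.log n
  have ht : 1 ≤ t := by linarith
  have hte : 1 ≤ t / ε := by
    rw [le_div_iff₀ hε]
    linarith
  have a1 : 800 * (31 * x) + 2 ≤ 24802 * t := by linarith
  have a2 : 16 / ε * (31 * x) + 2 ≤ 498 * (t / ε) := by
    have : x / ε ≤ t / ε := by gcongr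
    have e : 16 / ε * (31 * x) = 496 * (x / ε) := by ring
    rw [e]
    linarith
  have a3 : 1 ≤ t ^ 33 / ε ^ 2 := by
    rw [le_div_iff₀ (by positivity), one_mul]
    exact (pow_le_one₀ hε.le hε1).trans (one_le_pow₀ ht)
  have a4 : (800 * (31 * x) + 2) ^ 31 * (16 / ε * (31 * x) + 2) ^ 2 ≤
      (24802 * t) ^ 31 * (498 * (t / ε)) ^ 2 := by gcongr
  calc _ ≤ 4 * (50 * (t ^ 33 / ε ^ 2 + 103 / 50 * ((24802 * t) ^ 31 * (498 * (t / ε)) ^ 2))) / ε := by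
        gcongr
    _ = 200 * (1 + 103 / 50 * (24802 ^ 31 * 498 ^ 2)) * (ε ^ 3)⁻¹ * t ^ 33 := by
        generalize (24802 : ℝ) = a
        field_simp
        ring

theorem time_le {n : ℕ} (hn : 0 < n) (q d : ℕ) :
    ((q * ((n + 1) ^ 9 * (n.size + 1) ^ d) : ℕ) : ℝ) ≤
      (q * (2 ^ 9 * 2 ^ d)) * (n : ℝ) ^ 9 * (1 + Real.log n) ^ d := by
  have h1 : (n : ℝ) + 1 ≤ 2 * n := by
    have : (1 : ℝ) ≤ n := by exact_mod_cast hn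
    linarith
  push_cast
  calc _ ≤ (q : ℝ) * ((2 * n) ^ 9 * (2 * (1 + Real.log n)) ^ d) := by
        gcongr
        exact size_add_one_le hn
    _ = _ := by
        rw [mul_pow, mul_pow]
        ring

end Bounds


theorem mainTheorem5 :
    ∃ (P : RealRAM.Program) (K : ℝ) (c : ℕ),
      ∀ (V : Type*) [Fintype V] [DecidableEq V] [Nontrivial V] (G : WeightedGraph V)
        (A : Finset V) (ε lam : ℝ) (e : Fin A.card ≃ A) (σ : RealRAM.State),
        A.Nonempty → 0 < ε → ε ≤ 0.01 → lam ≤ 1.01 * G.minCut →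
        IsInput G A e ε lam σ →
        ∃ (τ : RealRAM.State) (t : ℕ) (𝒜 : Finpartition A),
          -- the algorithm halts within the time bound and outputs the partition `𝒜`
          RealRAM.Runs P σ τ t ∧
          (t : ℝ) ≤ K * (A.card : ℝ) ^ 9 * (1 + Real.log A.card) ^ c ∧
          IsOutput e 𝒜 τ ∧
          -- the parts are clusters
          (∀ δ s : ℝ, 0 ≤ δ → 0 ≤ s → G.IsStrong δ s A → ∀ B ∈ 𝒜.parts, G.IsCluster δ s B) ∧
          -- every small cut of `G[A]` can be uncrossed after grouping the parts
          (∀ S : Finset V, S ⊆ A → G.inducedBoundary A S ≤ 1.01 * lam →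
            ∃ 𝒢 : Finpartition 𝒜.parts, ∀ Q ∈ 𝒢.parts,
              ¬ G.BoundarySparse (1 - ε) (Q.sup id) (S ∩ Q.sup id)) ∧
          -- the sum of the boundaries
          ∑ B ∈ 𝒜.parts, G.boundary B ≤
            K * (ε ^ 3)⁻¹ * (1 + Real.log A.card) ^ c * G.boundary A := by
  classical
  set d := ArrayLang.decomposition.degL + 2 with hd
  set q := 3000 * ((ArrayLang.decomposition.coef + 1) * (401 + 1)) with hq
  set K₁ : ℝ := 200 * (1 + 103 / 50 * (24802 ^ 31 * 498 ^ 2)) with hK₁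
  set K₂ : ℝ := q * (2 ^ 9 * 2 ^ d) with hK₂
  have hK₁0 : 0 ≤ K₁ := by positivity
  have hK₂0 : 0 ≤ K₂ := by positivity
  refine ⟨ArrayLang.decomposition.machine, K₁ + K₂, 33 + d, ?_⟩
  intro V _ _ _ G A ε lam e σ hne hε hε1 hlam hσ
  have hpos : 0 < A.card := Finset.card_pos.mpr hne
  -- Beyond |A| the value is irrelevant, because all statements concern indices below |A|.
  set ι : ℕ → V := fun i => if h : i < A.card then e ⟨i, h⟩ else hne.choose with hι
  have hιe : ∀ i : Fin A.card, ι i = e i := fun i => dif_pos i.2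
  have hinj : Set.InjOn ι (Finset.range A.card) := by
    intro i hi j hj hij
    rw [Finset.coe_range, Set.mem_Iio] at hi hj
    rw [hιe ⟨i, hi⟩, hιe ⟨j, hj⟩] at hij
    exact congrArg Fin.val (e.injective (Subtype.ext hij))
  have himg : (Finset.range A.card).image ι = A := by
    ext v
    rw [Finset.mem_image]
    constructor
    · rintro ⟨i, hi, rfl⟩
      rw [hιe ⟨i, Finset.mem_range.mp hi⟩]
      exact (e _).2
    · intro hv
      exact ⟨e.symm ⟨v, hv⟩, Finset.mem_range.mpr (e.symm ⟨v, hv⟩).2, by simp [hιe]⟩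
  have hlog : 1 ≤ 1 + Real.log A.card := le_add_of_nonneg_right (Real.log_natCast_nonneg _)
  obtain ⟨τ, t, hrun, hout, ht⟩ := ArrayLang.Cmd.exists_runs_machine
    ArrayLang.decomposition_small ArrayLang.decomposition_degN.le (G.env A ι ε lam) rfl
    (fun a ha => if_neg (not_lt.mpr ha))
    (fun a b hab => if_neg fun h => hab.elim (not_le.mpr h.1) (not_le.mpr h.2)) hpos (by norm_num)
    hσ.card hσ.nat_zero hσ.eps hσ.est
    (fun a ha => (hσ.loop ⟨a, ha⟩).trans (by
      rw [← hιe ⟨a, ha⟩]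
      exact (if_pos ha).symm))
    (fun a ha b hb => (hσ.edge ⟨a, ha⟩ ⟨b, hb⟩).trans (by
      rw [← hιe ⟨a, ha⟩, ← hιe ⟨b, hb⟩]
      exact (if_pos ⟨ha, hb⟩).symm)) hσ.real_zero
  obtain ⟨𝒜, h1, h2, h3, h4⟩ := WeightedGraph.exists_decomposition hinj himg hne hε hε1 hlam
  refine ⟨τ, t, 𝒜, hrun, ?_, fun i j => ?_, h2, h3, h4.trans ?_⟩
  · calc (t : ℝ) ≤ ((q * ((A.card + 1) ^ 9 * (A.card.size + 1) ^ d) : ℕ) : ℝ) := by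
          exact_mod_cast ht
      _ ≤ K₂ * (A.card : ℝ) ^ 9 * (1 + Real.log A.card) ^ d := time_le hpos q d
      _ ≤ (K₁ + K₂) * (A.card : ℝ) ^ 9 * (1 + Real.log A.card) ^ (33 + d) := by
          gcongr
          · linarith
          · omega
  · rw [hout i i.2, hout j j.2, ← hιe i, ← hιe j]
    exact h1 i i.2 j j.2
  · refine mul_le_mul_of_nonneg_right ?_ (G.cut_nonneg _ _)
    refine (boundary_factor_le hpos hε (hε1.trans (by norm_num))).trans ?_
    rw [← hK₁]
    gcongr
    · linarith
    · omega
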